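/- **Setting.** Let $d,p\ge 0$ be integers. For $\theta\in\mathbb R^d$ let $(X(\theta),Y(\theta))$ be real random outputs of a stochastic system (jointly measurable in $\theta$ and the system randomness) with a joint density; $f(\cdot,\theta)$ is the density and $\mathcal X(\theta)$ the support of $X(\theta)$. Let $q(\theta,x,\nu)$ and $m_j(\theta,y,\lambda_1,\dots,\lambda_j)$, $1\le j\le p$, be measurable real functions, $\bar q(\theta,\nu)=\mathbb E[q(\theta,X(\theta),\nu)]$, and let $\bar m_j(\theta,\lambda_1,\dots,\lambda_j,\cdot)$ be a version of $\mathbb E[m_j(\theta,Y(\theta),\lambda_1,\dots,\lambda_j)\mid X(\theta)=\cdot\,]$; for $\lambda\in\mathbb R^p$ write $\bar m_j(\theta,\lambda,\nu)$ for $\bar m_j(\theta,\lambda_1,\dots,\lambda_j,\nu)$, and similarly $m_j(\theta,y,\lambda)$. Let $\Theta\subset\mathbb R^d$ be convex and compact, $\Theta=\{\theta:\boldsymbol c_i(\theta)\le 0,\ 1\le i\le k\}$ with $\boldsymbol c_i\in C^1$ and $\nabla\boldsymbol c_i\ne0$ wherever $\boldsymbol c_i=0$. For $\theta\in\Theta$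 let $\nu(\theta)$ be the unique root of $\bar q(\theta,\cdot)=0$ and $\lambda(\theta)\in\mathbb R^p$ the unique root of $\bar m_j(\theta,\lambda,\nu(\theta))=0$, $j=1,\dots,p$. Let $g:\mathbb R^{d}\times\mathbb R^p\to\mathbb R$ and $\bar g(\theta)=g(\theta,\lambda(\theta))$. **Algorithm.** Given deterministic initial values $\nu_0,\lambda_0,G_{\nu,0},G_{1,0},\dots,G_{p,0},\theta_0$, a kernel $K$ and sequences $\alpha_n,\beta_n,c_n,h_n$, put $\bar c_n=c_n/\max\{1,\|G_{\nu,n-1}\|/\sqrt d,\|G_{1,n-1}\|/\sqrt d,\dots,\|G_{p,n-1}\|/\sqrt d\}$, $\theta_n^\pm=\theta_n\pm\bar c_{n+1}\Delta_{n+1}$, $\nu_n^\pm=\nu_n\pm\bar c_{n+1}\Delta_{n+1}^\top G_{\nu,n}$, $\lambda_{j,n}^\pm=\lambda_{j,n}\pm\bar c_{n+1}\Delta_{n+1}^\top G_{j,n}$. At step $n$ output pairs $(X_n,Y_n)$, $(X_n^+,Y_n^+)$, $(X_n^-,Y_n^-)$ are generated from the system at $\theta_n$, $\theta_n^+$, $\theta_n^-$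 with mutually independent system randomness that is also independent of $\Delta_{n+1}$ and of the past. With $K_n=h_{n+1}^{-1}K((\nu_n-X_n)/h_{n+1})$ and $K_n^\pm=h_{n+1}^{-1}K((\nu_n^\pm-X_n^\pm)/h_{n+1})$, $$\nu_{n+1}=\nu_n+\beta_{n+1}q(\theta_n,X_n,\nu_n),\qquad \lambda_{j,n+1}=\lambda_{j,n}+\beta_{n+1}K_n\,m_j(\theta_n,Y_n,\lambda_n),$$ $$G_{\nu,n+1}=G_{\nu,n}+\beta_{n+1}\frac{q(\theta_n^+,X_n^+,\nu_n^+)-q(\theta_n^-,X_n^-,\nu_n^-)}{2\bar c_{n+1}\Delta_{n+1}},$$ $$G_{j,n+1}=G_{j,n}+\beta_{n+1}K_n^+K_n^-\frac{m_j(\theta_n^+,Y_n^+,\lambda_n^+)-m_j(\theta_n^-,Y_n^-,\lambda_n^-)}{2\bar c_{n+1}\Delta_{n+1}},$$ $$\theta_{n+1}=\Pi_\Theta\Big[\theta_n-\alpha_{n+1}\Big(\nabla_\theta g(\theta_n,\lambda_n)+\sum_{j=1}^p\frac{\partial g(\theta_n,\lambda_n)}{\partial\lambda_j}G_{j,n}\Big)\Big],$$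 where division by the vector $\Delta_{n+1}$ is componentwise and $\Pi_\Theta$ is the Euclidean projection. **Assumption 1.** There are open convex sets $\mathcal N\subset\mathbb R^d$, $\mathcal X_\varepsilon\subset\mathbb R$, $\Lambda_\varepsilon\subset\mathbb R^p$ and $r>0$ such that, almost surely, for all $n\ge0$ the $r$-balls around $\theta_n$, $\nu_n$, $\lambda_n$ lie in $\mathcal N$, $\mathcal X_\varepsilon$, $\Lambda_\varepsilon$ respectively and $(\theta_n^\pm,\nu_n^\pm,\lambda_n^\pm)\in\mathcal N\times\mathcal X_\varepsilon\times\Lambda_\varepsilon$; moreover $(\nu(\theta),\lambda(\theta))\in\mathcal X_\varepsilon\times\Lambda_\varepsilon$ for $\theta\in\Theta\cap\mathcal N$. There are a bound $B$ and constants $\varepsilon,C_q,\varepsilon_q,C_m,\varepsilon_m>0$ such that, where "$C^3_B$" means three times continuously differentiable with all derivatives of orders $1,2,3$ bounded by $B$: (a) $f(\cdot,\theta)$ is $C^3_B$ on $\operatorname{int}\mathcal X(\theta)$ for $\theta\in\mathcal N$, and $f(x,\cdot)$ is $C^3_B$ on $\mathcal N$ for every $x$; (b) $f\ge\varepsilon$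 on $\mathcal X_\varepsilon\times\mathcal N$; (c) $\bar q(\theta,\cdot)$ is $C^3_B$ on $\operatorname{int}\mathcal X(\theta)$ for $\theta\in\mathcal N$, and $\bar q(\cdot,\nu)$ is $C^3_B$ on $\mathcal N$ for $\nu\in\mathcal X_\varepsilon$; (d) $\mathbb E[q^2(\theta,X(\theta),\nu)]\le C_q$ and $\partial\bar q(\theta,\nu)/\partial\nu\le-\varepsilon_q$ for $(\theta,\nu)\in\mathcal N\times\mathcal X_\varepsilon$; (e) for each $j$, $\bar m_j(\theta,\lambda,\cdot)$ is $C^3_B$ on $\operatorname{int}\mathcal X(\theta)$ for $(\theta,\lambda)\in\mathcal N\times\Lambda_\varepsilon$, and $(\theta,\lambda)\mapsto\bar m_j(\theta,\lambda,\nu)$ is $C^3_B$ on $\mathcal N\times\Lambda_\varepsilon$ for every $\nu$; (f) for each $j$ and $(\theta,\lambda)\in\mathcal N\times\Lambda_\varepsilon$: $\mathbb E[m_j^2(\theta,Y(\theta),\lambda)\mid X(\theta)=\nu]\le C_m$ for almost every $\nu\in\mathcal X_\varepsilon$, $\mathbb E[m_j^2(\theta,Y(\theta),\lambda)]\le C_m$,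 and $\partial\bar m_j(\theta,\lambda,\nu)/\partial\lambda_j\le-\varepsilon_m$ for $\nu\in\mathcal X_\varepsilon$; (g) there is an integrable $\kappa$ such that for all $\theta_1,\theta_2\in\mathcal N$, $|X(\theta_1)-X(\theta_2)|\le\kappa\|\theta_1-\theta_2\|$ a.s.; (h) $g$ is $C^1$ with bounded derivatives; (i) $f(\cdot,\theta)$ and $\bar m_j(\theta,\lambda,\cdot)$ are Schwartz functions on $\mathbb R$ for $(\theta,\lambda)\in\mathcal N\times\Lambda_\varepsilon$ and all $j$. **Assumption 2.** The $\Delta_n$, $n\ge1$, are i.i.d. and independent of the past, with independent components equal to $\pm1$ with probability $1/2$ each. **Assumption 3.** $\alpha_n,\beta_n,c_n,h_n>0$ for $n\ge1$, $\sum\alpha_n=\infty$, $c_n\to0$, $h_n\to0$, $\sum\beta_n^2/(c_nh_n)^2<\infty$, $\beta_n=o(c_n^2h_n^2)$, $\alpha_n=o(\beta_n)$. **Assumption 4.** $K$ is a symmetric, bounded, continuous (integrable) probability density with $uK(u)\to0$ as $|u|\to\infty$ and $\int|u\ln|u||^{1/2}\,|dK(u)|<\infty$; $K$ is Lipschitz;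 $K$ is bounded below by a positive constant near $0$; $k(u)=\int e^{-iuy}K(y)\,dy$ is integrable and $(1-k(u))/u^2$ has a finite real limit as $u\to0$. **Assumption 5.** (a) For $n\ge1$, $\alpha_n=C_\alpha/(n+n_\alpha)^a$, $\beta_n=C_\beta/(n+n_\beta)^b$, $c_n=C_c/(n+n_c)^{\mathfrak c}$, $h_n=C_h/(n+n_h)^{\mathfrak h}$ with $C_\alpha,C_\beta,C_c,C_h>0$, $n_\alpha,n_\beta,n_c,n_h\ge0$, $a,b\in(1/2,1]$, $\mathfrak c,\mathfrak h>0$, $\mathfrak c+\mathfrak h<b/2$, and $1/n\le\alpha_n<1$ for all large $n$. (b) $\nu(\cdot)$ and $\lambda(\cdot)$ are $C^2$ on $\Theta$. (c) With $\mathcal C(\theta)=\{y\in\mathbb R^d:y^\top(\vartheta-\theta)\le0\ \ \forall\vartheta\in\Theta\}$, the projected ODE $\dot\theta=-\nabla\bar g(\theta)+z$, $z(t)\in-\mathcal C(\theta(t))$ the minimum force that keeps $\theta(t)$ in $\Theta$, has a unique globally asymptotically stable equilibrium $\theta^*\in\operatorname{int}\Theta$, and for some $\varepsilon_\rho>0$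 the smallest eigenvalue of the Hessian $\nabla^2\bar g(\theta)$ is, almost surely, at least $\varepsilon_\rho$ for all $\theta\in\Theta$ on the line segments between $\theta_n$ and $\theta^*$, $n\ge0$. (d) $g$ is $C^2$ with bounded derivatives. **Proposition.** Under Assumptions 1–5, $\nu_n-\nu(\theta_n)$ and $\lambda_n-\lambda(\theta_n)$ are square integrable for every $n$, and as $n\to\infty$ $$\sqrt{\mathbb E\big[(\nu_n-\nu(\theta_n))^2\big]}=O\Big(\frac{\alpha_{n+1}}{\beta_{n+1}}\Big)+O\big(\beta_{n+1}^{1/2}\big),$$ $$\sqrt{\mathbb E\big[\|\lambda_n-\lambda(\theta_n)\|^2\big]}=O\Big(\frac{\alpha_{n+1}}{\beta_{n+1}}\Big)+O\Big(\frac{\beta_{n+1}^{1/2}}{h_{n+1}^{1/2}}\Big)+O\big(h_{n+1}^2\big).$$ -/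

import Mathlib

open MeasureTheory ProbabilityTheory Filter Topology Set
open scoped ENNReal SchwartzMap

namespace KBSA

noncomputable section

/-- `ℝ^d` with the Euclidean norm. -/
abbrev Vec (d : ℕ) : Type := EuclideanSpace ℝ (Fin d)

/-- The first `j` components `(λ_1, …, λ_j)` of `λ ∈ ℝ^p` (the index `j : Fin p` is zero-based, so
that there are `j + 1` of them). -/
def lead {p : ℕ} (j : Fin p) (l : Vec p) : Fin ((j : ℕ) + 1) → ℝ :=
  fun i => l (Fin.castLE j.isLt i)

/-! ### The problem -/

/-- The data of a contextual optimization problem. `X θ` and `Y θ` are the two outputs of the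
stochastic system under the parameter `θ`, as functions of the randomness in `Ξ`; `q` and `m j` are
the link functions, `g` is the cost function and `Θ` is the feasible region. -/
structure Problem (d p : ℕ) (Ξ : Type*) where
  X : Vec d → Ξ → ℝ
  Y : Vec d → Ξ → ℝ
  q : Vec d → ℝ → ℝ → ℝ
  m : (j : Fin p) → Vec d → ℝ → (Fin ((j : ℕ) + 1) → ℝ) → ℝ
  g : Vec d → Vec p → ℝ
  Θ : Set (Vec d)

variable {d p : ℕ} {Ξ Ω : Type*} [MeasurableSpace Ξ] [MeasurableSpace Ω]

/-- `q̄(θ, ν) = E[q(θ, X(θ), ν)]`. -/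
def qbar (M : Problem d p Ξ) (μ : Measure Ξ) (θ : Vec d) (ν : ℝ) : ℝ :=
  ∫ ξ, M.q θ (M.X θ ξ) ν ∂μ

/-- The support of the law of `X(θ)`. -/
def suppX (M : Problem d p Ξ) (μ : Measure Ξ) (θ : Vec d) : Set ℝ :=
  (μ.map (M.X θ)).support

/-- `b` is a version of `x ↦ E[φ(Y) | X = x]` (if this conditional expectation exists). -/
def IsCondMean (μ : Measure Ξ) [IsProbabilityMeasure μ] (X Y : Ξ → ℝ) (φ b : ℝ → ℝ) : Prop :=
  Integrable (fun ξ => φ (Y ξ)) μ → ∀ᵐ x ∂(μ.map X), b x = ∫ y, φ y ∂(condDistrib Y X μ x)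

/-- Standing setting: everything is measurable, `(X(θ), Y(θ))` has a joint density, `f(·, θ)` is
the density of `X(θ)`, `m̄_j(θ, λ_1, …, λ_j, ·)` is a version of
`E[m_j(θ, Y(θ), λ_1, …, λ_j) | X(θ) = ·]`, and `ν(θ)`, `λ(θ)` are the unique roots of the
equations that define them. `Θ` is convex, compact and given by smooth inequality constraints. -/
structure Setting (M : Problem d p Ξ) (μ : Measure Ξ) [IsProbabilityMeasure μ]
    (f : Vec d → ℝ → ℝ) (mbar : (j : Fin p) → Vec d → (Fin ((j : ℕ) + 1) → ℝ) → ℝ → ℝ)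
    (nu : Vec d → ℝ) (lam : Vec d → Vec p) : Prop where
  measurable_X : Measurable (fun z : Vec d × Ξ => M.X z.1 z.2)
  measurable_Y : Measurable (fun z : Vec d × Ξ => M.Y z.1 z.2)
  measurable_q : Measurable (fun z : Vec d × ℝ × ℝ => M.q z.1 z.2.1 z.2.2)
  measurable_m : ∀ j : Fin p,
    Measurable (fun z : Vec d × ℝ × (Fin ((j : ℕ) + 1) → ℝ) => M.m j z.1 z.2.1 z.2.2)
  joint_density : ∀ θ, μ.map (fun ξ => (M.X θ ξ, M.Y θ ξ)) ≪ volume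
  measurable_f : ∀ θ, Measurable (f θ)
  f_nonneg : ∀ θ x, 0 ≤ f θ x
  f_density : ∀ θ, μ.map (M.X θ) = volume.withDensity (fun x => ENNReal.ofReal (f θ x))
  mbar_version : ∀ (j : Fin p) (θ : Vec d) (l : Fin ((j : ℕ) + 1) → ℝ),
    IsCondMean μ (M.X θ) (M.Y θ) (fun y => M.m j θ y l) (mbar j θ l)
  nu_root : ∀ θ ∈ M.Θ, ∀ ν : ℝ,
    (Integrable (fun ξ => M.q θ (M.X θ ξ) ν) μ ∧ qbar M μ θ ν = 0) ↔ ν = nu θ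
  lam_root : ∀ θ ∈ M.Θ, ∀ l : Vec p, (∀ j : Fin p, mbar j θ (lead j l) (nu θ) = 0) ↔ l = lam θ
  convex_Θ : Convex ℝ M.Θ
  compact_Θ : IsCompact M.Θ
  constraints_Θ : ∃ (k : ℕ) (con : Fin k → Vec d → ℝ),
    (∀ i, ContDiff ℝ 1 (con i)) ∧ (∀ i θ, con i θ = 0 → gradient (con i) θ ≠ 0) ∧
      M.Θ = {θ | ∀ i, con i θ ≤ 0}

/-! ### The algorithm -/

/-- One iterate `(ν_n, λ_n, G_{ν,n}, (G_{1,n}, …, G_{p,n}), θ_n)`. -/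
structure Iterate (d p : ℕ) where
  nu : ℝ
  lam : Vec p
  Gnu : Vec d
  G : Fin p → Vec d
  θ : Vec d

/-- The inputs of the algorithm: step sizes `α_n`, `β_n`, perturbation sizes `c_n`, bandwidths `h_n`
(`n ≥ 1`; the value at `0` is not used), the kernel `K`, and the initial estimates. -/
structure Input (d p : ℕ) where
  α : ℕ → ℝ
  β : ℕ → ℝ
  c : ℕ → ℝ
  h : ℕ → ℝ
  K : ℝ → ℝ
  init : Iterate d p

/-- The randomness of a run. In the step from `n` to `n + 1` the output pairs at `θ_n`, `θ_n^+`,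
`θ_n^-` are generated from `ξ n`, `ξp n`, `ξm n`, and `Δ (n + 1)` is the random direction. -/
structure Noise (d : ℕ) (Ξ Ω : Type*) where
  ξ : ℕ → Ω → Ξ
  ξp : ℕ → Ω → Ξ
  ξm : ℕ → Ω → Ξ
  Δ : ℕ → Ω → Vec d

/-- A point of `C` nearest to `x` (the Euclidean projection if `C` is nonempty, closed, convex). -/
def proj (C : Set (Vec d)) (x : Vec d) : Vec d :=
  open Classical in
  if hx : ∃ y ∈ C, ∀ z ∈ C, ‖x - y‖ ≤ ‖x - z‖ then hx.choose else x

/-- The scaled perturbation size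
`c / max {1, ‖G_ν‖ / √d, ‖G_1‖ / √d, …, ‖G_p‖ / √d}`. -/
def cbar (c : ℝ) (s : Iterate d p) : ℝ :=
  c / max (max 1 (‖s.Gnu‖ / √(d : ℝ))) (⨆ j : Fin p, ‖s.G j‖ / √(d : ℝ))

/-- `θ + σ c̄ Δ`, where `σ = 1` or `σ = -1`. -/
def pertθ (σ c : ℝ) (Δ : Vec d) (s : Iterate d p) : Vec d :=
  s.θ + (σ * cbar c s) • Δ

/-- `ν + σ c̄ Δᵀ G_ν`. -/
def pertNu (σ c : ℝ) (Δ : Vec d) (s : Iterate d p) : ℝ :=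
  s.nu + σ * cbar c s * inner ℝ Δ s.Gnu

/-- The vector with components `λ_j + σ c̄ Δᵀ G_j`. -/
def pertLam (σ c : ℝ) (Δ : Vec d) (s : Iterate d p) : Vec p :=
  WithLp.toLp 2 (fun j => s.lam j + σ * cbar c s * inner ℝ Δ (s.G j))

/-- `(1 / h) K((ν - x) / h)`. -/
def kern (K : ℝ → ℝ) (h ν x : ℝ) : ℝ := 1 / h * K ((ν - x) / h)

/-- The vector `a / (2 c̄ Δ)`, with the division taken componentwise. -/
def spQuot (a c : ℝ) (Δ : Vec d) (s : Iterate d p) : Vec d :=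
  WithLp.toLp 2 (fun i => a / (2 * cbar c s * Δ i))

/-- `∂g(θ, λ) / ∂λ_j`. -/
def dgLam (g : Vec d → Vec p → ℝ) (θ : Vec d) (l : Vec p) (j : Fin p) : ℝ :=
  fderiv ℝ (fun l' => g θ l') l (EuclideanSpace.single j 1)

/-- `∇_θ g(θ, λ) + ∑_j (∂g(θ, λ) / ∂λ_j) G_j` at an iterate. -/
def gradEst (g : Vec d → Vec p → ℝ) (s : Iterate d p) : Vec d :=
  gradient (fun θ => g θ s.lam) s.θ + ∑ j : Fin p, dgLam g s.θ s.lam j • s.G j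

/-- One step of the algorithm, with the outputs at `θ`, `θ^+`, `θ^-` generated from `ξ`, `ξp`,
`ξm`, and with the random direction `Δ`. -/
def step (M : Problem d p Ξ) (K : ℝ → ℝ) (α β c h : ℝ) (ξ ξp ξm : Ξ) (Δ : Vec d)
    (s : Iterate d p) : Iterate d p :=
  let x := M.X s.θ ξ
  let y := M.Y s.θ ξ
  let θp := pertθ 1 c Δ s
  let θm := pertθ (-1) c Δ s
  let xp := M.X θp ξp
  let yp := M.Y θp ξp
  let xm := M.X θm ξm
  let ym := M.Y θm ξm
  let νp := pertNu 1 c Δ s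
  let νm := pertNu (-1) c Δ s
  let lp := pertLam 1 c Δ s
  let lm := pertLam (-1) c Δ s
  { nu := s.nu + β * M.q s.θ x s.nu
    lam := WithLp.toLp 2 (fun j =>
      s.lam j + β * (M.m j s.θ y (lead j s.lam) * kern K h s.nu x))
    Gnu := s.Gnu + β • spQuot (M.q θp xp νp - M.q θm xm νm) c Δ s
    G := fun j => s.G j + β • spQuot
      ((M.m j θp yp (lead j lp) - M.m j θm ym (lead j lm)) * kern K h νp xp * kern K h νm xm) c Δ s
    θ := proj M.Θ (s.θ - α • gradEst M.g s) }

/-- The iterates of the algorithm. -/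
def iter (M : Problem d p Ξ) (I : Input d p) (W : Noise d Ξ Ω) : ℕ → Ω → Iterate d p
  | 0, _ => I.init
  | n + 1, ω => step M I.K (I.α (n + 1)) (I.β (n + 1)) (I.c (n + 1)) (I.h (n + 1))
      (W.ξ n ω) (W.ξp n ω) (W.ξm n ω) (W.Δ (n + 1) ω) (iter M I W n ω)

/-- The system outputs are independent samples, drawn independently of the random directions and of
the past. -/
structure IsSampling (μ : Measure Ξ) (P : Measure Ω) (W : Noise d Ξ Ω) : Prop where
  measurable_ξ : ∀ n, Measurable (W.ξ n)
  measurable_ξp : ∀ n, Measurable (W.ξp n)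
  measurable_ξm : ∀ n, Measurable (W.ξm n)
  measurable_Δ : ∀ n, Measurable (W.Δ n)
  law : ∀ n, P.map (fun ω => (W.ξ n ω, W.ξp n ω, W.ξm n ω)) = μ.prod (μ.prod μ)
  indep_Δ : ∀ n, IndepFun (fun ω => (W.ξ n ω, W.ξp n ω, W.ξm n ω)) (W.Δ (n + 1)) P
  indep_steps :
    iIndepFun (fun n ω => ((W.ξ n ω, W.ξp n ω, W.ξm n ω), W.Δ (n + 1) ω)) P

/-! ### Assumption 1: regularity -/

/-- `F` is three times continuously differentiable on the open set `S`, and its derivatives (of the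
orders 1, 2, 3) are bounded by `B` there. -/
def BddC3 {V : Type*} [NormedAddCommGroup V] [NormedSpace ℝ V] (F : V → ℝ) (S : Set V) (B : ℝ) :
    Prop :=
  ContDiffOn ℝ 3 F S ∧ ∀ k ∈ Finset.Icc 1 3, ∀ x ∈ S, ‖iteratedFDeriv ℝ k F x‖ ≤ B

/-- The regularity conditions on a fixed neighbourhood `N × Xε × Λε`, with the constants exhibited:
`B` bounds the derivatives. -/
structure Regular (M : Problem d p Ξ) (μ : Measure Ξ) [IsProbabilityMeasure μ]
    (f : Vec d → ℝ → ℝ) (mbar : (j : Fin p) → Vec d → (Fin ((j : ℕ) + 1) → ℝ) → ℝ → ℝ)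
    (N : Set (Vec d)) (Xε : Set ℝ) (Λε : Set (Vec p)) (B ε Cq εq Cm εm : ℝ) : Prop where
  ε_pos : 0 < ε
  Cq_pos : 0 < Cq
  εq_pos : 0 < εq
  Cm_pos : 0 < Cm
  εm_pos : 0 < εm
  f_smooth_x : ∀ θ ∈ N, BddC3 (f θ) (interior (suppX M μ θ)) B
  f_smooth_θ : ∀ x, BddC3 (fun θ => f θ x) N B
  f_lower : ∀ θ ∈ N, ∀ x ∈ Xε, ε ≤ f θ x
  q_smooth_ν : ∀ θ ∈ N, BddC3 (qbar M μ θ) (interior (suppX M μ θ)) B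
  q_smooth_θ : ∀ ν ∈ Xε, BddC3 (fun θ => qbar M μ θ ν) N B
  q_moment : ∀ θ ∈ N, ∀ ν ∈ Xε,
    ∫⁻ ξ, ENNReal.ofReal (M.q θ (M.X θ ξ) ν ^ 2) ∂μ ≤ ENNReal.ofReal Cq
  q_deriv : ∀ θ ∈ N, ∀ ν ∈ Xε, deriv (qbar M μ θ) ν ≤ -εq
  m_smooth_ν : ∀ j : Fin p, ∀ θ ∈ N, ∀ l ∈ Λε,
    BddC3 (mbar j θ (lead j l)) (interior (suppX M μ θ)) B
  m_smooth_θlam : ∀ (j : Fin p) (ν : ℝ),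
    BddC3 (fun z : Vec d × Vec p => mbar j z.1 (lead j z.2) ν) (N ×ˢ Λε) B
  m_cond_moment : ∀ j : Fin p, ∀ θ ∈ N, ∀ l ∈ Λε, ∀ᵐ x ∂(μ.map (M.X θ)), x ∈ Xε →
    ∫⁻ y, ENNReal.ofReal (M.m j θ y (lead j l) ^ 2) ∂(condDistrib (M.Y θ) (M.X θ) μ x)
      ≤ ENNReal.ofReal Cm
  m_moment : ∀ j : Fin p, ∀ θ ∈ N, ∀ l ∈ Λε,
    ∫⁻ ξ, ENNReal.ofReal (M.m j θ (M.Y θ ξ) (lead j l) ^ 2) ∂μ ≤ ENNReal.ofReal Cm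
  m_deriv : ∀ j : Fin p, ∀ θ ∈ N, ∀ ν ∈ Xε, ∀ l ∈ Λε,
    fderiv ℝ (fun l' : Vec p => mbar j θ (lead j l') ν) l (EuclideanSpace.single j 1) ≤ -εm
  X_lipschitz : ∃ κ : Ξ → ℝ, Integrable κ μ ∧ ∀ θ₁ ∈ N, ∀ θ₂ ∈ N,
    ∀ᵐ ξ ∂μ, |M.X θ₁ ξ - M.X θ₂ ξ| ≤ κ ξ * ‖θ₁ - θ₂‖
  g_smooth : ContDiff ℝ 1 (fun z : Vec d × Vec p => M.g z.1 z.2)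
  g_bdd : ∀ z, ‖fderiv ℝ (fun z : Vec d × Vec p => M.g z.1 z.2) z‖ ≤ B
  f_schwartz : ∀ θ ∈ N, ∃ φ : 𝓢(ℝ, ℝ), ∀ x, φ x = f θ x
  m_schwartz : ∀ j : Fin p, ∀ θ ∈ N, ∀ l ∈ Λε, ∃ φ : 𝓢(ℝ, ℝ), ∀ x, φ x = mbar j θ (lead j l) x

/-- `N × Xε × Λε` is a neighbourhood of the iterates, uniformly in `n` and `ω`: open and convex, it
almost surely contains a ball of fixed radius around every `(θ_n, ν_n, λ_n)`, and the perturbed points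
`(θ_n^±, ν_n^±, λ_n^±)`; for `θ` in `Θ ∩ N` it contains the roots `(ν(θ), λ(θ))`. -/
structure IsUniformNhd (M : Problem d p Ξ) (P : Measure Ω) (I : Input d p) (W : Noise d Ξ Ω)
    (nu : Vec d → ℝ) (lam : Vec d → Vec p)
    (N : Set (Vec d)) (Xε : Set ℝ) (Λε : Set (Vec p)) : Prop where
  open_N : IsOpen N
  open_X : IsOpen Xε
  open_Λ : IsOpen Λε
  convex_N : Convex ℝ N
  convex_X : Convex ℝ Xε
  convex_Λ : Convex ℝ Λε
  iterates : ∃ r > 0, ∀ᵐ ω ∂P, ∀ n,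
    Metric.ball (iter M I W n ω).θ r ⊆ N ∧ Metric.ball (iter M I W n ω).nu r ⊆ Xε ∧
      Metric.ball (iter M I W n ω).lam r ⊆ Λε
  perturbed : ∀ᵐ ω ∂P, ∀ n, ∀ σ ∈ ({1, -1} : Set ℝ),
    pertθ σ (I.c (n + 1)) (W.Δ (n + 1) ω) (iter M I W n ω) ∈ N ∧
    pertNu σ (I.c (n + 1)) (W.Δ (n + 1) ω) (iter M I W n ω) ∈ Xε ∧
    pertLam σ (I.c (n + 1)) (W.Δ (n + 1) ω) (iter M I W n ω) ∈ Λε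
  roots : ∀ θ ∈ M.Θ, θ ∈ N → nu θ ∈ Xε ∧ lam θ ∈ Λε

/-- Regularity along the iterates. -/
def RegularityAssumption (M : Problem d p Ξ) (μ : Measure Ξ) [IsProbabilityMeasure μ]
    (P : Measure Ω) (I : Input d p) (W : Noise d Ξ Ω)
    (f : Vec d → ℝ → ℝ) (mbar : (j : Fin p) → Vec d → (Fin ((j : ℕ) + 1) → ℝ) → ℝ → ℝ)
    (nu : Vec d → ℝ) (lam : Vec d → Vec p) : Prop :=
  ∃ (N : Set (Vec d)) (Xε : Set ℝ) (Λε : Set (Vec p)),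
    IsUniformNhd M P I W nu lam N Xε Λε ∧
    ∃ B ε Cq εq Cm εm : ℝ, Regular M μ f mbar N Xε Λε B ε Cq εq Cm εm

/-! ### Assumption 2: random directions -/

/-- The directions `Δ_1, Δ_2, …` have independent components that are `±1` with probability `1/2`.
(That they are i.i.d. and independent of the past is then part of `IsSampling`.) -/
structure DirectionAssumption (P : Measure Ω) (W : Noise d Ξ Ω) : Prop where
  indep : ∀ n, iIndepFun (fun (i : Fin d) ω => W.Δ (n + 1) ω i) P
  prob_one : ∀ n (i : Fin d), P {ω | W.Δ (n + 1) ω i = 1} = 1 / 2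
  prob_neg_one : ∀ n (i : Fin d), P {ω | W.Δ (n + 1) ω i = -1} = 1 / 2

/-! ### Assumption 3: step sizes, perturbation sizes, bandwidths -/

structure StepAssumption (I : Input d p) : Prop where
  α_pos : ∀ n ≥ 1, 0 < I.α n
  α_sum : ¬ Summable (fun n => I.α (n + 1))
  β_pos : ∀ n ≥ 1, 0 < I.β n
  c_pos : ∀ n ≥ 1, 0 < I.c n
  h_pos : ∀ n ≥ 1, 0 < I.h n
  c_lim : Tendsto I.c atTop (𝓝 0)
  h_lim : Tendsto I.h atTop (𝓝 0)
  β_sum : Summable (fun n => I.β (n + 1) ^ 2 / (I.c (n + 1) * I.h (n + 1)) ^ 2)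
  β_small : I.β =o[atTop] (fun n => I.c n ^ 2 * I.h n ^ 2)
  α_small : I.α =o[atTop] I.β

/-! ### Assumption 4: the kernel -/

/-- Since the kernel is Lipschitz, the measure `|dK(u)|` is `|K'(u)| du`. -/
structure KernelAssumption (K : ℝ → ℝ) : Prop where
  nonneg : ∀ u, 0 ≤ K u
  symm : ∀ u, K (-u) = K u
  bdd : ∃ C, ∀ u, K u ≤ C
  cont : Continuous K
  integrable : Integrable K
  integral_one : ∫ u, K u = 1
  tail : Tendsto (fun u => u * K u) (cocompact ℝ) (𝓝 0)
  variation : Integrable (fun u => |u * Real.log (|u|)| ^ (1 / 2 : ℝ) * |deriv K u|)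
  lipschitz : ∃ k₀ > 0, ∀ u₁ u₂, |K u₁ - K u₂| ≤ k₀ * |u₁ - u₂|
  pos_near_zero : ∃ δ > 0, ∃ U : Set ℝ, IsOpen U ∧ (0 : ℝ) ∈ U ∧ ∀ u ∈ U, δ ≤ K u
  fourier_integrable :
    Integrable (fun u : ℝ => ∫ y : ℝ, Complex.exp (-Complex.I * u * y) * (K y : ℂ))
  fourier_zero : ∃ k : ℝ, Tendsto
    (fun u : ℝ => (1 - ∫ y : ℝ, Complex.exp (-Complex.I * u * y) * (K y : ℂ)) / (u : ℂ) ^ 2)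
    (𝓝[≠] 0) (𝓝 (k : ℂ))

/-! ### Assumption 5: conditions for the rate -/

/-- The normal cone of `C` at `x`. -/
def normalCone (C : Set (Vec d)) (x : Vec d) : Set (Vec d) :=
  {y | ∀ z ∈ C, inner ℝ y (z - x) ≤ 0}

/-- `z` is the minimum force that keeps `x` from leaving `C` under the velocity `v`: the vector of
least norm in `-normalCone C x` for which `v + z` does not point out of `C`. -/
def IsMinForce (C : Set (Vec d)) (x v z : Vec d) : Prop :=
  (-z ∈ normalCone C x ∧ ∀ y ∈ normalCone C x, inner ℝ (v + z) y ≤ 0) ∧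
  ∀ z', -z' ∈ normalCone C x → (∀ y ∈ normalCone C x, inner ℝ (v + z') y ≤ 0) → ‖z‖ ≤ ‖z'‖

/-- `x` solves the projected differential equation `x' = b(x) + z`, `z(t) ∈ -normalCone C (x(t))`
(in integrated form), for `t ≥ 0`. -/
def IsProjSolution (C : Set (Vec d)) (b : Vec d → Vec d) (x : ℝ → Vec d) : Prop :=
  ContinuousOn x (Ici 0) ∧ (∀ t ≥ 0, x t ∈ C) ∧ ∃ z : ℝ → Vec d,
    (∀ t ≥ 0, IntervalIntegrable (fun s => b (x s) + z s) volume 0 t ∧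
      x t = x 0 + ∫ s in (0 : ℝ)..t, (b (x s) + z s)) ∧
    ∀ᵐ s, 0 ≤ s → IsMinForce C (x s) (b (x s)) (z s)

/-- `y` is a globally asymptotically stable equilibrium of the projected differential equation. -/
structure IsGAS (C : Set (Vec d)) (b : Vec d → Vec d) (y : Vec d) : Prop where
  equilibrium : IsProjSolution C b (fun _ => y)
  stable : ∀ ε > 0, ∃ δ > 0, ∀ x, IsProjSolution C b x → ‖x 0 - y‖ < δ → ∀ t ≥ 0, ‖x t - y‖ < ε
  attractive : ∀ x, IsProjSolution C b x → Tendsto x atTop (𝓝 y)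

/-- `ḡ(θ) = g(θ, λ(θ))`. -/
def gbar (M : Problem d p Ξ) (lam : Vec d → Vec p) (θ : Vec d) : ℝ := M.g θ (lam θ)

/-- The bound on the Hessian says that its smallest eigenvalue is at least `ε`. -/
structure RateAssumption (M : Problem d p Ξ) (P : Measure Ω) (I : Input d p) (W : Noise d Ξ Ω)
    (nu : Vec d → ℝ) (lam : Vec d → Vec p) : Prop where
  sizes : ∃ Cα Cβ Cc Ch nα nβ nc nh a b ec eh : ℝ,
    0 < Cα ∧ 0 < Cβ ∧ 0 < Cc ∧ 0 < Ch ∧ 0 ≤ nα ∧ 0 ≤ nβ ∧ 0 ≤ nc ∧ 0 ≤ nh ∧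
    a ∈ Ioc (1 / 2) 1 ∧ b ∈ Ioc (1 / 2) 1 ∧ 0 < ec ∧ 0 < eh ∧ ec + eh < b / 2 ∧
    ∀ n : ℕ, 1 ≤ n →
      I.α n = Cα / ((n : ℝ) + nα) ^ a ∧ I.β n = Cβ / ((n : ℝ) + nβ) ^ b ∧
      I.c n = Cc / ((n : ℝ) + nc) ^ ec ∧ I.h n = Ch / ((n : ℝ) + nh) ^ eh
  α_range : ∃ n₀ : ℕ, 0 < n₀ ∧ ∀ n ≥ n₀, 1 / (n : ℝ) ≤ I.α n ∧ I.α n < 1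
  nu_smooth : ContDiffOn ℝ 2 nu M.Θ
  lam_smooth : ContDiffOn ℝ 2 lam M.Θ
  equilibrium : ∃ θstar ∈ interior M.Θ,
    IsGAS M.Θ (fun θ => -gradientWithin (gbar M lam) M.Θ θ) θstar ∧
    (∀ y, IsGAS M.Θ (fun θ => -gradientWithin (gbar M lam) M.Θ θ) y → y = θstar) ∧
    ∃ ε > 0, ∀ᵐ ω ∂P, ∀ n, ∀ x ∈ segment ℝ (iter M I W n ω).θ θstar, x ∈ M.Θ →
      ∀ v : Vec d, ε * ‖v‖ ^ 2 ≤ iteratedFDerivWithin ℝ 2 (gbar M lam) M.Θ x ![v, v]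
  g_smooth : ContDiff ℝ 2 (fun z : Vec d × Vec p => M.g z.1 z.2)
  g_bdd : ∃ B, ∀ k ∈ Finset.Icc 1 2, ∀ z,
    ‖iteratedFDeriv ℝ k (fun z : Vec d × Vec p => M.g z.1 z.2) z‖ ≤ B

end

end KBSA

/-!
The proof reduces the claim to mean-square recursions that contract at the rate `β_n`: first for the
gradient estimates `G_ν, G_1, …, G_p`, then for the tracking errors of `ν_n` and of the components of
`λ_n`. Both systems are triangular: a component feels itself with a contracting factor, and is driven
by `ν` and by the earlier components only.

*Conditioning.* The noise of a step is independent of the current iterate, so that a bound on the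
mean of a functional of the next iterate, computed with the current one frozen, integrates to a bound
along the run (`Setting.lintegral_iter_stepNoise`, `IsRegularRun.integral_succ_le`).

*The gradient estimates are bounded in mean square.* For a direction `Δ`, write `φ` and `ψ` for the
convolutions with the kernel of the density `f` and of the product `m̄_j f`. The mean increment of `G_j`
is proportional to `ψ⁺ φ⁻ - φ⁺ ψ⁻`, the signs referring to the two perturbed points. Along `Δᵀ G_j` it
contracts, because `∂m̄_j/∂λ_j ≤ -ε_m` and `f ≥ ε` near `ν`; the dependence on `θ`, on `ν` and on the
earlier `λ_i` contributes terms linear in `Δᵀ G_j` (`Regular.exists_drift_le`). These terms have to be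
bounded uniformly in the bandwidth, also far from `ν`, where `m̄_j` has no uniform bound. There one uses the
bound on the integral of `m̄_j² f`, which makes `m̄_j f` bounded (`abs_mul_density_le`), and the inequality
`(∂f)² ≤ C f`, valid because `f` is nonnegative with bounded second derivatives
(`BddC3.sq_fderiv_le`, `Regular.pairBounds`). The variance of an increment is of order
`β² / (c̄ h)²`. Since `c̄` is scaled by the size of the gradient estimates, this is at most
`β · (β / (c h)²)` times a constant and `gradSize`, which is `1` plus the squared norms of the
estimates (`one_div_cbar_sq_le`), and `β = o(c² h²)` lets the contraction absorb it. Hence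
`E ‖G‖²` is bounded (`exists_eventually_integral_gradSize_le`), and the mean square of
`θ_{n+1} - θ_n` is `O(α²)`, the projection being nonexpansive.

*The tracking errors.* Since `q̄` and `m̄_j` are strongly decreasing in `ν` and `λ_j`, and the root
functions are Lipschitz on `Θ`, the mean square `x` of the error of `ν` satisfies
`x' ≤ (1 - κ β) x + C β ((α/β)² + β)`. For `λ_j` the forcing is `(α/β)² + β/h + h⁴` plus the errors of
`ν` and of the earlier components: `β/h` comes from the second moment of the kernel weight, and `h⁴` is
the square of the smoothing bias, of order `h²` since the kernel is symmetric with a finite second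
moment (`KernelAssumption.integrable_sq`, `abs_kern_mf_sub_le`). The one-step bounds are
`Regular.exists_lintegral_nu_step_le` and `Regular.exists_lintegral_lam_step_le`.

*From recursions to rates.* Rapidly decreasing weights turn a triangular system into a scalar
recursion (`exists_triangular_weights`, `exists_eventually_sum_le_mul`). Its solution is of the order
of the forcing `R` as soon as `R` loses at most a factor `1 + c β` in a step
(`exists_eventually_le_mul`). Power sequences do so: they lose a factor `1 + O(1/n)`, and `n β_n → ∞`
because `1/n ≤ α_n` and `α_n = o(β_n)` (`DecaysSlowly.eventually_le`, `tendsto_mul_β`).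
-/

/-! ### Recursive inequalities -/

namespace KBSA

/-- A recursion with contraction factor `1 - c β` and forcing term `C β R` is eventually dominated by
a multiple of `R`, as soon as `R` decays more slowly than the contraction. -/
theorem exists_eventually_le_mul {a R β : ℕ → ℝ} {c C : ℝ} (hc : 0 < c)
    (ha : ∀ n, 0 ≤ a n) (hR : ∀ n, 0 < R n) (hβ : ∀ n, 0 < β n) (hβ0 : Tendsto β atTop (𝓝 0))
    (hRslow : ∀ᶠ n in atTop, R n ≤ (1 + c / 2 * β n) * R (n + 1))
    (hrec : ∀ᶠ n in atTop, a (n + 1) ≤ (1 - c * β n) * a n + C * β n * R n) :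
    ∃ A, 0 ≤ A ∧ ∀ᶠ n in atTop, a n ≤ A * R n := by
  have hβ1 : ∀ᶠ n in atTop, c * β n ≤ 1 := by
    have : Tendsto (fun n => c * β n) atTop (𝓝 (c * 0)) := hβ0.const_mul c
    rw [mul_zero] at this
    exact (this.eventually (gt_mem_nhds one_pos)).mono fun n h => h.le
  obtain ⟨N, hN⟩ := eventually_atTop.1 ((hRslow.and hrec).and hβ1)
  set A := max (a N / R N) (2 * C / c) with hA
  have hA0 : 0 ≤ A := le_trans (div_nonneg (ha N) (hR N).le) (le_max_left _ _)
  have hAC : C ≤ c / 2 * A := by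
    have : 2 * C / c ≤ A := le_max_right _ _
    rw [div_le_iff₀ hc] at this
    linarith
  refine ⟨A, hA0, eventually_atTop.2 ⟨N, fun n hn => ?_⟩⟩
  induction n, hn using Nat.le_induction with
  | base =>
    have : a N / R N ≤ A := le_max_left _ _
    rwa [div_le_iff₀ (hR N)] at this
  | succ n hn ih =>
    obtain ⟨⟨h1, h2⟩, h3⟩ := hN n hn
    have hb := hβ n
    calc a (n + 1) ≤ (1 - c * β n) * a n + C * β n * R n := h2
      _ ≤ (1 - c * β n) * (A * R n) + (c / 2 * A) * β n * R n := by
          have hRn := (hR n).le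
          have := mul_le_mul_of_nonneg_left ih (sub_nonneg.2 h3)
          have := mul_le_mul_of_nonneg_right hAC (mul_nonneg hb.le hRn)
          linarith
      _ = A * (1 - c / 2 * β n) * R n := by ring
      _ ≤ A * (1 - c / 2 * β n) * ((1 + c / 2 * β n) * R (n + 1)) := by
          refine mul_le_mul_of_nonneg_left h1 (mul_nonneg hA0 ?_)
          nlinarith
      _ = A * R (n + 1) - A * R (n + 1) * (c / 2 * β n) ^ 2 := by ring
      _ ≤ A * R (n + 1) := by
          have := mul_nonneg (mul_nonneg hA0 (hR (n + 1)).le) (sq_nonneg (c / 2 * β n))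
          linarith

/-- A positive sequence that loses at most a factor `exp (k / (n + 1))` in one step, as powers of
`n` do. -/
def DecaysSlowly (T : ℕ → ℝ) : Prop :=
  ∃ k : ℝ, 0 ≤ k ∧ ∀ n : ℕ, 0 < T n ∧ T n ≤ Real.exp (k / ((n : ℝ) + 1)) * T (n + 1)

namespace DecaysSlowly

theorem mul {S T : ℕ → ℝ} (hS : DecaysSlowly S) (hT : DecaysSlowly T) :
    DecaysSlowly (fun n => S n * T n) := by
  obtain ⟨k, hk, hS⟩ := hS
  obtain ⟨l, hl, hT⟩ := hT
  refine ⟨k + l, by positivity, fun n => ⟨mul_pos (hS n).1 (hT n).1, ?_⟩⟩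
  rw [add_div, Real.exp_add]
  calc S n * T n ≤ (Real.exp (k / ((n : ℝ) + 1)) * S (n + 1))
        * (Real.exp (l / ((n : ℝ) + 1)) * T (n + 1)) :=
        mul_le_mul (hS n).2 (hT n).2 (hT n).1.le
          (mul_nonneg (Real.exp_pos _).le (hS (n + 1)).1.le)
    _ = _ := by ring

theorem add {S T : ℕ → ℝ} (hS : DecaysSlowly S) (hT : DecaysSlowly T) :
    DecaysSlowly (fun n => S n + T n) := by
  obtain ⟨k, hk, hS⟩ := hS
  obtain ⟨l, hl, hT⟩ := hT
  refine ⟨k + l, by positivity, fun n => ⟨add_pos (hS n).1 (hT n).1, ?_⟩⟩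
  have h1 : Real.exp (k / ((n : ℝ) + 1)) ≤ Real.exp ((k + l) / ((n : ℝ) + 1)) := by
    gcongr; linarith
  have h2 : Real.exp (l / ((n : ℝ) + 1)) ≤ Real.exp ((k + l) / ((n : ℝ) + 1)) := by
    gcongr; linarith
  have := mul_le_mul_of_nonneg_right h1 (hS (n + 1)).1.le
  have := mul_le_mul_of_nonneg_right h2 (hT (n + 1)).1.le
  linarith [(hS n).2, (hT n).2]

theorem pow {S : ℕ → ℝ} (hS : DecaysSlowly S) (m : ℕ) : DecaysSlowly (fun n => S n ^ m) := by
  induction m with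
  | zero => exact ⟨0, le_rfl, fun n => by simp⟩
  | succ m ih => simpa only [pow_succ] using ih.mul hS

theorem power {C s a : ℝ} (hC : 0 < C) (hs : 0 ≤ s) (ha : 0 ≤ a) :
    DecaysSlowly (fun n : ℕ => C / (((n + 1 : ℕ) : ℝ) + s) ^ a) := by
  refine ⟨a, ha, fun n => ⟨by positivity, ?_⟩⟩
  have hn : (0 : ℝ) < (n : ℝ) + 1 := by positivity
  have h1 : ((n + 1 + 1 : ℕ) : ℝ) + s ≤
      Real.exp (1 / ((n : ℝ) + 1)) * (((n + 1 : ℕ) : ℝ) + s) := by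
    have := Real.add_one_le_exp (1 / ((n : ℝ) + 1))
    have h2 : (1 / ((n : ℝ) + 1) + 1) * (((n + 1 : ℕ) : ℝ) + s) ≤
        Real.exp (1 / ((n : ℝ) + 1)) * (((n + 1 : ℕ) : ℝ) + s) := by gcongr
    refine le_trans ?_ h2
    push_cast
    have : 1 / ((n : ℝ) + 1) * (n + 1 + s) = 1 + s / (n + 1) := by field_simp
    rw [add_mul, this]
    have : 0 ≤ s / ((n : ℝ) + 1) := by positivity
    linarith
  have h2 : (((n + 1 + 1 : ℕ) : ℝ) + s) ^ a ≤
      Real.exp (a / ((n : ℝ) + 1)) * (((n + 1 : ℕ) : ℝ) + s) ^ a := by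
    refine (Real.rpow_le_rpow (by positivity) h1 ha).trans ?_
    rw [Real.mul_rpow (by positivity) (by positivity), ← Real.exp_mul]
    apply le_of_eq; congr 2; ring
  rw [← mul_div_assoc, div_le_div_iff₀ (by positivity) (by positivity)]
  calc C * (((n + 1 + 1 : ℕ) : ℝ) + s) ^ a
      ≤ C * (Real.exp (a / ((n : ℝ) + 1)) * (((n + 1 : ℕ) : ℝ) + s) ^ a) := by gcongr
    _ = _ := by ring

theorem power_inv {C s a : ℝ} (hC : 0 < C) (hs : 0 ≤ s) (ha : 0 ≤ a) :
    DecaysSlowly (fun n : ℕ => (C / (((n + 1 : ℕ) : ℝ) + s) ^ a)⁻¹) := by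
  refine ⟨0, le_rfl, fun n => ⟨by positivity, ?_⟩⟩
  simp only [zero_div, Real.exp_zero, one_mul, inv_div]
  gcongr
  linarith

theorem eventually_le {R β : ℕ → ℝ} (hR : DecaysSlowly R) {c : ℝ} (hc : 0 < c)
    (hβ : Tendsto (fun n : ℕ => ((n : ℝ) + 1) * β n) atTop atTop) :
    ∀ᶠ n in atTop, R n ≤ (1 + c * β n) * R (n + 1) := by
  obtain ⟨k, hk, hR⟩ := hR
  have h1 : Tendsto (fun n : ℕ => k / ((n : ℝ) + 1)) atTop (𝓝 0) :=
    tendsto_const_nhds.div_atTop (tendsto_atTop_add_const_right _ _ tendsto_natCast_atTop_atTop)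
  filter_upwards [h1.eventually (gt_mem_nhds one_pos), hβ.eventually_ge_atTop (2 * k / c)]
    with n h2 h3
  refine (hR n).2.trans (mul_le_mul_of_nonneg_right ?_ (hR (n + 1)).1.le)
  have hn : (0 : ℝ) < (n : ℝ) + 1 := by positivity
  have hx : 0 ≤ k / ((n : ℝ) + 1) := by positivity
  have h4 : Real.exp (k / ((n : ℝ) + 1)) ≤ 1 + 2 * (k / ((n : ℝ) + 1)) := by
    have := Real.abs_exp_sub_one_le (x := k / ((n : ℝ) + 1)) (by rw [abs_of_nonneg hx]; exact h2.le)
    rw [abs_of_nonneg hx] at this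
    linarith [le_abs_self (Real.exp (k / ((n : ℝ) + 1)) - 1)]
  refine h4.trans ?_
  rw [div_le_iff₀ hc] at h3
  have : 2 * (k / ((n : ℝ) + 1)) ≤ c * β n := by
    rw [← mul_div_assoc, div_le_iff₀ hn]; linarith
  linarith

end DecaysSlowly

/-- Weights that decrease fast enough make a strictly lower triangular coupling negligible. -/
theorem exists_triangular_weights (m : ℕ) {κ C : ℝ} (hκ : 0 < κ) (hC : 0 ≤ C) :
    ∃ w : Fin m → ℝ, (∀ j, 0 < w j) ∧ ∀ x : Fin m → ℝ, (∀ j, 0 ≤ x j) →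
      ∑ j, w j * (C * ∑ i ∈ Finset.univ.filter (· < j), x i) ≤ κ * ∑ j, w j * x j := by
  set q : ℝ := min 1 (κ / (C * m + 1)) with hq
  have hden : 0 < C * m + 1 := by positivity
  have hq0 : 0 < q := lt_min one_pos (by positivity)
  have hq1 : q ≤ 1 := min_le_left _ _
  have hqκ : C * m * q ≤ κ := by
    have h1 : q ≤ κ / (C * m + 1) := min_le_right _ _
    rw [le_div_iff₀ hden] at h1
    nlinarith
  refine ⟨fun j => q ^ (j : ℕ), fun j => by positivity, fun x hx => ?_⟩
  have key : ∀ j : Fin m, q ^ (j : ℕ) * (C * ∑ i ∈ Finset.univ.filter (· < j), x i) ≤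
      C * q * ∑ i : Fin m, q ^ (i : ℕ) * x i := by
    intro j
    have : q ^ (j : ℕ) * ∑ i ∈ Finset.univ.filter (· < j), x i ≤ q * ∑ i : Fin m, q ^ (i : ℕ) * x i := by
      rw [Finset.mul_sum, Finset.mul_sum]
      refine (Finset.sum_le_sum (g := fun i : Fin m => q * (q ^ (i : ℕ) * x i)) fun i hi => ?_).trans
        (Finset.sum_le_sum_of_subset_of_nonneg (Finset.filter_subset _ _) fun i _ _ => ?_)
      · rw [Finset.mem_filter] at hi
        have h2 : (i : ℕ) + 1 ≤ j := hi.2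
        have := pow_le_pow_of_le_one hq0.le hq1 h2
        rw [pow_succ] at this
        have := mul_le_mul_of_nonneg_right this (hx i)
        linarith
      · exact mul_nonneg hq0.le (mul_nonneg (by positivity) (hx i))
    calc _ = C * (q ^ (j : ℕ) * ∑ i ∈ Finset.univ.filter (· < j), x i) := by ring
      _ ≤ C * (q * ∑ i : Fin m, q ^ (i : ℕ) * x i) := by gcongr
      _ = _ := by ring
  calc _ ≤ ∑ _j : Fin m, C * q * ∑ i : Fin m, q ^ (i : ℕ) * x i := Finset.sum_le_sum fun j _ => key j
    _ = C * m * q * ∑ i : Fin m, q ^ (i : ℕ) * x i := by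
        rw [Finset.sum_const, Finset.card_univ, Fintype.card_fin, nsmul_eq_mul]; ring
    _ ≤ κ * ∑ i : Fin m, q ^ (i : ℕ) * x i := by
        refine mul_le_mul_of_nonneg_right hqκ (Finset.sum_nonneg fun i _ => ?_)
        exact mul_nonneg (by positivity) (hx i)

end KBSA

/-! ### The smoothing kernel -/

namespace KBSA

/-- The quantitative consequences of the conditions on the kernel, with one constant `C` in all the
bounds. -/
structure KernelBounds (K : ℝ → ℝ) (C : ℝ) : Prop where
  one_le : 1 ≤ C
  nonneg : ∀ u, 0 ≤ K u
  symm : ∀ u, K (-u) = K u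
  cont : Continuous K
  integrable : Integrable K
  integral_one : ∫ u, K u = 1
  le : ∀ u, K u ≤ C
  tail : ∀ u, |u| * K u ≤ C
  sq_integrable : Integrable (fun u => u ^ 2 * K u)
  sq_le : ∫ u, u ^ 2 * K u ≤ C

/-- The second moment of the kernel is finite: by Fatou's lemma it is bounded in terms of the limit of
`(1 - k(u)) / u²`, whose real part is the integral of `(1 - cos (u y)) / u²` against the kernel. -/
theorem KernelAssumption.integrable_sq {K : ℝ → ℝ} (hK : KernelAssumption K) :
    Integrable (fun u => u ^ 2 * K u) := by
  obtain ⟨k, hk⟩ := hK.fourier_zero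
  set u : ℕ → ℝ := fun n => 1 / ((n : ℝ) + 1) with hu
  have hupos : ∀ n, 0 < u n := fun n => by simp only [hu]; positivity
  have hu0 : Tendsto u atTop (𝓝 0) := tendsto_one_div_add_atTop_nhds_zero_nat
  have hu1 : Tendsto u atTop (𝓝[≠] 0) :=
    tendsto_nhdsWithin_iff.2 ⟨hu0, Eventually.of_forall fun n => (hupos n).ne'⟩
  set φ : ℕ → ℝ → ℝ := fun n y => (1 - Real.cos (u n * y)) / u n ^ 2 * K y with hφ
  have hφnn : ∀ n y, 0 ≤ φ n y := fun n y =>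
    mul_nonneg (div_nonneg (sub_nonneg.2 (Real.cos_le_one _)) (sq_nonneg _)) (hK.nonneg y)
  have hcosint : ∀ n, Integrable (fun y => Real.cos (u n * y) * K y) := fun n => by
    refine hK.integrable.bdd_mul (c := 1) (by fun_prop) (Eventually.of_forall fun y => ?_)
    simpa using Real.abs_cos_le_one _
  have hφint : ∀ n, Integrable (φ n) := fun n => by
    have := (hK.integrable.sub (hcosint n)).const_mul (1 / u n ^ 2)
    refine this.congr (Eventually.of_forall fun y => ?_)
    simp only [hφ, Pi.sub_apply]; ring
  have hval : ∀ n, ∫ y, φ n y =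
      ((1 - ∫ y : ℝ, Complex.exp (-Complex.I * (u n : ℝ) * y) * (K y : ℂ)) /
        ((u n : ℝ) : ℂ) ^ 2).re := fun n => by
    have hint : Integrable
        (fun y : ℝ => Complex.exp (-Complex.I * (u n : ℝ) * y) * (K y : ℂ)) := by
      refine hK.integrable.ofReal.bdd_mul (c := 1) (by fun_prop) (Eventually.of_forall fun y => ?_)
      rw [Complex.norm_exp]; simp
    have h1 : (∫ y : ℝ, Complex.exp (-Complex.I * (u n : ℝ) * y) * (K y : ℂ)).re =
        ∫ y, Real.cos (u n * y) * K y := by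
      have := integral_re hint
      simp only [RCLike.re_to_complex] at this
      rw [← this]
      congr 1; ext y
      rw [Complex.mul_re, Complex.ofReal_re, Complex.ofReal_im, Complex.exp_re]
      simp
    have h2 : ((1 - ∫ y : ℝ, Complex.exp (-Complex.I * (u n : ℝ) * y) * (K y : ℂ)) /
        ((u n : ℝ) : ℂ) ^ 2).re = (1 - ∫ y, Real.cos (u n * y) * K y) / u n ^ 2 := by
      rw [← Complex.ofReal_pow, Complex.div_ofReal_re, Complex.sub_re, h1, Complex.one_re]
    rw [h2, ← hK.integral_one, ← integral_sub hK.integrable (hcosint n), ← integral_div]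
    congr 1; ext y
    simp only [hφ]; ring
  have hlim : Tendsto (fun n => ∫ y, φ n y) atTop (𝓝 k) := by
    have := (Complex.continuous_re.tendsto _).comp (hk.comp hu1)
    simp only [Complex.ofReal_re] at this
    refine this.congr fun n => ?_
    simp only [Function.comp_apply]
    exact (hval n).symm
  have hpt : ∀ y, Tendsto (fun n => φ n y) atTop (𝓝 (y ^ 2 / 2 * K y)) := fun y => by
    have h1 : ∀ n, φ n y = y ^ 2 / 2 * Real.sinc (u n * y / 2) ^ 2 * K y := fun n => by
      have hun := (hupos n).ne'
      have h2 : 1 - Real.cos (u n * y) = 2 * Real.sin (u n * y / 2) ^ 2 := by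
        have := Real.cos_sq (u n * y / 2)
        rw [Real.sin_sq, this, show 2 * (u n * y / 2) = u n * y by ring]
        ring
      have h3 : Real.sin (u n * y / 2) = u n * y / 2 * Real.sinc (u n * y / 2) := by
        by_cases h0 : u n * y / 2 = 0
        · rw [h0]; simp
        · rw [Real.sinc_of_ne_zero h0, mul_div_assoc', mul_div_cancel_left₀ _ h0]
      simp only [hφ]
      rw [h2, h3]; field_simp
    simp_rw [h1]
    have h4 : Tendsto (fun n => u n * y / 2) atTop (𝓝 0) := by
      have := (hu0.mul_const y).div_const 2
      simpa using this
    have h5 := (Real.continuous_sinc.tendsto 0).comp h4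
    rw [Real.sinc_zero] at h5
    have := ((h5.pow 2).const_mul (y ^ 2 / 2)).mul_const (K y)
    simpa using this
  have hfatou : ∫⁻ y, ENNReal.ofReal (y ^ 2 / 2 * K y) ≤ ENNReal.ofReal k := by
    have h1 : ∀ y, ENNReal.ofReal (y ^ 2 / 2 * K y) =
        liminf (fun n => ENNReal.ofReal (φ n y)) atTop := fun y =>
      ((ENNReal.tendsto_ofReal (hpt y)).liminf_eq).symm
    simp_rw [h1]
    have hKm := hK.cont.measurable
    refine (lintegral_liminf_le fun n => ?_).trans ?_
    · simp only [hφ]; fun_prop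
    have h2 : ∀ n, ∫⁻ y, ENNReal.ofReal (φ n y) = ENNReal.ofReal (∫ y, φ n y) := fun n =>
      (ofReal_integral_eq_lintegral_ofReal (hφint n) (Eventually.of_forall (hφnn n))).symm
    simp_rw [h2]
    exact ((ENNReal.tendsto_ofReal hlim).liminf_eq).le
  have hKc := hK.cont
  have hI : Integrable (fun y => y ^ 2 / 2 * K y) := by
    refine ⟨by fun_prop, ?_⟩
    rw [hasFiniteIntegral_iff_ofReal
      (Eventually.of_forall fun y => mul_nonneg (by positivity) (hK.nonneg y))]
    exact hfatou.trans_lt ENNReal.ofReal_lt_top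
  refine (hI.const_mul 2).congr (Eventually.of_forall fun y => ?_)
  simp only; ring

theorem KernelAssumption.exists_bounds {K : ℝ → ℝ} (hK : KernelAssumption K) :
    ∃ C, KernelBounds K C := by
  obtain ⟨C₁, hC₁⟩ := hK.bdd
  have hKc := hK.cont
  obtain ⟨C₂, hC₂⟩ : ∃ C₂, ∀ u, |u| * K u ≤ C₂ := by
    have h1 := hK.tail.eventually (Metric.ball_mem_nhds (0 : ℝ) one_pos)
    obtain ⟨s, hs, hs'⟩ := mem_cocompact.1 h1
    have hcont : Continuous (fun u => |u| * K u) := by fun_prop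
    obtain ⟨b, hb⟩ := (hs.image hcont).bddAbove
    refine ⟨max b 1, fun u => ?_⟩
    by_cases hu : u ∈ s
    · exact (hb (mem_image_of_mem _ hu)).trans (le_max_left _ _)
    · have := hs' hu
      simp only [mem_ofPred_eq, dist_zero_right, Real.norm_eq_abs, abs_mul] at this
      rw [abs_of_nonneg (hK.nonneg u)] at this
      exact this.le.trans (le_max_right _ _)
  set C := max (max 1 C₁) (max C₂ (∫ u, u ^ 2 * K u))
  exact ⟨C, le_trans (le_max_left _ _) (le_max_left _ _), hK.nonneg, hK.symm, hK.cont,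
    hK.integrable, hK.integral_one,
    fun u => (hC₁ u).trans (le_trans (le_max_right _ _) (le_max_left _ _)),
    fun u => (hC₂ u).trans (le_trans (le_max_left _ _) (le_max_right _ _)), hK.integrable_sq,
    le_trans (le_max_right _ _) (le_max_right _ _)⟩

namespace KernelBounds

variable {K : ℝ → ℝ} {C h ν : ℝ}

theorem pos (hK : KernelBounds K C) : 0 < C := one_pos.trans_le hK.one_le

theorem kern_nonneg (hK : KernelBounds K C) (hh : 0 < h) (x : ℝ) : 0 ≤ kern K h ν x :=
  mul_nonneg (by positivity) (hK.nonneg _)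

theorem kern_le (hK : KernelBounds K C) (hh : 0 < h) (x : ℝ) : kern K h ν x ≤ C / h := by
  rw [kern, div_mul_eq_mul_div, one_mul]
  gcongr
  exact hK.le _

theorem kern_le_of_le (hK : KernelBounds K C) (hh : 0 < h) {ρ x : ℝ} (hρ : 0 < ρ)
    (hx : ρ ≤ |ν - x|) : kern K h ν x ≤ C / ρ := by
  have h1 := hK.tail ((ν - x) / h)
  rw [abs_div, abs_of_pos hh] at h1
  have h2 : kern K h ν x * |ν - x| ≤ C := by
    calc _ = |ν - x| / h * K ((ν - x) / h) := by rw [kern]; ring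
      _ ≤ C := h1
  rw [le_div_iff₀ hρ]
  exact (mul_le_mul_of_nonneg_left hx (hK.kern_nonneg hh x)).trans h2

theorem continuous_kern (hK : KernelBounds K C) : Continuous (kern K h ν) := by
  have := hK.cont
  unfold kern
  fun_prop

/-- The substitution `x = ν - h u`. -/
theorem integral_kern_mul (hh : 0 < h) (F : ℝ → ℝ) :
    ∫ x, kern K h ν x * F x = ∫ u, K u * F (ν - h * u) := by
  have h1 := integral_sub_left_eq_self (fun y => kern K h ν y * F y) volume ν
  rw [← h1]
  have h2 := Measure.integral_comp_mul_left (fun x => kern K h ν (ν - x) * F (ν - x)) h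
  rw [abs_of_pos (inv_pos.2 hh)] at h2
  have h3 : ∫ x, kern K h ν (ν - x) * F (ν - x)
      = h * ∫ x, kern K h ν (ν - h * x) * F (ν - h * x) := by
    rw [h2, smul_eq_mul, ← mul_assoc, mul_inv_cancel₀ hh.ne', one_mul]
  rw [h3, ← integral_const_mul]
  congr 1; ext x
  rw [kern, show (ν - (ν - h * x)) / h = x by field_simp; ring]
  field_simp

theorem integrable_kern (hK : KernelBounds K C) (hh : 0 < h) : Integrable (kern K h ν) := by
  have h1 : Integrable (fun x => K (x / h)) := hK.integrable.comp_div hh.ne'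
  exact (h1.comp_sub_left ν).const_mul (1 / h)

theorem integral_kern (hK : KernelBounds K C) (hh : 0 < h) : ∫ x, kern K h ν x = 1 := by
  have := integral_kern_mul (K := K) (ν := ν) hh (fun _ => 1)
  simpa [hK.integral_one] using this

theorem integrable_kern_mul (hK : KernelBounds K C) (hh : 0 < h) {F : ℝ → ℝ} {M : ℝ}
    (hF : AEStronglyMeasurable F) (hM : ∀ x, |F x| ≤ M) :
    Integrable (fun x => kern K h ν x * F x) :=
  (hK.integrable_kern hh).mul_bdd hF (Eventually.of_forall hM)

theorem integrable_kern_mul_sq (hK : KernelBounds K C) (hh : 0 < h) :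
    Integrable (fun x => kern K h ν x * (ν - x) ^ 2) := by
  have h1 : Integrable (fun x => (x / h) ^ 2 * K (x / h)) := hK.sq_integrable.comp_div hh.ne'
  refine ((h1.comp_sub_left ν).const_mul h).congr (Eventually.of_forall fun x => ?_)
  simp only [kern]; field_simp

theorem integral_kern_mul_sq_le (hK : KernelBounds K C) (hh : 0 < h) :
    ∫ x, kern K h ν x * (ν - x) ^ 2 ≤ C * h ^ 2 := by
  rw [integral_kern_mul hh (fun x => (ν - x) ^ 2)]
  calc _ = h ^ 2 * ∫ u, u ^ 2 * K u := by
        rw [← integral_const_mul]; congr 1; ext u; ring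
    _ ≤ h ^ 2 * C := by gcongr; exact hK.sq_le
    _ = _ := by ring

/-- The kernel puts only mass `O(h²)` outside a fixed neighbourhood of `ν`. -/
theorem setIntegral_kern_le (hK : KernelBounds K C) (hh : 0 < h) {ρ : ℝ} (hρ : 0 < ρ) {S : Set ℝ}
    (hSm : MeasurableSet S) (hS : ∀ x ∈ S, ρ ≤ |ν - x|) :
    ∫ x in S, kern K h ν x ≤ C / ρ ^ 2 * h ^ 2 := by
  have hi := hK.integrable_kern_mul_sq (ν := ν) hh
  calc ∫ x in S, kern K h ν x ≤ ∫ x in S, 1 / ρ ^ 2 * (kern K h ν x * (ν - x) ^ 2) := by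
        refine setIntegral_mono_on (hK.integrable_kern hh).integrableOn
          (hi.const_mul _).integrableOn hSm fun x hx => ?_
        have h1 : ρ ^ 2 ≤ (ν - x) ^ 2 := by
          rw [← sq_abs (ν - x)]
          exact pow_le_pow_left₀ hρ.le (hS x hx) 2
        rw [div_mul_eq_mul_div, one_mul, le_div_iff₀ (by positivity)]
        exact mul_le_mul_of_nonneg_left h1 (hK.kern_nonneg hh x)
    _ ≤ ∫ x, 1 / ρ ^ 2 * (kern K h ν x * (ν - x) ^ 2) :=
        setIntegral_le_integral (hi.const_mul _) (Eventually.of_forall fun x =>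
          mul_nonneg (by positivity) (mul_nonneg (hK.kern_nonneg hh x) (sq_nonneg _)))
    _ ≤ 1 / ρ ^ 2 * (C * h ^ 2) := by
        rw [integral_const_mul]
        gcongr
        exact hK.integral_kern_mul_sq_le hh
    _ = _ := by ring

theorem integral_kern_mul_le (hK : KernelBounds K C) (hh : 0 < h) {F : ℝ → ℝ} {M : ℝ}
    (hM : ∀ x, |F x| ≤ M) : |∫ x, kern K h ν x * F x| ≤ M := by
  have h1 := norm_integral_le_of_norm_le ((hK.integrable_kern (ν := ν) hh).mul_const M)
    (f := fun x => kern K h ν x * F x) (Eventually.of_forall fun x => by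
      rw [norm_mul, Real.norm_of_nonneg (hK.kern_nonneg hh x)]
      exact mul_le_mul_of_nonneg_left (hM x) (hK.kern_nonneg hh x))
  rwa [integral_mul_const, hK.integral_kern hh, one_mul] at h1

end KernelBounds

end KBSA

/-! ### Kernel-smoothed regression functions -/

namespace KBSA

/-- A nonnegative `C²` function on `[-R, R]` with bounded derivatives satisfies `F'(0)² ≤ A F(0)`. -/
theorem sq_deriv_le_of_nonneg {F F' : ℝ → ℝ} {B R : ℝ} (hB : 1 ≤ B) (hR : 0 < R)
    (hF : ∀ t, |t| ≤ R → HasDerivAt F (F' t) t) (hF0 : ∀ t, |t| ≤ R → 0 ≤ F t)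
    (h1 : |F' 0| ≤ B) (h2 : ∀ t, |t| ≤ R → |F' t - F' 0| ≤ B * |t|) :
    F' 0 ^ 2 ≤ 4 * B * (1 + 1 / R) * F 0 := by
  set a := F' 0
  have hB0 : 0 < B := by linarith
  -- a step against the gradient, short enough to stay inside `[-R, R]`
  set τ : ℝ := 1 / (2 * B * (1 + 1 / R)) with hτ
  have hden : 0 < 2 * B * (1 + 1 / R) := by positivity
  have hτ0 : 0 < τ := by positivity
  have hτB : B * τ ≤ 1 / 2 := by
    rw [hτ, mul_one_div, div_le_iff₀ hden]
    have : 0 ≤ B * (1 / R) := by positivity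
    linarith
  have hτR : B * τ ≤ R := by
    rw [hτ, mul_one_div, div_le_iff₀ hden]
    have : R * (2 * B * (1 + 1 / R)) = 2 * B * R + 2 * B := by field_simp
    rw [this]
    nlinarith
  have hstep : |-(a * τ)| ≤ R := by
    rw [abs_neg, abs_mul, abs_of_pos hτ0]
    exact (mul_le_mul_of_nonneg_right h1 hτ0.le).trans hτR
  have hseg : ∀ t ∈ uIcc 0 (-(a * τ)), |t| ≤ |a * τ| := fun t ht => by
    have := abs_sub_left_of_mem_uIcc ht
    simpa using this
  have hder : ∀ t ∈ uIcc 0 (-(a * τ)),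
      HasDerivWithinAt (fun t => F t - a * t) (F' t - a) (uIcc 0 (-(a * τ))) t := fun t ht => by
    have h5 := (hF t ((hseg t ht).trans (by simpa using hstep))).fun_sub
      ((hasDerivAt_id' t).const_mul a)
    rw [mul_one] at h5
    exact h5.hasDerivWithinAt
  have hmv := (convex_uIcc 0 (-(a * τ))).norm_image_sub_le_of_norm_hasDerivWithin_le
    (C := B * |a * τ|) hder (fun t ht => by
      rw [Real.norm_eq_abs]
      exact (h2 t ((hseg t ht).trans (by simpa using hstep))).trans
        (mul_le_mul_of_nonneg_left (hseg t ht) hB0.le)) left_mem_uIcc right_mem_uIcc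
  rw [Real.norm_eq_abs, Real.norm_eq_abs, sub_zero, abs_neg, mul_assoc, abs_mul_abs_self] at hmv
  have h3 := (abs_le.1 hmv).2
  have h4 := hF0 _ hstep
  have h5 : a ^ 2 * τ ≤ 2 * F 0 := by
    have : B * (a * τ * (a * τ)) ≤ 1 / 2 * (a ^ 2 * τ) := by
      calc B * (a * τ * (a * τ)) = B * τ * (a ^ 2 * τ) := by ring
        _ ≤ 1 / 2 * (a ^ 2 * τ) := mul_le_mul_of_nonneg_right hτB (by positivity)
    nlinarith
  rw [hτ, mul_one_div, div_le_iff₀ hden] at h5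
  linarith

/-- Bounds on a density `f` and a regression function `m`, with one constant `C` in all the upper
bounds; `U` is the set on which `f` is bounded below. The bound `M` of the last field does not enter
any estimate. -/
structure PairBounds (m f : ℝ → ℝ) (U : Set ℝ) (ε C : ℝ) : Prop where
  one_le : 1 ≤ C
  ε_pos : 0 < ε
  f_smooth : ContDiff ℝ 2 f
  m_smooth : ContDiff ℝ 2 m
  f_integrable : Integrable f
  f_integral : ∫ x, f x = 1
  f_nonneg : ∀ x, 0 ≤ f x
  f_le : ∀ x, f x ≤ C
  f_deriv : ∀ x, |deriv f x| ≤ C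
  f_deriv2 : ∀ x, |deriv (deriv f) x| ≤ C
  f_sq : ∀ x, deriv f x ^ 2 ≤ C * f x
  f_lower : ∀ x ∈ U, ε ≤ f x
  m_deriv : ∀ x, 0 < f x → |deriv m x| ≤ C
  m_deriv2 : ∀ x ∈ U, |deriv (deriv m) x| ≤ C
  m_le : ∀ x ∈ U, |m x| ≤ C
  m_sq_integrable : Integrable (fun x => m x ^ 2 * f x)
  m_sq : ∫ x, m x ^ 2 * f x ≤ C
  mf_le : ∀ x, |m x * f x| ≤ C
  bdd : ∃ M, ∀ x, |m x| ≤ M ∧ |deriv m x| ≤ M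

namespace PairBounds

variable {K m f W : ℝ → ℝ} {U : Set ℝ} {CK ε C h ν ρ A : ℝ}

theorem pos (hP : PairBounds m f U ε C) : 0 < C := one_pos.trans_le hP.one_le

/-- An integral against the kernel is controlled by a bound that may grow like `m² f` off the
neighbourhood `U` of `ν`: there the kernel is bounded and `m² f` has a bounded integral. -/
theorem abs_integral_kern_le (hP : PairBounds m f U ε C) (hK : KernelBounds K CK) (hh : 0 < h)
    (hρ : 0 < ρ) (hU : Metric.ball ν ρ ⊆ U) (h1 : ∀ x ∈ U, |W x| ≤ A)
    (h2 : ∀ x ∉ U, |W x| ≤ A + m x ^ 2 * f x) :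
    |∫ x, kern K h ν x * W x| ≤ A + CK / ρ * C := by
  have hmf : ∀ x, 0 ≤ m x ^ 2 * f x := fun x => mul_nonneg (sq_nonneg _) (hP.f_nonneg x)
  have hCK : 0 ≤ CK / ρ := div_nonneg hK.pos.le hρ.le
  have h3 := norm_integral_le_of_norm_le (f := fun x => kern K h ν x * W x)
    (((hK.integrable_kern (ν := ν) hh).mul_const A).add (hP.m_sq_integrable.const_mul (CK / ρ)))
    (Eventually.of_forall fun x => by
      have hk := hK.kern_nonneg (ν := ν) hh x
      simp only [Pi.add_apply]
      rw [norm_mul, Real.norm_of_nonneg hk, Real.norm_eq_abs]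
      by_cases hx : x ∈ U
      · exact (mul_le_mul_of_nonneg_left (h1 x hx) hk).trans
          (le_add_of_nonneg_right (mul_nonneg hCK (hmf x)))
      · have hx' : ρ ≤ |ν - x| := by
          by_contra hlt
          exact hx (hU (by rw [Metric.mem_ball, dist_comm, Real.dist_eq]; linarith))
        have h4 := mul_le_mul_of_nonneg_left (h2 x hx) hk
        have h5 := mul_le_mul_of_nonneg_right (hK.kern_le_of_le hh hρ hx') (hmf x)
        linarith)
  simp only [Pi.add_apply] at h3
  rw [integral_add ((hK.integrable_kern hh).mul_const A) (hP.m_sq_integrable.const_mul _),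
    integral_mul_const, hK.integral_kern hh, integral_const_mul, one_mul] at h3
  exact h3.trans (by have := mul_le_mul_of_nonneg_left hP.m_sq hCK; linarith)

theorem m_mul_deriv_le (hP : PairBounds m f U ε C) {f' : ℝ} {x : ℝ} (hf' : |f'| ≤ C)
    (hf'2 : f' ^ 2 ≤ C * f x) :
    (x ∈ U → |m x * f'| ≤ C ^ 2) ∧ |m x * f'| ≤ C ^ 2 + m x ^ 2 * f x := by
  refine ⟨fun hx => ?_, ?_⟩
  · rw [abs_mul, sq]
    exact mul_le_mul (hP.m_le x hx) hf' (abs_nonneg _) hP.pos.le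
  · have hC := hP.one_le
    have hf := hP.f_nonneg x
    have h1 : |m x * f'| ^ 2 ≤ (C ^ 2 + m x ^ 2 * f x) ^ 2 := by
      rw [sq_abs, mul_pow]
      have h2 : m x ^ 2 * f' ^ 2 ≤ C * (m x ^ 2 * f x) := by
        calc m x ^ 2 * f' ^ 2 ≤ m x ^ 2 * (C * f x) := by gcongr
          _ = _ := by ring
      have h3 : 0 ≤ m x ^ 2 * f x := mul_nonneg (sq_nonneg _) hf
      have h4 : C * (m x ^ 2 * f x) ≤ C ^ 2 * (m x ^ 2 * f x) := by
        gcongr; nlinarith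
      nlinarith [sq_nonneg (C ^ 2), sq_nonneg (m x ^ 2 * f x)]
    exact abs_le_of_sq_le_sq' h1 (by positivity) |>.2

theorem hasDerivAt_f (hP : PairBounds m f U ε C) (x : ℝ) : HasDerivAt f (deriv f x) x :=
  (hP.f_smooth.differentiable (by norm_num) x).hasDerivAt

theorem hasDerivAt_m (hP : PairBounds m f U ε C) (x : ℝ) : HasDerivAt m (deriv m x) x :=
  (hP.m_smooth.differentiable (by norm_num) x).hasDerivAt

theorem continuous_deriv_f (hP : PairBounds m f U ε C) : Continuous (deriv f) :=
  hP.f_smooth.continuous_deriv (by norm_num)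

theorem continuous_deriv_m (hP : PairBounds m f U ε C) : Continuous (deriv m) :=
  hP.m_smooth.continuous_deriv (by norm_num)

theorem hasDerivAt_deriv_f (hP : PairBounds m f U ε C) (x : ℝ) :
    HasDerivAt (deriv f) (deriv (deriv f) x) x := by
  have h1 : ContDiff ℝ 1 (deriv f) := ((contDiff_succ_iff_deriv (n := 1)).1 hP.f_smooth).2.2
  exact (h1.differentiable (by norm_num) x).hasDerivAt

theorem hasDerivAt_deriv_m (hP : PairBounds m f U ε C) (x : ℝ) :
    HasDerivAt (deriv m) (deriv (deriv m) x) x := by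
  have h1 : ContDiff ℝ 1 (deriv m) := ((contDiff_succ_iff_deriv (n := 1)).1 hP.m_smooth).2.2
  exact (h1.differentiable (by norm_num) x).hasDerivAt

theorem abs_m_deriv_mul_f_le (hP : PairBounds m f U ε C) (x : ℝ) :
    |deriv m x * f x| ≤ C ^ 2 := by
  have hC := hP.one_le
  rcases (hP.f_nonneg x).eq_or_lt with h0 | h0
  · rw [← h0, mul_zero, abs_zero]; positivity
  · rw [abs_mul, sq, abs_of_pos h0]
    exact mul_le_mul (hP.m_deriv x h0) (hP.f_le x) h0.le hP.pos.le

theorem abs_kern_f_le (hP : PairBounds m f U ε C) (hK : KernelBounds K CK) (hh : 0 < h) :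
    |∫ x, kern K h ν x * f x| ≤ C :=
  hK.integral_kern_mul_le hh fun x => by rw [abs_of_nonneg (hP.f_nonneg x)]; exact hP.f_le x

theorem abs_kern_mf_le (hP : PairBounds m f U ε C) (hK : KernelBounds K CK) (hh : 0 < h) :
    |∫ x, kern K h ν x * (m x * f x)| ≤ C :=
  hK.integral_kern_mul_le hh hP.mf_le

theorem integrable_kern_f (hP : PairBounds m f U ε C) (hK : KernelBounds K CK) (hh : 0 < h) :
    Integrable (fun x => kern K h ν x * f x) :=
  hK.integrable_kern_mul hh (M := C) hP.f_smooth.continuous.aestronglyMeasurable fun x => by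
    rw [abs_of_nonneg (hP.f_nonneg x)]; exact hP.f_le x

theorem integrable_kern_mf (hP : PairBounds m f U ε C) (hK : KernelBounds K CK) (hh : 0 < h) :
    Integrable (fun x => kern K h ν x * (m x * f x)) :=
  hK.integrable_kern_mul hh (M := C)
    (hP.m_smooth.continuous.mul hP.f_smooth.continuous).aestronglyMeasurable hP.mf_le

theorem le_kern_f (hP : PairBounds m f U ε C) (hK : KernelBounds K CK) (hh : 0 < h)
    (hρ : 0 < ρ) (hU : Metric.ball ν ρ ⊆ U) (hsmall : CK / ρ ^ 2 * h ^ 2 ≤ 1 / 2) :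
    ε / 2 ≤ ∫ x, kern K h ν x * f x := by
  have hS : MeasurableSet (Metric.ball ν ρ)ᶜ := measurableSet_ball.compl
  have h1 := hK.setIntegral_kern_le (ν := ν) hh hρ hS fun x hx => by
    rw [mem_compl_iff, Metric.mem_ball, not_lt, dist_comm, Real.dist_eq] at hx; exact hx
  have h2 : ∫ x in Metric.ball ν ρ, kern K h ν x = 1 - ∫ x in (Metric.ball ν ρ)ᶜ, kern K h ν x := by
    rw [← hK.integral_kern (ν := ν) hh, ← integral_add_compl measurableSet_ball
      (hK.integrable_kern hh)]; ring
  calc ε / 2 ≤ (∫ x in Metric.ball ν ρ, kern K h ν x) * ε := by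
        have := hP.ε_pos
        nlinarith
    _ = ∫ x in Metric.ball ν ρ, kern K h ν x * ε := (integral_mul_const _ _).symm
    _ ≤ ∫ x in Metric.ball ν ρ, kern K h ν x * f x := by
        refine setIntegral_mono_on ((hK.integrable_kern hh).mul_const ε).integrableOn
          (hP.integrable_kern_f hK hh).integrableOn measurableSet_ball fun x hx => ?_
        exact mul_le_mul_of_nonneg_left (hP.f_lower x (hU hx)) (hK.kern_nonneg hh x)
    _ ≤ ∫ x, kern K h ν x * f x := setIntegral_le_integral (hP.integrable_kern_f hK hh)
        (Eventually.of_forall fun x => mul_nonneg (hK.kern_nonneg hh x) (hP.f_nonneg x))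

/-- The smoothing bias is `O(h²)`. -/
theorem abs_kern_mf_sub_le (hP : PairBounds m f U ε C) (hK : KernelBounds K CK) (hh : 0 < h)
    (hρ : 0 < ρ) (hU : Metric.ball ν ρ ⊆ U) :
    |(∫ x, kern K h ν x * (m x * f x)) - m ν * f ν| ≤ (8 * C ^ 2 + 4 * C / ρ ^ 2) * CK * h ^ 2 := by
  have hC := hP.pos
  set F : ℝ → ℝ := fun x => m x * f x with hF
  have hFle : ∀ x, |F x| ≤ C := hP.mf_le
  have hFc : Continuous F := hP.m_smooth.continuous.mul hP.f_smooth.continuous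
  set F' : ℝ → ℝ := fun x => deriv m x * f x + m x * deriv f x with hF'
  have hd1 : ∀ x, HasDerivAt F (F' x) x := fun x => (hP.hasDerivAt_m x).mul (hP.hasDerivAt_f x)
  have hd2 : ∀ x, HasDerivAt F' (deriv (deriv m) x * f x + deriv m x * deriv f x +
      (deriv m x * deriv f x + m x * deriv (deriv f) x)) x := fun x =>
    ((hP.hasDerivAt_deriv_m x).mul (hP.hasDerivAt_f x)).add
      ((hP.hasDerivAt_m x).mul (hP.hasDerivAt_deriv_f x))
  have hF'' : ∀ x ∈ Metric.ball ν ρ, ‖deriv (deriv m) x * f x + deriv m x * deriv f x +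
      (deriv m x * deriv f x + m x * deriv (deriv f) x)‖ ≤ 4 * C ^ 2 := fun x hx => by
    have hxU := hU hx
    have hf0 : 0 < f x := hP.ε_pos.trans_le (hP.f_lower x hxU)
    have e1 : |deriv (deriv m) x * f x| ≤ C ^ 2 := by
      rw [abs_mul, sq, abs_of_pos hf0]
      exact mul_le_mul (hP.m_deriv2 x hxU) (hP.f_le x) hf0.le hC.le
    have e2 : |deriv m x * deriv f x| ≤ C ^ 2 := by
      rw [abs_mul, sq]
      exact mul_le_mul (hP.m_deriv x hf0) (hP.f_deriv x) (abs_nonneg _) hC.le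
    have e3 : |m x * deriv (deriv f) x| ≤ C ^ 2 := by
      rw [abs_mul, sq]
      exact mul_le_mul (hP.m_le x hxU) (hP.f_deriv2 x) (abs_nonneg _) hC.le
    rw [Real.norm_eq_abs, abs_le]
    rw [abs_le] at e1 e2 e3
    constructor <;> linarith [e1.1, e1.2, e2.1, e2.2, e3.1, e3.2]
  have hlip : ∀ x ∈ Metric.ball ν ρ, ∀ y ∈ Metric.ball ν ρ, |F' y - F' x| ≤ 4 * C ^ 2 * |y - x| :=
    fun x hx y hy => (convex_ball ν ρ).norm_image_sub_le_of_norm_hasDerivWithin_le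
      (fun z _ => (hd2 z).hasDerivWithinAt) hF'' hx hy
  set A := 8 * C ^ 2 + 4 * C / ρ ^ 2 with hA
  have hsec : ∀ t, |F (ν - t) + F (ν + t) - 2 * F ν| ≤ 2 * A * t ^ 2 := by
    intro t
    rcases lt_or_ge |t| ρ with ht | ht
    · have hmem : ∀ u ∈ uIcc 0 t, |u| ≤ |t| := fun u hu => by
        simpa using abs_sub_left_of_mem_uIcc hu
      have hder : ∀ u ∈ uIcc 0 t, HasDerivWithinAt (fun u => F (ν - u) + F (ν + u))
          (-F' (ν - u) + F' (ν + u)) (uIcc 0 t) u := fun u _ => by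
        have h1 : HasDerivAt (fun u => F (ν - u)) (-F' (ν - u)) u := by
          exact (hd1 (ν - u)).comp_const_sub ν u
        have h2 : HasDerivAt (fun u => F (ν + u)) (F' (ν + u)) u := by
          exact (hd1 (ν + u)).comp_const_add ν u
        exact (h1.add h2).hasDerivWithinAt
      have hmv := (convex_uIcc 0 t).norm_image_sub_le_of_norm_hasDerivWithin_le
        (C := 8 * C ^ 2 * |t|) hder (fun u hu => by
          have hu' := hmem u hu
          have h1 := hlip (ν - u) (by simp; linarith) (ν + u) (by simp; linarith)
          rw [Real.norm_eq_abs, neg_add_eq_sub]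
          refine h1.trans ?_
          rw [show ν + u - (ν - u) = 2 * u by ring, abs_mul, abs_two]
          nlinarith [sq_nonneg C]) left_mem_uIcc right_mem_uIcc
      simp only [sub_zero, add_zero] at hmv
      rw [Real.norm_eq_abs, Real.norm_eq_abs, mul_assoc, abs_mul_abs_self] at hmv
      rw [show F (ν - t) + F (ν + t) - 2 * F ν = F (ν - t) + F (ν + t) - (F ν + F ν) by ring]
      refine hmv.trans ?_
      have : 0 ≤ 4 * C / ρ ^ 2 := by positivity
      nlinarith [sq_nonneg t, mul_nonneg this (sq_nonneg t), mul_nonneg (sq_nonneg C) (sq_nonneg t)]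
    · have h1 : ρ ^ 2 ≤ t ^ 2 := by rw [← sq_abs t]; exact pow_le_pow_left₀ hρ.le ht 2
      have h2 : 4 * C ≤ 4 * C / ρ ^ 2 * t ^ 2 := by
        rw [div_mul_eq_mul_div, le_div_iff₀ (by positivity)]
        gcongr
      have h3 := abs_le.1 (hFle (ν - t))
      have h4 := abs_le.1 (hFle (ν + t))
      have h5 := abs_le.1 (hFle ν)
      have h6 : 0 ≤ 8 * C ^ 2 * t ^ 2 := by positivity
      rw [abs_le]
      constructor <;> nlinarith [h3.1, h3.2, h4.1, h4.2, h5.1, h5.2]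
  -- by the symmetry of the kernel the first-order term of the expansion cancels
  have hi1 : Integrable (fun u => K u * F (ν - h * u)) :=
    hK.integrable.mul_bdd (c := C) (by fun_prop) (Eventually.of_forall fun u => hFle _)
  have hi2 : Integrable (fun u => K u * F (ν + h * u)) :=
    hK.integrable.mul_bdd (c := C) (by fun_prop) (Eventually.of_forall fun u => hFle _)
  have hsymm : ∫ u, K u * F (ν + h * u) = ∫ u, K u * F (ν - h * u) := by
    rw [← integral_neg_eq_self]
    congr 1; ext u
    rw [hK.symm, mul_neg, sub_eq_add_neg]
  have hrep : (∫ x, kern K h ν x * F x) - F ν =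
      ∫ u, K u * ((F (ν - h * u) + F (ν + h * u) - 2 * F ν) / 2) := by
    have hi3 : Integrable (fun u => (1 / 2) * (K u * F (ν - h * u)) +
        (1 / 2) * (K u * F (ν + h * u))) := (hi1.const_mul _).add (hi2.const_mul _)
    have h1 : ∀ u, K u * ((F (ν - h * u) + F (ν + h * u) - 2 * F ν) / 2) =
        (1 / 2) * (K u * F (ν - h * u)) + (1 / 2) * (K u * F (ν + h * u)) - K u * F ν :=
      fun u => by ring
    simp_rw [h1]
    rw [integral_sub hi3 (hK.integrable.mul_const _),
      integral_add (hi1.const_mul _) (hi2.const_mul _), integral_const_mul, integral_const_mul,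
      integral_mul_const, hK.integral_one, hsymm, KernelBounds.integral_kern_mul hh]
    ring
  rw [show m ν * f ν = F ν from rfl, hrep]
  have hb := norm_integral_le_of_norm_le (hK.sq_integrable.const_mul (A * h ^ 2))
    (f := fun u => K u * ((F (ν - h * u) + F (ν + h * u) - 2 * F ν) / 2))
    (Eventually.of_forall fun u => by
      rw [norm_mul, Real.norm_of_nonneg (hK.nonneg u), Real.norm_eq_abs, abs_div, abs_two]
      have := hsec (h * u)
      have hk := hK.nonneg u
      calc K u * (|F (ν - h * u) + F (ν + h * u) - 2 * F ν| / 2)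
          ≤ K u * ((2 * A * (h * u) ^ 2) / 2) := by gcongr
        _ = A * h ^ 2 * (u ^ 2 * K u) := by ring)
  rw [integral_const_mul, Real.norm_eq_abs] at hb
  refine hb.trans ?_
  have hA0 : 0 ≤ A * h ^ 2 := by positivity
  have := mul_le_mul_of_nonneg_left hK.sq_le hA0
  linarith

theorem abs_kern_f_sub_kern_f_le (hP : PairBounds m f U ε C) (hK : KernelBounds K CK) (hh : 0 < h)
    (ν₁ ν₂ : ℝ) :
    |(∫ x, kern K h ν₁ x * f x) - ∫ x, kern K h ν₂ x * f x| ≤ C * |ν₁ - ν₂| := by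
  have hlip : ∀ x y, |f y - f x| ≤ C * |y - x| := fun x y =>
    convex_univ.norm_image_sub_le_of_norm_hasDerivWithin_le
      (fun z _ => (hP.hasDerivAt_f z).hasDerivWithinAt) (fun z _ => hP.f_deriv z)
      (mem_univ x) (mem_univ y)
  have hfc := hP.f_smooth.continuous
  have hb : ∀ x, ‖f x‖ ≤ C := fun x => by
    rw [Real.norm_of_nonneg (hP.f_nonneg x)]; exact hP.f_le x
  rw [KernelBounds.integral_kern_mul hh, KernelBounds.integral_kern_mul hh, ← integral_sub
    (hK.integrable.mul_bdd (c := C) (by fun_prop) (Eventually.of_forall fun u => hb _))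
    (hK.integrable.mul_bdd (c := C) (by fun_prop) (Eventually.of_forall fun u => hb _))]
  have := norm_integral_le_of_norm_le (hK.integrable.mul_const (C * |ν₁ - ν₂|))
    (f := fun u => K u * f (ν₁ - h * u) - K u * f (ν₂ - h * u)) (Eventually.of_forall fun u => by
      rw [← mul_sub, norm_mul, Real.norm_of_nonneg (hK.nonneg u)]
      have := hlip (ν₂ - h * u) (ν₁ - h * u)
      rw [show ν₁ - h * u - (ν₂ - h * u) = ν₁ - ν₂ by ring] at this
      exact mul_le_mul_of_nonneg_left this (hK.nonneg u))
  rwa [integral_mul_const, hK.integral_one, one_mul] at this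

/-- The smoothed regression function is Lipschitz in `ν`, uniformly in the bandwidth. -/
theorem abs_kern_mf_sub_kern_mf_le (hP : PairBounds m f U ε C) (hK : KernelBounds K CK)
    (hh : 0 < h) (hρ : 0 < ρ) {S : Set ℝ} (hS : Convex ℝ S)
    (hU : ∀ ν ∈ S, Metric.ball ν ρ ⊆ U) {ν₁ ν₂ : ℝ} (h₁ : ν₁ ∈ S) (h₂ : ν₂ ∈ S) :
    |(∫ x, kern K h ν₁ x * (m x * f x)) - ∫ x, kern K h ν₂ x * (m x * f x)| ≤
      (2 * C ^ 2 + CK / ρ * C) * |ν₁ - ν₂| := by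
  obtain ⟨M, hM⟩ := hP.bdd
  have hC := hP.pos
  set F' : ℝ → ℝ := fun x => deriv m x * f x + m x * deriv f x with hF'
  have hd1 : ∀ x, HasDerivAt (fun x => m x * f x) (F' x) x := fun x =>
    (hP.hasDerivAt_m x).mul (hP.hasDerivAt_f x)
  have hFc : Continuous (fun x => m x * f x) := hP.m_smooth.continuous.mul hP.f_smooth.continuous
  have hF'c : Continuous F' := (hP.continuous_deriv_m.mul hP.f_smooth.continuous).add
    (hP.m_smooth.continuous.mul hP.continuous_deriv_f)
  have hF'M : ∀ x, ‖F' x‖ ≤ C ^ 2 + M * C := fun x => by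
    refine (norm_add_le _ _).trans (add_le_add (hP.abs_m_deriv_mul_f_le x) ?_)
    rw [norm_mul]
    exact mul_le_mul (hM x).1 (hP.f_deriv x) (abs_nonneg _) ((abs_nonneg _).trans (hM x).1)
  have hder : ∀ ν, HasDerivAt (fun ν => ∫ u, K u * (m (ν - h * u) * f (ν - h * u)))
      (∫ u, K u * F' (ν - h * u)) ν := fun ν => by
    have hKc := hK.cont
    refine (hasDerivAt_integral_of_dominated_loc_of_deriv_le (μ := volume) (s := univ)
      (F := fun ν u => K u * (m (ν - h * u) * f (ν - h * u)))
      (F' := fun ν u => K u * F' (ν - h * u)) (bound := fun u => K u * (C ^ 2 + M * C))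
      univ_mem (Eventually.of_forall fun ν => ?_) ?_ ?_
      (Eventually.of_forall fun u ν _ => ?_) (hK.integrable.mul_const _)
      (Eventually.of_forall fun u ν _ => ?_)).2
    · exact (hKc.mul (hFc.comp (by fun_prop))).aestronglyMeasurable
    · exact hK.integrable.mul_bdd (c := C) (hFc.comp (by fun_prop)).aestronglyMeasurable
        (Eventually.of_forall fun u => hP.mf_le _)
    · exact (hKc.mul (hF'c.comp (by fun_prop))).aestronglyMeasurable
    · rw [norm_mul, Real.norm_of_nonneg (hK.nonneg u)]
      exact mul_le_mul_of_nonneg_left (hF'M _) (hK.nonneg u)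
    · have := (hd1 (ν - h * u)).comp ν ((hasDerivAt_id ν).sub_const (h * u))
      simpa using this.const_mul (K u)
  rw [KernelBounds.integral_kern_mul hh (fun x => m x * f x),
    KernelBounds.integral_kern_mul hh (fun x => m x * f x)]
  refine hS.norm_image_sub_le_of_norm_hasDerivWithin_le
    (fun ν _ => (hder ν).hasDerivWithinAt) (fun ν hν => ?_) h₂ h₁
  rw [← KernelBounds.integral_kern_mul hh F', Real.norm_eq_abs]
  refine hP.abs_integral_kern_le hK hh hρ (hU ν hν) (fun x hx => ?_) (fun x _ => ?_)
  · refine (abs_add_le _ _).trans ?_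
    have := hP.abs_m_deriv_mul_f_le x
    have := (hP.m_mul_deriv_le (hP.f_deriv x) (hP.f_sq x)).1 hx
    linarith
  · refine (abs_add_le _ _).trans ?_
    have := hP.abs_m_deriv_mul_f_le x
    have := (hP.m_mul_deriv_le (hP.f_deriv x) (hP.f_sq x)).2
    linarith

end PairBounds

end KBSA

/-! ### Smoothed regression functions along a path -/

namespace KBSA

/-- A derivative with respect to a parameter is a pointwise limit of difference quotients. -/
theorem measurable_of_hasDerivAt_param {F : ℝ → ℝ → ℝ} {F' : ℝ → ℝ} {s R : ℝ} (hs : |s| < R)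
    (hF : ∀ t, |t| < R → Measurable (F t))
    (hd : ∀ x, HasDerivAt (fun t => F t x) (F' x) s) : Measurable F' := by
  set u : ℕ → ℝ := fun n => (R - |s|) / ((n : ℝ) + 2) with hu
  have hR : 0 < R - |s| := by linarith
  have hupos : ∀ n, 0 < u n := fun n => by simp only [hu]; positivity
  have hult : ∀ n, |s + u n| < R := fun n => by
    have : u n < R - |s| := by
      simp only [hu]
      rw [div_lt_iff₀ (by positivity)]
      have : (0 : ℝ) ≤ n := n.cast_nonneg
      nlinarith
    have := abs_add_le s (u n)
    rw [abs_of_pos (hupos n)] at this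
    linarith
  have hu0 : Tendsto u atTop (𝓝 0) :=
    tendsto_const_nhds.div_atTop (tendsto_atTop_add_const_right _ _ tendsto_natCast_atTop_atTop)
  have hu1 : Tendsto u atTop (𝓝[≠] 0) :=
    tendsto_nhdsWithin_iff.2 ⟨hu0, Eventually.of_forall fun n => (hupos n).ne'⟩
  refine measurable_of_tendsto_metrizable
    (f := fun n x => (u n)⁻¹ • (F (s + u n) x - F s x)) (fun n => ?_) ?_
  · simp only [smul_eq_mul]
    exact ((hF _ (hult n)).sub (hF _ hs)).const_mul _
  · rw [tendsto_pi_nhds]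
    intro x
    exact (hasDerivAt_iff_tendsto_slope_zero.1 (hd x)).comp hu1

/-- Along a path `s ↦ (m_s, f_s)` along which `a ∂m` is at most `-εm a²` near `ν`, up to terms that
are linear in `a`, the same holds for the smoothed product of `m` and `f`. Away from `ν` the
derivative of `f` has to compensate for the size of `m`: this is where `(∂f)² ≤ C f` and the bound on
the integral of `m² f` enter. -/
theorem mul_kern_mf_sub_le {K : ℝ → ℝ} {U : Set ℝ} {CK ε εm C h ν ρ a b R κ : ℝ}
    {m f m' f' : ℝ → ℝ → ℝ} (hP : ∀ s, |s| < R → PairBounds (m s) (f s) U ε C)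
    (hK : KernelBounds K CK) (hh : 0 < h) (hρ : 0 < ρ) (hU : Metric.ball ν ρ ⊆ U)
    (hεm : 0 < εm) (hb : 0 ≤ b) (hκ : 0 ≤ κ) (hκR : κ < R)
    (hm : ∀ s, |s| < R → ∀ x, HasDerivAt (fun t => m t x) (m' s x) s)
    (hf : ∀ s, |s| < R → ∀ x, HasDerivAt (fun t => f t x) (f' s x) s)
    (hf' : ∀ s, |s| < R → ∀ x, |f' s x| ≤ C)
    (hf'sq : ∀ s, |s| < R → ∀ x, f' s x ^ 2 ≤ C * f s x)
    (hm' : ∀ s, |s| < R → ∀ x, |m' s x| ≤ C * |a| + b)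
    (hm'U : ∀ s, |s| < R → ∀ x ∈ U, a * m' s x ≤ -εm * a ^ 2 + |a| * b)
    (hsmall : (C ^ 2 + εm * ε) * (CK / ρ ^ 2 * h ^ 2) ≤ εm * ε / 2) :
    a * ((∫ x, kern K h ν x * (m κ x * f κ x)) - ∫ x, kern K h ν x * (m (-κ) x * f (-κ) x)) ≤
      2 * κ * (-(εm * ε / 2) * a ^ 2 + |a| * (b * C + C ^ 2 + CK / ρ * C)) := by
  have hR : 0 < R := hκ.trans_lt hκR
  have h0R : |(0 : ℝ)| < R := by simpa using hR
  have hC := (hP 0 h0R).pos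
  have hε := (hP 0 h0R).ε_pos
  obtain ⟨M, hM⟩ := (hP 0 h0R).bdd
  have hM0 : 0 ≤ M := (abs_nonneg _).trans (hM 0).1
  -- the regression function stays bounded along the path
  have hmM : ∀ s, |s| < R → ∀ x, |m s x| ≤ M + (C * |a| + b) * R := fun s hs x => by
    have hseg : ∀ t ∈ uIcc 0 s, |t| < R := fun t ht => by
      have := abs_sub_left_of_mem_uIcc ht
      rw [sub_zero, sub_zero] at this
      exact this.trans_lt hs
    have := (convex_uIcc 0 s).norm_image_sub_le_of_norm_hasDerivWithin_le
      (fun t ht => (hm t (hseg t ht) x).hasDerivWithinAt) (fun t ht => hm' t (hseg t ht) x)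
      left_mem_uIcc right_mem_uIcc
    rw [Real.norm_eq_abs, Real.norm_eq_abs, sub_zero] at this
    have h1 := abs_sub_abs_le_abs_sub (m s x) (m 0 x)
    have h2 : (C * |a| + b) * |s| ≤ (C * |a| + b) * R := by
      have : 0 ≤ C * |a| + b := by positivity
      gcongr
    linarith [(hM x).1]
  have hmc : ∀ s, |s| < R → Continuous (m s) := fun s hs => (hP s hs).m_smooth.continuous
  have hfc : ∀ s, |s| < R → Continuous (f s) := fun s hs => (hP s hs).f_smooth.continuous
  have hm'm : ∀ s, |s| < R → Measurable (m' s) := fun s hs =>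
    measurable_of_hasDerivAt_param hs (fun t ht => (hmc t ht).measurable) (hm s hs)
  have hf'm : ∀ s, |s| < R → Measurable (f' s) := fun s hs =>
    measurable_of_hasDerivAt_param hs (fun t ht => (hfc t ht).measurable) (hf s hs)
  set D : ℝ := (C * |a| + b) * C + (M + (C * |a| + b) * R) * C with hD
  have hF'D : ∀ s, |s| < R → ∀ x, |m' s x * f s x + m s x * f' s x| ≤ D := fun s hs x => by
    refine (abs_add_le _ _).trans (add_le_add ?_ ?_)
    · rw [abs_mul, abs_of_nonneg ((hP s hs).f_nonneg x)]
      exact mul_le_mul (hm' s hs x) ((hP s hs).f_le x) ((hP s hs).f_nonneg x) (by positivity)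
    · rw [abs_mul]
      exact mul_le_mul (hmM s hs x) (hf' s hs x) (abs_nonneg _) (by positivity)
  have hF'm : ∀ s, |s| < R → AEStronglyMeasurable (fun x => m' s x * f s x + m s x * f' s x)
      volume := fun s hs =>
    (((hm'm s hs).mul (hfc s hs).measurable).add
      ((hmc s hs).measurable.mul (hf'm s hs))).aestronglyMeasurable
  have hF'i : ∀ s, |s| < R →
      Integrable (fun x => kern K h ν x * (m' s x * f s x + m s x * f' s x)) := fun s hs =>
    hK.integrable_kern_mul hh (hF'm s hs) (hF'D s hs)
  have hder : ∀ s, |s| < R → HasDerivAt (fun t => ∫ x, kern K h ν x * (m t x * f t x))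
      (∫ x, kern K h ν x * (m' s x * f s x + m s x * f' s x)) s := fun s hs => by
    have hnhds : {t : ℝ | |t| < R} ∈ 𝓝 s := (isOpen_lt continuous_abs continuous_const).mem_nhds hs
    refine (hasDerivAt_integral_of_dominated_loc_of_deriv_le (μ := volume) (s := {t : ℝ | |t| < R})
      (F := fun t x => kern K h ν x * (m t x * f t x))
      (F' := fun t x => kern K h ν x * (m' t x * f t x + m t x * f' t x))
      (bound := fun x => kern K h ν x * D)
      hnhds (eventually_of_mem hnhds fun t ht => ?_) ?_ ?_
      (Eventually.of_forall fun x t ht => ?_) ((hK.integrable_kern hh).mul_const _)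
      (Eventually.of_forall fun x t ht => ?_)).2
    · exact ((hP t ht).integrable_kern_mf hK hh).aestronglyMeasurable
    · exact (hP s hs).integrable_kern_mf hK hh
    · exact (hF'i s hs).aestronglyMeasurable
    · rw [norm_mul, Real.norm_of_nonneg (hK.kern_nonneg hh x)]
      exact mul_le_mul_of_nonneg_left (hF'D t ht x) (hK.kern_nonneg hh x)
    · exact ((hm t ht x).mul (hf t ht x)).const_mul _
  set S : Set ℝ := (Metric.ball ν ρ)ᶜ with hS
  have hSm : MeasurableSet S := measurableSet_ball.compl
  have hSd : ∀ x ∈ S, ρ ≤ |ν - x| := fun x hx => by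
    rw [hS, mem_compl_iff, Metric.mem_ball, not_lt, dist_comm, Real.dist_eq] at hx; exact hx
  have hCK : 0 ≤ CK / ρ := div_nonneg hK.pos.le hρ.le
  have hbound : ∀ s, |s| < R →
      a * (∫ x, kern K h ν x * (m' s x * f s x + m s x * f' s x)) ≤
        -(εm * ε / 2) * a ^ 2 + |a| * (b * C + C ^ 2 + CK / ρ * C) := fun s hs => by
    have hPs := hP s hs
    have hi1 : Integrable (fun x => kern K h ν x * (-(εm * ε) * a ^ 2 + |a| * (b * C + C ^ 2))) :=
      (hK.integrable_kern hh).mul_const _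
    have hi2 : Integrable (fun x => S.indicator (kern K h ν) x * ((C ^ 2 + εm * ε) * a ^ 2)) :=
      ((hK.integrable_kern hh).indicator hSm).mul_const _
    have hi3 : Integrable (fun x => |a| * (CK / ρ) * (m s x ^ 2 * f s x)) :=
      hPs.m_sq_integrable.const_mul _
    have hpt : ∀ x, a * (kern K h ν x * (m' s x * f s x + m s x * f' s x)) ≤
        kern K h ν x * (-(εm * ε) * a ^ 2 + |a| * (b * C + C ^ 2)) +
        S.indicator (kern K h ν) x * ((C ^ 2 + εm * ε) * a ^ 2) +
        |a| * (CK / ρ) * (m s x ^ 2 * f s x) := fun x => by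
      have hk := hK.kern_nonneg (ν := ν) hh x
      have hf0 := hPs.f_nonneg x
      have hmf0 : 0 ≤ m s x ^ 2 * f s x := mul_nonneg (sq_nonneg _) hf0
      have hmd := hPs.m_mul_deriv_le (hf' s hs x) (hf'sq s hs x)
      have e0 : a * (m s x * f' s x) ≤ |a| * |m s x * f' s x| := by
        rw [← abs_mul]; exact le_abs_self _
      by_cases hx : x ∈ U
      · have e1 : a * (m' s x * f s x) ≤ -(εm * ε) * a ^ 2 + |a| * (b * C) := by
          have h1 := mul_le_mul_of_nonneg_right (hm'U s hs x hx) hf0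
          have h2 : ε * (εm * a ^ 2) ≤ f s x * (εm * a ^ 2) :=
            mul_le_mul_of_nonneg_right (hPs.f_lower x hx) (by positivity)
          have h3 : (|a| * b) * f s x ≤ (|a| * b) * C :=
            mul_le_mul_of_nonneg_left (hPs.f_le x) (by positivity)
          nlinarith
        have e2 := mul_le_mul_of_nonneg_left (hmd.1 hx) (abs_nonneg a)
        have e3 : 0 ≤ S.indicator (kern K h ν) x * ((C ^ 2 + εm * ε) * a ^ 2) :=
          mul_nonneg (indicator_nonneg (fun y _ => hK.kern_nonneg hh y) x) (by positivity)
        have e4 : 0 ≤ |a| * (CK / ρ) * (m s x ^ 2 * f s x) :=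
          mul_nonneg (mul_nonneg (abs_nonneg _) hCK) hmf0
        have e5 : a * (m' s x * f s x + m s x * f' s x) ≤
            -(εm * ε) * a ^ 2 + |a| * (b * C + C ^ 2) := by linarith
        have := mul_le_mul_of_nonneg_left e5 hk
        linarith
      · have hxS : x ∈ S := fun hxb => hx (hU hxb)
        rw [indicator_of_mem hxS]
        have e1 : a * (m' s x * f s x) ≤ C ^ 2 * a ^ 2 + |a| * (b * C) := by
          calc a * (m' s x * f s x) ≤ |a * (m' s x * f s x)| := le_abs_self _
            _ = |a| * (|m' s x| * f s x) := by rw [abs_mul, abs_mul, abs_of_nonneg hf0]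
            _ ≤ |a| * ((C * |a| + b) * C) := by
                have := mul_le_mul (hm' s hs x) (hPs.f_le x) hf0 (by positivity)
                exact mul_le_mul_of_nonneg_left this (abs_nonneg a)
            _ = C ^ 2 * |a| ^ 2 + |a| * (b * C) := by ring
            _ = _ := by rw [sq_abs]
        have e2 := mul_le_mul_of_nonneg_left hmd.2 (abs_nonneg a)
        have e3 : kern K h ν x * (|a| * (m s x ^ 2 * f s x)) ≤
            CK / ρ * (|a| * (m s x ^ 2 * f s x)) :=
          mul_le_mul_of_nonneg_right (hK.kern_le_of_le hh hρ (hSd x hxS)) (by positivity)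
        have e5 : a * (m' s x * f s x + m s x * f' s x) ≤
            C ^ 2 * a ^ 2 + |a| * (b * C + C ^ 2) + |a| * (m s x ^ 2 * f s x) := by linarith
        have := mul_le_mul_of_nonneg_left e5 hk
        linarith
    have hint := integral_mono ((hF'i s hs).const_mul a) ((hi1.add hi2).add hi3) hpt
    rw [integral_const_mul] at hint
    refine hint.trans ?_
    have hsplit : ∫ x, (kern K h ν x * (-(εm * ε) * a ^ 2 + |a| * (b * C + C ^ 2)) +
        S.indicator (kern K h ν) x * ((C ^ 2 + εm * ε) * a ^ 2) +
        |a| * (CK / ρ) * (m s x ^ 2 * f s x)) =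
        (-(εm * ε) * a ^ 2 + |a| * (b * C + C ^ 2)) +
        (∫ x in S, kern K h ν x) * ((C ^ 2 + εm * ε) * a ^ 2) +
        |a| * (CK / ρ) * ∫ x, m s x ^ 2 * f s x := by
      have hi12 : Integrable (fun x => kern K h ν x * (-(εm * ε) * a ^ 2 + |a| * (b * C + C ^ 2)) +
        S.indicator (kern K h ν) x * ((C ^ 2 + εm * ε) * a ^ 2)) := hi1.add hi2
      rw [integral_add hi12 hi3, integral_add hi1 hi2, integral_mul_const, integral_mul_const,
        integral_const_mul, hK.integral_kern hh, integral_indicator hSm, one_mul]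
    change ∫ x, (kern K h ν x * (-(εm * ε) * a ^ 2 + |a| * (b * C + C ^ 2)) +
        S.indicator (kern K h ν) x * ((C ^ 2 + εm * ε) * a ^ 2) +
        |a| * (CK / ρ) * (m s x ^ 2 * f s x)) ≤ _
    rw [hsplit]
    have e1 := hK.setIntegral_kern_le (ν := ν) hh hρ hSm hSd
    have e2 : (∫ x in S, kern K h ν x) * ((C ^ 2 + εm * ε) * a ^ 2) ≤ εm * ε / 2 * a ^ 2 := by
      calc _ ≤ (CK / ρ ^ 2 * h ^ 2) * ((C ^ 2 + εm * ε) * a ^ 2) :=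
            mul_le_mul_of_nonneg_right e1 (by positivity)
        _ = (C ^ 2 + εm * ε) * (CK / ρ ^ 2 * h ^ 2) * a ^ 2 := by ring
        _ ≤ _ := mul_le_mul_of_nonneg_right hsmall (sq_nonneg a)
    have e3 := mul_le_mul_of_nonneg_left hPs.m_sq (mul_nonneg (abs_nonneg a) hCK)
    linarith
  have hseg : ∀ s ∈ Icc (-κ) κ, |s| < R := fun s hs => (abs_le.2 hs).trans_lt hκR
  have hderA : ∀ s ∈ Icc (-κ) κ, HasDerivAt (fun t => a * ∫ x, kern K h ν x * (m t x * f t x))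
      (a * ∫ x, kern K h ν x * (m' s x * f s x + m s x * f' s x)) s := fun s hs =>
    (hder s (hseg s hs)).const_mul a
  have hmv := (convex_Icc (-κ) κ).image_sub_le_mul_sub_of_deriv_le
    (f := fun t => a * ∫ x, kern K h ν x * (m t x * f t x))
    (fun s hs => (hderA s hs).continuousAt.continuousWithinAt)
    (fun s hs => (hderA s (interior_subset hs)).differentiableAt.differentiableWithinAt)
    (C := -(εm * ε / 2) * a ^ 2 + |a| * (b * C + C ^ 2 + CK / ρ * C))
    (fun s hs => by
      rw [(hderA s (interior_subset hs)).deriv]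
      exact hbound s (hseg s (interior_subset hs)))
    (-κ) (left_mem_Icc.2 (by linarith)) κ (right_mem_Icc.2 (by linarith)) (by linarith)
  rw [mul_sub]
  refine hmv.trans (le_of_eq ?_)
  ring

end KBSA

/-! ### Second moments and conditional means -/

namespace KBSA

section Moments

variable {α : Type*} [MeasurableSpace α] {μ : Measure α} {φ : α → ℝ} {c : ℝ}

theorem memLp_two_of_lintegral_sq_lt (hφ : AEStronglyMeasurable φ μ)
    (h : ∫⁻ x, ENNReal.ofReal (φ x ^ 2) ∂μ < ∞) : MemLp φ 2 μ := by
  rw [memLp_two_iff_integrable_sq hφ]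
  refine ⟨hφ.pow 2, ?_⟩
  rwa [hasFiniteIntegral_iff_ofReal (Eventually.of_forall fun x => sq_nonneg _)]

theorem memLp_two_of_lintegral_sq_le (hφ : AEStronglyMeasurable φ μ)
    (h : ∫⁻ x, ENNReal.ofReal (φ x ^ 2) ∂μ ≤ ENNReal.ofReal c) : MemLp φ 2 μ :=
  memLp_two_of_lintegral_sq_lt hφ (h.trans_lt ENNReal.ofReal_lt_top)

theorem integral_le_of_lintegral_le (hφ : AEStronglyMeasurable φ μ) (hφ0 : ∀ x, 0 ≤ φ x)
    (hc : 0 ≤ c) (h : ∫⁻ x, ENNReal.ofReal (φ x) ∂μ ≤ ENNReal.ofReal c) : ∫ x, φ x ∂μ ≤ c := by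
  rw [integral_eq_lintegral_of_nonneg_ae (Eventually.of_forall hφ0) hφ]
  exact ENNReal.toReal_le_of_le_ofReal hc h

theorem integrable_of_lintegral_le (hφ : AEStronglyMeasurable φ μ) (hφ0 : ∀ x, 0 ≤ φ x)
    (h : ∫⁻ x, ENNReal.ofReal (φ x) ∂μ ≤ ENNReal.ofReal c) : Integrable φ μ := by
  refine ⟨hφ, ?_⟩
  rw [hasFiniteIntegral_iff_ofReal (Eventually.of_forall hφ0)]
  exact h.trans_lt ENNReal.ofReal_lt_top

theorem sq_integral_le [IsProbabilityMeasure μ] (hφ : MemLp φ 2 μ) :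
    (∫ x, φ x ∂μ) ^ 2 ≤ ∫ x, φ x ^ 2 ∂μ := by
  have h1 := variance_nonneg φ μ
  rw [variance_eq_sub hφ] at h1
  simpa using h1

theorem ofReal_sq_integral_le [IsProbabilityMeasure μ] (hφ : AEStronglyMeasurable φ μ) :
    ENNReal.ofReal ((∫ x, φ x ∂μ) ^ 2) ≤ ∫⁻ x, ENNReal.ofReal (φ x ^ 2) ∂μ := by
  rcases eq_or_ne (∫⁻ x, ENNReal.ofReal (φ x ^ 2) ∂μ) ∞ with h | h
  · rw [h]; exact le_top
  · have hm := memLp_two_of_lintegral_sq_lt hφ h.lt_top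
    rw [← ofReal_integral_eq_lintegral_ofReal hm.integrable_sq
      (Eventually.of_forall fun x => sq_nonneg _)]
    exact ENNReal.ofReal_le_ofReal (sq_integral_le hm)

end Moments

section Conditional

variable {Ξ : Type*} [MeasurableSpace Ξ] {μ : Measure Ξ} [IsProbabilityMeasure μ]
  {X Y : Ξ → ℝ} {φ b k : ℝ → ℝ}

theorem lintegral_condDistrib (hX : Measurable X) (hY : Measurable Y) {g : ℝ × ℝ → ℝ≥0∞}
    (hg : Measurable g) :
    ∫⁻ x, ∫⁻ y, g (x, y) ∂(condDistrib Y X μ x) ∂(μ.map X) = ∫⁻ ξ, g (X ξ, Y ξ) ∂μ := by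
  rw [← Measure.lintegral_compProd hg, compProd_map_condDistrib hY.aemeasurable,
    lintegral_map hg (hX.prodMk hY)]

theorem IsCondMean.integral_mul (hb : IsCondMean μ X Y φ b) (hX : Measurable X)
    (hY : Measurable Y) (hφ : Measurable φ) (hφi : Integrable (fun ξ => φ (Y ξ)) μ)
    (hk : Measurable k) {M : ℝ} (hkM : ∀ x, |k x| ≤ M) :
    ∫ ξ, k (X ξ) * φ (Y ξ) ∂μ = ∫ x, k x * b x ∂(μ.map X) := by
  have hi : Integrable (fun ξ => k (X ξ) * φ (Y ξ)) μ :=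
    hφi.bdd_mul (hk.comp hX).aestronglyMeasurable (Eventually.of_forall fun ξ => hkM _)
  have hg : Measurable (fun z : ℝ × ℝ => k z.1 * φ z.2) := by fun_prop
  have h1 : ∫ ξ, k (X ξ) * φ (Y ξ) ∂μ =
      ∫ z, k z.1 * φ z.2 ∂(μ.map (fun ξ => (X ξ, Y ξ))) := by
    rw [integral_map (hX.prodMk hY).aemeasurable hg.aestronglyMeasurable]
  have hi2 : Integrable (fun z : ℝ × ℝ => k z.1 * φ z.2) (μ.map X ⊗ₘ condDistrib Y X μ) := by
    rw [compProd_map_condDistrib hY.aemeasurable,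
      integrable_map_measure hg.aestronglyMeasurable (hX.prodMk hY).aemeasurable]
    exact hi
  rw [h1, ← compProd_map_condDistrib hY.aemeasurable, Measure.integral_compProd hi2]
  refine integral_congr_ae ?_
  filter_upwards [hb hφi] with x hx
  rw [integral_const_mul, hx]

theorem IsCondMean.lintegral_sq_le (hb : IsCondMean μ X Y φ b) (hX : Measurable X)
    (hY : Measurable Y) (hφ : Measurable φ) (hφi : Integrable (fun ξ => φ (Y ξ)) μ) :
    ∫⁻ x, ENNReal.ofReal (b x ^ 2) ∂(μ.map X) ≤ ∫⁻ ξ, ENNReal.ofReal (φ (Y ξ) ^ 2) ∂μ := by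
  rw [← lintegral_condDistrib hX hY (g := fun z => ENNReal.ofReal (φ z.2 ^ 2)) (by fun_prop)]
  refine lintegral_mono_ae ?_
  filter_upwards [hb hφi] with x hx
  rw [hx]
  exact ofReal_sq_integral_le hφ.aestronglyMeasurable

end Conditional

section Density

variable {Ξ : Type*} [MeasurableSpace Ξ] {μ : Measure Ξ} {X : Ξ → ℝ} {f : ℝ → ℝ}

theorem integral_map_of_density (hfm : Measurable f) (hf0 : ∀ x, 0 ≤ f x)
    (hf : μ.map X = volume.withDensity (fun x => ENNReal.ofReal (f x))) (G : ℝ → ℝ) :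
    ∫ x, G x ∂(μ.map X) = ∫ x, G x * f x := by
  rw [hf, integral_withDensity_eq_integral_toReal_smul (by fun_prop)
    (Eventually.of_forall fun x => ENNReal.ofReal_lt_top)]
  congr 1; ext x
  rw [ENNReal.toReal_ofReal (hf0 x), smul_eq_mul, mul_comm]

theorem lintegral_map_of_density (hfm : Measurable f)
    (hf : μ.map X = volume.withDensity (fun x => ENNReal.ofReal (f x))) {G : ℝ → ℝ≥0∞}
    (hG : Measurable G) :
    ∫⁻ x, G x ∂(μ.map X) = ∫⁻ x, ENNReal.ofReal (f x) * G x := by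
  rw [hf, lintegral_withDensity_eq_lintegral_mul _ (by fun_prop) hG]
  rfl

end Density

/-! ### Functions with bounded derivatives -/

section BddC3

variable {V : Type*} [NormedAddCommGroup V] [NormedSpace ℝ V] {F : V → ℝ} {S : Set V} {B : ℝ}

theorem BddC3.hasFDerivAt (hF : BddC3 F S B) (hS : IsOpen S) {x : V} (hx : x ∈ S) :
    HasFDerivAt F (fderiv ℝ F x) x :=
  ((hF.1.contDiffAt (hS.mem_nhds hx)).differentiableAt (by norm_num)).hasFDerivAt

theorem BddC3.norm_fderiv_le (hF : BddC3 F S B) {x : V} (hx : x ∈ S) : ‖fderiv ℝ F x‖ ≤ B := by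
  rw [← norm_iteratedFDeriv_one]
  exact hF.2 1 (by simp) x hx

theorem BddC3.abs_sub_le (hF : BddC3 F S B) (hS : IsOpen S) (hc : Convex ℝ S) {x y : V}
    (hx : x ∈ S) (hy : y ∈ S) : |F y - F x| ≤ B * ‖y - x‖ :=
  hc.norm_image_sub_le_of_norm_hasFDerivWithin_le
    (fun _ hz => (hF.hasFDerivAt hS hz).hasFDerivWithinAt) (fun _ hz => hF.norm_fderiv_le hz) hx hy

theorem BddC3.norm_fderiv_sub_le (hF : BddC3 F S B) (hS : IsOpen S) (hc : Convex ℝ S) {x y : V}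
    (hx : x ∈ S) (hy : y ∈ S) : ‖fderiv ℝ F y - fderiv ℝ F x‖ ≤ B * ‖y - x‖ := by
  refine hc.norm_image_sub_le_of_norm_hasFDerivWithin_le (f' := fderiv ℝ (fderiv ℝ F))
    (fun z hz => ?_) (fun z hz => ?_) hx hy
  · have h1 : ContDiffAt ℝ 1 (fderiv ℝ F) z :=
      (hF.1.contDiffAt (hS.mem_nhds hz)).fderiv_right (by norm_num)
    exact (h1.differentiableAt (by norm_num)).hasFDerivAt.hasFDerivWithinAt
  · rw [← norm_iteratedFDeriv_one, norm_iteratedFDeriv_fderiv]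
    exact hF.2 2 (by simp) z hz

/-- The directional derivatives of a nonnegative function with bounded derivatives are controlled by
the square root of the function. -/
theorem BddC3.sq_fderiv_le (hF : BddC3 F S B) (hS : IsOpen S) (hc : Convex ℝ S)
    (hF0 : ∀ x, 0 ≤ F x) {x v : V} {ρ : ℝ} (hρ : 0 < ρ) (hx : Metric.ball x ρ ⊆ S) :
    fderiv ℝ F x v ^ 2 ≤
      4 * (1 + |B| * (1 + ‖v‖ ^ 2)) * (1 + 2 * (1 + ‖v‖) / ρ) * F x := by
  set R : ℝ := ρ / (2 * (1 + ‖v‖)) with hR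
  have hv : 0 < 1 + ‖v‖ := by positivity
  have hR0 : 0 < R := by positivity
  have hmem : ∀ t : ℝ, |t| ≤ R → x + t • v ∈ S := fun t ht => hx (by
    rw [Metric.mem_ball, dist_eq_norm, add_sub_cancel_left, norm_smul, Real.norm_eq_abs]
    calc |t| * ‖v‖ ≤ R * (1 + ‖v‖) := by gcongr; linarith
      _ = ρ / 2 := by rw [hR]; field_simp
      _ < ρ := by linarith)
  have h0 : x ∈ S := by simpa using hmem 0 (by simpa using hR0.le)
  have hB : 0 ≤ |B| := abs_nonneg B
  have hBv : |B| * ‖v‖ ≤ 1 + |B| * (1 + ‖v‖ ^ 2) := by nlinarith [sq_nonneg (‖v‖ - 1)]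
  have key := sq_deriv_le_of_nonneg (F := fun t : ℝ => F (x + t • v))
    (F' := fun t : ℝ => fderiv ℝ F (x + t • v) v) (B := 1 + |B| * (1 + ‖v‖ ^ 2)) (R := R)
    (by have : 0 ≤ |B| * (1 + ‖v‖ ^ 2) := by positivity
        linarith) hR0
    (fun t ht => by
      have h1 : HasDerivAt (fun t : ℝ => x + t • v) v t := by
        simpa using ((hasDerivAt_id' t).smul_const v).const_add x
      exact (hF.hasFDerivAt hS (hmem t ht)).comp_hasDerivAt t h1)
    (fun t _ => hF0 _)
    (by
      simp only [zero_smul, add_zero]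
      refine ((fderiv ℝ F x).le_opNorm v).trans (le_trans ?_ hBv)
      have := (hF.norm_fderiv_le h0).trans (le_abs_self B)
      gcongr)
    (fun t ht => by
      simp only [zero_smul, add_zero]
      rw [← sub_apply]
      refine ((fderiv ℝ F (x + t • v) - fderiv ℝ F x).le_opNorm v).trans ?_
      have h1 := hF.norm_fderiv_sub_le hS hc h0 (hmem t ht)
      rw [add_sub_cancel_left, norm_smul, Real.norm_eq_abs] at h1
      calc _ ≤ (B * (|t| * ‖v‖)) * ‖v‖ := by gcongr
        _ ≤ (|B| * (|t| * ‖v‖)) * ‖v‖ := by gcongr; exact le_abs_self B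
        _ = |B| * ‖v‖ ^ 2 * |t| := by ring
        _ ≤ (1 + |B| * (1 + ‖v‖ ^ 2)) * |t| := by gcongr; linarith)
  simp only [zero_smul, add_zero] at key
  refine key.trans (le_of_eq ?_)
  rw [hR, one_div_div]

theorem BddC3.abs_deriv_le {F : ℝ → ℝ} {S : Set ℝ} (hF : BddC3 F S B) {x : ℝ} (hx : x ∈ S) :
    |deriv F x| ≤ B := by
  have := hF.2 1 (by simp) x hx
  rwa [norm_iteratedFDeriv_eq_norm_iteratedDeriv, iteratedDeriv_one] at this

theorem BddC3.abs_deriv_deriv_le {F : ℝ → ℝ} {S : Set ℝ} (hF : BddC3 F S B) {x : ℝ} (hx : x ∈ S) :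
    |deriv (deriv F) x| ≤ B := by
  have := hF.2 2 (by simp) x hx
  rwa [norm_iteratedFDeriv_eq_norm_iteratedDeriv, iteratedDeriv_succ, iteratedDeriv_one] at this

end BddC3

end KBSA

/-! ### Bounds on the density and the regression functions -/

namespace KBSA

theorem two_mul_le_integral_of_le {g : ℝ → ℝ} (hg : Integrable g) (hg0 : ∀ x, 0 ≤ g x)
    {x δ c : ℝ} (hδ : 0 ≤ δ) (h : ∀ y, |y - x| ≤ δ → c ≤ g y) : 2 * δ * c ≤ ∫ y, g y := by
  calc 2 * δ * c = ∫ _ in Icc (x - δ) (x + δ), c := by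
        rw [setIntegral_const, smul_eq_mul, Measure.real, Real.volume_Icc,
          ENNReal.toReal_ofReal (by linarith)]
        ring
    _ ≤ ∫ y in Icc (x - δ) (x + δ), g y := by
        refine setIntegral_mono_on (by simp) hg.integrableOn measurableSet_Icc fun y hy => h y ?_
        rw [abs_le]; constructor <;> linarith [hy.1, hy.2]
    _ ≤ ∫ y, g y := setIntegral_le_integral hg (Eventually.of_forall hg0)

/-- A Lipschitz probability density is bounded. -/
theorem density_le_of_lipschitz {f : ℝ → ℝ} {B : ℝ} (hB : 1 ≤ B) (hf : Integrable f)
    (hf0 : ∀ x, 0 ≤ f x) (hf1 : ∫ x, f x = 1) (hlip : ∀ x y, |f y - f x| ≤ B * |y - x|) (x : ℝ) :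
    f x ≤ 2 * B := by
  have hB0 : 0 < B := by linarith
  have h1 := two_mul_le_integral_of_le hf hf0 (x := x) (δ := f x / (2 * B)) (c := f x / 2)
    (div_nonneg (hf0 x) (by linarith)) (fun y hy => by
      have h2 := hlip x y
      have h3 : B * |y - x| ≤ f x / 2 := by
        calc B * |y - x| ≤ B * (f x / (2 * B)) := by gcongr
          _ = _ := by field_simp
      have := (abs_le.1 (h2.trans h3)).1
      linarith)
  rw [hf1] at h1
  have h2 : f x ^ 2 ≤ 2 * B := by
    have : 2 * (f x / (2 * B)) * (f x / 2) = f x ^ 2 / (2 * B) := by field_simp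
    rw [this, div_le_one (by positivity)] at h1
    exact h1
  nlinarith [hf0 x]

/-- If `f` is a Lipschitz density, `m` is Lipschitz where `f` is positive, and `m² f` has a bounded
integral, then `m f` is bounded: where `|m f|` is large, so is `m² f` on an interval of length
comparable with `min |m| f`. -/
theorem abs_mul_density_le {m f : ℝ → ℝ} {B A : ℝ} (hB : 1 ≤ B)
    (hf0 : ∀ x, 0 ≤ f x) (hf2 : ∀ x, f x ≤ 2 * B) (hlip : ∀ x y, |f y - f x| ≤ B * |y - x|)
    (hmd : ∀ x, 0 < f x → DifferentiableAt ℝ m x) (hm : ∀ x, 0 < f x → |deriv m x| ≤ B)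
    (hi : Integrable (fun x => m x ^ 2 * f x)) (hA : ∫ x, m x ^ 2 * f x ≤ A) (x : ℝ) :
    |m x * f x| ≤ 1 + 4 * B ^ 2 + 8 * B * A := by
  have hB0 : 0 < B := by linarith
  have hA0 : 0 ≤ A :=
    le_trans (integral_nonneg fun y => mul_nonneg (sq_nonneg _) (hf0 y)) hA
  rw [abs_mul, abs_of_nonneg (hf0 x)]
  set s := f x with hs
  set M := |m x| with hM
  have hM0 : 0 ≤ M := abs_nonneg _
  rcases (hf0 x).eq_or_lt with h0 | h0
  · rw [← hs] at h0; rw [← h0, mul_zero]; positivity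
  rw [← hs] at h0
  set δ := min s M / (2 * B) with hδ
  have hδ0 : 0 ≤ δ := div_nonneg (le_min h0.le hM0) (by linarith)
  have hBδ : B * δ = min s M / 2 := by rw [hδ]; field_simp
  have hBs : B * δ ≤ s / 2 := by rw [hBδ]; have := min_le_left s M; linarith
  have hBM : B * δ ≤ M / 2 := by rw [hBδ]; have := min_le_right s M; linarith
  have hfs : ∀ y, |y - x| ≤ δ → s / 2 ≤ f y := fun y hy => by
    have h1 := (abs_le.1 ((hlip x y).trans (mul_le_mul_of_nonneg_left hy hB0.le))).1
    linarith
  have hmM : ∀ y, |y - x| ≤ δ → M / 2 ≤ |m y| := fun y hy => by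
    have hpos : ∀ z ∈ uIcc x y, 0 < f z := fun z hz => by
      have := hfs z ((abs_sub_left_of_mem_uIcc hz).trans hy)
      linarith
    have := (convex_uIcc x y).norm_image_sub_le_of_norm_hasDerivWithin_le
      (fun z hz => (hmd z (hpos z hz)).hasDerivAt.hasDerivWithinAt)
      (fun z hz => hm z (hpos z hz)) left_mem_uIcc right_mem_uIcc
    rw [Real.norm_eq_abs, Real.norm_eq_abs] at this
    have h2 := abs_sub_abs_le_abs_sub (m x) (m y)
    rw [abs_sub_comm] at h2
    have h3 := mul_le_mul_of_nonneg_left hy hB0.le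
    linarith
  have h1 := two_mul_le_integral_of_le hi (fun y => mul_nonneg (sq_nonneg _) (hf0 y))
    (x := x) hδ0 (c := (M / 2) ^ 2 * (s / 2)) (fun y hy => by
      have e1 : (M / 2) ^ 2 ≤ m y ^ 2 := by
        rw [← sq_abs (m y)]; exact pow_le_pow_left₀ (by positivity) (hmM y hy) 2
      exact mul_le_mul e1 (hfs y hy) (by positivity) (sq_nonneg _))
  have h2 : min s M * (M ^ 2 * s) ≤ 8 * B * A := by
    have h3 : 2 * δ * ((M / 2) ^ 2 * (s / 2)) * (8 * B) = min s M * (M ^ 2 * s) := by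
      rw [hδ]; field_simp; ring
    rw [← h3]
    nlinarith
  rcases le_total M s with h | h
  · have : M * s ≤ (2 * B) * (2 * B) := mul_le_mul (h.trans (hf2 x)) (hf2 x) h0.le (by linarith)
    have : 0 ≤ 8 * B * A := by positivity
    nlinarith
  · rw [min_eq_left h] at h2
    have h3 : (M * s) ^ 2 ≤ 8 * B * A := by linarith
    nlinarith [sq_nonneg (M * s - 1), sq_nonneg B]

variable {d p : ℕ} {Ξ Ω : Type*} [MeasurableSpace Ξ] [MeasurableSpace Ω]
  {μ : Measure Ξ} [IsProbabilityMeasure μ] {P : Measure Ω}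
  {M : Problem d p Ξ} {I : Input d p} {W : Noise d Ξ Ω} {f : Vec d → ℝ → ℝ}
  {mbar : (j : Fin p) → Vec d → (Fin ((j : ℕ) + 1) → ℝ) → ℝ → ℝ}
  {nu : Vec d → ℝ} {lam : Vec d → Vec p} {N : Set (Vec d)} {Xε : Set ℝ} {Λε : Set (Vec p)}
  {B ε Cq εq Cm εm : ℝ} {θ : Vec d} {l : Vec p} {j : Fin p}

theorem Setting.measurable_X_section (hset : Setting M μ f mbar nu lam) (θ : Vec d) :
    Measurable (M.X θ) := hset.measurable_X.comp (measurable_const.prodMk measurable_id)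

theorem Setting.measurable_Y_section (hset : Setting M μ f mbar nu lam) (θ : Vec d) :
    Measurable (M.Y θ) := hset.measurable_Y.comp (measurable_const.prodMk measurable_id)

theorem Setting.measurable_m_section (hset : Setting M μ f mbar nu lam) (j : Fin p) (θ : Vec d)
    (l : Fin ((j : ℕ) + 1) → ℝ) : Measurable (fun y => M.m j θ y l) :=
  (hset.measurable_m j).comp
    (measurable_const.prodMk (measurable_id.prodMk measurable_const))

theorem Setting.integrable_f (hset : Setting M μ f mbar nu lam) (θ : Vec d) :
    Integrable (f θ) ∧ ∫ x, f θ x = 1 := by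
  have h1 : ∫⁻ x, ENNReal.ofReal (f θ x) = 1 := by
    have : (μ.map (M.X θ)) univ = 1 := by
      rw [Measure.map_apply (hset.measurable_X_section θ) MeasurableSet.univ]; simp
    rwa [hset.f_density θ, withDensity_apply _ MeasurableSet.univ, Measure.restrict_univ] at this
  have hi : Integrable (f θ) := integrable_of_lintegral_le (c := 1)
    (hset.measurable_f θ).aestronglyMeasurable (hset.f_nonneg θ) (by rw [h1]; simp)
  refine ⟨hi, ?_⟩
  rw [integral_eq_lintegral_of_nonneg_ae (Eventually.of_forall (hset.f_nonneg θ))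
    hi.aestronglyMeasurable, h1]
  simp

theorem Regular.contDiff_f (hreg : Regular M μ f mbar N Xε Λε B ε Cq εq Cm εm) (hθ : θ ∈ N) :
    ContDiff ℝ 3 (f θ) := by
  obtain ⟨φ, hφ⟩ := hreg.f_schwartz θ hθ
  rw [← (funext hφ : ⇑φ = f θ)]
  exact φ.smooth 3

/-- The density is positive only in the interior of the support. -/
theorem Regular.mem_interior_suppX (hset : Setting M μ f mbar nu lam)
    (hreg : Regular M μ f mbar N Xε Λε B ε Cq εq Cm εm) (hθ : θ ∈ N) {x : ℝ} (hx : 0 < f θ x) :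
    x ∈ interior (suppX M μ θ) := by
  have hopen : IsOpen {y | 0 < f θ y} :=
    isOpen_lt continuous_const (hreg.contDiff_f hθ).continuous
  refine mem_interior.2 ⟨{y | 0 < f θ y}, fun y hy => ?_, hopen, hx⟩
  rw [suppX, Measure.mem_support_iff_forall]
  intro U hU
  obtain ⟨V, hVU, hVo, hyV⟩ := mem_nhds_iff.1 (inter_mem hU (hopen.mem_nhds hy))
  refine lt_of_lt_of_le ?_ (measure_mono (hVU.trans inter_subset_left))
  rw [hset.f_density θ, withDensity_apply _ hVo.measurableSet,
    setLIntegral_pos_iff (hset.measurable_f θ).ennreal_ofReal]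
  refine (hVo.measure_pos volume ⟨y, hyV⟩).trans_le (measure_mono fun z hz => ⟨?_, hz⟩)
  rw [Function.mem_support]
  exact (ENNReal.ofReal_pos.2 (hVU hz).2).ne'

/-- The constant for the bounds on the densities and regression functions. -/
def pairConst (B Cm : ℝ) : ℝ :=
  1 + 8 * max |B| 1 + 4 * max |B| 1 ^ 2 + 8 * max |B| 1 * |Cm| + |Cm|

theorem Regular.memLp_m (hset : Setting M μ f mbar nu lam)
    (hreg : Regular M μ f mbar N Xε Λε B ε Cq εq Cm εm) (hθ : θ ∈ N) (hl : l ∈ Λε) (j : Fin p) :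
    MemLp (fun ξ => M.m j θ (M.Y θ ξ) (lead j l)) 2 μ :=
  memLp_two_of_lintegral_sq_le
    ((hset.measurable_m_section j θ _).comp (hset.measurable_Y_section θ)).aestronglyMeasurable
    (hreg.m_moment j θ hθ l hl)

/-- Where the density vanishes its derivative does too, so the bounds on the interior of the support
hold everywhere; the bound on `m f` comes from the second moment of `m`. The constants depend on
neither `θ` nor `λ`. -/
theorem Regular.pairBounds (hset : Setting M μ f mbar nu lam)
    (hreg : Regular M μ f mbar N Xε Λε B ε Cq εq Cm εm) (hXε : IsOpen Xε)
    (hθ : θ ∈ N) (hl : l ∈ Λε) (j : Fin p) :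
    PairBounds (mbar j θ (lead j l)) (f θ) Xε ε (pairConst B Cm) := by
  set B' := max |B| 1 with hB'
  have hB1 : 1 ≤ B' := le_max_right _ _
  have hBB : B ≤ B' := (le_abs_self B).trans (le_max_left _ _)
  have hCm := hreg.Cm_pos
  have hCdef : pairConst B Cm = 1 + 8 * B' + 4 * B' ^ 2 + 8 * B' * Cm + Cm := by
    rw [pairConst, ← hB', abs_of_pos hCm]
  have hBCm : 0 ≤ B' * Cm := by positivity
  have hf3 := hreg.contDiff_f hθ
  have hf0 := hset.f_nonneg θ
  obtain ⟨hfi, hf1⟩ := hset.integrable_f θ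
  have hfd : Differentiable ℝ (f θ) := hf3.differentiable (by norm_num)
  have hsupp : ∀ x, 0 < f θ x → x ∈ interior (suppX M μ θ) := fun x hx =>
    hreg.mem_interior_suppX hset hθ hx
  have hd1 : ∀ x, |deriv (f θ) x| ≤ B' := fun x => by
    rcases (hf0 x).eq_or_lt with h0 | h0
    · have : IsLocalMin (f θ) x := Eventually.of_forall fun y => by rw [← h0]; exact hf0 y
      rw [this.deriv_eq_zero, abs_zero]; linarith
    · exact ((hreg.f_smooth_x θ hθ).abs_deriv_le (hsupp x h0)).trans hBB
  have hc2 : ContDiff ℝ 2 (deriv (f θ)) := ((contDiff_succ_iff_deriv (n := 2)).1 hf3).2.2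
  have hd2 : ∀ x, |deriv (deriv (f θ)) x| ≤ B' := by
    -- on the closure of `{f > 0}` by continuity; off it `f` vanishes locally
    have hcl : closure {x | 0 < f θ x} ⊆ {x | |deriv (deriv (f θ)) x| ≤ B'} :=
      closure_minimal (fun x hx => ((hreg.f_smooth_x θ hθ).abs_deriv_deriv_le (hsupp x hx)).trans hBB)
        (isClosed_le (hc2.continuous_deriv (by norm_num)).abs continuous_const)
    intro x
    by_cases hx : x ∈ closure {x | 0 < f θ x}
    · exact hcl hx
    · have hloc : f θ =ᶠ[𝓝 x] fun _ => 0 := by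
        filter_upwards [isClosed_closure.isOpen_compl.mem_nhds hx] with y hy
        by_contra hne
        exact hy (subset_closure (lt_of_le_of_ne (hf0 y) (Ne.symm hne)))
      rw [hloc.deriv.deriv_eq]
      simp only [deriv_const', abs_zero]; linarith
  have hlip : ∀ x y, |f θ y - f θ x| ≤ B' * |y - x| := fun x y =>
    convex_univ.norm_image_sub_le_of_norm_hasDerivWithin_le
      (fun z _ => (hfd z).hasDerivAt.hasDerivWithinAt) (fun z _ => hd1 z) (mem_univ x) (mem_univ y)
  have hlip' : ∀ x y, |deriv (f θ) y - deriv (f θ) x| ≤ B' * |y - x| := fun x y =>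
    convex_univ.norm_image_sub_le_of_norm_hasDerivWithin_le
      (fun z _ => (hc2.differentiable (by norm_num) z).hasDerivAt.hasDerivWithinAt)
      (fun z _ => hd2 z) (mem_univ x) (mem_univ y)
  have hf2 := density_le_of_lipschitz hB1 hfi hf0 hf1 hlip
  have hXsupp : ∀ x ∈ Xε, x ∈ interior (suppX M μ θ) := fun x hx =>
    hsupp x (hreg.ε_pos.trans_le (hreg.f_lower θ hθ x hx))
  obtain ⟨ψ, hψ⟩ := hreg.m_schwartz j θ hθ l hl
  have hψ' : ⇑ψ = mbar j θ (lead j l) := funext hψ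
  have hm2 : ContDiff ℝ 2 (mbar j θ (lead j l)) := by rw [← hψ']; exact ψ.smooth 2
  have hmc := hm2.continuous
  have hfc := hf3.continuous
  have hXm := hset.measurable_X_section θ
  have hYm := hset.measurable_Y_section θ
  have hφm := hset.measurable_m_section j θ (lead j l)
  have hφi : Integrable (fun ξ => M.m j θ (M.Y θ ξ) (lead j l)) μ :=
    (hreg.memLp_m hset hθ hl j).integrable (by norm_num)
  have hcm := hset.mbar_version j θ (lead j l)
  have hsq0 : ∀ x, 0 ≤ mbar j θ (lead j l) x ^ 2 * f θ x := fun x =>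
    mul_nonneg (sq_nonneg _) (hf0 x)
  have hsq : ∫⁻ x, ENNReal.ofReal (mbar j θ (lead j l) x ^ 2 * f θ x) ≤ ENNReal.ofReal Cm := by
    refine le_trans (le_of_eq ?_) ((hcm.lintegral_sq_le hXm hYm hφm hφi).trans
      (hreg.m_moment j θ hθ l hl))
    rw [lintegral_map_of_density (hset.measurable_f θ) (hset.f_density θ) (by fun_prop)]
    congr 1; ext x
    rw [← ENNReal.ofReal_mul (hf0 x), mul_comm]
  have hsqi : Integrable (fun x => mbar j θ (lead j l) x ^ 2 * f θ x) :=
    integrable_of_lintegral_le (by fun_prop) hsq0 hsq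
  have hsqle : ∫ x, mbar j θ (lead j l) x ^ 2 * f θ x ≤ Cm :=
    integral_le_of_lintegral_le hsqi.aestronglyMeasurable hsq0 hCm.le hsq
  have hmX : ∀ x ∈ Xε, mbar j θ (lead j l) x ^ 2 ≤ Cm := by
    have hae : ∀ᵐ x ∂(μ.map (M.X θ)), x ∈ Xε → mbar j θ (lead j l) x ^ 2 ≤ Cm := by
      filter_upwards [hcm hφi, hreg.m_cond_moment j θ hθ l hl] with x hx1 hx2 hxX
      have h1 := (ofReal_sq_integral_le (μ := condDistrib (M.Y θ) (M.X θ) μ x)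
        hφm.aestronglyMeasurable).trans (hx2 hxX)
      rw [← hx1] at h1
      exact (ENNReal.ofReal_le_ofReal_iff hCm.le).1 h1
    rw [hset.f_density θ, ae_withDensity_iff (hset.measurable_f θ).ennreal_ofReal] at hae
    -- the exceptional set is open and null, hence empty
    have hopen : IsOpen (Xε ∩ {x | Cm < mbar j θ (lead j l) x ^ 2}) :=
      hXε.inter (isOpen_lt continuous_const (hmc.pow 2))
    have hnull : volume (Xε ∩ {x | Cm < mbar j θ (lead j l) x ^ 2}) = 0 := by
      refine measure_mono_null (fun x hx => ?_) hae
      simp only [mem_compl_iff, mem_ofPred_eq, not_forall]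
      exact ⟨(ENNReal.ofReal_pos.2 (hreg.ε_pos.trans_le (hreg.f_lower θ hθ x hx.1))).ne', hx.1,
        not_le.2 hx.2⟩
    have hempty := (hopen.measure_eq_zero_iff volume).1 hnull
    intro x hx
    by_contra hlt
    have : x ∈ Xε ∩ {x | Cm < mbar j θ (lead j l) x ^ 2} := ⟨hx, not_le.1 hlt⟩
    rw [hempty] at this
    exact this
  refine
    { one_le := ?_
      ε_pos := hreg.ε_pos
      f_smooth := hf3.of_le (by norm_num)
      m_smooth := hm2
      f_integrable := hfi
      f_integral := hf1
      f_nonneg := hf0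
      f_le := fun x => (hf2 x).trans ?_
      f_deriv := fun x => (hd1 x).trans ?_
      f_deriv2 := fun x => (hd2 x).trans ?_
      f_sq := fun x => ?_
      f_lower := hreg.f_lower θ hθ
      m_deriv := fun x hx =>
        ((hreg.m_smooth_ν j θ hθ l hl).abs_deriv_le (hsupp x hx)).trans (hBB.trans ?_)
      m_deriv2 := fun x hx =>
        ((hreg.m_smooth_ν j θ hθ l hl).abs_deriv_deriv_le (hXsupp x hx)).trans (hBB.trans ?_)
      m_le := fun x hx => abs_le_of_sq_le_sq' ((hmX x hx).trans ?_) ?_ |> abs_le.2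
      m_sq_integrable := hsqi
      m_sq := hsqle.trans ?_
      mf_le := fun x => (abs_mul_density_le hB1 hf0 hf2 hlip
        (fun y _ => hm2.differentiable (by norm_num) y)
        (fun y hy => ((hreg.m_smooth_ν j θ hθ l hl).abs_deriv_le (hsupp y hy)).trans hBB)
        hsqi hsqle x).trans ?_
      bdd := ?_ } <;> try (rw [hCdef]; nlinarith)
  · rw [hCdef]
    have h1 := sq_deriv_le_of_nonneg (F := fun t => f θ (x + t)) (F' := fun t => deriv (f θ) (x + t))
      hB1 one_pos (fun t _ => (hfd (x + t)).hasDerivAt.comp_const_add x t) (fun t _ => hf0 _)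
      (hd1 _) (fun t _ => by simpa using hlip' x (x + t))
    simp only [add_zero] at h1
    refine h1.trans (mul_le_mul_of_nonneg_right ?_ (hf0 x))
    nlinarith
  · obtain ⟨M₀, hM₀⟩ := ψ.decay 0 0
    obtain ⟨M₁, hM₁⟩ := ψ.decay 0 1
    refine ⟨max M₀ M₁, fun x => ⟨?_, ?_⟩⟩
    · have := hM₀.2 x
      rw [norm_iteratedFDeriv_zero, hψ', pow_zero, one_mul] at this
      exact this.trans (le_max_left _ _)
    · have := hM₁.2 x
      rw [norm_iteratedFDeriv_eq_norm_iteratedDeriv, iteratedDeriv_one, hψ', pow_zero,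
        one_mul] at this
      exact this.trans (le_max_right _ _)

end KBSA

/-! ### The mean drift of the gradient estimates -/

namespace KBSA

theorem PairBounds.mono {m f : ℝ → ℝ} {U : Set ℝ} {ε C C' : ℝ} (h : PairBounds m f U ε C)
    (hC : C ≤ C') : PairBounds m f U ε C' :=
  { one_le := h.one_le.trans hC
    ε_pos := h.ε_pos
    f_smooth := h.f_smooth
    m_smooth := h.m_smooth
    f_integrable := h.f_integrable
    f_integral := h.f_integral
    f_nonneg := h.f_nonneg
    f_le := fun x => (h.f_le x).trans hC
    f_deriv := fun x => (h.f_deriv x).trans hC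
    f_deriv2 := fun x => (h.f_deriv2 x).trans hC
    f_sq := fun x => (h.f_sq x).trans (mul_le_mul_of_nonneg_right hC (h.f_nonneg x))
    f_lower := h.f_lower
    m_deriv := fun x hx => (h.m_deriv x hx).trans hC
    m_deriv2 := fun x hx => (h.m_deriv2 x hx).trans hC
    m_le := fun x hx => (h.m_le x hx).trans hC
    m_sq_integrable := h.m_sq_integrable
    m_sq := h.m_sq.trans hC
    mf_le := fun x => (h.mf_le x).trans hC
    bdd := h.bdd }

variable {d p : ℕ} {Ξ Ω : Type*} [MeasurableSpace Ξ] [MeasurableSpace Ω]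
  {μ : Measure Ξ} [IsProbabilityMeasure μ] {P : Measure Ω}
  {M : Problem d p Ξ} {I : Input d p} {W : Noise d Ξ Ω} {f : Vec d → ℝ → ℝ}
  {mbar : (j : Fin p) → Vec d → (Fin ((j : ℕ) + 1) → ℝ) → ℝ → ℝ}
  {nu : Vec d → ℝ} {lam : Vec d → Vec p} {N : Set (Vec d)} {Xε : Set ℝ} {Λε : Set (Vec p)}
  {B ε Cq εq Cm εm : ℝ}

theorem lead_add_smul_single {j i : Fin p} (hij : j < i) (l : Vec p) (t : ℝ) :
    lead j (l + t • EuclideanSpace.single i 1) = lead j l := by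
  funext k
  have hne : Fin.castLE j.isLt k ≠ i := fun h => by
    have h1 := congrArg Fin.val h
    have h2 := k.isLt
    have h3 : (j : ℕ) < i := hij
    simp only [Fin.val_castLE] at h1
    omega
  simp [lead, hne]

theorem vec_eq_sum (a : Vec p) : a = ∑ i, a i • EuclideanSpace.single i (1 : ℝ) := by
  ext k
  simp [Pi.single_apply]

/-- The derivatives of a regression function in the directions of the components of `λ`: it depends
only on the first `j`, and it is decreasing in the `j`-th one. -/
theorem Regular.fderiv_mbar_apply (hreg : Regular M μ f mbar N Xε Λε B ε Cq εq Cm εm)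
    (hN : IsOpen N) (hΛ : IsOpen Λε) (j : Fin p) (x : ℝ) {θ : Vec d} {l : Vec p} (hθ : θ ∈ N)
    (hl : l ∈ Λε) (v : Vec d) (a : Vec p) :
    ∃ e : Fin p → ℝ, e j ≤ B ∧ -B ≤ e j ∧ (x ∈ Xε → e j ≤ -εm) ∧
      |fderiv ℝ (fun z : Vec d × Vec p => mbar j z.1 (lead j z.2) x) (θ, l) (v, a) - a j * e j| ≤
        B * (‖v‖ + ∑ i ∈ Finset.univ.filter (· < j), |a i|) := by
  set G : Vec d × Vec p → ℝ := fun z => mbar j z.1 (lead j z.2) x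
  have hG := hreg.m_smooth_θlam j x
  have hz : (θ, l) ∈ N ×ˢ Λε := ⟨hθ, hl⟩
  set L := fderiv ℝ G (θ, l)
  have hL : HasFDerivAt G L (θ, l) := hG.hasFDerivAt (hN.prod hΛ) hz
  have hLB : ‖L‖ ≤ B := hG.norm_fderiv_le hz
  have hB : 0 ≤ B := (norm_nonneg _).trans hLB
  have hpart : ∀ i : Fin p, |L (0, EuclideanSpace.single i 1)| ≤ B := fun i => by
    refine (L.le_opNorm _).trans ?_
    have : ‖((0 : Vec d), (EuclideanSpace.single i 1 : Vec p))‖ = 1 := by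
      rw [Prod.norm_mk]; simp
    rw [this, mul_one]; exact hLB
  have hzero : ∀ i : Fin p, j < i → L (0, EuclideanSpace.single i 1) = 0 := fun i hij => by
    have h1 : HasDerivAt (fun t : ℝ => ((θ, l + t • EuclideanSpace.single i 1) : Vec d × Vec p))
        (0, EuclideanSpace.single i 1) 0 := by
      refine (hasDerivAt_const _ _).prodMk ?_
      simpa using ((hasDerivAt_id' (0 : ℝ)).smul_const
        (EuclideanSpace.single i (1 : ℝ) : Vec p)).const_add l
    have h2 : HasDerivAt (fun t : ℝ => G (θ, l + t • EuclideanSpace.single i 1))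
        (L (0, EuclideanSpace.single i 1)) 0 := by
      have hL' : HasFDerivAt G L (θ, l + (0 : ℝ) • EuclideanSpace.single i 1) := by
        simpa using hL
      exact hL'.comp_hasDerivAt 0 h1
    have h3 : (fun t : ℝ => G (θ, l + t • EuclideanSpace.single i 1)) = fun _ => G (θ, l) := by
      funext t
      simp only [G, lead_add_smul_single hij]
    rw [h3] at h2
    exact h2.unique (hasDerivAt_const _ _)
  have hdiag : x ∈ Xε → L (0, EuclideanSpace.single j 1) ≤ -εm := fun hx => by
    have h1 : HasFDerivAt (fun l' : Vec p => ((θ, l') : Vec d × Vec p))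
        (ContinuousLinearMap.inr ℝ (Vec d) (Vec p)) l := hasFDerivAt_prodMk_right θ l
    have h2 : HasFDerivAt (fun l' : Vec p => mbar j θ (lead j l') x)
        (L.comp (ContinuousLinearMap.inr ℝ (Vec d) (Vec p))) l := hL.comp l h1
    have h3 := hreg.m_deriv j θ hθ x hx l hl
    rw [h2.fderiv] at h3
    simpa using h3
  refine ⟨fun i => L (0, EuclideanSpace.single i 1), (abs_le.1 (hpart j)).2, (abs_le.1 (hpart j)).1,
    hdiag, ?_⟩
  have hdec : L (v, a) = L (v, 0) + ∑ i, a i * L (0, EuclideanSpace.single i 1) := by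
    have h1 : ((v, a) : Vec d × Vec p) =
        (v, 0) + ∑ i, a i • ((0, EuclideanSpace.single i 1) : Vec d × Vec p) := by
      rw [Prod.ext_iff]
      refine ⟨by simp [Prod.fst_sum], ?_⟩
      simp only [Prod.snd_add, Prod.snd_sum, Prod.smul_snd, zero_add]
      exact vec_eq_sum a
    rw [h1, map_add, map_sum]
    simp only [map_smul, smul_eq_mul]
  have hsum : ∑ i, a i * L (0, EuclideanSpace.single i 1) =
      a j * L (0, EuclideanSpace.single j 1) +
        ∑ i ∈ Finset.univ.filter (· < j), a i * L (0, EuclideanSpace.single i 1) := by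
    rw [← Finset.add_sum_erase _ _ (Finset.mem_univ j)]
    congr 1
    symm
    refine Finset.sum_subset (fun i hi => ?_) (fun i hi hi' => ?_)
    · simp only [Finset.mem_filter, Finset.mem_univ, true_and] at hi
      simp [hi.ne]
    · simp only [Finset.mem_filter, Finset.mem_univ, true_and, not_lt] at hi'
      simp only [Finset.mem_erase, Finset.mem_univ, and_true] at hi
      rw [hzero i (lt_of_le_of_ne hi' (Ne.symm hi)), mul_zero]
  rw [hdec, hsum, show ∀ u w z : ℝ, u + (w + z) - w = u + z by intros; ring, mul_add]
  refine (abs_add_le _ _).trans (add_le_add ?_ ?_)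
  · refine (L.le_opNorm _).trans ?_
    have : ‖((v, 0) : Vec d × Vec p)‖ = ‖v‖ := by rw [Prod.norm_mk]; simp
    rw [this]; gcongr
  · refine (Finset.abs_sum_le_sum_abs _ _).trans ?_
    rw [Finset.mul_sum]
    refine Finset.sum_le_sum fun i _ => ?_
    rw [abs_mul, mul_comm]
    gcongr
    exact hpart i

/-- The change of `ψ φ⁻ - φ ψ⁻` is split into the change of `ψ` with the parameters, its change with
the argument, and the change of `φ`. -/
theorem mean_drift_combine {φp φm φmp ψp ψm ψmp A b c C L D ε εm R Sa bb : ℝ} (hC0 : 0 < C)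
    (hc : 0 < c) (hε : 0 < ε) (hεm : 0 < εm) (hR : 0 ≤ R) (hL0 : 0 ≤ L) (hD0 : 0 ≤ D)
    (hSa0 : 0 ≤ Sa) (hbb0 : 0 ≤ bb) (hbb' : bb ≤ C * D + C * Sa) (hφ1 : ε / 2 ≤ φm) (hφ2 : φm ≤ C)
    (hψ : |ψm| ≤ C)
    (hT1 : A * (ψp - ψmp) ≤ 2 * c * (-(εm * ε / 2) * A ^ 2 + |A| * (bb * C + C ^ 2 + R * C)))
    (hT2 : |ψmp - ψm| ≤ L * (2 * c * |b|)) (hT3 : |φmp - φm| ≤ C * (2 * c * |b|))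
    (hT4 : |φp - φmp| ≤ C * (2 * c * D)) :
    A * (ψp * φm - φp * ψm) ≤ 2 * c * (-(ε / 2 * (εm * ε / 2)) * A ^ 2 +
      2 * (C * (C * C + C * C * D + C ^ 2 + R * C) + C * L + C * (C + C * D)) * |A| *
        (1 + |b| + Sa)) := by
  set E := C * (C * C + C * C * D + C ^ 2 + R * C) + C * L + C * (C + C * D) with hE
  have hA0 : 0 ≤ |A| := abs_nonneg _
  have hφ0 : 0 ≤ φm := by linarith
  have h2c : 0 < 2 * c := by linarith
  -- the three contributions
  have f1 : A * (ψp - ψmp) * φm ≤ 2 * c * (-(ε / 2 * (εm * ε / 2)) * A ^ 2 +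
      C * |A| * (bb * C + C ^ 2 + R * C)) := by
    have g1 := mul_le_mul_of_nonneg_right hT1 hφ0
    have g2 : ε / 2 * (2 * c * (εm * ε / 2 * A ^ 2)) ≤ φm * (2 * c * (εm * ε / 2 * A ^ 2)) :=
      mul_le_mul_of_nonneg_right hφ1 (by positivity)
    have g3 : φm * (2 * c * (|A| * (bb * C + C ^ 2 + R * C))) ≤
        C * (2 * c * (|A| * (bb * C + C ^ 2 + R * C))) :=
      mul_le_mul_of_nonneg_right hφ2 (by positivity)
    linarith
  have f2 : A * (ψmp - ψm) * φm ≤ 2 * c * (C * L * |A| * |b|) := by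
    have g1 : A * (ψmp - ψm) ≤ |A| * (L * (2 * c * |b|)) := by
      refine (le_abs_self _).trans ?_
      rw [abs_mul]
      gcongr
    have g2 := mul_le_mul_of_nonneg_right g1 hφ0
    have g3 : φm * (|A| * (L * (2 * c * |b|))) ≤ C * (|A| * (L * (2 * c * |b|))) :=
      mul_le_mul_of_nonneg_right hφ2 (by positivity)
    linarith
  have f3 : -(A * ((φp - φm) * ψm)) ≤ 2 * c * (|A| * (C * D + C * |b|) * C) := by
    have g1 : |φp - φm| ≤ 2 * c * (C * D + C * |b|) := by
      have e1 : |φp - φm| ≤ |φp - φmp| + |φmp - φm| := abs_sub_le _ _ _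
      linarith
    refine (neg_le_abs _).trans ?_
    rw [abs_mul, abs_mul]
    calc |A| * (|φp - φm| * |ψm|) ≤ |A| * ((2 * c * (C * D + C * |b|)) * C) := by gcongr
      _ = _ := by ring
  have f4 : C * |A| * (bb * C + C ^ 2 + R * C) + C * L * |A| * |b| +
      |A| * (C * D + C * |b|) * C ≤ 2 * E * |A| * (1 + |b| + Sa) := by
    have g0 : bb * C + C ^ 2 + R * C ≤ (C * C + C * C * D + C ^ 2 + R * C) * (1 + Sa) := by
      have e1 : bb * C ≤ (C * D + C * Sa) * C := mul_le_mul_of_nonneg_right hbb' hC0.le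
      have e2 : 0 ≤ (C * C * D + C ^ 2 + R * C) * Sa := by positivity
      have e3 : 0 ≤ C * C := by positivity
      nlinarith
    have g1 : C * (bb * C + C ^ 2 + R * C) + C * L * |b| + (C * D + C * |b|) * C ≤
        2 * E * (1 + |b| + Sa) := by
      have e1 := mul_le_mul_of_nonneg_left g0 hC0.le
      have hb0 := abs_nonneg b
      have e2 : 0 ≤ C * (C * C + C * C * D + C ^ 2 + R * C) := by positivity
      have e3 : 0 ≤ C * L := by positivity
      have e4 : 0 ≤ C * (C + C * D) := by positivity
      have e5 : 0 ≤ C * (C * D) := by positivity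
      have e6 : 0 ≤ C * C := by positivity
      have e7 : C * (C * C + C * C * D + C ^ 2 + R * C) * (1 + Sa) ≤ E * (1 + |b| + Sa) := by
        refine mul_le_mul (by linarith) (by linarith) (by positivity) (by linarith)
      have e8 : C * L * |b| + (C * D + C * |b|) * C ≤ E * (1 + |b| + Sa) := by
        have u1 : C * L * |b| + (C * D + C * |b|) * C ≤ (C * L + C * (C + C * D)) * (1 + |b|) := by
          nlinarith [mul_nonneg e5 hb0]
        refine u1.trans (mul_le_mul (by linarith) (by linarith) (by positivity) (by linarith))
      linarith
    have := mul_le_mul_of_nonneg_left g1 hA0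
    linarith
  have f5 := mul_le_mul_of_nonneg_left f4 h2c.le
  have hid : A * (ψp * φm - φp * ψm) =
      A * (ψp - ψmp) * φm + A * (ψmp - ψm) * φm + -(A * ((φp - φm) * ψm)) := by ring
  rw [hid]
  linarith

theorem exists_eq_add_mul_of_mem_segment {ν b c z : ℝ} (hc : 0 ≤ c)
    (hz : z ∈ segment ℝ (ν + (-c) * b) (ν + c * b)) : ∃ s, |s| ≤ c ∧ z = ν + s * b := by
  obtain ⟨u, v, hu, hv, huv, rfl⟩ := hz
  refine ⟨(v - u) * c, ?_, ?_⟩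
  · rw [abs_mul, abs_of_nonneg hc]
    exact mul_le_of_le_one_left hc (abs_le.2 ⟨by linarith, by linarith⟩)
  · simp only [smul_eq_mul]
    have : ν = (u + v) * ν := by rw [huv, one_mul]
    linear_combination -this

set_option maxHeartbeats 1000000 in
/-- The mean, given a direction, of the increment of the estimate `G_j`: along `G_j` it is strictly
contracting, up to terms that are linear in the projection `a_j` of `G_j` on the direction. Here `a`,
`b` are the projections of the estimates on the direction `Δ`. -/
theorem Regular.exists_drift_le (hset : Setting M μ f mbar nu lam)
    (hreg : Regular M μ f mbar N Xε Λε B ε Cq εq Cm εm)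
    (hN : IsOpen N) (hNc : Convex ℝ N) (hX : IsOpen Xε) (hΛ : IsOpen Λε)
    {K : ℝ → ℝ} {CK : ℝ} (hK : KernelBounds K CK) {ρ : ℝ} (hρ : 0 < ρ) :
    ∃ κ > 0, ∃ C > 0, ∃ h₀ > 0, ∀ (j : Fin p) (θ : Vec d) (ν : ℝ) (l : Vec p) (Δ : Vec d)
      (a : Vec p) (b h c : ℝ), ‖Δ‖ ≤ √(d : ℝ) → 0 < h → h ≤ h₀ → 0 < c →
      (∀ s, |s| < 2 * c → Metric.ball (θ + s • Δ) ρ ⊆ N ∧ l + s • a ∈ Λε) →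
      (∀ s, |s| ≤ c → Metric.ball (ν + s * b) ρ ⊆ Xε) →
      a j * ((∫ x, kern K h (ν + c * b) x *
            (mbar j (θ + c • Δ) (lead j (l + c • a)) x * f (θ + c • Δ) x)) *
          (∫ x, kern K h (ν + (-c) * b) x * f (θ + (-c) • Δ) x) -
        (∫ x, kern K h (ν + c * b) x * f (θ + c • Δ) x) *
          ∫ x, kern K h (ν + (-c) * b) x *
            (mbar j (θ + (-c) • Δ) (lead j (l + (-c) • a)) x * f (θ + (-c) • Δ) x)) ≤
      2 * c * (-κ * a j ^ 2 + C * |a j| * (1 + |b| + ∑ i ∈ Finset.univ.filter (· < j), |a i|)) := by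
  obtain ⟨D, hD⟩ : ∃ D, D = √(d : ℝ) := ⟨_, rfl⟩
  have hD0 : 0 ≤ D := by rw [hD]; exact Real.sqrt_nonneg _
  have hB0 : 0 ≤ |B| := abs_nonneg B
  obtain ⟨C, hC1, hpC, hBC, hBD, hqC⟩ : ∃ C, 1 ≤ C ∧ pairConst B Cm ≤ C ∧ |B| ≤ C ∧ |B| * D ≤ C ∧
      4 * (1 + |B| * (1 + D ^ 2)) * (1 + 2 * (1 + D) / ρ) ≤ C := by
    have hp0 : 1 ≤ pairConst B Cm := by
      rw [pairConst]
      have : 0 ≤ 8 * max |B| 1 + 4 * max |B| 1 ^ 2 + 8 * max |B| 1 * |Cm| + |Cm| := by positivity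
      linarith
    have hq0 : 0 ≤ 4 * (1 + |B| * (1 + D ^ 2)) * (1 + 2 * (1 + D) / ρ) := by positivity
    have hBD0 : 0 ≤ |B| * D := by positivity
    refine ⟨pairConst B Cm + |B| * D + |B| + 4 * (1 + |B| * (1 + D ^ 2)) * (1 + 2 * (1 + D) / ρ),
      ?_, ?_, ?_, ?_, ?_⟩ <;> linarith
  have hC0 : 0 < C := by linarith
  have hε := hreg.ε_pos
  have hεm := hreg.εm_pos
  have hCK := hK.pos
  obtain ⟨h₀, hh₀pos, hh₁, hh₂, hh₃⟩ : ∃ h₀ : ℝ, 0 < h₀ ∧ h₀ ≤ 1 ∧ h₀ ≤ 1 / 2 * (ρ ^ 2 / CK) ∧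
      h₀ ≤ εm * ε / 2 / (C ^ 2 + εm * ε) * (ρ ^ 2 / CK) :=
    ⟨min 1 (min (1 / 2 * (ρ ^ 2 / CK)) (εm * ε / 2 / (C ^ 2 + εm * ε) * (ρ ^ 2 / CK))),
      by positivity, min_le_left _ _, (min_le_right _ _).trans (min_le_left _ _),
      (min_le_right _ _).trans (min_le_right _ _)⟩
  have hQ0 : 0 ≤ CK / ρ := by positivity
  have hL0 : 0 ≤ 2 * C ^ 2 + CK / ρ * C := by positivity
  refine ⟨ε / 2 * (εm * ε / 2), by positivity,
    2 * (C * (C * C + C * C * D + C ^ 2 + CK / ρ * C) + C * (2 * C ^ 2 + CK / ρ * C) +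
      C * (C + C * D)), by positivity, h₀, hh₀pos, ?_⟩
  intro j θ ν l Δ a b h c hΔ hh hhh₀ hc hpath hν
  rw [← hD] at hΔ
  have hP : ∀ s, |s| < 2 * c →
      PairBounds (mbar j (θ + s • Δ) (lead j (l + s • a))) (f (θ + s • Δ)) Xε ε C := fun s hs =>
    (hreg.pairBounds hset hX ((hpath s hs).1 (Metric.mem_ball_self hρ)) (hpath s hs).2 j).mono
      hpC
  have hmemN : ∀ s, |s| < 2 * c → θ + s • Δ ∈ N := fun s hs =>
    (hpath s hs).1 (Metric.mem_ball_self hρ)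
  have hc2 : |c| < 2 * c := by rw [abs_of_pos hc]; linarith
  have hc2' : |-c| < 2 * c := by rw [abs_neg]; exact hc2
  have hsm : ∀ {t : ℝ}, 0 < t → h ≤ t * (ρ ^ 2 / CK) → CK / ρ ^ 2 * h ^ 2 ≤ t := fun {t} ht hle => by
    have h1 : h ≤ 1 := hhh₀.trans hh₁
    calc CK / ρ ^ 2 * h ^ 2 ≤ CK / ρ ^ 2 * h := by gcongr; nlinarith
      _ ≤ CK / ρ ^ 2 * (t * (ρ ^ 2 / CK)) := by gcongr
      _ = t := by field_simp
  have hs1 : CK / ρ ^ 2 * h ^ 2 ≤ 1 / 2 :=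
    hsm (by norm_num) (hhh₀.trans hh₂)
  have hs2 : (C ^ 2 + εm * ε) * (CK / ρ ^ 2 * h ^ 2) ≤ εm * ε / 2 := by
    have := hsm (t := εm * ε / 2 / (C ^ 2 + εm * ε)) (by positivity)
      (hhh₀.trans hh₃)
    rwa [le_div_iff₀ (by positivity), mul_comm] at this
  obtain ⟨Sa, hSa⟩ : ∃ S, S = ∑ i ∈ Finset.univ.filter (· < j), |a i| := ⟨_, rfl⟩
  have hSa0 : 0 ≤ Sa := by rw [hSa]; exact Finset.sum_nonneg fun i _ => abs_nonneg _
  rw [← hSa]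
  obtain ⟨bb, hbb⟩ : ∃ b, b = |B| * (‖Δ‖ + Sa) := ⟨_, rfl⟩
  have hbb0 : 0 ≤ bb := by rw [hbb]; positivity
  have hdθ : ∀ s : ℝ, HasDerivAt (fun t : ℝ => θ + t • Δ) Δ s := fun s => by
    simpa using ((hasDerivAt_id' s).smul_const Δ).const_add θ
  have hdl : ∀ s : ℝ, HasDerivAt (fun t : ℝ => l + t • a) a s := fun s => by
    simpa using ((hasDerivAt_id' s).smul_const a).const_add l
  have hνp : Metric.ball (ν + c * b) ρ ⊆ Xε := hν c (by rw [abs_of_pos hc])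
  have hνm : Metric.ball (ν + (-c) * b) ρ ⊆ Xε := hν (-c) (by rw [abs_neg, abs_of_pos hc])
  -- the change of the parameters `θ`, `λ`
  have hT1 := mul_kern_mf_sub_le (K := K) (U := Xε) (CK := CK) (ε := ε) (εm := εm) (C := C) (h := h)
    (ν := ν + c * b) (ρ := ρ) (a := a j) (b := bb) (R := 2 * c) (κ := c)
    (m := fun s x => mbar j (θ + s • Δ) (lead j (l + s • a)) x) (f := fun s x => f (θ + s • Δ) x)
    (m' := fun s x => fderiv ℝ (fun z : Vec d × Vec p => mbar j z.1 (lead j z.2) x)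
      (θ + s • Δ, l + s • a) (Δ, a))
    (f' := fun s x => fderiv ℝ (fun θ => f θ x) (θ + s • Δ) Δ)
    hP hK hh hρ hνp hεm hbb0 hc.le (by linarith)
    (fun s hs x => by
      have h1 := (hreg.m_smooth_θlam j x).hasFDerivAt (hN.prod hΛ)
        (x := (θ + s • Δ, l + s • a)) ⟨hmemN s hs, (hpath s hs).2⟩
      exact h1.comp_hasDerivAt s ((hdθ s).prodMk (hdl s)))
    (fun s hs x => by
      have h1 := (hreg.f_smooth_θ x).hasFDerivAt hN (hmemN s hs)
      exact h1.comp_hasDerivAt s (hdθ s))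
    (fun s hs x => by
      refine ((fderiv ℝ (fun θ => f θ x) (θ + s • Δ)).le_opNorm Δ).trans (le_trans ?_ hBD)
      have := ((hreg.f_smooth_θ x).norm_fderiv_le (hmemN s hs)).trans (le_abs_self B)
      gcongr)
    (fun s hs x => by
      refine ((hreg.f_smooth_θ x).sq_fderiv_le hN hNc (fun θ => hset.f_nonneg θ x) hρ
        (hpath s hs).1 (v := Δ)).trans (mul_le_mul_of_nonneg_right ?_ (hset.f_nonneg _ x))
      have : 4 * (1 + |B| * (1 + ‖Δ‖ ^ 2)) * (1 + 2 * (1 + ‖Δ‖) / ρ) ≤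
          4 * (1 + |B| * (1 + D ^ 2)) * (1 + 2 * (1 + D) / ρ) := by gcongr
      exact this.trans hqC)
    (fun s hs x => by
      obtain ⟨e, e1, e2, -, e4⟩ :=
        hreg.fderiv_mbar_apply hN hΛ j x (hmemN s hs) (hpath s hs).2 Δ a
      rw [← hSa] at e4
      have hB0' : B ≤ |B| := le_abs_self B
      have e5 := e4.trans (mul_le_mul_of_nonneg_right hB0' (add_nonneg (norm_nonneg Δ) hSa0))
      rw [← hbb] at e5
      have e6 : |a j * e j| ≤ C * |a j| := by
        rw [abs_mul, mul_comm]
        gcongr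
        exact (abs_le.2 ⟨e2, e1⟩).trans (hB0'.trans hBC)
      have e7 := abs_sub_abs_le_abs_sub
        (fderiv ℝ (fun z : Vec d × Vec p => mbar j z.1 (lead j z.2) x)
          (θ + s • Δ, l + s • a) (Δ, a)) (a j * e j)
      linarith)
    (fun s hs x hx => by
      obtain ⟨e, -, -, e3, e4⟩ :=
        hreg.fderiv_mbar_apply hN hΛ j x (hmemN s hs) (hpath s hs).2 Δ a
      rw [← hSa] at e4
      have e5 := e4.trans (mul_le_mul_of_nonneg_right (le_abs_self B)
        (add_nonneg (norm_nonneg Δ) hSa0))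
      rw [← hbb] at e5
      set m' := fderiv ℝ (fun z : Vec d × Vec p => mbar j z.1 (lead j z.2) x)
          (θ + s • Δ, l + s • a) (Δ, a)
      have e6 : a j * (m' - a j * e j) ≤ |a j| * bb := by
        refine (le_abs_self _).trans ?_
        rw [abs_mul]
        gcongr
      have e7 := mul_le_mul_of_nonneg_left (e3 hx) (sq_nonneg (a j))
      nlinarith)
    hs2
  -- the change of the argument `ν`
  have hPm := hP (-c) hc2'
  have hPp := hP c hc2
  have hseg : Convex ℝ (segment ℝ (ν + (-c) * b) (ν + c * b)) := convex_segment _ _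
  have hsegU : ∀ z ∈ segment ℝ (ν + (-c) * b) (ν + c * b), Metric.ball z ρ ⊆ Xε := by
    intro z hz
    obtain ⟨s, hs, rfl⟩ := exists_eq_add_mul_of_mem_segment hc.le hz
    exact hν s hs
  have hT2 := hPm.abs_kern_mf_sub_kern_mf_le hK hh hρ hseg hsegU
    (right_mem_segment ℝ (ν + (-c) * b) (ν + c * b)) (left_mem_segment ℝ (ν + (-c) * b) (ν + c * b))
  have hT3 := hPm.abs_kern_f_sub_kern_f_le hK hh (ν + c * b) (ν + (-c) * b)
  have hT4 : |(∫ x, kern K h (ν + c * b) x * f (θ + c • Δ) x) -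
      ∫ x, kern K h (ν + c * b) x * f (θ + (-c) • Δ) x| ≤ |B| * (2 * c * ‖Δ‖) := by
    rw [← integral_sub (hPp.integrable_kern_f hK hh) (hPm.integrable_kern_f hK hh)]
    simp_rw [← mul_sub]
    refine hK.integral_kern_mul_le hh fun x => ?_
    have h1 := (hreg.f_smooth_θ x).abs_sub_le hN hNc (hmemN _ hc2') (hmemN _ hc2)
    have h2 : θ + c • Δ - (θ + (-c) • Δ) = (2 * c) • Δ := by module
    rw [h2, norm_smul, Real.norm_eq_abs, abs_of_pos (by linarith : 0 < 2 * c)] at h1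
    exact h1.trans (mul_le_mul_of_nonneg_right (le_abs_self B) (by positivity))
  have hν2 : |ν + c * b - (ν + (-c) * b)| = 2 * c * |b| := by
    rw [show ν + c * b - (ν + (-c) * b) = 2 * c * b by ring, abs_mul,
      abs_of_pos (by linarith : 0 < 2 * c)]
  rw [hν2] at hT2 hT3
  have hbb' : bb ≤ C * D + C * Sa := by
    rw [hbb, mul_add]; gcongr
  have hT4' : |B| * (2 * c * ‖Δ‖) ≤ C * (2 * c * D) := by gcongr
  exact mean_drift_combine hC0 hc hε hεm hQ0 hL0 hD0 hSa0 hbb0 hbb'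
    (hPm.le_kern_f hK hh hρ hνm hs1) ((le_abs_self _).trans (hPm.abs_kern_f_le hK hh))
    (hPm.abs_kern_mf_le hK hh) hT1 hT2 hT3 (hT4.trans hT4')

end KBSA

/-! ### The projection and the gradient estimate -/

namespace KBSA

section Projection

variable {d : ℕ} {C : Set (Vec d)}

theorem proj_spec (hC : Convex ℝ C) (hc : IsClosed C) (hne : C.Nonempty) (x : Vec d) :
    proj C x ∈ C ∧ ∀ z ∈ C, inner ℝ (x - proj C x) (z - proj C x) ≤ 0 := by
  have hex : ∃ y ∈ C, ∀ z ∈ C, ‖x - y‖ ≤ ‖x - z‖ := by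
    obtain ⟨y, hy, hy'⟩ := hc.exists_infDist_eq_dist hne x
    refine ⟨y, hy, fun z hz => ?_⟩
    rw [← dist_eq_norm, ← dist_eq_norm, ← hy']
    exact Metric.infDist_le_dist_of_mem hz
  have hp : proj C x = hex.choose := by rw [proj, dif_pos hex]
  obtain ⟨h1, h2⟩ := hex.choose_spec
  rw [← hp] at h1 h2
  refine ⟨h1, (norm_eq_iInf_iff_real_inner_le_zero hC h1).1 ?_⟩
  have : Nonempty C := ⟨⟨_, h1⟩⟩
  refine le_antisymm (le_ciInf fun w => h2 w w.2) ?_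
  exact ciInf_le ⟨0, by rintro _ ⟨w, rfl⟩; exact norm_nonneg _⟩ (⟨_, h1⟩ : C)

theorem norm_proj_sub_proj_le (hC : Convex ℝ C) (hc : IsClosed C) (hne : C.Nonempty)
    (x y : Vec d) : ‖proj C x - proj C y‖ ≤ ‖x - y‖ := by
  obtain ⟨hx, hx'⟩ := proj_spec hC hc hne x
  obtain ⟨hy, hy'⟩ := proj_spec hC hc hne y
  have h1 := hx' _ hy
  have h2 := hy' _ hx
  have h3 : ‖proj C x - proj C y‖ ^ 2 ≤ inner ℝ (x - y) (proj C x - proj C y) := by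
    rw [← real_inner_self_eq_norm_sq]
    have e : inner ℝ (x - y) (proj C x - proj C y) - inner ℝ (proj C x - proj C y)
        (proj C x - proj C y) = -inner ℝ (x - proj C x) (proj C y - proj C x) -
          inner ℝ (y - proj C y) (proj C x - proj C y) := by
      simp only [inner_sub_left, inner_sub_right]
      ring
    linarith
  have h4 := real_inner_le_norm (x - y) (proj C x - proj C y)
  rcases (norm_nonneg (proj C x - proj C y)).eq_or_lt with h0 | h0
  · rw [← h0]; exact norm_nonneg _
  · nlinarith

theorem continuous_proj (hC : Convex ℝ C) (hc : IsClosed C) (hne : C.Nonempty) :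
    Continuous (proj C) :=
  (LipschitzWith.of_dist_le_mul (K := 1) fun x y => by
    simpa [dist_eq_norm] using norm_proj_sub_proj_le hC hc hne x y).continuous

theorem proj_eq_self (hC : Convex ℝ C) (hc : IsClosed C) {x : Vec d} (hx : x ∈ C) :
    proj C x = x := by
  have h := (proj_spec hC hc ⟨x, hx⟩ x).2 x hx
  rw [real_inner_self_eq_norm_sq] at h
  have : ‖x - proj C x‖ = 0 := by nlinarith [norm_nonneg (x - proj C x)]
  exact (sub_eq_zero.1 (norm_eq_zero.1 this)).symm

end Projection

section Gradient

variable {d p : ℕ} {g : Vec d → Vec p → ℝ}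

theorem gradient_eq_of_contDiff (hg : ContDiff ℝ 1 (fun z : Vec d × Vec p => g z.1 z.2))
    (θ : Vec d) (l : Vec p) :
    gradient (fun θ => g θ l) θ = (InnerProductSpace.toDual ℝ (Vec d)).symm
      ((fderiv ℝ (fun z : Vec d × Vec p => g z.1 z.2) (θ, l)).comp
        (ContinuousLinearMap.inl ℝ (Vec d) (Vec p))) := by
  have h1 : HasFDerivAt (fun z : Vec d × Vec p => g z.1 z.2)
      (fderiv ℝ (fun z : Vec d × Vec p => g z.1 z.2) (θ, l)) (θ, l) :=
    (hg.differentiable (by norm_num) _).hasFDerivAt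
  have h2 : HasFDerivAt (fun θ => g θ l)
      ((fderiv ℝ (fun z : Vec d × Vec p => g z.1 z.2) (θ, l)).comp
        (ContinuousLinearMap.inl ℝ (Vec d) (Vec p))) θ :=
    h1.comp (f := fun e : Vec d => (e, l)) θ (hasFDerivAt_prodMk_left θ l)
  rw [gradient, h2.fderiv]

theorem dgLam_eq_of_contDiff (hg : ContDiff ℝ 1 (fun z : Vec d × Vec p => g z.1 z.2))
    (θ : Vec d) (l : Vec p) (j : Fin p) :
    dgLam g θ l j = fderiv ℝ (fun z : Vec d × Vec p => g z.1 z.2) (θ, l)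
      (0, EuclideanSpace.single j 1) := by
  have h1 : HasFDerivAt (fun z : Vec d × Vec p => g z.1 z.2)
      (fderiv ℝ (fun z : Vec d × Vec p => g z.1 z.2) (θ, l)) (θ, l) :=
    (hg.differentiable (by norm_num) _).hasFDerivAt
  have h2 : HasFDerivAt (fun l' => g θ l') _ l := h1.comp l (hasFDerivAt_prodMk_right θ l)
  rw [dgLam, h2.fderiv]
  simp

theorem norm_gradEst_le (hg : ContDiff ℝ 1 (fun z : Vec d × Vec p => g z.1 z.2)) {B : ℝ}
    (hB : ∀ z, ‖fderiv ℝ (fun z : Vec d × Vec p => g z.1 z.2) z‖ ≤ B) (s : Iterate d p) :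
    ‖gradEst g s‖ ≤ B * (1 + ∑ j, ‖s.G j‖) := by
  have hB0 : 0 ≤ B := (norm_nonneg _).trans (hB 0)
  rw [gradEst, mul_add, mul_one, Finset.mul_sum]
  refine (norm_add_le _ _).trans (add_le_add ?_ ((norm_sum_le _ _).trans
    (Finset.sum_le_sum fun j _ => ?_)))
  · rw [gradient_eq_of_contDiff hg, LinearIsometryEquiv.norm_map]
    refine (ContinuousLinearMap.opNorm_comp_le _ _).trans ?_
    have := mul_le_mul (hB (s.θ, s.lam)) (ContinuousLinearMap.norm_inl_le_one ℝ (Vec d) (Vec p))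
      (norm_nonneg _) hB0
    simpa using this
  · rw [norm_smul, Real.norm_eq_abs]
    gcongr
    rw [dgLam_eq_of_contDiff hg]
    refine ((fderiv ℝ (fun z : Vec d × Vec p => g z.1 z.2) (s.θ, s.lam)).le_opNorm _).trans ?_
    have : ‖((0 : Vec d), (EuclideanSpace.single j 1 : Vec p))‖ = 1 := by
      rw [Prod.norm_mk]; simp
    rw [this, mul_one]
    exact hB _

theorem continuous_gradient (hg : ContDiff ℝ 1 (fun z : Vec d × Vec p => g z.1 z.2)) :
    Continuous (fun z : Vec d × Vec p => gradient (fun θ => g θ z.2) z.1) := by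
  simp_rw [gradient_eq_of_contDiff hg]
  have := hg.continuous_fderiv (by norm_num)
  fun_prop

theorem continuous_dgLam (hg : ContDiff ℝ 1 (fun z : Vec d × Vec p => g z.1 z.2)) (j : Fin p) :
    Continuous (fun z : Vec d × Vec p => dgLam g z.1 z.2 j) := by
  simp_rw [dgLam_eq_of_contDiff hg]
  have := hg.continuous_fderiv (by norm_num)
  fun_prop

end Gradient

/-! ### Measurability of the algorithm -/

section Measurability

variable {d p : ℕ} {Ξ Ω : Type*} [MeasurableSpace Ξ] [MeasurableSpace Ω]

/-- The components of an iterate. -/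
def Iterate.toTuple (s : Iterate d p) : ℝ × Vec p × Vec d × (Fin p → Vec d) × Vec d :=
  (s.nu, s.lam, s.Gnu, s.G, s.θ)

/-- The σ-algebra generated by the components of an iterate. -/
instance : MeasurableSpace (Iterate d p) := MeasurableSpace.comap Iterate.toTuple inferInstance

theorem Iterate.measurable_toTuple : Measurable (Iterate.toTuple : Iterate d p → _) :=
  comap_measurable _

@[fun_prop]
theorem Iterate.measurable_nu : Measurable (Iterate.nu : Iterate d p → ℝ) :=
  measurable_fst.comp Iterate.measurable_toTuple

@[fun_prop]
theorem Iterate.measurable_lam : Measurable (Iterate.lam : Iterate d p → Vec p) :=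
  (measurable_fst.comp measurable_snd).comp Iterate.measurable_toTuple

@[fun_prop]
theorem Iterate.measurable_Gnu : Measurable (Iterate.Gnu : Iterate d p → Vec d) :=
  (measurable_fst.comp (measurable_snd.comp measurable_snd)).comp Iterate.measurable_toTuple

@[fun_prop]
theorem Iterate.measurable_G : Measurable (Iterate.G : Iterate d p → Fin p → Vec d) :=
  (measurable_fst.comp (measurable_snd.comp (measurable_snd.comp measurable_snd))).comp
    Iterate.measurable_toTuple

@[fun_prop]
theorem Iterate.measurable_θ : Measurable (Iterate.θ : Iterate d p → Vec d) :=
  (measurable_snd.comp (measurable_snd.comp (measurable_snd.comp measurable_snd))).comp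
    Iterate.measurable_toTuple

variable {α : Type*} [MeasurableSpace α] {s : α → Iterate d p} {Δ : α → Vec d}

theorem Iterate.measurable_iff : Measurable s ↔ Measurable (fun a => (s a).nu) ∧
    Measurable (fun a => (s a).lam) ∧ Measurable (fun a => (s a).Gnu) ∧
    Measurable (fun a => (s a).G) ∧ Measurable (fun a => (s a).θ) := by
  refine ⟨fun h => ⟨by fun_prop, by fun_prop, by fun_prop, by fun_prop, by fun_prop⟩,
    fun ⟨h1, h2, h3, h4, h5⟩ => measurable_comap_iff.2 ?_⟩
  exact h1.prodMk (h2.prodMk (h3.prodMk (h4.prodMk h5)))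

theorem measurable_toLp {n : ℕ} {u : α → Fin n → ℝ} (hu : ∀ i, Measurable (fun a => u a i)) :
    Measurable (fun a => (WithLp.toLp 2 (u a) : Vec n)) :=
  (WithLp.measurable_toLp 2 (Fin n → ℝ)).comp (measurable_pi_iff.2 hu)

theorem measurable_coord {n : ℕ} {u : α → Vec n} (hu : Measurable u) (i : Fin n) :
    Measurable (fun a => u a i) :=
  ((continuous_apply i).comp (PiLp.continuous_ofLp 2 _)).measurable.comp hu

theorem measurable_lead {l : α → Vec p} (hl : Measurable l) (j : Fin p) :
    Measurable (fun a => lead j (l a)) :=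
  measurable_pi_iff.2 fun _ => measurable_coord hl _

theorem measurable_cbar (hs : Measurable s) (c : ℝ) : Measurable (fun a => cbar c (s a)) := by
  unfold cbar
  have h : Measurable (fun a => ⨆ j : Fin p, ‖(s a).G j‖ / √(d : ℝ)) :=
    Measurable.iSup fun j => by fun_prop
  fun_prop

theorem measurable_pertθ (hs : Measurable s) (hΔ : Measurable Δ) (σ c : ℝ) :
    Measurable (fun a => pertθ σ c (Δ a) (s a)) := by
  unfold pertθ
  have := measurable_cbar hs c
  fun_prop

theorem measurable_pertNu (hs : Measurable s) (hΔ : Measurable Δ) (σ c : ℝ) :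
    Measurable (fun a => pertNu σ c (Δ a) (s a)) := by
  unfold pertNu
  have := measurable_cbar hs c
  fun_prop

theorem measurable_pertLam (hs : Measurable s) (hΔ : Measurable Δ) (σ c : ℝ) :
    Measurable (fun a => pertLam σ c (Δ a) (s a)) := by
  unfold pertLam
  have := measurable_cbar hs c
  refine measurable_toLp fun j => ?_
  have h1 := measurable_coord (Iterate.measurable_lam.comp hs) j
  simp only [Function.comp_apply] at h1
  have h2 : Measurable (fun a => (s a).G j) := by fun_prop
  fun_prop

theorem measurable_spQuot {z : α → ℝ} (hz : Measurable z) (hs : Measurable s) (hΔ : Measurable Δ)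
    (c : ℝ) : Measurable (fun a => spQuot (z a) c (Δ a) (s a)) := by
  unfold spQuot
  have := measurable_cbar hs c
  refine measurable_toLp fun i => ?_
  have h1 := measurable_coord hΔ i
  fun_prop

theorem measurable_gradEst {g : Vec d → Vec p → ℝ}
    (hg : ContDiff ℝ 1 (fun z : Vec d × Vec p => g z.1 z.2)) (hs : Measurable s) :
    Measurable (fun a => gradEst g (s a)) := by
  unfold gradEst
  have h1 : Measurable (fun a => gradient (fun θ => g θ (s a).lam) (s a).θ) :=
    (continuous_gradient hg).measurable.comp
      ((Iterate.measurable_θ.comp hs).prodMk (Iterate.measurable_lam.comp hs))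
  have h2 : ∀ j, Measurable (fun a => dgLam g (s a).θ (s a).lam j) := fun j =>
    (continuous_dgLam hg j).measurable.comp
      ((Iterate.measurable_θ.comp hs).prodMk (Iterate.measurable_lam.comp hs))
  have h3 : ∀ j, Measurable (fun a => (s a).G j) := fun j => by fun_prop
  refine h1.add (Finset.measurable_fun_sum _ fun j _ => (h2 j).smul (h3 j))

variable {μ : Measure Ξ} [IsProbabilityMeasure μ] {M : Problem d p Ξ} {f : Vec d → ℝ → ℝ}
  {mbar : (j : Fin p) → Vec d → (Fin ((j : ℕ) + 1) → ℝ) → ℝ → ℝ}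
  {nu : Vec d → ℝ} {lam : Vec d → Vec p}

theorem Setting.measurable_X_comp (hset : Setting M μ f mbar nu lam) {θ : α → Vec d} {ξ : α → Ξ}
    (hθ : Measurable θ) (hξ : Measurable ξ) : Measurable (fun a => M.X (θ a) (ξ a)) :=
  hset.measurable_X.comp (hθ.prodMk hξ)

theorem Setting.measurable_Y_comp (hset : Setting M μ f mbar nu lam) {θ : α → Vec d} {ξ : α → Ξ}
    (hθ : Measurable θ) (hξ : Measurable ξ) : Measurable (fun a => M.Y (θ a) (ξ a)) :=
  hset.measurable_Y.comp (hθ.prodMk hξ)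

theorem Setting.measurable_q_comp (hset : Setting M μ f mbar nu lam) {θ : α → Vec d} {ξ : α → Ξ}
    {ν : α → ℝ} (hθ : Measurable θ) (hξ : Measurable ξ) (hν : Measurable ν) :
    Measurable (fun a => M.q (θ a) (M.X (θ a) (ξ a)) (ν a)) :=
  hset.measurable_q.comp (hθ.prodMk ((hset.measurable_X_comp hθ hξ).prodMk hν))

theorem Setting.measurable_m_comp (hset : Setting M μ f mbar nu lam) (j : Fin p) {θ : α → Vec d}
    {ξ : α → Ξ} {l : α → Vec p} (hθ : Measurable θ) (hξ : Measurable ξ) (hl : Measurable l) :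
    Measurable (fun a => M.m j (θ a) (M.Y (θ a) (ξ a)) (lead j (l a))) :=
  (hset.measurable_m j).comp
    (hθ.prodMk ((hset.measurable_Y_comp hθ hξ).prodMk (measurable_lead hl j)))

theorem measurable_kern {K : ℝ → ℝ} (hK : Continuous K) (h : ℝ) {ν x : α → ℝ} (hν : Measurable ν)
    (hx : Measurable x) : Measurable (fun a => kern K h (ν a) (x a)) := by
  unfold kern
  have := hK.measurable
  fun_prop

theorem Setting.measurable_step (hset : Setting M μ f mbar nu lam) (hΘ : M.Θ.Nonempty)
    (hg : ContDiff ℝ 1 (fun z : Vec d × Vec p => M.g z.1 z.2)) {K : ℝ → ℝ} (hK : Continuous K)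
    (a b c h : ℝ) {ξ ξp ξm : α → Ξ} (hs : Measurable s) (hξ : Measurable ξ)
    (hξp : Measurable ξp) (hξm : Measurable ξm) (hΔ : Measurable Δ) :
    Measurable (fun x => step M K a b c h (ξ x) (ξp x) (ξm x) (Δ x) (s x)) := by
  have hθ : Measurable (fun x => (s x).θ) := by fun_prop
  have hν : Measurable (fun x => (s x).nu) := by fun_prop
  have hl : Measurable (fun x => (s x).lam) := by fun_prop
  have hGν : Measurable (fun x => (s x).Gnu) := by fun_prop
  have hG : ∀ j, Measurable (fun x => (s x).G j) := fun j => by fun_prop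
  have hθp := measurable_pertθ hs hΔ 1 c
  have hθm := measurable_pertθ hs hΔ (-1) c
  have hνp := measurable_pertNu hs hΔ 1 c
  have hνm := measurable_pertNu hs hΔ (-1) c
  have hlp := measurable_pertLam hs hΔ 1 c
  have hlm := measurable_pertLam hs hΔ (-1) c
  rw [Iterate.measurable_iff]
  refine ⟨?_, ?_, ?_, ?_, ?_⟩
  · exact hν.add ((hset.measurable_q_comp hθ hξ hν).const_mul b)
  · exact measurable_toLp fun j => (measurable_coord hl j).add
      (((hset.measurable_m_comp j hθ hξ hl).mul
        (measurable_kern hK h hν (hset.measurable_X_comp hθ hξ))).const_mul b)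
  · exact hGν.add ((measurable_spQuot ((hset.measurable_q_comp hθp hξp hνp).sub
      (hset.measurable_q_comp hθm hξm hνm)) hs hΔ c).const_smul b)
  · exact measurable_pi_iff.2 fun j => (hG j).add ((measurable_spQuot
      ((((hset.measurable_m_comp j hθp hξp hlp).sub (hset.measurable_m_comp j hθm hξm hlm)).mul
        (measurable_kern hK h hνp (hset.measurable_X_comp hθp hξp))).mul
        (measurable_kern hK h hνm (hset.measurable_X_comp hθm hξm))) hs hΔ c).const_smul b)
  · exact (continuous_proj hset.convex_Θ hset.compact_Θ.isClosed hΘ).measurable.comp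
      (hθ.sub ((measurable_gradEst hg hs).const_smul a))

end Measurability

/-! ### Independence of the steps -/

section Independence

variable {d p : ℕ} {Ξ Ω : Type*} [MeasurableSpace Ξ] [MeasurableSpace Ω]
  {μ : Measure Ξ} [IsProbabilityMeasure μ] {P : Measure Ω} [IsProbabilityMeasure P]
  {M : Problem d p Ξ} {I : Input d p} {W : Noise d Ξ Ω} {f : Vec d → ℝ → ℝ}
  {mbar : (j : Fin p) → Vec d → (Fin ((j : ℕ) + 1) → ℝ) → ℝ → ℝ}
  {nu : Vec d → ℝ} {lam : Vec d → Vec p}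

/-- The randomness that drives the step from `n` to `n + 1`. -/
def stepNoise (W : Noise d Ξ Ω) (n : ℕ) (ω : Ω) : (Ξ × Ξ × Ξ) × Vec d :=
  ((W.ξ n ω, W.ξp n ω, W.ξm n ω), W.Δ (n + 1) ω)

/-- One step of the algorithm as a function of the current iterate and the randomness. -/
noncomputable def stepWith (M : Problem d p Ξ) (I : Input d p) (n : ℕ) (s : Iterate d p)
    (e : (Ξ × Ξ × Ξ) × Vec d) : Iterate d p :=
  step M I.K (I.α (n + 1)) (I.β (n + 1)) (I.c (n + 1)) (I.h (n + 1)) e.1.1 e.1.2.1 e.1.2.2 e.2 s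

theorem iter_succ (n : ℕ) (ω : Ω) :
    iter M I W (n + 1) ω = stepWith M I n (iter M I W n ω) (stepNoise W n ω) := rfl

theorem IsSampling.measurable_stepNoise (hW : IsSampling μ P W) (n : ℕ) :
    Measurable (stepNoise W n) :=
  ((hW.measurable_ξ n).prodMk ((hW.measurable_ξp n).prodMk (hW.measurable_ξm n))).prodMk
    (hW.measurable_Δ (n + 1))

theorem IsSampling.map_stepNoise (hW : IsSampling μ P W) (n : ℕ) :
    P.map (stepNoise W n) = (μ.prod (μ.prod μ)).prod (P.map (W.Δ (n + 1))) := by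
  rw [← hW.law n]
  exact (hW.indep_Δ n).map_prod_eq_prod_map_map
    ((hW.measurable_ξ n).prodMk ((hW.measurable_ξp n).prodMk (hW.measurable_ξm n))).aemeasurable
    (hW.measurable_Δ (n + 1)).aemeasurable

theorem Setting.measurable_stepWith (hset : Setting M μ f mbar nu lam) (hΘ : M.Θ.Nonempty)
    (hg : ContDiff ℝ 1 (fun z : Vec d × Vec p => M.g z.1 z.2)) (hK : Continuous I.K) (n : ℕ) :
    Measurable (fun z : Iterate d p × ((Ξ × Ξ × Ξ) × Vec d) => stepWith M I n z.1 z.2) :=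
  hset.measurable_step hΘ hg hK _ _ _ _ (by fun_prop) (by fun_prop) (by fun_prop) (by fun_prop)
    (by fun_prop)

/-- The iterate is a function of the randomness of the earlier steps. -/
theorem Setting.exists_iter_eq (hset : Setting M μ f mbar nu lam) (hΘ : M.Θ.Nonempty)
    (hg : ContDiff ℝ 1 (fun z : Vec d × Vec p => M.g z.1 z.2)) (hK : Continuous I.K) (n : ℕ) :
    ∃ Φ : ((i : Finset.range n) → (Ξ × Ξ × Ξ) × Vec d) → Iterate d p, Measurable Φ ∧
      ∀ ω, iter M I W n ω = Φ (fun i => stepNoise W i ω) := by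
  induction n with
  | zero => exact ⟨fun _ => I.init, measurable_const, fun _ => rfl⟩
  | succ n ih =>
    obtain ⟨Φ, hΦ, hΦ'⟩ := ih
    refine ⟨fun v => stepWith M I n
      (Φ fun i => v ⟨i, Finset.mem_range.2 ((Finset.mem_range.1 i.2).trans n.lt_succ_self)⟩)
      (v ⟨n, Finset.self_mem_range_succ n⟩), ?_, fun ω => ?_⟩
    · exact (hset.measurable_stepWith hΘ hg hK n).comp
        ((hΦ.comp (measurable_pi_iff.2 fun i => measurable_pi_apply _)).prodMk
          (measurable_pi_apply _))
    · rw [iter_succ, hΦ' ω]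

theorem Setting.measurable_iter (hset : Setting M μ f mbar nu lam) (hΘ : M.Θ.Nonempty)
    (hg : ContDiff ℝ 1 (fun z : Vec d × Vec p => M.g z.1 z.2)) (hK : Continuous I.K)
    (hW : IsSampling μ P W) (n : ℕ) : Measurable (iter M I W n) := by
  obtain ⟨Φ, hΦ, hΦ'⟩ := hset.exists_iter_eq (W := W) hΘ hg hK n
  rw [funext hΦ']
  exact hΦ.comp (measurable_pi_iff.2 fun i => hW.measurable_stepNoise i)

theorem Setting.indepFun_iter (hset : Setting M μ f mbar nu lam) (hΘ : M.Θ.Nonempty)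
    (hg : ContDiff ℝ 1 (fun z : Vec d × Vec p => M.g z.1 z.2)) (hK : Continuous I.K)
    (hW : IsSampling μ P W) (n : ℕ) : IndepFun (iter M I W n) (stepNoise W n) P := by
  obtain ⟨Φ, hΦ, hΦ'⟩ := hset.exists_iter_eq (W := W) hΘ hg hK n
  have hind : iIndepFun (stepNoise W) P := hW.indep_steps
  have h1 := hind.indepFun_finset (Finset.range n) {n} (by simp) hW.measurable_stepNoise
  have h2 := h1.comp hΦ
    (measurable_pi_apply (⟨n, Finset.mem_singleton_self n⟩ : ({n} : Finset ℕ)))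
  rw [funext hΦ']
  exact h2

/-- The law of the iterate together with the randomness of the next step is a product. -/
theorem Setting.map_iter_stepNoise (hset : Setting M μ f mbar nu lam) (hΘ : M.Θ.Nonempty)
    (hg : ContDiff ℝ 1 (fun z : Vec d × Vec p => M.g z.1 z.2)) (hK : Continuous I.K)
    (hW : IsSampling μ P W) (n : ℕ) :
    P.map (fun ω => (iter M I W n ω, stepNoise W n ω)) =
      (P.map (iter M I W n)).prod ((μ.prod (μ.prod μ)).prod (P.map (W.Δ (n + 1)))) := by
  rw [← hW.map_stepNoise n]
  exact (hset.indepFun_iter hΘ hg hK hW n).map_prod_eq_prod_map_map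
    (hset.measurable_iter hΘ hg hK hW n).aemeasurable (hW.measurable_stepNoise n).aemeasurable

/-- The expectation of a function of the next iterate, by integrating out the randomness of the step
first. -/
theorem Setting.lintegral_iter_stepNoise (hset : Setting M μ f mbar nu lam) (hΘ : M.Θ.Nonempty)
    (hg : ContDiff ℝ 1 (fun z : Vec d × Vec p => M.g z.1 z.2)) (hK : Continuous I.K)
    (hW : IsSampling μ P W) (n : ℕ) {F : Iterate d p × ((Ξ × Ξ × Ξ) × Vec d) → ℝ≥0∞}
    (hF : Measurable F) :
    ∫⁻ ω, F (iter M I W n ω, stepNoise W n ω) ∂P =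
      ∫⁻ ω, ∫⁻ e, F (iter M I W n ω, e) ∂((μ.prod (μ.prod μ)).prod (P.map (W.Δ (n + 1)))) ∂P := by
  have : IsProbabilityMeasure (P.map (W.Δ (n + 1))) :=
    Measure.isProbabilityMeasure_map (hW.measurable_Δ (n + 1)).aemeasurable
  have hm := hset.measurable_iter hΘ hg hK hW n
  rw [← lintegral_map (f := F) hF (hm.prodMk (hW.measurable_stepNoise n)),
    hset.map_iter_stepNoise hΘ hg hK hW n, lintegral_prod _ hF.aemeasurable,
    lintegral_map hF.lintegral_prod_right' hm]

/-- What holds almost surely along the run holds, for almost every current iterate, for almost every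
fresh randomness. -/
theorem Setting.ae_ae_of_ae_iter_stepNoise (hset : Setting M μ f mbar nu lam) (hΘ : M.Θ.Nonempty)
    (hg : ContDiff ℝ 1 (fun z : Vec d × Vec p => M.g z.1 z.2)) (hK : Continuous I.K)
    (hW : IsSampling μ P W) (n : ℕ) {S : Set (Iterate d p × ((Ξ × Ξ × Ξ) × Vec d))}
    (hS : MeasurableSet S) (h : ∀ᵐ ω ∂P, (iter M I W n ω, stepNoise W n ω) ∈ S) :
    ∀ᵐ ω ∂P, ∀ᵐ e ∂((μ.prod (μ.prod μ)).prod (P.map (W.Δ (n + 1)))), (iter M I W n ω, e) ∈ S := by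
  have : IsProbabilityMeasure (P.map (W.Δ (n + 1))) :=
    Measure.isProbabilityMeasure_map (hW.measurable_Δ (n + 1)).aemeasurable
  have hm := hset.measurable_iter hΘ hg hK hW n
  have h1 : ∀ᵐ z ∂(P.map (fun ω => (iter M I W n ω, stepNoise W n ω))), z ∈ S :=
    (ae_map_iff (hm.prodMk (hW.measurable_stepNoise n)).aemeasurable hS).2 h
  rw [hset.map_iter_stepNoise hΘ hg hK hW n] at h1
  exact ae_of_ae_map hm.aemeasurable (Measure.ae_ae_of_ae_prod h1)

end Independence

/-! ### The random directions -/

section Directions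

variable {d : ℕ} {Ξ Ω : Type*} [MeasurableSpace Ξ] [MeasurableSpace Ω]
  {μ : Measure Ξ} [IsProbabilityMeasure μ] {P : Measure Ω} [IsProbabilityMeasure P]
  {W : Noise d Ξ Ω}

theorem DirectionAssumption.ae_sign (hD : DirectionAssumption P W) (hW : IsSampling μ P W) (n : ℕ) :
    ∀ᵐ ω ∂P, ∀ i, W.Δ (n + 1) ω i = 1 ∨ W.Δ (n + 1) ω i = -1 := by
  rw [ae_all_iff]
  intro i
  have hm : Measurable (fun ω => W.Δ (n + 1) ω i) := measurable_coord (hW.measurable_Δ (n + 1)) i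
  have h1 : MeasurableSet {ω | W.Δ (n + 1) ω i = 1} := hm (measurableSet_singleton 1)
  have h2 : MeasurableSet {ω | W.Δ (n + 1) ω i = -1} := hm (measurableSet_singleton (-1))
  have hdisj : Disjoint {ω | W.Δ (n + 1) ω i = 1} {ω | W.Δ (n + 1) ω i = -1} := by
    rw [Set.disjoint_left]
    intro ω h h'
    have e1 : W.Δ (n + 1) ω i = 1 := h
    have e2 : W.Δ (n + 1) ω i = -1 := h'
    linarith
  have h3 : P ({ω | W.Δ (n + 1) ω i = 1} ∪ {ω | W.Δ (n + 1) ω i = -1}) = 1 := by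
    rw [measure_union hdisj h2, hD.prob_one n i, hD.prob_neg_one n i]
    exact ENNReal.add_halves 1
  exact (prob_compl_eq_zero_iff (h1.union h2)).2 h3

theorem DirectionAssumption.integral_coord (hD : DirectionAssumption P W) (hW : IsSampling μ P W)
    (n : ℕ) (i : Fin d) : ∫ ω, W.Δ (n + 1) ω i ∂P = 0 := by
  have hm : Measurable (fun ω => W.Δ (n + 1) ω i) := measurable_coord (hW.measurable_Δ (n + 1)) i
  have h1 : MeasurableSet {ω | W.Δ (n + 1) ω i = 1} := hm (measurableSet_singleton 1)
  have h2 : MeasurableSet {ω | W.Δ (n + 1) ω i = -1} := hm (measurableSet_singleton (-1))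
  have h3 : ∫ ω, W.Δ (n + 1) ω i ∂P =
      ∫ ω, ({ω | W.Δ (n + 1) ω i = 1}.indicator (fun _ => (1 : ℝ)) ω -
        {ω | W.Δ (n + 1) ω i = -1}.indicator (fun _ => (1 : ℝ)) ω) ∂P := by
    refine integral_congr_ae ?_
    filter_upwards [hD.ae_sign hW n] with ω hω
    rcases hω i with h | h <;> simp [indicator, h] <;> norm_num
  rw [h3, integral_sub ((integrable_const _).indicator h1) ((integrable_const _).indicator h2),
    integral_indicator_const _ h1, integral_indicator_const _ h2, Measure.real, Measure.real,
    hD.prob_one n i, hD.prob_neg_one n i, sub_self]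

theorem inner_vec_eq_sum {n : ℕ} (x y : Vec n) : inner ℝ x y = ∑ i, y i * x i := by
  simp [PiLp.inner_apply]

/-- The components of a direction are orthonormal in `L²`. -/
theorem DirectionAssumption.integral_inner_sq (hD : DirectionAssumption P W)
    (hW : IsSampling μ P W) (n : ℕ) (G : Vec d) :
    Integrable (fun ω => inner ℝ (W.Δ (n + 1) ω) G ^ 2) P ∧
      ∫ ω, inner ℝ (W.Δ (n + 1) ω) G ^ 2 ∂P = ‖G‖ ^ 2 := by
  have hm : ∀ i, Measurable (fun ω => W.Δ (n + 1) ω i) := fun i =>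
    measurable_coord (hW.measurable_Δ (n + 1)) i
  have hsq : ∀ i, ∫ ω, W.Δ (n + 1) ω i * W.Δ (n + 1) ω i ∂P = 1 := fun i => by
    have : ∫ ω, W.Δ (n + 1) ω i * W.Δ (n + 1) ω i ∂P = ∫ _, (1 : ℝ) ∂P := by
      refine integral_congr_ae ?_
      filter_upwards [hD.ae_sign hW n] with ω hω
      rcases hω i with h | h <;> rw [h] <;> norm_num
    rw [this]; simp
  have hcross : ∀ i k, i ≠ k → ∫ ω, W.Δ (n + 1) ω i * W.Δ (n + 1) ω k ∂P = 0 := fun i k hik => by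
    have h1 := (hD.indep n).indepFun hik
    rw [h1.integral_fun_mul_eq_mul_integral (hm i).aestronglyMeasurable
      (hm k).aestronglyMeasurable, hD.integral_coord hW n i, zero_mul]
  have hi : ∀ i k, Integrable (fun ω => W.Δ (n + 1) ω i * W.Δ (n + 1) ω k) P := fun i k => by
    refine Integrable.of_bound ((hm i).mul (hm k)).aestronglyMeasurable 1 ?_
    filter_upwards [hD.ae_sign hW n] with ω hω
    rcases hω i with h | h <;> rcases hω k with h' | h' <;> rw [h, h'] <;> norm_num
  have hexp : ∀ ω, inner ℝ (W.Δ (n + 1) ω) G ^ 2 =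
      ∑ i, ∑ k, (G i * G k) * (W.Δ (n + 1) ω i * W.Δ (n + 1) ω k) := fun ω => by
    rw [inner_vec_eq_sum, sq, Finset.sum_mul_sum]
    refine Finset.sum_congr rfl fun i _ => Finset.sum_congr rfl fun k _ => ?_
    ring
  simp_rw [hexp]
  refine ⟨integrable_finsetSum _ fun i _ => integrable_finsetSum _ fun k _ =>
    (hi i k).const_mul _, ?_⟩
  rw [integral_finsetSum _ fun i _ => integrable_finsetSum _ fun k _ => (hi i k).const_mul _]
  have : ∀ i, ∫ ω, ∑ k, (G i * G k) * (W.Δ (n + 1) ω i * W.Δ (n + 1) ω k) ∂P = G i ^ 2 := fun i => by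
    rw [integral_finsetSum _ fun k _ => (hi i k).const_mul _]
    simp_rw [integral_const_mul]
    rw [Finset.sum_eq_single i (fun k _ hk => by rw [hcross i k hk.symm, mul_zero])
      (fun h => absurd (Finset.mem_univ i) h), hsq, mul_one, sq]
  simp_rw [this]
  rw [EuclideanSpace.real_norm_sq_eq]

end Directions

end KBSA

/-! ### One step of a gradient estimate -/

namespace KBSA

section Perturbation

variable {d p : ℕ}

theorem cbar_pos {c : ℝ} (hc : 0 < c) (s : Iterate d p) : 0 < cbar c s :=
  div_pos hc (lt_of_lt_of_le one_pos ((le_max_left _ _).trans (le_max_left _ _)))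

theorem cbar_le {c : ℝ} (hc : 0 < c) (s : Iterate d p) : cbar c s ≤ c :=
  div_le_self hc.le ((le_max_left _ _).trans (le_max_left _ _))

theorem bddAbove_norm_G (s : Iterate d p) :
    BddAbove (range fun j : Fin p => ‖s.G j‖ / √(d : ℝ)) := (finite_range _).bddAbove

theorem norm_eq_norm_div_sqrt_mul (x : Vec d) : ‖x‖ = ‖x‖ / √(d : ℝ) * √(d : ℝ) := by
  rcases Nat.eq_zero_or_pos d with h | h
  · subst h
    rw [Subsingleton.elim x 0]; simp
  · rw [div_mul_cancel₀]
    positivity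

theorem cbar_mul_norm_Gnu_le {c : ℝ} (hc : 0 < c) (s : Iterate d p) :
    cbar c s * ‖s.Gnu‖ ≤ c * √(d : ℝ) := by
  rw [norm_eq_norm_div_sqrt_mul s.Gnu, ← mul_assoc]
  refine mul_le_mul_of_nonneg_right ?_ (Real.sqrt_nonneg _)
  rw [cbar, div_mul_eq_mul_div, div_le_iff₀
    (lt_of_lt_of_le one_pos ((le_max_left _ _).trans (le_max_left _ _)))]
  exact mul_le_mul_of_nonneg_left ((le_max_right _ _).trans (le_max_left _ _)) hc.le

theorem cbar_mul_norm_G_le {c : ℝ} (hc : 0 < c) (s : Iterate d p) (j : Fin p) :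
    cbar c s * ‖s.G j‖ ≤ c * √(d : ℝ) := by
  rw [norm_eq_norm_div_sqrt_mul (s.G j), ← mul_assoc]
  refine mul_le_mul_of_nonneg_right ?_ (Real.sqrt_nonneg _)
  rw [cbar, div_mul_eq_mul_div, div_le_iff₀
    (lt_of_lt_of_le one_pos ((le_max_left _ _).trans (le_max_left _ _)))]
  exact mul_le_mul_of_nonneg_left ((le_ciSup (bddAbove_norm_G s) j).trans (le_max_right _ _)) hc.le

/-- `1` plus the sum of the squared norms of the gradient estimates. -/
noncomputable def gradSize (s : Iterate d p) : ℝ := 1 + ‖s.Gnu‖ ^ 2 + ∑ j, ‖s.G j‖ ^ 2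

theorem one_le_gradSize (s : Iterate d p) : 1 ≤ gradSize s := by
  have : 0 ≤ ∑ j, ‖s.G j‖ ^ 2 := Finset.sum_nonneg fun _ _ => sq_nonneg _
  unfold gradSize
  nlinarith [sq_nonneg ‖s.Gnu‖]

/-- The price of scaling `c̄` down: the variance of a difference quotient grows only linearly with the
squared size of the gradient estimates. -/
theorem one_div_cbar_sq_le {c : ℝ} (hc : 0 < c) (s : Iterate d p) :
    1 / cbar c s ^ 2 ≤ gradSize s / c ^ 2 := by
  have hdiv : ∀ x : Vec d, (‖x‖ / √(d : ℝ)) ^ 2 ≤ ‖x‖ ^ 2 := fun x => by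
    refine pow_le_pow_left₀ (by positivity) ?_ 2
    -- for `d = 0` all vectors vanish, and so does the quotient by `√d = 0`
    rcases Nat.eq_zero_or_pos d with h | h
    · subst h; simp
    · refine div_le_self (norm_nonneg _) ?_
      rw [Real.one_le_sqrt]
      exact_mod_cast h
  have hsum : 0 ≤ ∑ j, ‖s.G j‖ ^ 2 := Finset.sum_nonneg fun _ _ => sq_nonneg _
  set m := max (max 1 (‖s.Gnu‖ / √(d : ℝ))) (⨆ j : Fin p, ‖s.G j‖ / √(d : ℝ)) with hm
  have hm2 : m ^ 2 ≤ gradSize s := by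
    have h1 := hdiv s.Gnu
    rcases max_choice (max 1 (‖s.Gnu‖ / √(d : ℝ))) (⨆ j : Fin p, ‖s.G j‖ / √(d : ℝ)) with h | h
    · rw [hm, h]
      rcases max_choice 1 (‖s.Gnu‖ / √(d : ℝ)) with h' | h' <;> rw [h'] <;> unfold gradSize <;>
        nlinarith [sq_nonneg ‖s.Gnu‖]
    · rw [hm, h]
      rcases isEmpty_or_nonempty (Fin p) with h' | h'
      · rw [Real.iSup_of_isEmpty]
        have := one_le_gradSize s
        linarith [sq_nonneg ‖s.Gnu‖]
      · obtain ⟨j, hj⟩ := exists_eq_ciSup_of_finite (f := fun j : Fin p => ‖s.G j‖ / √(d : ℝ))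
        rw [← hj]
        have h2 : ‖s.G j‖ ^ 2 ≤ ∑ j, ‖s.G j‖ ^ 2 :=
          Finset.single_le_sum (f := fun j => ‖s.G j‖ ^ 2) (fun _ _ => sq_nonneg _)
            (Finset.mem_univ j)
        have := hdiv (s.G j)
        unfold gradSize
        nlinarith [sq_nonneg ‖s.Gnu‖]
  have hm0 : m ≠ 0 :=
    (lt_of_lt_of_le one_pos ((le_max_left _ _).trans (le_max_left _ _))).ne'
  have : 1 / cbar c s ^ 2 = m ^ 2 / c ^ 2 := by
    rw [cbar, ← hm]; field_simp
  rw [this]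
  gcongr

theorem norm_of_sign {Δ : Vec d} (hΔ : ∀ i, Δ i = 1 ∨ Δ i = -1) : ‖Δ‖ = √(d : ℝ) := by
  rw [EuclideanSpace.norm_eq]
  congr 1
  have : ∀ i, ‖Δ i‖ ^ 2 = 1 := fun i => by rcases hΔ i with h | h <;> rw [h] <;> norm_num
  rw [Finset.sum_congr rfl fun i _ => this i]; simp

theorem spQuot_of_sign {Δ : Vec d} (hΔ : ∀ i, Δ i = 1 ∨ Δ i = -1) (a c : ℝ) (s : Iterate d p) :
    spQuot a c Δ s = (a / (2 * cbar c s)) • Δ := by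
  ext i
  simp only [spQuot, PiLp.smul_apply, smul_eq_mul]
  rcases hΔ i with h | h
  · rw [h]; ring
  · rw [h, mul_neg_one, div_neg]; ring

end Perturbation

/-- One step `G + β (Z / (2 c)) Δ` of a gradient estimate: if, given the direction, the mean of `Z`
is contracting along `Δ`, then the second moment of `G` contracts, up to the variance of `Z`. -/
theorem lintegral_norm_sq_step_le {d : ℕ} {Ψ : Type*} [MeasurableSpace Ψ] {Q : Measure Ψ}
    [IsProbabilityMeasure Q] {D : Measure (Vec d)} [IsProbabilityMeasure D]
    (hsign : ∀ᵐ Δ ∂D, ∀ i, Δ i = 1 ∨ Δ i = -1) {G : Vec d}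
    (hi : Integrable (fun Δ => inner ℝ Δ G ^ 2) D) (hsq : ∫ Δ, inner ℝ Δ G ^ 2 ∂D = ‖G‖ ^ 2)
    {Z : Ψ × Vec d → ℝ} (hZm : Measurable Z) {β c κ b v : ℝ} (hβ : 0 < β) (hc : 0 < c)
    (hZ : ∀ᵐ Δ ∂D, MemLp (fun e => Z (e, Δ)) 2 Q ∧
      inner ℝ Δ G * ∫ e, Z (e, Δ) ∂Q ≤ 2 * c * (-κ * inner ℝ Δ G ^ 2 + b) ∧
      ∫ e, Z (e, Δ) ^ 2 ∂Q ≤ v) :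
    ∫⁻ z, ENNReal.ofReal (‖G + β • (Z z / (2 * c)) • z.2‖ ^ 2) ∂(Q.prod D) ≤
      ENNReal.ofReal ((1 - 2 * β * κ) * ‖G‖ ^ 2 + 2 * β * b + β ^ 2 * d * v / (4 * c ^ 2)) := by
  set T : Vec d → ℝ := fun Δ =>
    ‖G‖ ^ 2 + 2 * β * (-κ * inner ℝ Δ G ^ 2 + b) + β ^ 2 * d * v / (4 * c ^ 2) with hT
  have hmeas : Measurable (fun z : Ψ × Vec d =>
      ENNReal.ofReal (‖G + β • (Z z / (2 * c)) • z.2‖ ^ 2)) := by fun_prop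
  have hkey : ∀ᵐ Δ ∂D, 0 ≤ T Δ ∧
      ∫⁻ e, ENNReal.ofReal (‖G + β • (Z (e, Δ) / (2 * c)) • Δ‖ ^ 2) ∂Q ≤ ENNReal.ofReal (T Δ) := by
    filter_upwards [hsign, hZ] with Δ hΔ ⟨h1, h2, h3⟩
    have hexp : ∀ e, ‖G + β • (Z (e, Δ) / (2 * c)) • Δ‖ ^ 2 =
        ‖G‖ ^ 2 + (β * inner ℝ Δ G / c) * Z (e, Δ) + (β ^ 2 * d / (4 * c ^ 2)) * Z (e, Δ) ^ 2 :=
      fun e => by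
        rw [norm_add_sq_real, smul_smul, inner_smul_right, norm_smul, norm_of_sign hΔ,
          real_inner_comm, mul_pow, Real.sq_sqrt d.cast_nonneg, Real.norm_eq_abs, sq_abs]
        field_simp
        ring
    simp_rw [hexp]
    have i1 : Integrable (fun e => Z (e, Δ)) Q := h1.integrable (by norm_num)
    have i2 : Integrable (fun e => Z (e, Δ) ^ 2) Q := h1.integrable_sq
    have i3 : Integrable (fun e => ‖G‖ ^ 2 + (β * inner ℝ Δ G / c) * Z (e, Δ)) Q :=
      (integrable_const _).add (i1.const_mul _)
    have i4 : Integrable (fun e => ‖G‖ ^ 2 + (β * inner ℝ Δ G / c) * Z (e, Δ) +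
        (β ^ 2 * d / (4 * c ^ 2)) * Z (e, Δ) ^ 2) Q := i3.add (i2.const_mul _)
    have hint : ∫ e, (‖G‖ ^ 2 + (β * inner ℝ Δ G / c) * Z (e, Δ) +
        (β ^ 2 * d / (4 * c ^ 2)) * Z (e, Δ) ^ 2) ∂Q ≤ T Δ := by
      rw [integral_add i3 (i2.const_mul _), integral_add (integrable_const _) (i1.const_mul _),
        integral_const_mul, integral_const_mul]
      simp only [integral_const, probReal_univ, one_smul]
      have e1 : β * inner ℝ Δ G / c * ∫ e, Z (e, Δ) ∂Q ≤
          2 * β * (-κ * inner ℝ Δ G ^ 2 + b) := by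
        have : β * inner ℝ Δ G / c * ∫ e, Z (e, Δ) ∂Q =
            β / c * (inner ℝ Δ G * ∫ e, Z (e, Δ) ∂Q) := by ring
        rw [this]
        calc _ ≤ β / c * (2 * c * (-κ * inner ℝ Δ G ^ 2 + b)) := by gcongr
          _ = _ := by field_simp
      have e2 : β ^ 2 * d / (4 * c ^ 2) * ∫ e, Z (e, Δ) ^ 2 ∂Q ≤ β ^ 2 * d * v / (4 * c ^ 2) := by
        calc _ ≤ β ^ 2 * d / (4 * c ^ 2) * v := by gcongr
          _ = _ := by ring
      simp only [hT]
      linarith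
    have hnn : ∀ e, 0 ≤ ‖G‖ ^ 2 + (β * inner ℝ Δ G / c) * Z (e, Δ) +
        (β ^ 2 * d / (4 * c ^ 2)) * Z (e, Δ) ^ 2 := fun e => by rw [← hexp]; positivity
    refine ⟨(integral_nonneg hnn).trans hint, ?_⟩
    rw [← ofReal_integral_eq_lintegral_ofReal i4 (Eventually.of_forall hnn)]
    exact ENNReal.ofReal_le_ofReal hint
  have hTi : Integrable T D :=
    ((integrable_const _).add (((hi.const_mul _).add (integrable_const _)).const_mul _)).add
      (integrable_const _)
  rw [lintegral_prod_symm' _ hmeas]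
  calc _ ≤ ∫⁻ Δ, ENNReal.ofReal (T Δ) ∂D := lintegral_mono_ae (hkey.mono fun Δ h => h.2)
    _ = ENNReal.ofReal (∫ Δ, T Δ ∂D) :=
        (ofReal_integral_eq_lintegral_ofReal hTi (hkey.mono fun Δ h => h.1)).symm
    _ = _ := by
        congr 1
        have : ∀ Δ, T Δ = (‖G‖ ^ 2 + 2 * β * b + β ^ 2 * d * v / (4 * c ^ 2)) +
            (-(2 * β * κ)) * inner ℝ Δ G ^ 2 := fun Δ => by simp only [hT]; ring
        simp_rw [this]
        rw [integral_add (integrable_const _) (hi.const_mul _), integral_const_mul, hsq]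
        simp only [integral_const, probReal_univ, one_smul]
        ring

section Product

variable {Ξ : Type*} [MeasurableSpace Ξ] {μ : Measure Ξ} [IsProbabilityMeasure μ] {F G : Ξ → ℝ}

theorem memLp_fst_of_three (hF : MemLp F 2 μ) :
    MemLp (fun e : Ξ × Ξ × Ξ => F e.2.1) 2 (μ.prod (μ.prod μ)) ∧
      ∫ e : Ξ × Ξ × Ξ, F e.2.1 ∂(μ.prod (μ.prod μ)) = ∫ ξ, F ξ ∂μ ∧
      ∫ e : Ξ × Ξ × Ξ, F e.2.1 ^ 2 ∂(μ.prod (μ.prod μ)) = ∫ ξ, F ξ ^ 2 ∂μ := by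
  have h : MeasurePreserving (fun e : Ξ × Ξ × Ξ => e.2.1) (μ.prod (μ.prod μ)) μ :=
    measurePreserving_fst.comp measurePreserving_snd
  refine ⟨hF.comp_measurePreserving h, ?_, ?_⟩
  · have := integral_map h.measurable.aemeasurable (f := F) (by rw [h.map_eq]; exact hF.1)
    rw [h.map_eq] at this
    exact this.symm
  · have := integral_map h.measurable.aemeasurable (f := fun ξ => F ξ ^ 2)
      (by rw [h.map_eq]; exact hF.1.pow 2)
    rw [h.map_eq] at this
    exact this.symm

theorem memLp_snd_of_three (hF : MemLp F 2 μ) :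
    MemLp (fun e : Ξ × Ξ × Ξ => F e.2.2) 2 (μ.prod (μ.prod μ)) ∧
      ∫ e : Ξ × Ξ × Ξ, F e.2.2 ∂(μ.prod (μ.prod μ)) = ∫ ξ, F ξ ∂μ ∧
      ∫ e : Ξ × Ξ × Ξ, F e.2.2 ^ 2 ∂(μ.prod (μ.prod μ)) = ∫ ξ, F ξ ^ 2 ∂μ := by
  have h : MeasurePreserving (fun e : Ξ × Ξ × Ξ => e.2.2) (μ.prod (μ.prod μ)) μ :=
    measurePreserving_snd.comp measurePreserving_snd
  refine ⟨hF.comp_measurePreserving h, ?_, ?_⟩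
  · have := integral_map h.measurable.aemeasurable (f := F) (by rw [h.map_eq]; exact hF.1)
    rw [h.map_eq] at this
    exact this.symm
  · have := integral_map h.measurable.aemeasurable (f := fun ξ => F ξ ^ 2)
      (by rw [h.map_eq]; exact hF.1.pow 2)
    rw [h.map_eq] at this
    exact this.symm

theorem memLp_mul_of_three (hF : MemLp F 2 μ) (hG : MemLp G 2 μ) :
    MemLp (fun e : Ξ × Ξ × Ξ => F e.2.1 * G e.2.2) 2 (μ.prod (μ.prod μ)) ∧
      ∫ e : Ξ × Ξ × Ξ, F e.2.1 * G e.2.2 ∂(μ.prod (μ.prod μ)) = (∫ ξ, F ξ ∂μ) * ∫ ξ, G ξ ∂μ ∧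
      ∫ e : Ξ × Ξ × Ξ, (F e.2.1 * G e.2.2) ^ 2 ∂(μ.prod (μ.prod μ)) =
        (∫ ξ, F ξ ^ 2 ∂μ) * ∫ ξ, G ξ ^ 2 ∂μ := by
  have h : MeasurePreserving (Prod.snd : Ξ × Ξ × Ξ → Ξ × Ξ) (μ.prod (μ.prod μ)) (μ.prod μ) :=
    measurePreserving_snd
  have h1 : AEStronglyMeasurable (fun z : Ξ × Ξ => F z.1 * G z.2) (μ.prod μ) :=
    hF.1.comp_fst.mul hG.1.comp_snd
  have hpt : ∀ z : Ξ × Ξ, (F z.1 * G z.2) ^ 2 = F z.1 ^ 2 * G z.2 ^ 2 := fun z => mul_pow _ _ _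
  have h2 : MemLp (fun z : Ξ × Ξ => F z.1 * G z.2) 2 (μ.prod μ) := by
    rw [memLp_two_iff_integrable_sq h1]
    simp_rw [hpt]
    exact hF.integrable_sq.mul_prod hG.integrable_sq
  refine ⟨h2.comp_measurePreserving h, ?_, ?_⟩
  · rw [← integral_prod_mul]
    have := integral_map h.measurable.aemeasurable
      (f := fun z : Ξ × Ξ => F z.1 * G z.2) (by rw [h.map_eq]; exact h1)
    rw [h.map_eq] at this
    exact this.symm
  · rw [← integral_prod_mul]
    simp_rw [← hpt]
    have := integral_map h.measurable.aemeasurable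
      (f := fun z : Ξ × Ξ => (F z.1 * G z.2) ^ 2) (by rw [h.map_eq]; exact h1.pow 2)
    rw [h.map_eq] at this
    exact this.symm

end Product

/-! ### Moments of the kernel-weighted outputs -/

section KernelMoments

variable {d p : ℕ} {Ξ Ω : Type*} [MeasurableSpace Ξ] [MeasurableSpace Ω]
  {μ : Measure Ξ} [IsProbabilityMeasure μ] {P : Measure Ω}
  {M : Problem d p Ξ} {I : Input d p} {W : Noise d Ξ Ω} {f : Vec d → ℝ → ℝ}
  {mbar : (j : Fin p) → Vec d → (Fin ((j : ℕ) + 1) → ℝ) → ℝ → ℝ}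
  {nu : Vec d → ℝ} {lam : Vec d → Vec p} {N : Set (Vec d)} {Xε : Set ℝ} {Λε : Set (Vec p)}
  {B ε Cq εq Cm εm : ℝ} {θ : Vec d} {l : Vec p} {K : ℝ → ℝ} {CK h ν : ℝ}

/-- The kernel weight of an output. -/
noncomputable def outK (M : Problem d p Ξ) (K : ℝ → ℝ) (h : ℝ) (θ : Vec d) (ν : ℝ) (ξ : Ξ) : ℝ :=
  kern K h ν (M.X θ ξ)

/-- The kernel-weighted value of `m_j` at an output. -/
noncomputable def outMK (M : Problem d p Ξ) (K : ℝ → ℝ) (h : ℝ) (j : Fin p) (θ : Vec d) (l : Vec p)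
    (ν : ℝ) (ξ : Ξ) : ℝ :=
  M.m j θ (M.Y θ ξ) (lead j l) * kern K h ν (M.X θ ξ)

theorem abs_kern_le (hK : KernelBounds K CK) (hh : 0 < h) (x : ℝ) : |kern K h ν x| ≤ CK / h := by
  rw [abs_of_nonneg (hK.kern_nonneg hh x)]; exact hK.kern_le hh x

theorem Setting.measurable_outK (hset : Setting M μ f mbar nu lam) (hK : KernelBounds K CK) :
    Measurable (outK M K h θ ν) :=
  hK.continuous_kern.measurable.comp (hset.measurable_X_section θ)

theorem Setting.measurable_outMK (hset : Setting M μ f mbar nu lam) (hK : KernelBounds K CK)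
    (j : Fin p) : Measurable (outMK M K h j θ l ν) :=
  ((hset.measurable_m_section j θ _).comp (hset.measurable_Y_section θ)).mul
    (hset.measurable_outK hK)

theorem Setting.memLp_outK (hset : Setting M μ f mbar nu lam) (hK : KernelBounds K CK)
    (hh : 0 < h) : MemLp (outK M K h θ ν) 2 μ :=
  MemLp.of_bound (hset.measurable_outK hK).aestronglyMeasurable (CK / h)
    (Eventually.of_forall fun _ => abs_kern_le hK hh _)

theorem Setting.integral_outK_sq_le (hset : Setting M μ f mbar nu lam) (hK : KernelBounds K CK)
    (hh : 0 < h) : ∫ ξ, outK M K h θ ν ξ ^ 2 ∂μ ≤ (CK / h) ^ 2 := by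
  have : ∫ ξ, outK M K h θ ν ξ ^ 2 ∂μ ≤ ∫ _, (CK / h) ^ 2 ∂μ :=
    integral_mono (hset.memLp_outK hK hh).integrable_sq (integrable_const _) fun ξ =>
      pow_le_pow_left₀ (hK.kern_nonneg hh _) (hK.kern_le hh _) 2
  simpa using this

theorem Setting.integral_outK (hset : Setting M μ f mbar nu lam) (hK : KernelBounds K CK) :
    ∫ ξ, outK M K h θ ν ξ ∂μ = ∫ x, kern K h ν x * f θ x := by
  rw [← integral_map_of_density (hset.measurable_f θ) (hset.f_nonneg θ) (hset.f_density θ),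
    integral_map (hset.measurable_X_section θ).aemeasurable
      hK.continuous_kern.aestronglyMeasurable]
  rfl

theorem PairBounds.integral_outK_sq_le {m : ℝ → ℝ} {U : Set ℝ} {C : ℝ}
    (hP : PairBounds m (f θ) U ε C) (hset : Setting M μ f mbar nu lam)
    (hK : KernelBounds K CK) (hh : 0 < h) : ∫ ξ, outK M K h θ ν ξ ^ 2 ∂μ ≤ CK * C / h := by
  have h1 : ∫ ξ, outK M K h θ ν ξ ^ 2 ∂μ ≤ ∫ ξ, CK / h * outK M K h θ ν ξ ∂μ := by
    refine integral_mono (hset.memLp_outK hK hh).integrable_sq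
      (((hset.memLp_outK hK hh).integrable (by norm_num)).const_mul _) fun ξ => ?_
    simp only [sq]
    exact mul_le_mul_of_nonneg_right (hK.kern_le hh _) (hK.kern_nonneg hh _)
  refine h1.trans ?_
  rw [integral_const_mul, hset.integral_outK hK]
  calc _ ≤ CK / h * C := by
        have := hK.pos
        gcongr
        exact (le_abs_self _).trans (hP.abs_kern_f_le hK hh)
    _ = _ := by ring

/-- The crude bound of order `h⁻²`, which needs nothing about `ν`. -/
theorem Regular.lintegral_outMK_sq_le' (hreg : Regular M μ f mbar N Xε Λε B ε Cq εq Cm εm)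
    (hK : KernelBounds K CK) (hh : 0 < h)
    (hθ : θ ∈ N) (hl : l ∈ Λε) (j : Fin p) :
    ∫⁻ ξ, ENNReal.ofReal (outMK M K h j θ l ν ξ ^ 2) ∂μ ≤ ENNReal.ofReal ((CK / h) ^ 2 * Cm) := by
  calc _ ≤ ∫⁻ ξ, ENNReal.ofReal ((CK / h) ^ 2) *
        ENNReal.ofReal (M.m j θ (M.Y θ ξ) (lead j l) ^ 2) ∂μ := by
        refine lintegral_mono fun ξ => ?_
        rw [← ENNReal.ofReal_mul (sq_nonneg _)]
        refine ENNReal.ofReal_le_ofReal ?_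
        rw [outMK, mul_pow, mul_comm]
        exact mul_le_mul_of_nonneg_right
          (pow_le_pow_left₀ (hK.kern_nonneg hh _) (hK.kern_le hh _) 2) (sq_nonneg _)
    _ ≤ _ := by
        rw [lintegral_const_mul' _ _ ENNReal.ofReal_ne_top, ENNReal.ofReal_mul (sq_nonneg _)]
        gcongr
        exact hreg.m_moment j θ hθ l hl

theorem Regular.memLp_outMK (hset : Setting M μ f mbar nu lam)
    (hreg : Regular M μ f mbar N Xε Λε B ε Cq εq Cm εm) (hK : KernelBounds K CK) (hh : 0 < h)
    (hθ : θ ∈ N) (hl : l ∈ Λε) (j : Fin p) : MemLp (outMK M K h j θ l ν) 2 μ :=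
  memLp_two_of_lintegral_sq_le (hset.measurable_outMK hK j).aestronglyMeasurable
    (hreg.lintegral_outMK_sq_le' hK hh hθ hl j)

theorem Regular.integral_outMK_sq_le' (hset : Setting M μ f mbar nu lam)
    (hreg : Regular M μ f mbar N Xε Λε B ε Cq εq Cm εm) (hK : KernelBounds K CK) (hh : 0 < h)
    (hθ : θ ∈ N) (hl : l ∈ Λε) (j : Fin p) :
    ∫ ξ, outMK M K h j θ l ν ξ ^ 2 ∂μ ≤ (CK / h) ^ 2 * Cm :=
  integral_le_of_lintegral_le ((hset.measurable_outMK hK j).pow_const 2).aestronglyMeasurable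
    (fun _ => sq_nonneg _) (mul_nonneg (sq_nonneg _) hreg.Cm_pos.le)
    (hreg.lintegral_outMK_sq_le' hK hh hθ hl j)

theorem Regular.integral_outMK (hset : Setting M μ f mbar nu lam)
    (hreg : Regular M μ f mbar N Xε Λε B ε Cq εq Cm εm) (hK : KernelBounds K CK) (hh : 0 < h)
    (hθ : θ ∈ N) (hl : l ∈ Λε) (j : Fin p) :
    ∫ ξ, outMK M K h j θ l ν ξ ∂μ =
      ∫ x, kern K h ν x * (mbar j θ (lead j l) x * f θ x) := by
  have h1 := (hset.mbar_version j θ (lead j l)).integral_mul (hset.measurable_X_section θ)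
    (hset.measurable_Y_section θ) (hset.measurable_m_section j θ (lead j l))
    ((hreg.memLp_m hset hθ hl j).integrable (by norm_num))
    (hK.continuous_kern (h := h) (ν := ν)).measurable (M := CK / h) (abs_kern_le hK hh)
  rw [integral_map_of_density (hset.measurable_f θ) (hset.f_nonneg θ) (hset.f_density θ)] at h1
  calc ∫ ξ, outMK M K h j θ l ν ξ ∂μ
      = ∫ ξ, kern K h ν (M.X θ ξ) * M.m j θ (M.Y θ ξ) (lead j l) ∂μ := by
        congr 1; ext ξ; rw [outMK, mul_comm]
    _ = _ := by
        rw [h1]; congr 1; ext x; ring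

/-- The second moment of the weighted output is `O(1/h)`: near `ν` by the bound on the conditional
second moment, elsewhere because the kernel is bounded there. -/
theorem Regular.integral_outMK_sq_le (hset : Setting M μ f mbar nu lam)
    (hreg : Regular M μ f mbar N Xε Λε B ε Cq εq Cm εm) (hX : IsOpen Xε)
    (hK : KernelBounds K CK) (hh : 0 < h) (hh1 : h ≤ 1)
    (hθ : θ ∈ N) (hl : l ∈ Λε) {ρ : ℝ} (hρ : 0 < ρ) (hν : Metric.ball ν ρ ⊆ Xε) (j : Fin p) :
    ∫ ξ, outMK M K h j θ l ν ξ ^ 2 ∂μ ≤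
      (CK * Cm * pairConst B Cm + (CK / ρ) ^ 2 * Cm) / h := by
  have hCK := hK.pos
  have hCm := hreg.Cm_pos
  have hP := hreg.pairBounds hset hX hθ hl j
  have hC0 := hP.pos
  set φ : ℝ → ℝ := fun y => M.m j θ y (lead j l)
  have hφm : Measurable φ := hset.measurable_m_section j θ (lead j l)
  have hXm := hset.measurable_X_section θ
  have hYm := hset.measurable_Y_section θ
  have hkm : Measurable (kern K h ν) := hK.continuous_kern.measurable
  have h1 : ∫⁻ ξ, ENNReal.ofReal (outMK M K h j θ l ν ξ ^ 2) ∂μ =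
      ∫⁻ x, ENNReal.ofReal (kern K h ν x ^ 2) *
        ∫⁻ y, ENNReal.ofReal (φ y ^ 2) ∂(condDistrib (M.Y θ) (M.X θ) μ x) ∂(μ.map (M.X θ)) := by
    have := lintegral_condDistrib (μ := μ) hXm hYm
      (g := fun z => ENNReal.ofReal (kern K h ν z.1 ^ 2) * ENNReal.ofReal (φ z.2 ^ 2))
      (by fun_prop)
    rw [← lintegral_congr fun x => lintegral_const_mul' _ _ ENNReal.ofReal_ne_top, this]
    refine lintegral_congr fun ξ => ?_
    rw [← ENNReal.ofReal_mul (sq_nonneg _), outMK, mul_pow, mul_comm]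
  have h2 : ∫⁻ ξ, ENNReal.ofReal (outMK M K h j θ l ν ξ ^ 2) ∂μ ≤
      ∫⁻ x, (ENNReal.ofReal (CK / h * Cm) * ENNReal.ofReal (kern K h ν x) +
        ENNReal.ofReal ((CK / ρ) ^ 2) *
          ∫⁻ y, ENNReal.ofReal (φ y ^ 2) ∂(condDistrib (M.Y θ) (M.X θ) μ x)) ∂(μ.map (M.X θ)) := by
    rw [h1]
    refine lintegral_mono_ae ?_
    filter_upwards [hreg.m_cond_moment j θ hθ l hl] with x hx
    have hk := hK.kern_nonneg (ν := ν) hh x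
    by_cases hxX : x ∈ Xε
    · refine le_trans ?_ le_self_add
      refine (mul_le_mul_right (hx hxX) _).trans ?_
      rw [← ENNReal.ofReal_mul (sq_nonneg _), ← ENNReal.ofReal_mul (by positivity)]
      refine ENNReal.ofReal_le_ofReal ?_
      have := mul_le_mul_of_nonneg_right (hK.kern_le (ν := ν) hh x) (mul_nonneg hk hCm.le)
      linarith
    · refine le_trans ?_ le_add_self
      gcongr
      refine hK.kern_le_of_le hh hρ ?_
      by_contra hlt
      exact hxX (hν (by rw [Metric.mem_ball, dist_comm, Real.dist_eq]; linarith))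
  have h3 : ∫⁻ x, ENNReal.ofReal (kern K h ν x) ∂(μ.map (M.X θ)) ≤ ENNReal.ofReal (pairConst B Cm) := by
    rw [lintegral_map_of_density (hset.measurable_f θ) (hset.f_density θ) hkm.ennreal_ofReal]
    have e1 : ∀ x, ENNReal.ofReal (f θ x) * ENNReal.ofReal (kern K h ν x) =
        ENNReal.ofReal (kern K h ν x * f θ x) := fun x => by
      rw [← ENNReal.ofReal_mul (hset.f_nonneg θ x), mul_comm]
    simp_rw [e1]
    rw [← ofReal_integral_eq_lintegral_ofReal (hP.integrable_kern_f hK hh)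
      (Eventually.of_forall fun x => mul_nonneg (hK.kern_nonneg hh x) (hset.f_nonneg θ x))]
    exact ENNReal.ofReal_le_ofReal ((le_abs_self _).trans (hP.abs_kern_f_le hK hh))
  have h4 : ∫⁻ x, ∫⁻ y, ENNReal.ofReal (φ y ^ 2) ∂(condDistrib (M.Y θ) (M.X θ) μ x)
      ∂(μ.map (M.X θ)) ≤ ENNReal.ofReal Cm := by
    rw [lintegral_condDistrib hXm hYm (g := fun z => ENNReal.ofReal (φ z.2 ^ 2)) (by fun_prop)]
    exact hreg.m_moment j θ hθ l hl
  have h5 : ∫⁻ ξ, ENNReal.ofReal (outMK M K h j θ l ν ξ ^ 2) ∂μ ≤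
      ENNReal.ofReal (CK / h * Cm * pairConst B Cm + (CK / ρ) ^ 2 * Cm) := by
    refine h2.trans ?_
    rw [lintegral_add_left (by fun_prop), lintegral_const_mul' _ _ ENNReal.ofReal_ne_top,
      lintegral_const_mul' _ _ ENNReal.ofReal_ne_top, ENNReal.ofReal_add (by positivity)
      (by positivity), ENNReal.ofReal_mul (p := CK / h * Cm) (by positivity),
      ENNReal.ofReal_mul (p := (CK / ρ) ^ 2) (by positivity)]
    gcongr
  refine (integral_le_of_lintegral_le
    ((hset.measurable_outMK hK j).pow_const 2).aestronglyMeasurable (fun _ => sq_nonneg _)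
    (by positivity) h5).trans ?_
  rw [add_div]
  refine add_le_add (le_of_eq (by ring)) ?_
  exact le_div_self (by positivity) hh hh1

end KernelMoments

end KBSA

/-! ### Perturbation in a random direction -/

namespace KBSA

section Direction

variable {d p : ℕ}

/-- The properties of the law of a random direction that enter the bounds: its components are signs,
and its inner product with `G` has second moment `‖G‖²`. -/
structure IsDirectionLaw (D : Measure (Vec d)) : Prop where
  sign : ∀ᵐ Δ ∂D, ∀ i, Δ i = 1 ∨ Δ i = -1
  integrable : ∀ G : Vec d, Integrable (fun Δ => inner ℝ Δ G ^ 2) D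
  integral : ∀ G : Vec d, ∫ Δ, inner ℝ Δ G ^ 2 ∂D = ‖G‖ ^ 2

theorem DirectionAssumption.isDirectionLaw {Ξ Ω : Type*} [MeasurableSpace Ξ] [MeasurableSpace Ω]
    {μ : Measure Ξ} [IsProbabilityMeasure μ] {P : Measure Ω} [IsProbabilityMeasure P] {W : Noise d Ξ Ω}
    (hD : DirectionAssumption P W) (hW : IsSampling μ P W) (n : ℕ) :
    IsDirectionLaw (P.map (W.Δ (n + 1))) where
  sign := by
    rw [ae_map_iff (hW.measurable_Δ _).aemeasurable]
    · exact hD.ae_sign hW n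
    · have : {Δ : Vec d | ∀ i, Δ i = 1 ∨ Δ i = -1} =
          ⋂ i, ((fun Δ : Vec d => Δ i) ⁻¹' ({1} ∪ {-1})) := by
        ext Δ; simp [or_comm]
      rw [this]
      exact MeasurableSet.iInter fun i =>
        (measurable_coord measurable_id i) (MeasurableSet.union (measurableSet_singleton _)
          (measurableSet_singleton _))
  integrable G := by
    rw [integrable_map_measure (by fun_prop) (hW.measurable_Δ _).aemeasurable]
    exact (hD.integral_inner_sq hW n G).1
  integral G := by
    rw [integral_map (hW.measurable_Δ _).aemeasurable (by fun_prop)]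
    exact (hD.integral_inner_sq hW n G).2

/-- The vector with components `Δᵀ G_j`. -/
noncomputable def dirG (Δ : Vec d) (s : Iterate d p) : Vec p :=
  WithLp.toLp 2 (fun j => inner ℝ Δ (s.G j))

theorem dirG_apply (Δ : Vec d) (s : Iterate d p) (j : Fin p) :
    dirG Δ s j = inner ℝ Δ (s.G j) := rfl

theorem pertθ_eq (σ c : ℝ) (Δ : Vec d) (s : Iterate d p) :
    pertθ σ c Δ s = s.θ + (σ * cbar c s) • Δ := rfl

theorem pertNu_eq (σ c : ℝ) (Δ : Vec d) (s : Iterate d p) :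
    pertNu σ c Δ s = s.nu + σ * cbar c s * inner ℝ Δ s.Gnu := rfl

theorem pertLam_eq (σ c : ℝ) (Δ : Vec d) (s : Iterate d p) :
    pertLam σ c Δ s = s.lam + (σ * cbar c s) • dirG Δ s := by
  ext j; simp [pertLam, dirG]

theorem abs_inner_le_of_norm {Δ : Vec d} (hΔ : ‖Δ‖ = √(d : ℝ)) (G : Vec d) :
    |inner ℝ Δ G| ≤ √(d : ℝ) * ‖G‖ := by
  rw [← hΔ]; exact abs_real_inner_le_norm _ _

theorem sq_inner_le_of_norm {Δ : Vec d} (hΔ : ‖Δ‖ = √(d : ℝ)) (G : Vec d) :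
    inner ℝ Δ G ^ 2 ≤ d * ‖G‖ ^ 2 := by
  rw [← sq_abs, ← Real.sq_sqrt d.cast_nonneg, ← mul_pow]
  exact pow_le_pow_left₀ (abs_nonneg _) (abs_inner_le_of_norm hΔ G) 2

theorem cbar_mul_abs_inner_le {c : ℝ} {Δ : Vec d} (hΔ : ‖Δ‖ = √(d : ℝ)) {G : Vec d} {s : Iterate d p}
    (hc : 0 < c) (hG : cbar c s * ‖G‖ ≤ c * √(d : ℝ)) : cbar c s * |inner ℝ Δ G| ≤ c * d := by
  calc cbar c s * |inner ℝ Δ G| ≤ cbar c s * (√(d : ℝ) * ‖G‖) :=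
        mul_le_mul_of_nonneg_left (abs_inner_le_of_norm hΔ G) (cbar_pos hc s).le
    _ = √(d : ℝ) * (cbar c s * ‖G‖) := by ring
    _ ≤ √(d : ℝ) * (c * √(d : ℝ)) := by gcongr
    _ = c * (√(d : ℝ) * √(d : ℝ)) := by ring
    _ = c * d := by rw [Real.mul_self_sqrt d.cast_nonneg]

theorem norm_vec_le_sum_abs {n : ℕ} (x : Vec n) : ‖x‖ ≤ ∑ i, |x i| := by
  rw [EuclideanSpace.norm_eq]
  refine Real.sqrt_le_iff.2 ⟨Finset.sum_nonneg fun _ _ => abs_nonneg _, ?_⟩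
  simp only [Real.norm_eq_abs]
  exact Finset.sum_sq_le_sq_sum_of_nonneg fun i _ => abs_nonneg _

/-- A ball of radius `r` around each of `θ`, `ν`, `λ` lies in the given neighbourhoods. -/
structure IsInner (N : Set (Vec d)) (Xε : Set ℝ) (Λε : Set (Vec p)) (r : ℝ) (s : Iterate d p) :
    Prop where
  θ : Metric.ball s.θ r ⊆ N
  nu : Metric.ball s.nu r ⊆ Xε
  lam : Metric.ball s.lam r ⊆ Λε

/-- If the perturbation size is small, the segments between the perturbed points stay in the
neighbourhoods: `c̄` is scaled by the gradient estimates. -/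
theorem IsInner.segment_mem {N : Set (Vec d)} {Xε : Set ℝ} {Λε : Set (Vec p)} {r c : ℝ}
    {s : Iterate d p} (h : IsInner N Xε Λε r s) (hc : 0 < c)
    (hcr : c * (4 * (1 + d) * (1 + p)) ≤ r) {Δ : Vec d} (hΔ : ‖Δ‖ = √(d : ℝ)) :
    (∀ t, |t| < 2 * cbar c s →
      Metric.ball (s.θ + t • Δ) (r / 2) ⊆ N ∧ s.lam + t • dirG Δ s ∈ Λε) ∧
    ∀ t, |t| ≤ cbar c s → Metric.ball (s.nu + t * inner ℝ Δ s.Gnu) (r / 2) ⊆ Xε := by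
  have hcc := cbar_pos hc s
  have hccle := cbar_le hc s
  have hd : (0 : ℝ) ≤ d := d.cast_nonneg
  have hp : (0 : ℝ) ≤ p := p.cast_nonneg
  have hcd : 0 ≤ c * d := by positivity
  have hcp : 0 ≤ c * p := by positivity
  have hcdp : 0 ≤ c * d * p := by positivity
  have hsd : √(d : ℝ) ≤ 1 + d := by
    rw [Real.sqrt_le_iff]; constructor <;> nlinarith
  have hexp : c * (4 * (1 + d) * (1 + p)) = 4 * c + 4 * (c * d) + 4 * (c * p) + 4 * (c * d * p) := by
    ring
  refine ⟨fun t ht => ⟨?_, ?_⟩, fun t ht => ?_⟩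
  · refine (Metric.ball_subset_ball' ?_).trans h.θ
    have : dist (s.θ + t • Δ) s.θ ≤ r / 2 := by
      rw [dist_eq_norm, add_sub_cancel_left, norm_smul, Real.norm_eq_abs, hΔ]
      calc |t| * √(d : ℝ) ≤ 2 * c * (1 + d) := by gcongr; linarith
        _ ≤ r / 2 := by nlinarith
    linarith
  · refine h.lam ?_
    rw [Metric.mem_ball, dist_eq_norm, add_sub_cancel_left, norm_smul, Real.norm_eq_abs]
    have h1 : cbar c s * ∑ j, |dirG Δ s j| ≤ p * (c * d) := by
      rw [Finset.mul_sum]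
      calc _ ≤ ∑ _j : Fin p, c * d := Finset.sum_le_sum fun j _ =>
            cbar_mul_abs_inner_le hΔ hc (cbar_mul_norm_G_le hc s j)
        _ = _ := by simp
    have h2 := norm_vec_le_sum_abs (dirG Δ s)
    have h3 : |t| * ‖dirG Δ s‖ ≤ 2 * cbar c s * ∑ j, |dirG Δ s j| :=
      mul_le_mul ht.le h2 (norm_nonneg _) (by positivity)
    nlinarith
  · refine (Metric.ball_subset_ball' ?_).trans h.nu
    have : dist (s.nu + t * inner ℝ Δ s.Gnu) s.nu ≤ c * d := by
      rw [Real.dist_eq, add_sub_cancel_left, abs_mul]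
      exact (mul_le_mul_of_nonneg_right ht (abs_nonneg _)).trans
        (cbar_mul_abs_inner_le hΔ hc (cbar_mul_norm_Gnu_le hc s))
    linarith

end Direction

section Regularity

variable {d p : ℕ} {Ξ Ω : Type*} [MeasurableSpace Ξ] [MeasurableSpace Ω]
  {μ : Measure Ξ} [IsProbabilityMeasure μ]
  {M : Problem d p Ξ} {I : Input d p} {f : Vec d → ℝ → ℝ}
  {mbar : (j : Fin p) → Vec d → (Fin ((j : ℕ) + 1) → ℝ) → ℝ → ℝ}
  {nu : Vec d → ℝ} {lam : Vec d → Vec p} {N : Set (Vec d)} {Xε : Set ℝ} {Λε : Set (Vec p)}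
  {B ε Cq εq Cm εm : ℝ} {θ : Vec d} {ν : ℝ}

theorem BddC3.mono {V : Type*} [NormedAddCommGroup V] [NormedSpace ℝ V] {F : V → ℝ} {S T : Set V}
    (hF : BddC3 F S B) (hT : T ⊆ S) : BddC3 F T B :=
  ⟨hF.1.mono hT, fun k hk x hx => hF.2 k hk x (hT hx)⟩

theorem Regular.subset_interior_suppX (hset : Setting M μ f mbar nu lam)
    (hreg : Regular M μ f mbar N Xε Λε B ε Cq εq Cm εm) (hθ : θ ∈ N) :
    Xε ⊆ interior (suppX M μ θ) := fun x hx =>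
  hreg.mem_interior_suppX hset hθ (hreg.ε_pos.trans_le (hreg.f_lower θ hθ x hx))

theorem Setting.measurable_q_section (hset : Setting M μ f mbar nu lam) (θ : Vec d) (ν : ℝ) :
    Measurable (fun ξ => M.q θ (M.X θ ξ) ν) :=
  hset.measurable_q_comp measurable_const measurable_id measurable_const

theorem Regular.memLp_q (hset : Setting M μ f mbar nu lam)
    (hreg : Regular M μ f mbar N Xε Λε B ε Cq εq Cm εm) (hθ : θ ∈ N) (hν : ν ∈ Xε) :
    MemLp (fun ξ => M.q θ (M.X θ ξ) ν) 2 μ :=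
  memLp_two_of_lintegral_sq_le (hset.measurable_q_section θ ν).aestronglyMeasurable
    (hreg.q_moment θ hθ ν hν)

theorem Regular.integral_q_sq_le (hset : Setting M μ f mbar nu lam)
    (hreg : Regular M μ f mbar N Xε Λε B ε Cq εq Cm εm) (hθ : θ ∈ N) (hν : ν ∈ Xε) :
    ∫ ξ, M.q θ (M.X θ ξ) ν ^ 2 ∂μ ≤ Cq :=
  integral_le_of_lintegral_le ((hset.measurable_q_section θ ν).pow_const 2).aestronglyMeasurable
    (fun _ => sq_nonneg _) hreg.Cq_pos.le (hreg.q_moment θ hθ ν hν)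

theorem Regular.sq_qbar_le (hset : Setting M μ f mbar nu lam)
    (hreg : Regular M μ f mbar N Xε Λε B ε Cq εq Cm εm) (hθ : θ ∈ N) (hν : ν ∈ Xε) :
    qbar M μ θ ν ^ 2 ≤ Cq :=
  (sq_integral_le (hreg.memLp_q hset hθ hν)).trans (hreg.integral_q_sq_le hset hθ hν)

/-- `q̄(θ, ·)` is strongly decreasing on the neighbourhood. -/
theorem Regular.mul_qbar_sub_le (hset : Setting M μ f mbar nu lam)
    (hreg : Regular M μ f mbar N Xε Λε B ε Cq εq Cm εm) (hX : IsOpen Xε) (hXc : Convex ℝ Xε)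
    (hθ : θ ∈ N) {ν₁ ν₂ : ℝ} (h₁ : ν₁ ∈ Xε) (h₂ : ν₂ ∈ Xε) :
    (ν₂ - ν₁) * (qbar M μ θ ν₂ - qbar M μ θ ν₁) ≤ -εq * (ν₂ - ν₁) ^ 2 := by
  have hF : BddC3 (qbar M μ θ) Xε B :=
    (hreg.q_smooth_ν θ hθ).mono (hreg.subset_interior_suppX hset hθ)
  have hmono : ∀ a ∈ Xε, ∀ b ∈ Xε, a ≤ b →
      qbar M μ θ b - qbar M μ θ a ≤ -εq * (b - a) := by
    refine fun a ha b hb hab => hXc.image_sub_le_mul_sub_of_deriv_le hF.1.continuousOn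
      ?_ ?_ a ha b hb hab
    · rw [hX.interior_eq]
      exact hF.1.differentiableOn (by norm_num)
    · rw [hX.interior_eq]
      exact fun x hx => hreg.q_deriv θ hθ x hx
  rcases le_total ν₁ ν₂ with h | h
  · nlinarith [hmono _ h₁ _ h₂ h]
  · nlinarith [hmono _ h₂ _ h₁ h]

/-- The mean increment of `G_ν` in a direction contracts the projection `b` of `G_ν` on it. -/
theorem Regular.nu_drift_le (hset : Setting M μ f mbar nu lam)
    (hreg : Regular M μ f mbar N Xε Λε B ε Cq εq Cm εm) (hN : IsOpen N) (hNc : Convex ℝ N)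
    (hX : IsOpen Xε) (hXc : Convex ℝ Xε) {Δ : Vec d} {b c : ℝ} (hc : 0 < c)
    (hΔ : ‖Δ‖ = √(d : ℝ)) (h₁ : θ + c • Δ ∈ N) (h₂ : θ + (-c) • Δ ∈ N)
    (h₃ : ν + c * b ∈ Xε) (h₄ : ν + (-c) * b ∈ Xε) :
    b * (qbar M μ (θ + c • Δ) (ν + c * b) - qbar M μ (θ + (-c) • Δ) (ν + (-c) * b)) ≤
      2 * c * (-(εq / 2) * b ^ 2 + B ^ 2 * d / (2 * εq)) := by
  have hε := hreg.εq_pos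
  have e1 := hreg.mul_qbar_sub_le hset hX hXc h₂ h₄ h₃
  have e2 := (hreg.q_smooth_θ _ h₃).abs_sub_le hN hNc h₂ h₁
  have e3 : ‖θ + c • Δ - (θ + (-c) • Δ)‖ = 2 * c * √(d : ℝ) := by
    have : θ + c • Δ - (θ + (-c) • Δ) = (2 * c) • Δ := by module
    rw [this, norm_smul, hΔ, Real.norm_eq_abs, abs_of_pos (by positivity)]
  rw [e3] at e2
  have e4 : ν + c * b - (ν + -c * b) = 2 * c * b := by ring
  rw [e4] at e1
  set u := qbar M μ (θ + c • Δ) (ν + c * b)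
  set v := qbar M μ (θ + (-c) • Δ) (ν + c * b)
  set w := qbar M μ (θ + (-c) • Δ) (ν + -c * b)
  have e5 : b * (v - w) ≤ 2 * c * (-εq * b ^ 2) := by
    have : 2 * c * (b * (v - w)) ≤ 2 * c * (2 * c * (-εq * b ^ 2)) := by linarith
    exact le_of_mul_le_mul_left this (by positivity)
  have e6 : b * (u - v) ≤ |b| * (B * (2 * c * √(d : ℝ))) :=
    (le_abs_self _).trans (by rw [abs_mul]; exact mul_le_mul_of_nonneg_left e2 (abs_nonneg _))
  have e7 : |b| * (B * √(d : ℝ)) ≤ εq / 2 * b ^ 2 + B ^ 2 * d / (2 * εq) := by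
    have h := sq_nonneg (εq * |b| - B * √(d : ℝ))
    have hs : (B * √(d : ℝ)) ^ 2 = B ^ 2 * d := by rw [mul_pow, Real.sq_sqrt d.cast_nonneg]
    have : εq / 2 * b ^ 2 + B ^ 2 * d / (2 * εq) - |b| * (B * √(d : ℝ)) =
        (εq * |b| - B * √(d : ℝ)) ^ 2 / (2 * εq) := by
      rw [← hs, ← sq_abs b]; field_simp; ring
    have := div_nonneg h (by positivity : 0 ≤ 2 * εq)
    linarith
  have e8 := mul_le_mul_of_nonneg_left e7 (by positivity : 0 ≤ 2 * c)
  nlinarith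

variable {D : Measure (Vec d)} [IsProbabilityMeasure D] {s : Iterate d p} {n : ℕ}

/-- One step of the gradient estimate for `ν`, given a bound on the drift. -/
theorem Regular.lintegral_Gnu_step_le (hset : Setting M μ f mbar nu lam)
    (hreg : Regular M μ f mbar N Xε Λε B ε Cq εq Cm εm) (hD : IsDirectionLaw D)
    (hβ : 0 < I.β (n + 1)) (hc : 0 < I.c (n + 1)) {κ b : ℝ}
    (h : ∀ᵐ Δ ∂D, (∀ σ ∈ ({1, -1} : Set ℝ), pertθ σ (I.c (n + 1)) Δ s ∈ N ∧
        pertNu σ (I.c (n + 1)) Δ s ∈ Xε) ∧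
      inner ℝ Δ s.Gnu * (qbar M μ (pertθ 1 (I.c (n + 1)) Δ s) (pertNu 1 (I.c (n + 1)) Δ s) -
        qbar M μ (pertθ (-1) (I.c (n + 1)) Δ s) (pertNu (-1) (I.c (n + 1)) Δ s)) ≤
      2 * cbar (I.c (n + 1)) s * (-κ * inner ℝ Δ s.Gnu ^ 2 + b)) :
    ∫⁻ z, ENNReal.ofReal (‖(stepWith M I n s z).Gnu‖ ^ 2) ∂((μ.prod (μ.prod μ)).prod D) ≤
      ENNReal.ofReal ((1 - 2 * I.β (n + 1) * κ) * ‖s.Gnu‖ ^ 2 + 2 * I.β (n + 1) * b +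
        d * Cq * I.β (n + 1) ^ 2 / I.c (n + 1) ^ 2 * gradSize s) := by
  set c := I.c (n + 1) with hcdef
  set β := I.β (n + 1) with hβdef
  have hcc := cbar_pos hc s
  set Z : (Ξ × Ξ × Ξ) × Vec d → ℝ := fun z =>
    M.q (pertθ 1 c z.2 s) (M.X (pertθ 1 c z.2 s) z.1.2.1) (pertNu 1 c z.2 s) -
      M.q (pertθ (-1) c z.2 s) (M.X (pertθ (-1) c z.2 s) z.1.2.2) (pertNu (-1) c z.2 s) with hZ
  have hZm : Measurable Z :=
    (hset.measurable_q_comp (measurable_pertθ measurable_const measurable_snd _ _) (by fun_prop)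
      (measurable_pertNu measurable_const measurable_snd _ _)).sub
    (hset.measurable_q_comp (measurable_pertθ measurable_const measurable_snd _ _) (by fun_prop)
      (measurable_pertNu measurable_const measurable_snd _ _))
  have hsign2 : ∀ᵐ z ∂((μ.prod (μ.prod μ)).prod D), ∀ i, z.2 i = 1 ∨ z.2 i = -1 :=
    (Measure.quasiMeasurePreserving_snd (μ := μ.prod (μ.prod μ)) (ν := D)).ae hD.sign
  have h0 := lintegral_norm_sq_step_le hD.sign (hD.integrable s.Gnu) (hD.integral s.Gnu) hZm hβ hcc
    (Q := μ.prod (μ.prod μ)) (κ := κ) (b := b) (v := 4 * Cq) (by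
      filter_upwards [h] with Δ ⟨hpts, hdrift⟩
      obtain ⟨hp1, hp2⟩ := hpts 1 (by simp)
      obtain ⟨hm1, hm2⟩ := hpts (-1) (by simp)
      have F1 := hreg.memLp_q hset hp1 hp2
      have F2 := hreg.memLp_q hset hm1 hm2
      obtain ⟨a1, a2, j1⟩ := memLp_fst_of_three F1
      obtain ⟨b1, b2, j2⟩ := memLp_snd_of_three F2
      refine ⟨a1.sub b1, ?_, ?_⟩
      · have : ∫ e, Z (e, Δ) ∂(μ.prod (μ.prod μ)) =
            qbar M μ (pertθ 1 c Δ s) (pertNu 1 c Δ s) -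
              qbar M μ (pertθ (-1) c Δ s) (pertNu (-1) c Δ s) := by
          simp only [hZ]
          rw [integral_sub (a1.integrable (by norm_num)) (b1.integrable (by norm_num)), a2, b2]
          rfl
        rw [this]
        exact hdrift
      · have k1 := hreg.integral_q_sq_le hset hp1 hp2
        have k2 := hreg.integral_q_sq_le hset hm1 hm2
        rw [← j1] at k1
        rw [← j2] at k2
        calc ∫ e, Z (e, Δ) ^ 2 ∂(μ.prod (μ.prod μ)) ≤
            ∫ e : Ξ × Ξ × Ξ, (2 * M.q (pertθ 1 c Δ s) (M.X (pertθ 1 c Δ s) e.2.1)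
              (pertNu 1 c Δ s) ^ 2 + 2 * M.q (pertθ (-1) c Δ s)
                (M.X (pertθ (-1) c Δ s) e.2.2) (pertNu (-1) c Δ s) ^ 2)
              ∂(μ.prod (μ.prod μ)) := by
              refine integral_mono (a1.sub b1).integrable_sq
                ((a1.integrable_sq.const_mul 2).add (b1.integrable_sq.const_mul 2)) fun e => ?_
              beta_reduce
              nlinarith [sq_nonneg (M.q (pertθ 1 c Δ s) (M.X (pertθ 1 c Δ s) e.2.1)
                (pertNu 1 c Δ s) + M.q (pertθ (-1) c Δ s) (M.X (pertθ (-1) c Δ s) e.2.2)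
                (pertNu (-1) c Δ s))]
          _ ≤ 4 * Cq := by
              rw [integral_add (a1.integrable_sq.const_mul 2) (b1.integrable_sq.const_mul 2),
                integral_const_mul, integral_const_mul]
              linarith)
  refine (lintegral_congr_ae ?_).trans_le (h0.trans (ENNReal.ofReal_le_ofReal ?_))
  · filter_upwards [hsign2] with z hz
    have : (stepWith M I n s z).Gnu = s.Gnu + β • spQuot (Z z) c z.2 s := rfl
    rw [this, spQuot_of_sign hz]
  · have h1 := one_div_cbar_sq_le hc s
    have hCq := hreg.Cq_pos
    have : β ^ 2 * d * (4 * Cq) / (4 * cbar c s ^ 2) = d * Cq * β ^ 2 * (1 / cbar c s ^ 2) := by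
      field_simp
    rw [this]
    have h2 := mul_le_mul_of_nonneg_left h1 (by positivity : 0 ≤ d * Cq * β ^ 2)
    have h3 : d * Cq * β ^ 2 * (gradSize s / c ^ 2) = d * Cq * β ^ 2 / c ^ 2 * gradSize s := by ring
    linarith

end Regularity

end KBSA

/-! ### Contraction of the gradient estimates -/

namespace KBSA

variable {d p : ℕ} {Ξ Ω : Type*} [MeasurableSpace Ξ] [MeasurableSpace Ω]
  {μ : Measure Ξ} [IsProbabilityMeasure μ]
  {M : Problem d p Ξ} {I : Input d p} {f : Vec d → ℝ → ℝ}
  {mbar : (j : Fin p) → Vec d → (Fin ((j : ℕ) + 1) → ℝ) → ℝ → ℝ}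
  {nu : Vec d → ℝ} {lam : Vec d → Vec p} {N : Set (Vec d)} {Xε : Set ℝ} {Λε : Set (Vec p)}
  {B ε Cq εq Cm εm : ℝ} {D : Measure (Vec d)} [IsProbabilityMeasure D] {s : Iterate d p} {n : ℕ}
  {CK : ℝ}

/-- Without any drift bound, the second moment of the gradient estimate stays finite. -/
theorem Regular.lintegral_Gnu_step_le_crude (hset : Setting M μ f mbar nu lam)
    (hreg : Regular M μ f mbar N Xε Λε B ε Cq εq Cm εm) (hD : IsDirectionLaw D)
    (hβ : 0 < I.β (n + 1)) (hc : 0 < I.c (n + 1))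
    (h : ∀ᵐ Δ ∂D, ∀ σ ∈ ({1, -1} : Set ℝ), pertθ σ (I.c (n + 1)) Δ s ∈ N ∧
        pertNu σ (I.c (n + 1)) Δ s ∈ Xε) :
    ∫⁻ z, ENNReal.ofReal (‖(stepWith M I n s z).Gnu‖ ^ 2) ∂((μ.prod (μ.prod μ)).prod D) ≤
      ENNReal.ofReal ((1 + I.β (n + 1)) * ‖s.Gnu‖ ^ 2 +
        (I.β (n + 1) + d * I.β (n + 1) ^ 2) * Cq / I.c (n + 1) ^ 2 * gradSize s) := by
  have hcc := cbar_pos hc s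
  have h1 := one_div_cbar_sq_le hc s
  refine (hreg.lintegral_Gnu_step_le hset hD hβ hc (κ := -(1 / 2))
    (b := Cq / 2 * (1 / cbar (I.c (n + 1)) s ^ 2)) ?_).trans (ENNReal.ofReal_le_ofReal ?_)
  · filter_upwards [h] with Δ hpts
    refine ⟨hpts, ?_⟩
    obtain ⟨hp1, hp2⟩ := hpts 1 (by simp)
    obtain ⟨hm1, hm2⟩ := hpts (-1) (by simp)
    have e1 := hreg.sq_qbar_le hset hp1 hp2
    have e2 := hreg.sq_qbar_le hset hm1 hm2
    set u := qbar M μ (pertθ 1 (I.c (n + 1)) Δ s) (pertNu 1 (I.c (n + 1)) Δ s)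
    set v := qbar M μ (pertθ (-1) (I.c (n + 1)) Δ s) (pertNu (-1) (I.c (n + 1)) Δ s)
    set k := cbar (I.c (n + 1)) s
    have e3 : 2 * k * (-(-(1 / 2)) * inner ℝ Δ s.Gnu ^ 2 + Cq / 2 * (1 / k ^ 2)) =
        (k * inner ℝ Δ s.Gnu) ^ 2 / k + Cq / k := by field_simp
    have e4 : inner ℝ Δ s.Gnu * (u - v) = (k * inner ℝ Δ s.Gnu) * (u - v) / k := by field_simp
    rw [e3, e4, ← add_div]
    gcongr
    nlinarith [sq_nonneg (k * inner ℝ Δ s.Gnu - (u - v) / 2), sq_nonneg (u + v)]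
  · have hCq := hreg.Cq_pos
    have h2 := mul_le_mul_of_nonneg_left h1 (by positivity : 0 ≤ I.β (n + 1) * Cq)
    have h3 : (I.β (n + 1) + d * I.β (n + 1) ^ 2) * Cq / I.c (n + 1) ^ 2 * gradSize s =
      I.β (n + 1) * Cq * (gradSize s / I.c (n + 1) ^ 2) +
        d * Cq * I.β (n + 1) ^ 2 / I.c (n + 1) ^ 2 * gradSize s := by ring
    rw [h3]
    nlinarith

/-- The perturbed points lie in the neighbourhoods, the perturbed `ν` even with room to spare. -/
theorem IsInner.pert_mem {N : Set (Vec d)} {Xε : Set ℝ} {Λε : Set (Vec p)} {r c : ℝ}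
    (h : IsInner N Xε Λε r s) (hr : 0 < r) (hc : 0 < c)
    (hcr : c * (4 * (1 + d) * (1 + p)) ≤ r) {Δ : Vec d} (hΔ : ‖Δ‖ = √(d : ℝ)) :
    ∀ σ ∈ ({1, -1} : Set ℝ), pertθ σ c Δ s ∈ N ∧ Metric.ball (pertNu σ c Δ s) (r / 2) ⊆ Xε ∧
      pertLam σ c Δ s ∈ Λε := by
  intro σ hσ
  obtain ⟨h1, h2⟩ := h.segment_mem hc hcr hΔ
  have hcc := cbar_pos hc s
  have habs : |σ * cbar c s| = cbar c s := by
    rcases hσ with h | h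
    · rw [h, one_mul, abs_of_pos hcc]
    · rw [mem_singleton_iff.1 h, neg_one_mul, abs_neg, abs_of_pos hcc]
  obtain ⟨h3, h4⟩ := h1 (σ * cbar c s) (by rw [habs]; linarith)
  refine ⟨h3 (Metric.mem_ball_self (by positivity)), h2 _ habs.le, ?_⟩
  rw [pertLam_eq]
  exact h4

/-- One step of the gradient estimate for `ν` near the regular region: it contracts. -/
theorem Regular.lintegral_Gnu_step_le_of_isInner (hset : Setting M μ f mbar nu lam)
    (hreg : Regular M μ f mbar N Xε Λε B ε Cq εq Cm εm) (hN : IsOpen N) (hNc : Convex ℝ N)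
    (hX : IsOpen Xε) (hXc : Convex ℝ Xε) (hD : IsDirectionLaw D) {r : ℝ} (hr : 0 < r)
    (hs : IsInner N Xε Λε r s)
    (hβ : 0 < I.β (n + 1)) (hc : 0 < I.c (n + 1))
    (hcr : I.c (n + 1) * (4 * (1 + d) * (1 + p)) ≤ r) :
    ∫⁻ z, ENNReal.ofReal (‖(stepWith M I n s z).Gnu‖ ^ 2) ∂((μ.prod (μ.prod μ)).prod D) ≤
      ENNReal.ofReal ((1 - εq * I.β (n + 1)) * ‖s.Gnu‖ ^ 2 + B ^ 2 * d / εq * I.β (n + 1) +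
        d * Cq * I.β (n + 1) ^ 2 / I.c (n + 1) ^ 2 * gradSize s) := by
  have hε := hreg.εq_pos
  refine (hreg.lintegral_Gnu_step_le hset hD hβ hc (κ := εq / 2)
    (b := B ^ 2 * d / (2 * εq)) ?_).trans_eq ?_
  · filter_upwards [hD.sign] with Δ hΔs
    have hΔ := norm_of_sign hΔs
    have hpts : ∀ σ ∈ ({1, -1} : Set ℝ), pertθ σ (I.c (n + 1)) Δ s ∈ N ∧
        pertNu σ (I.c (n + 1)) Δ s ∈ Xε := fun σ hσ => by
      obtain ⟨h1, h2, h3⟩ := hs.pert_mem hr hc hcr hΔ σ hσ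
      exact ⟨h1, h2 (Metric.mem_ball_self (by positivity))⟩
    refine ⟨hpts, ?_⟩
    obtain ⟨hp1, hp2⟩ := hpts 1 (by simp)
    obtain ⟨hm1, hm2⟩ := hpts (-1) (by simp)
    rw [pertθ_eq, one_mul] at hp1
    rw [pertNu_eq, one_mul] at hp2
    rw [pertθ_eq, neg_one_mul] at hm1
    rw [pertNu_eq, neg_one_mul] at hm2
    have := hreg.nu_drift_le hset hN hNc hX hXc (cbar_pos hc s) hΔ hp1 hm1 hp2 hm2
    rw [pertθ_eq, pertθ_eq, pertNu_eq, pertNu_eq, one_mul, neg_one_mul]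
    exact this
  · congr 1
    field_simp

theorem sub_sq_le_two_mul (x y : ℝ) : (x - y) ^ 2 ≤ 2 * x ^ 2 + 2 * y ^ 2 := by
  nlinarith [sq_nonneg (x + y)]

/-- One step of the gradient estimate for `λ_j`, given a bound on the drift and on the second
moment. -/
theorem Regular.lintegral_G_step_le (hset : Setting M μ f mbar nu lam)
    (hreg : Regular M μ f mbar N Xε Λε B ε Cq εq Cm εm) (hK : KernelBounds I.K CK)
    (hD : IsDirectionLaw D)
    (hβ : 0 < I.β (n + 1)) (hc : 0 < I.c (n + 1)) (hh : 0 < I.h (n + 1)) (j : Fin p) {κ b v : ℝ}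
    (hv : 0 ≤ v)
    (h : ∀ᵐ Δ ∂D, (∀ σ ∈ ({1, -1} : Set ℝ), pertθ σ (I.c (n + 1)) Δ s ∈ N ∧
        pertLam σ (I.c (n + 1)) Δ s ∈ Λε ∧
        ∫ ξ, outMK M I.K (I.h (n + 1)) j (pertθ σ (I.c (n + 1)) Δ s) (pertLam σ (I.c (n + 1)) Δ s)
          (pertNu σ (I.c (n + 1)) Δ s) ξ ^ 2 ∂μ ≤ v ∧
        ∫ ξ, outK M I.K (I.h (n + 1)) (pertθ σ (I.c (n + 1)) Δ s)
          (pertNu σ (I.c (n + 1)) Δ s) ξ ^ 2 ∂μ ≤ v) ∧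
      inner ℝ Δ (s.G j) *
        ((∫ ξ, outMK M I.K (I.h (n + 1)) j (pertθ 1 (I.c (n + 1)) Δ s) (pertLam 1 (I.c (n + 1)) Δ s)
          (pertNu 1 (I.c (n + 1)) Δ s) ξ ∂μ) *
        (∫ ξ, outK M I.K (I.h (n + 1)) (pertθ (-1) (I.c (n + 1)) Δ s)
          (pertNu (-1) (I.c (n + 1)) Δ s) ξ ∂μ) -
        (∫ ξ, outK M I.K (I.h (n + 1)) (pertθ 1 (I.c (n + 1)) Δ s)
          (pertNu 1 (I.c (n + 1)) Δ s) ξ ∂μ) *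
        ∫ ξ, outMK M I.K (I.h (n + 1)) j (pertθ (-1) (I.c (n + 1)) Δ s)
          (pertLam (-1) (I.c (n + 1)) Δ s) (pertNu (-1) (I.c (n + 1)) Δ s) ξ ∂μ) ≤
      2 * cbar (I.c (n + 1)) s * (-κ * inner ℝ Δ (s.G j) ^ 2 + b)) :
    ∫⁻ z, ENNReal.ofReal (‖(stepWith M I n s z).G j‖ ^ 2) ∂((μ.prod (μ.prod μ)).prod D) ≤
      ENNReal.ofReal ((1 - 2 * I.β (n + 1) * κ) * ‖s.G j‖ ^ 2 + 2 * I.β (n + 1) * b +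
        d * v ^ 2 * I.β (n + 1) ^ 2 / I.c (n + 1) ^ 2 * gradSize s) := by
  set c := I.c (n + 1) with hcdef
  set β := I.β (n + 1) with hβdef
  set h' := I.h (n + 1) with hhdef
  have hcc := cbar_pos hc s
  have hKc : Continuous I.K := hK.cont
  set Z : (Ξ × Ξ × Ξ) × Vec d → ℝ := fun z =>
    (M.m j (pertθ 1 c z.2 s) (M.Y (pertθ 1 c z.2 s) z.1.2.1) (lead j (pertLam 1 c z.2 s)) -
      M.m j (pertθ (-1) c z.2 s) (M.Y (pertθ (-1) c z.2 s) z.1.2.2)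
        (lead j (pertLam (-1) c z.2 s))) *
      kern I.K h' (pertNu 1 c z.2 s) (M.X (pertθ 1 c z.2 s) z.1.2.1) *
      kern I.K h' (pertNu (-1) c z.2 s) (M.X (pertθ (-1) c z.2 s) z.1.2.2) with hZ
  have hmθ : ∀ σ, Measurable (fun z : (Ξ × Ξ × Ξ) × Vec d => pertθ σ c z.2 s) := fun σ =>
    measurable_pertθ measurable_const measurable_snd _ _
  have hmν : ∀ σ, Measurable (fun z : (Ξ × Ξ × Ξ) × Vec d => pertNu σ c z.2 s) := fun σ =>
    measurable_pertNu measurable_const measurable_snd _ _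
  have hml : ∀ σ, Measurable (fun z : (Ξ × Ξ × Ξ) × Vec d => pertLam σ c z.2 s) := fun σ =>
    measurable_pertLam measurable_const measurable_snd _ _
  have hZm : Measurable Z :=
    (((hset.measurable_m_comp j (hmθ _) (by fun_prop) (hml _)).sub
      (hset.measurable_m_comp j (hmθ _) (by fun_prop) (hml _))).mul
      (measurable_kern hKc _ (hmν _) (hset.measurable_X_comp (hmθ _) (by fun_prop)))).mul
      (measurable_kern hKc _ (hmν _) (hset.measurable_X_comp (hmθ _) (by fun_prop)))
  have hZeq : ∀ (e : Ξ × Ξ × Ξ) Δ, Z (e, Δ) =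
      outMK M I.K h' j (pertθ 1 c Δ s) (pertLam 1 c Δ s) (pertNu 1 c Δ s) e.2.1 *
        outK M I.K h' (pertθ (-1) c Δ s) (pertNu (-1) c Δ s) e.2.2 -
      outK M I.K h' (pertθ 1 c Δ s) (pertNu 1 c Δ s) e.2.1 *
        outMK M I.K h' j (pertθ (-1) c Δ s) (pertLam (-1) c Δ s) (pertNu (-1) c Δ s) e.2.2 :=
    fun e Δ => by simp only [hZ, outMK, outK]; ring
  have hsign2 : ∀ᵐ z ∂((μ.prod (μ.prod μ)).prod D), ∀ i, z.2 i = 1 ∨ z.2 i = -1 :=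
    (Measure.quasiMeasurePreserving_snd (μ := μ.prod (μ.prod μ)) (ν := D)).ae hD.sign
  have h0 := lintegral_norm_sq_step_le hD.sign (hD.integrable (s.G j)) (hD.integral (s.G j)) hZm hβ
    hcc (Q := μ.prod (μ.prod μ)) (κ := κ) (b := b) (v := 4 * v ^ 2) (by
      filter_upwards [h] with Δ ⟨hpts, hdrift⟩
      obtain ⟨hp1, hp2, hp3, hp4⟩ := hpts 1 (by simp)
      obtain ⟨hm1, hm2, hm3, hm4⟩ := hpts (-1) (by simp)
      have A1 := hreg.memLp_outMK hset hK hh hp1 hp2 (ν := pertNu 1 c Δ s) j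
      have A2 := hreg.memLp_outMK hset hK hh hm1 hm2 (ν := pertNu (-1) c Δ s) j
      have b1 := hset.memLp_outK hK hh (θ := pertθ 1 c Δ s) (ν := pertNu 1 c Δ s)
      have b2 := hset.memLp_outK hK hh (θ := pertθ (-1) c Δ s) (ν := pertNu (-1) c Δ s)
      obtain ⟨u1, u2, u3⟩ := memLp_mul_of_three A1 b2
      obtain ⟨w1, w2, w3⟩ := memLp_mul_of_three b1 A2
      simp only [hZeq]
      refine ⟨u1.sub w1, ?_, ?_⟩
      · rw [integral_sub (u1.integrable (by norm_num)) (w1.integrable (by norm_num)), u2, w2]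
        exact hdrift
      · refine (integral_mono (u1.sub w1).integrable_sq
          ((u1.integrable_sq.const_mul 2).add (w1.integrable_sq.const_mul 2)) fun e => ?_).trans
          (b := ∫ e : Ξ × Ξ × Ξ, (2 * (outMK M I.K h' j (pertθ 1 c Δ s) (pertLam 1 c Δ s)
            (pertNu 1 c Δ s) e.2.1 * outK M I.K h' (pertθ (-1) c Δ s) (pertNu (-1) c Δ s) e.2.2) ^ 2 +
          2 * (outK M I.K h' (pertθ 1 c Δ s) (pertNu 1 c Δ s) e.2.1 *
            outMK M I.K h' j (pertθ (-1) c Δ s) (pertLam (-1) c Δ s) (pertNu (-1) c Δ s) e.2.2) ^ 2)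
            ∂(μ.prod (μ.prod μ))) ?_
        · exact sub_sq_le_two_mul _ _
        · rw [integral_add (u1.integrable_sq.const_mul 2) (w1.integrable_sq.const_mul 2),
            integral_const_mul, integral_const_mul, u3, w3]
          have k1 := mul_le_mul hp3 hm4 (integral_nonneg fun _ => sq_nonneg _) hv
          have k2 := mul_le_mul hp4 hm3 (integral_nonneg fun _ => sq_nonneg _) hv
          linarith)
  refine (lintegral_congr_ae ?_).trans_le (h0.trans (ENNReal.ofReal_le_ofReal ?_))
  · filter_upwards [hsign2] with z hz
    have : (stepWith M I n s z).G j = s.G j + β • spQuot (Z z) c z.2 s := rfl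
    rw [this, spQuot_of_sign hz]
  · have h1 := one_div_cbar_sq_le hc s
    have : β ^ 2 * d * (4 * v ^ 2) / (4 * cbar c s ^ 2) =
        d * v ^ 2 * β ^ 2 * (1 / cbar c s ^ 2) := by field_simp
    rw [this]
    have h2 := mul_le_mul_of_nonneg_left h1 (by positivity : 0 ≤ d * v ^ 2 * β ^ 2)
    have h3 : d * v ^ 2 * β ^ 2 * (gradSize s / c ^ 2) =
        d * v ^ 2 * β ^ 2 / c ^ 2 * gradSize s := by ring
    linarith

/-- Without any drift bound, the second moment of the gradient estimate stays finite. -/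
theorem Regular.lintegral_G_step_le_crude (hset : Setting M μ f mbar nu lam)
    (hreg : Regular M μ f mbar N Xε Λε B ε Cq εq Cm εm) (hK : KernelBounds I.K CK)
    (hD : IsDirectionLaw D)
    (hβ : 0 < I.β (n + 1)) (hc : 0 < I.c (n + 1)) (hh : 0 < I.h (n + 1)) (j : Fin p)
    (h : ∀ᵐ Δ ∂D, ∀ σ ∈ ({1, -1} : Set ℝ), pertθ σ (I.c (n + 1)) Δ s ∈ N ∧
        pertLam σ (I.c (n + 1)) Δ s ∈ Λε) :
    ∫⁻ z, ENNReal.ofReal (‖(stepWith M I n s z).G j‖ ^ 2) ∂((μ.prod (μ.prod μ)).prod D) ≤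
      ENNReal.ofReal ((1 + I.β (n + 1)) * ‖s.G j‖ ^ 2 +
        (I.β (n + 1) + d * I.β (n + 1) ^ 2) * ((CK / I.h (n + 1)) ^ 2 * (Cm + 1)) ^ 2 /
          I.c (n + 1) ^ 2 * gradSize s) := by
  have hcc := cbar_pos hc s
  have h1 := one_div_cbar_sq_le hc s
  have hCm := hreg.Cm_pos
  set v := (CK / I.h (n + 1)) ^ 2 * (Cm + 1) with hv
  have hv0 : 0 ≤ v := by positivity
  refine (hreg.lintegral_G_step_le hset hK hD hβ hc hh j (κ := -(1 / 2))
    (b := v ^ 2 / 2 * (1 / cbar (I.c (n + 1)) s ^ 2)) hv0 ?_).trans (ENNReal.ofReal_le_ofReal ?_)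
  · filter_upwards [h] with Δ hpts
    have hA : ∀ σ ∈ ({1, -1} : Set ℝ),
        ∫ ξ, outMK M I.K (I.h (n + 1)) j (pertθ σ (I.c (n + 1)) Δ s) (pertLam σ (I.c (n + 1)) Δ s)
          (pertNu σ (I.c (n + 1)) Δ s) ξ ^ 2 ∂μ ≤ v := fun σ hσ =>
      (hreg.integral_outMK_sq_le' hset hK hh (hpts σ hσ).1 (hpts σ hσ).2 j).trans (by
        rw [hv]; gcongr; linarith)
    have hb : ∀ σ, ∫ ξ, outK M I.K (I.h (n + 1)) (pertθ σ (I.c (n + 1)) Δ s)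
          (pertNu σ (I.c (n + 1)) Δ s) ξ ^ 2 ∂μ ≤ v := fun σ =>
      (hset.integral_outK_sq_le hK hh).trans
        (le_mul_of_one_le_right (sq_nonneg _) (by linarith))
    refine ⟨fun σ hσ => ⟨(hpts σ hσ).1, (hpts σ hσ).2, hA σ hσ, hb σ⟩, ?_⟩
    have hA' : ∀ σ ∈ ({1, -1} : Set ℝ), (∫ ξ, outMK M I.K (I.h (n + 1)) j
          (pertθ σ (I.c (n + 1)) Δ s) (pertLam σ (I.c (n + 1)) Δ s)
          (pertNu σ (I.c (n + 1)) Δ s) ξ ∂μ) ^ 2 ≤ v := fun σ hσ =>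
      (sq_integral_le (hreg.memLp_outMK hset hK hh (hpts σ hσ).1 (hpts σ hσ).2 j)).trans (hA σ hσ)
    have hb' : ∀ σ, (∫ ξ, outK M I.K (I.h (n + 1)) (pertθ σ (I.c (n + 1)) Δ s)
          (pertNu σ (I.c (n + 1)) Δ s) ξ ∂μ) ^ 2 ≤ v := fun σ =>
      (sq_integral_le (hset.memLp_outK hK hh)).trans (hb σ)
    have a1 := hA' 1 (by simp)
    have a2 := hA' (-1) (by simp)
    have b1 := hb' 1
    have b2 := hb' (-1)
    generalize (∫ ξ, outMK M I.K (I.h (n + 1)) j (pertθ 1 (I.c (n + 1)) Δ s)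
      (pertLam 1 (I.c (n + 1)) Δ s) (pertNu 1 (I.c (n + 1)) Δ s) ξ ∂μ) = x1 at *
    generalize (∫ ξ, outMK M I.K (I.h (n + 1)) j (pertθ (-1) (I.c (n + 1)) Δ s)
      (pertLam (-1) (I.c (n + 1)) Δ s) (pertNu (-1) (I.c (n + 1)) Δ s) ξ ∂μ) = x2 at *
    generalize (∫ ξ, outK M I.K (I.h (n + 1)) (pertθ 1 (I.c (n + 1)) Δ s)
      (pertNu 1 (I.c (n + 1)) Δ s) ξ ∂μ) = y1 at *
    generalize (∫ ξ, outK M I.K (I.h (n + 1)) (pertθ (-1) (I.c (n + 1)) Δ s)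
      (pertNu (-1) (I.c (n + 1)) Δ s) ξ ∂μ) = y2 at *
    have c1 : (x1 * y2) ^ 2 ≤ v ^ 2 := by
      rw [mul_pow, sq v]; exact mul_le_mul a1 b2 (sq_nonneg _) hv0
    have c2 : (y1 * x2) ^ 2 ≤ v ^ 2 := by
      rw [mul_pow, sq v]; exact mul_le_mul b1 a2 (sq_nonneg _) hv0
    set k := cbar (I.c (n + 1)) s
    have e3 : 2 * k * (-(-(1 / 2)) * inner ℝ Δ (s.G j) ^ 2 + v ^ 2 / 2 * (1 / k ^ 2)) =
        (k * inner ℝ Δ (s.G j)) ^ 2 / k + v ^ 2 / k := by field_simp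
    have e4 : inner ℝ Δ (s.G j) * (x1 * y2 - y1 * x2) =
        (k * inner ℝ Δ (s.G j)) * (x1 * y2 - y1 * x2) / k := by field_simp
    rw [e3, e4, ← add_div]
    gcongr
    nlinarith [sq_nonneg (k * inner ℝ Δ (s.G j) - (x1 * y2 - y1 * x2) / 2),
      sub_sq_le_two_mul (x1 * y2) (y1 * x2)]
  · have h2 := mul_le_mul_of_nonneg_left h1 (by positivity : 0 ≤ I.β (n + 1) * v ^ 2)
    have h3 : (I.β (n + 1) + d * I.β (n + 1) ^ 2) * v ^ 2 / I.c (n + 1) ^ 2 * gradSize s =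
      I.β (n + 1) * v ^ 2 * (gradSize s / I.c (n + 1) ^ 2) +
        d * v ^ 2 * I.β (n + 1) ^ 2 / I.c (n + 1) ^ 2 * gradSize s := by ring
    rw [h3]
    nlinarith

theorem add_add_sum_sq_le {ι : Type*} (S : Finset ι) (x : ι → ℝ) (t y : ℝ) :
    (t + |y| + ∑ i ∈ S, |x i|) ^ 2 ≤ (S.card + 2) * (t ^ 2 + y ^ 2 + ∑ i ∈ S, x i ^ 2) := by
  have h1 : (∑ i ∈ S, |x i|) ^ 2 ≤ S.card * ∑ i ∈ S, x i ^ 2 := by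
    have := sq_sum_le_card_mul_sum_sq (s := S) (f := fun i => |x i|)
    simpa using this
  have h2 : 0 ≤ ∑ i ∈ S, x i ^ 2 := Finset.sum_nonneg fun _ _ => sq_nonneg _
  set σ := ∑ i ∈ S, |x i|
  set τ := ∑ i ∈ S, x i ^ 2
  rw [← sq_abs y]
  have hc : (0 : ℝ) ≤ S.card := Nat.cast_nonneg _
  set k : ℝ := (S.card : ℝ)
  rcases hc.eq_or_lt with h0 | h0
  · rw [← h0] at h1 ⊢
    have : σ = 0 := by nlinarith
    rw [this]
    nlinarith [sq_nonneg (t - |y|)]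
  · have hk : σ ^ 2 / k ≤ τ := by rw [div_le_iff₀ h0]; linarith
    have e : (k + 2) * (t ^ 2 + |y| ^ 2 + σ ^ 2 / k) - (t + |y| + σ) ^ 2 =
        (t - |y|) ^ 2 + (k * t - σ) ^ 2 / k + (k * |y| - σ) ^ 2 / k := by field_simp; ring
    have p1 : 0 ≤ (k * t - σ) ^ 2 / k := by positivity
    have p2 : 0 ≤ (k * |y| - σ) ^ 2 / k := by positivity
    nlinarith [sq_nonneg (t - |y|)]

/-- One step of the gradient estimate for `λ_j` near the regular region: it contracts, up to the
estimates of the previous components. -/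
theorem Regular.exists_lintegral_G_step_le (hset : Setting M μ f mbar nu lam)
    (hreg : Regular M μ f mbar N Xε Λε B ε Cq εq Cm εm) (hN : IsOpen N) (hNc : Convex ℝ N)
    (hX : IsOpen Xε) (hΛ : IsOpen Λε) (hK : KernelBounds I.K CK) {r : ℝ} (hr : 0 < r) :
    ∃ κ > 0, ∃ C > 0, ∃ h₀ > 0, ∀ (n : ℕ) (D : Measure (Vec d)) [IsProbabilityMeasure D]
      (s : Iterate d p) (j : Fin p), IsDirectionLaw D → IsInner N Xε Λε r s →
      0 < I.β (n + 1) → 0 < I.c (n + 1) → I.c (n + 1) * (4 * (1 + d) * (1 + p)) ≤ r →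
      0 < I.h (n + 1) → I.h (n + 1) ≤ h₀ →
      ∫⁻ z, ENNReal.ofReal (‖(stepWith M I n s z).G j‖ ^ 2) ∂((μ.prod (μ.prod μ)).prod D) ≤
        ENNReal.ofReal ((1 - κ * I.β (n + 1)) * ‖s.G j‖ ^ 2 +
          C * I.β (n + 1) * (1 + ‖s.Gnu‖ ^ 2 + ∑ i ∈ Finset.univ.filter (· < j), ‖s.G i‖ ^ 2) +
          C * (I.β (n + 1) ^ 2 / (I.c (n + 1) * I.h (n + 1)) ^ 2) * gradSize s) := by
  obtain ⟨κ, hκ, C, hC, h₀, hh₀, hdrift⟩ :=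
    hreg.exists_drift_le hset hN hNc hX hΛ hK (ρ := r / 2) (by positivity)
  have hCm := hreg.Cm_pos
  have hCK := hK.pos
  set C₁ := CK * Cm * pairConst B Cm + (CK / (r / 2)) ^ 2 * Cm with hC₁
  set C₂ := |C₁| + |CK * pairConst B Cm| with hC₂
  set C₃ := C ^ 2 * (p + 2) / κ * (1 + d) with hC₃
  have hC₃0 : 0 ≤ C₃ := by positivity
  have hC₂0 : 0 ≤ C₂ := by positivity
  refine ⟨κ, hκ, C₃ + d * C₂ ^ 2 + 1, by positivity, min h₀ 1, by positivity, ?_⟩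
  intro n D _ s j hD hs hβ hc hcr hh hhle
  have hcc := cbar_pos hc s
  have hh1 : I.h (n + 1) ≤ 1 := hhle.trans (min_le_right _ _)
  set Q := 1 + ‖s.Gnu‖ ^ 2 + ∑ i ∈ Finset.univ.filter (· < j), ‖s.G i‖ ^ 2 with hQ
  have hQ0 : 0 ≤ Q := by positivity
  refine (hreg.lintegral_G_step_le hset hK hD hβ hc hh j (κ := κ / 2) (b := C₃ / 2 * Q)
    (v := C₂ / I.h (n + 1)) (by positivity) ?_).trans (ENNReal.ofReal_le_ofReal ?_)
  · filter_upwards [hD.sign] with Δ hΔs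
    have hΔ := norm_of_sign hΔs
    have hpert := hs.pert_mem hr hc hcr hΔ
    refine ⟨fun σ hσ => ?_, ?_⟩
    · obtain ⟨h1, h2, h3⟩ := hpert σ hσ
      refine ⟨h1, h3, ?_, ?_⟩
      · refine (hreg.integral_outMK_sq_le hset hX hK hh hh1 h1 h3 (by positivity) h2 j).trans ?_
        gcongr
        linarith [le_abs_self C₁, abs_nonneg (CK * pairConst B Cm)]
      · refine ((hreg.pairBounds hset hX h1 h3 j).integral_outK_sq_le hset hK hh).trans ?_
        gcongr
        linarith [abs_nonneg C₁, le_abs_self (CK * pairConst B Cm)]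
    · obtain ⟨hp1, -, hp3⟩ := hpert 1 (by simp)
      obtain ⟨hm1, -, hm3⟩ := hpert (-1) (by simp)
      obtain ⟨hseg, hsegν⟩ := hs.segment_mem hc hcr hΔ
      have h1 := hdrift j s.θ s.nu s.lam Δ (dirG Δ s) (inner ℝ Δ s.Gnu) (I.h (n + 1))
        (cbar (I.c (n + 1)) s) hΔ.le hh (hhle.trans (min_le_left _ _)) hcc hseg hsegν
      rw [hreg.integral_outMK hset hK hh hp1 hp3, hreg.integral_outMK hset hK hh hm1 hm3,
        hset.integral_outK hK, hset.integral_outK hK]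
      simp only [pertθ_eq, pertNu_eq, pertLam_eq, one_mul, neg_one_mul]
      refine h1.trans (mul_le_mul_of_nonneg_left ?_ (by positivity))
      rw [dirG_apply]
      set a := inner ℝ Δ (s.G j) with ha
      set T := 1 + |inner ℝ Δ s.Gnu| + ∑ i ∈ Finset.univ.filter (· < j), |dirG Δ s i| with hT
      have hT2 : T ^ 2 ≤ (p + 2) * ((1 + d) * Q) := by
        refine (add_add_sum_sq_le _ _ _ _).trans ?_
        rw [one_pow]
        have hcard : ((Finset.univ.filter (· < j)).card : ℝ) ≤ p := by
          exact_mod_cast (Finset.card_le_univ _).trans_eq (by simp)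
        refine mul_le_mul (by linarith) ?_ (by positivity) (by positivity)
        have k1 := sq_inner_le_of_norm hΔ s.Gnu
        have k2 : ∑ i ∈ Finset.univ.filter (· < j), dirG Δ s i ^ 2 ≤
            d * ∑ i ∈ Finset.univ.filter (· < j), ‖s.G i‖ ^ 2 := by
          rw [Finset.mul_sum]
          exact Finset.sum_le_sum fun i _ => sq_inner_le_of_norm hΔ (s.G i)
        have k3 : 0 ≤ ∑ i ∈ Finset.univ.filter (· < j), ‖s.G i‖ ^ 2 :=
          Finset.sum_nonneg fun _ _ => sq_nonneg _
        have k4 : (0 : ℝ) ≤ d := d.cast_nonneg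
        rw [hQ]
        nlinarith [sq_nonneg ‖s.Gnu‖]
      have hy : C * |a| * T ≤ κ / 2 * a ^ 2 + C ^ 2 * T ^ 2 / (2 * κ) := by
        have e : κ / 2 * a ^ 2 + C ^ 2 * T ^ 2 / (2 * κ) - C * |a| * T =
            (κ * |a| - C * T) ^ 2 / (2 * κ) := by rw [← sq_abs a]; field_simp; ring
        have : 0 ≤ (κ * |a| - C * T) ^ 2 / (2 * κ) := by positivity
        linarith
      have hz : C ^ 2 * T ^ 2 / (2 * κ) ≤ C₃ / 2 * Q := by
        calc _ ≤ C ^ 2 * ((p + 2) * ((1 + d) * Q)) / (2 * κ) := by gcongr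
          _ = _ := by rw [hC₃]; field_simp
      linarith
  · have hG := one_le_gradSize s
    have e1 : d * (C₂ / I.h (n + 1)) ^ 2 * I.β (n + 1) ^ 2 / I.c (n + 1) ^ 2 * gradSize s =
        d * C₂ ^ 2 * (I.β (n + 1) ^ 2 / (I.c (n + 1) * I.h (n + 1)) ^ 2 * gradSize s) := by
      field_simp
    have e2 : 0 ≤ I.β (n + 1) ^ 2 / (I.c (n + 1) * I.h (n + 1)) ^ 2 * gradSize s := by positivity
    have e3 : 0 ≤ I.β (n + 1) * Q := by positivity
    have e4 : 0 ≤ d * C₂ ^ 2 := by positivity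
    rw [e1]
    have e5 := mul_nonneg hC₃0 e2
    have e6 := mul_nonneg e4 e3
    have e7 : (C₃ + d * C₂ ^ 2 + 1) * I.β (n + 1) * Q =
      C₃ * (I.β (n + 1) * Q) + d * C₂ ^ 2 * (I.β (n + 1) * Q) + I.β (n + 1) * Q := by ring
    have e8 : (C₃ + d * C₂ ^ 2 + 1) * (I.β (n + 1) ^ 2 / (I.c (n + 1) * I.h (n + 1)) ^ 2) *
        gradSize s =
      C₃ * (I.β (n + 1) ^ 2 / (I.c (n + 1) * I.h (n + 1)) ^ 2 * gradSize s) +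
      d * C₂ ^ 2 * (I.β (n + 1) ^ 2 / (I.c (n + 1) * I.h (n + 1)) ^ 2 * gradSize s) +
      I.β (n + 1) ^ 2 / (I.c (n + 1) * I.h (n + 1)) ^ 2 * gradSize s := by ring
    rw [e7, e8]
    linarith

end KBSA

/-! ### One step of the tracking errors -/

namespace KBSA

variable {d p : ℕ} {Ξ Ω : Type*} [MeasurableSpace Ξ] [MeasurableSpace Ω]
  {μ : Measure Ξ} [IsProbabilityMeasure μ]
  {M : Problem d p Ξ} {I : Input d p} {f : Vec d → ℝ → ℝ}
  {mbar : (j : Fin p) → Vec d → (Fin ((j : ℕ) + 1) → ℝ) → ℝ → ℝ}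
  {nu : Vec d → ℝ} {lam : Vec d → Vec p} {N : Set (Vec d)} {Xε : Set ℝ} {Λε : Set (Vec p)}
  {B ε Cq εq Cm εm : ℝ} {CK : ℝ}

/-- One step `e - δ + β Z` of a recursive estimator whose target moves by `δ`: if the mean of `Z`
pulls the error `e` back to `0`, then the mean square error contracts. -/
theorem lintegral_sq_step_le {Ψ : Type*} [MeasurableSpace Ψ] {Q : Measure Ψ}
    [IsProbabilityMeasure Q] {Z : Ψ → ℝ} (hZ : MemLp Z 2 Q) {e δ β κ T v : ℝ} (hβ : 0 < β)
    (hβ1 : β ≤ 1) (hκ : 0 < κ) (h1 : e * ∫ x, Z x ∂Q ≤ -κ * e ^ 2 + |e| * T)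
    (h2 : ∫ x, Z x ^ 2 ∂Q ≤ v) :
    ∫⁻ x, ENNReal.ofReal ((e - δ + β * Z x) ^ 2) ∂Q ≤
      ENNReal.ofReal ((1 - κ * β) * e ^ 2 + (2 / κ + 2) * (δ ^ 2 / β) + 2 / κ * β * T ^ 2 +
        2 * β ^ 2 * v) := by
  have i1 : Integrable Z Q := hZ.integrable (by norm_num)
  have i2 : Integrable (fun x => Z x ^ 2) Q := hZ.integrable_sq
  have hexp : ∀ x, (e - δ + β * Z x) ^ 2 =
      (e - δ) ^ 2 + 2 * β * (e - δ) * Z x + β ^ 2 * Z x ^ 2 := fun x => by ring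
  have i3 : Integrable (fun x => (e - δ) ^ 2 + 2 * β * (e - δ) * Z x) Q :=
    (integrable_const _).add (i1.const_mul _)
  have i4 : Integrable (fun x => (e - δ + β * Z x) ^ 2) Q := by
    simp_rw [hexp]
    exact i3.add (i2.const_mul _)
  rw [← ofReal_integral_eq_lintegral_ofReal i4 (Eventually.of_forall fun x => sq_nonneg _)]
  refine ENNReal.ofReal_le_ofReal ?_
  simp_rw [hexp]
  rw [integral_add i3 (i2.const_mul _), integral_add (integrable_const _) (i1.const_mul _),
    integral_const_mul, integral_const_mul]
  simp only [integral_const, probReal_univ, one_smul]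
  have h3 := (sq_integral_le hZ).trans h2
  set ζ := ∫ x, Z x ∂Q
  have e1 : -(2 * e * δ) ≤ κ * β / 2 * e ^ 2 + 2 / κ * (δ ^ 2 / β) := by
    have : κ * β / 2 * e ^ 2 + 2 / κ * (δ ^ 2 / β) + 2 * e * δ =
        (κ * β * e + 2 * δ) ^ 2 / (2 * κ * β) := by field_simp; ring
    have h : 0 ≤ (κ * β * e + 2 * δ) ^ 2 / (2 * κ * β) := by positivity
    linarith
  have e2 : 2 * |e| * T ≤ κ / 2 * e ^ 2 + 2 / κ * T ^ 2 := by
    have : κ / 2 * e ^ 2 + 2 / κ * T ^ 2 - 2 * |e| * T =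
        (κ * |e| - 2 * T) ^ 2 / (2 * κ) := by rw [← sq_abs e]; field_simp; ring
    have h : 0 ≤ (κ * |e| - 2 * T) ^ 2 / (2 * κ) := by positivity
    linarith
  have e3 : -(2 * β * δ * ζ) ≤ β ^ 2 * v + δ ^ 2 := by
    nlinarith [sq_nonneg (β * ζ + δ), mul_le_mul_of_nonneg_left h3 (sq_nonneg β)]
  have e4 : δ ^ 2 ≤ δ ^ 2 / β := le_div_self (sq_nonneg _) hβ hβ1
  have e5 := mul_le_mul_of_nonneg_left h1 (by positivity : 0 ≤ 2 * β)
  have e6 := mul_le_mul_of_nonneg_left e2 hβ.le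
  have e7 := mul_le_mul_of_nonneg_left h2 (sq_nonneg β)
  nlinarith

/-- The parameter after one step; it does not depend on the noise of the step. -/
noncomputable def nextθ (M : Problem d p Ξ) (I : Input d p) (n : ℕ) (s : Iterate d p) : Vec d :=
  proj M.Θ (s.θ - I.α (n + 1) • gradEst M.g s)

theorem stepWith_θ (n : ℕ) (s : Iterate d p) (e : (Ξ × Ξ × Ξ) × Vec d) :
    (stepWith M I n s e).θ = nextθ M I n s := rfl

theorem Setting.nextθ_mem (hset : Setting M μ f mbar nu lam) (hΘ : M.Θ.Nonempty) (n : ℕ)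
    (s : Iterate d p) : nextθ M I n s ∈ M.Θ :=
  (proj_spec hset.convex_Θ hset.compact_Θ.isClosed hΘ _).1

/-- The projection is nonexpansive and the gradient estimate grows at most linearly in the `G`s. -/
theorem Regular.norm_nextθ_sub_sq_le (hset : Setting M μ f mbar nu lam)
    (hreg : Regular M μ f mbar N Xε Λε B ε Cq εq Cm εm) {n : ℕ} {s : Iterate d p}
    (hs : s.θ ∈ M.Θ) :
    ‖nextθ M I n s - s.θ‖ ^ 2 ≤ B ^ 2 * (p + 2) * (I.α (n + 1) ^ 2 * gradSize s) := by
  have h1 : ‖nextθ M I n s - s.θ‖ ≤ ‖I.α (n + 1) • gradEst M.g s‖ := by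
    conv_lhs => rw [← proj_eq_self hset.convex_Θ hset.compact_Θ.isClosed hs]
    refine (norm_proj_sub_proj_le hset.convex_Θ hset.compact_Θ.isClosed ⟨_, hs⟩ _ _).trans_eq ?_
    rw [← norm_neg]; congr 1
    module
  have h2 := norm_gradEst_le hreg.g_smooth hreg.g_bdd s
  have h3 := add_add_sum_sq_le Finset.univ (fun j => ‖s.G j‖) 1 0
  simp only [abs_zero, add_zero, abs_norm, Finset.card_univ, Fintype.card_fin] at h3
  have h4 : (1 : ℝ) ^ 2 + 0 ^ 2 + ∑ j, ‖s.G j‖ ^ 2 ≤ gradSize s := by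
    unfold gradSize; nlinarith [sq_nonneg ‖s.Gnu‖]
  calc _ ≤ ‖I.α (n + 1) • gradEst M.g s‖ ^ 2 := pow_le_pow_left₀ (norm_nonneg _) h1 2
    _ = I.α (n + 1) ^ 2 * ‖gradEst M.g s‖ ^ 2 := by
        rw [norm_smul, mul_pow, Real.norm_eq_abs, sq_abs]
    _ ≤ I.α (n + 1) ^ 2 * (B * (1 + ∑ j, ‖s.G j‖)) ^ 2 := by gcongr
    _ = I.α (n + 1) ^ 2 * B ^ 2 * (1 + ∑ j, ‖s.G j‖) ^ 2 := by ring
    _ ≤ I.α (n + 1) ^ 2 * B ^ 2 * ((p + 2) * gradSize s) := by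
        gcongr
        exact h3.trans (mul_le_mul_of_nonneg_left h4 (by positivity))
    _ = _ := by ring

/-- The error of `ν_n` contracts. -/
theorem Regular.exists_lintegral_nu_step_le (hset : Setting M μ f mbar nu lam)
    (hreg : Regular M μ f mbar N Xε Λε B ε Cq εq Cm εm) (hX : IsOpen Xε) (hXc : Convex ℝ Xε)
    {L : ℝ} (hL : ∀ θ₁ ∈ M.Θ, ∀ θ₂ ∈ M.Θ, |nu θ₁ - nu θ₂| ≤ L * ‖θ₁ - θ₂‖) :
    ∃ C > 0, ∀ (n : ℕ) (D : Measure (Vec d)) [IsProbabilityMeasure D] (s : Iterate d p),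
      s.θ ∈ N → s.θ ∈ M.Θ → s.nu ∈ Xε → nu s.θ ∈ Xε → 0 < I.β (n + 1) → I.β (n + 1) ≤ 1 →
      ∫⁻ z, ENNReal.ofReal (((stepWith M I n s z).nu - nu (stepWith M I n s z).θ) ^ 2)
        ∂((μ.prod (μ.prod μ)).prod D) ≤
      ENNReal.ofReal ((1 - εq * I.β (n + 1)) * (s.nu - nu s.θ) ^ 2 +
        C * (I.α (n + 1) ^ 2 / I.β (n + 1) * gradSize s + I.β (n + 1) ^ 2)) := by
  have hε := hreg.εq_pos
  have hCq := hreg.Cq_pos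
  set C₁ := (2 / εq + 2) * (L ^ 2 * (B ^ 2 * (p + 2))) with hC₁
  have hC₁0 : 0 ≤ C₁ := by positivity
  refine ⟨C₁ + 2 * Cq, by positivity, ?_⟩
  intro n D _ s hθN hθ hν hνθ hβ hβ1
  have mp : MeasurePreserving (fun z : (Ξ × Ξ × Ξ) × Vec d => z.1.1)
      ((μ.prod (μ.prod μ)).prod D) μ := measurePreserving_fst.comp measurePreserving_fst
  set δ := nu (nextθ M I n s) - nu s.θ with hδ
  set Z : Ξ → ℝ := fun ξ => M.q s.θ (M.X s.θ ξ) s.nu with hZ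
  have hZm : Measurable Z := hset.measurable_q_section _ _
  have h0 : ∫⁻ z, ENNReal.ofReal (((stepWith M I n s z).nu - nu (stepWith M I n s z).θ) ^ 2)
      ∂((μ.prod (μ.prod μ)).prod D) =
      ∫⁻ ξ, ENNReal.ofReal (((s.nu - nu s.θ) - δ + I.β (n + 1) * Z ξ) ^ 2) ∂μ := by
    rw [← mp.lintegral_comp (by fun_prop)]
    refine lintegral_congr fun z => ?_
    rw [stepWith_θ]
    have : (stepWith M I n s z).nu = s.nu + I.β (n + 1) * Z z.1.1 := rfl
    rw [this, hδ]
    congr 2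
    ring
  rw [h0]
  have hroot : qbar M μ s.θ (nu s.θ) = 0 := ((hset.nu_root s.θ hθ _).2 rfl).2
  have hdrift : (s.nu - nu s.θ) * ∫ ξ, Z ξ ∂μ ≤
      -εq * (s.nu - nu s.θ) ^ 2 + |s.nu - nu s.θ| * 0 := by
    have := hreg.mul_qbar_sub_le hset hX hXc hθN hνθ hν
    rw [hroot, sub_zero] at this
    rw [mul_zero, add_zero]
    exact this
  refine (lintegral_sq_step_le (hreg.memLp_q hset hθN hν) hβ hβ1 hε hdrift
    (hreg.integral_q_sq_le hset hθN hν) (δ := δ)).trans (ENNReal.ofReal_le_ofReal ?_)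
  have hδ2 : δ ^ 2 ≤ L ^ 2 * (B ^ 2 * (p + 2) * (I.α (n + 1) ^ 2 * gradSize s)) := by
    have h1 := hL _ (hset.nextθ_mem ⟨_, hθ⟩ n s (I := I)) _ hθ
    calc δ ^ 2 = |δ| ^ 2 := (sq_abs _).symm
      _ ≤ (L * ‖nextθ M I n s - s.θ‖) ^ 2 := pow_le_pow_left₀ (abs_nonneg _) h1 2
      _ = L ^ 2 * ‖nextθ M I n s - s.θ‖ ^ 2 := by ring
      _ ≤ _ := by gcongr; exact hreg.norm_nextθ_sub_sq_le hset hθ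
  have hG := one_le_gradSize s
  have h3 : (2 / εq + 2) * (δ ^ 2 / I.β (n + 1)) ≤
      C₁ * (I.α (n + 1) ^ 2 / I.β (n + 1) * gradSize s) := by
    calc _ ≤ (2 / εq + 2) *
          (L ^ 2 * (B ^ 2 * (p + 2) * (I.α (n + 1) ^ 2 * gradSize s)) / I.β (n + 1)) := by gcongr
      _ = _ := by rw [hC₁]; ring
  have h4 : 0 ≤ 2 * Cq * (I.α (n + 1) ^ 2 / I.β (n + 1) * gradSize s) := by positivity
  have h5 : 0 ≤ C₁ * I.β (n + 1) ^ 2 := by positivity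
  nlinarith

/-- The mean of the kernel-weighted output pulls `λ_j` towards the root, up to the errors of the
previous components and of `ν`, and up to the bias of the kernel. -/
theorem Regular.mul_integral_outMK_le (hset : Setting M μ f mbar nu lam)
    (hreg : Regular M μ f mbar N Xε Λε B ε Cq εq Cm εm) (hN : IsOpen N)
    (hX : IsOpen Xε) (hXc : Convex ℝ Xε) (hΛ : IsOpen Λε) (hΛc : Convex ℝ Λε) {K : ℝ → ℝ}
    (hK : KernelBounds K CK) {ρ h ν : ℝ} (hρ : 0 < ρ) (hh : 0 < h) {θ : Vec d} {l : Vec p}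
    (hθN : θ ∈ N) (hθ : θ ∈ M.Θ) (hν : Metric.ball ν ρ ⊆ Xε) (hl : l ∈ Λε) (hνθ : nu θ ∈ Xε)
    (hlθ : lam θ ∈ Λε) (j : Fin p) :
    (l j - lam θ j) * ∫ ξ, outMK M K h j θ l ν ξ ∂μ ≤
      -(ε * εm) * (l j - lam θ j) ^ 2 + |l j - lam θ j| *
        ((pairConst B Cm * |B| + (8 * pairConst B Cm ^ 2 + 4 * pairConst B Cm / ρ ^ 2) * CK) *
          (h ^ 2 + |ν - nu θ| + ∑ i ∈ Finset.univ.filter (· < j), |l i - lam θ i|)) := by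
  have hε := hreg.ε_pos
  have hεm := hreg.εm_pos
  have hP := hreg.pairBounds hset hX hθN hl j
  have hPC := hP.pos
  have hνX : ν ∈ Xε := hν (Metric.mem_ball_self hρ)
  rw [hreg.integral_outMK hset hK hh hθN hl j]
  have hbias := hP.abs_kern_mf_sub_le hK hh hρ hν
  have hf1 := hreg.f_lower θ hθN ν hνX
  have hf2 := hP.f_le ν
  set ψ := ∫ x, kern K h ν x * (mbar j θ (lead j l) x * f θ x)
  set K₃ := (8 * pairConst B Cm ^ 2 + 4 * pairConst B Cm / ρ ^ 2) * CK with hK₃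
  have hK₃0 : 0 ≤ K₃ := by have := hK.pos; positivity
  set m₁ := mbar j θ (lead j l) ν
  set m₂ := mbar j θ (lead j (lam θ)) ν
  have hm3 : mbar j θ (lead j (lam θ)) (nu θ) = 0 := (hset.lam_root θ hθ _).2 rfl j
  have hm2 : |m₂| ≤ |B| * |ν - nu θ| := by
    have := ((hreg.m_smooth_ν j θ hθN _ hlθ).mono
      (hreg.subset_interior_suppX hset hθN)).abs_sub_le hX hXc hνθ hνX
    rw [hm3, sub_zero, Real.norm_eq_abs] at this
    exact this.trans (mul_le_mul_of_nonneg_right (le_abs_self B) (abs_nonneg _))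
  set S := ∑ i ∈ Finset.univ.filter (· < j), |l i - lam θ i| with hS
  have hS0 : 0 ≤ S := Finset.sum_nonneg fun _ _ => abs_nonneg _
  have hm12 : (l j - lam θ j) * (m₁ - m₂) ≤
      -εm * (l j - lam θ j) ^ 2 + |l j - lam θ j| * (|B| * S) := by
    set F : ℝ → ℝ := fun t => mbar j θ (lead j (lam θ + t • (l - lam θ))) ν
    have hpath : ∀ t ∈ Icc (0 : ℝ) 1, lam θ + t • (l - lam θ) ∈ Λε := fun t ht =>
      hΛc.add_smul_sub_mem hlθ hl ht
    have hder : ∀ t ∈ Icc (0 : ℝ) 1, HasDerivAt F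
        (fderiv ℝ (fun z : Vec d × Vec p => mbar j z.1 (lead j z.2) ν)
          (θ, lam θ + t • (l - lam θ)) (0, l - lam θ)) t := fun t ht => by
      have h1 := (hreg.m_smooth_θlam j ν).hasFDerivAt (hN.prod hΛ)
        (x := (θ, lam θ + t • (l - lam θ))) ⟨hθN, hpath t ht⟩
      have h2 : HasDerivAt (fun t : ℝ => (θ, lam θ + t • (l - lam θ))) (0, l - lam θ) t := by
        refine (hasDerivAt_const t θ).prodMk ?_
        have := ((hasDerivAt_id t).smul_const (l - lam θ)).const_add (lam θ)
        simpa using this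
      exact h1.comp_hasDerivAt t h2
    obtain ⟨t, ht, hteq⟩ := exists_hasDerivAt_eq_slope F _ one_pos
      (fun t ht => (hder t ht).continuousAt.continuousWithinAt)
      (fun t ht => hder t (Ioo_subset_Icc_self ht))
    obtain ⟨e, -, -, he3, he4⟩ := hreg.fderiv_mbar_apply hN hΛ j ν hθN
      (hpath t (Ioo_subset_Icc_self ht)) 0 (l - lam θ)
    rw [hteq] at he4
    have hF1 : F 1 = m₁ := by simp only [F, one_smul, add_sub_cancel, m₁]
    have hF0 : F 0 = m₂ := by simp only [F, zero_smul, add_zero, m₂]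
    rw [hF1, hF0, sub_zero, div_one, norm_zero, zero_add] at he4
    have he5 := he3 hνX
    simp only [PiLp.sub_apply] at he4
    rw [← hS] at he4
    have he6 : |m₁ - m₂ - (l j - lam θ j) * e j| ≤ |B| * S :=
      he4.trans (mul_le_mul_of_nonneg_right (le_abs_self B) hS0)
    set a := l j - lam θ j
    calc a * (m₁ - m₂) = e j * a ^ 2 + a * (m₁ - m₂ - a * e j) := by ring
      _ ≤ -εm * a ^ 2 + |a| * (|B| * S) := by
          refine add_le_add (mul_le_mul_of_nonneg_right he5 (sq_nonneg _)) ?_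
          refine (le_abs_self _).trans ?_
          rw [abs_mul]
          exact mul_le_mul_of_nonneg_left he6 (abs_nonneg _)
  set a := l j - lam θ j
  set fv := f θ ν
  have hfv0 : 0 ≤ fv := hε.le.trans hf1
  have e1 : a * (ψ - m₁ * fv) ≤ |a| * (K₃ * h ^ 2) :=
    (le_abs_self _).trans (by rw [abs_mul]; exact mul_le_mul_of_nonneg_left hbias (abs_nonneg _))
  have e2 : a * m₂ ≤ |a| * (|B| * |ν - nu θ|) :=
    (le_abs_self _).trans (by rw [abs_mul]; exact mul_le_mul_of_nonneg_left hm2 (abs_nonneg _))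
  have e3 : fv * (a * m₁) ≤ fv * (-εm * a ^ 2 + |a| * (|B| * (|ν - nu θ| + S))) :=
    mul_le_mul_of_nonneg_left (by linarith) hfv0
  have e4 : fv * (|a| * (|B| * (|ν - nu θ| + S))) ≤
      pairConst B Cm * (|a| * (|B| * (|ν - nu θ| + S))) :=
    mul_le_mul_of_nonneg_right hf2 (by positivity)
  have e5 : ε * (εm * a ^ 2) ≤ fv * (εm * a ^ 2) := mul_le_mul_of_nonneg_right hf1 (by positivity)
  have e6 : 0 ≤ |a| * (K₃ * (|ν - nu θ| + S)) := by positivity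
  have e7 : 0 ≤ |a| * (pairConst B Cm * |B| * h ^ 2) := by positivity
  have e8 : |a| * ((pairConst B Cm * |B| + K₃) * (h ^ 2 + |ν - nu θ| + S)) =
      |a| * (pairConst B Cm * |B| * h ^ 2) + pairConst B Cm * (|a| * (|B| * (|ν - nu θ| + S))) +
        |a| * (K₃ * h ^ 2) + |a| * (K₃ * (|ν - nu θ| + S)) := by ring
  rw [e8]
  linarith

/-- The error of `λ_{j,n}` contracts, up to the errors of the previous components and of `ν_n`. -/
theorem Regular.exists_lintegral_lam_step_le (hset : Setting M μ f mbar nu lam)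
    (hreg : Regular M μ f mbar N Xε Λε B ε Cq εq Cm εm) (hN : IsOpen N)
    (hX : IsOpen Xε) (hXc : Convex ℝ Xε) (hΛ : IsOpen Λε) (hΛc : Convex ℝ Λε)
    (hK : KernelBounds I.K CK) {r : ℝ} (hr : 0 < r)
    {L : ℝ} (hL : ∀ θ₁ ∈ M.Θ, ∀ θ₂ ∈ M.Θ, ‖lam θ₁ - lam θ₂‖ ≤ L * ‖θ₁ - θ₂‖) :
    ∃ C > 0, ∀ (n : ℕ) (D : Measure (Vec d)) [IsProbabilityMeasure D] (s : Iterate d p)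
      (j : Fin p), IsInner N Xε Λε r s → s.θ ∈ M.Θ → nu s.θ ∈ Xε → lam s.θ ∈ Λε →
      0 < I.β (n + 1) → I.β (n + 1) ≤ 1 → 0 < I.h (n + 1) → I.h (n + 1) ≤ 1 →
      ∫⁻ z, ENNReal.ofReal (((stepWith M I n s z).lam j - lam (stepWith M I n s z).θ j) ^ 2)
        ∂((μ.prod (μ.prod μ)).prod D) ≤
      ENNReal.ofReal ((1 - ε * εm * I.β (n + 1)) * (s.lam j - lam s.θ j) ^ 2 +
        C * I.β (n + 1) * ((s.nu - nu s.θ) ^ 2 +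
          ∑ i ∈ Finset.univ.filter (· < j), (s.lam i - lam s.θ i) ^ 2) +
        C * (I.α (n + 1) ^ 2 / I.β (n + 1) * gradSize s + I.β (n + 1) * I.h (n + 1) ^ 4 +
          I.β (n + 1) ^ 2 / I.h (n + 1))) := by
  have hε := hreg.ε_pos
  have hεm := hreg.εm_pos
  have hCm := hreg.Cm_pos
  have hCK := hK.pos
  have hκ : 0 < ε * εm := by positivity
  set C₁ := (2 / (ε * εm) + 2) * (L ^ 2 * (B ^ 2 * (p + 2))) with hC₁
  set C₂ := |CK * Cm * pairConst B Cm + (CK / r) ^ 2 * Cm| with hC₂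
  set C₃ := pairConst B Cm * |B| + (8 * pairConst B Cm ^ 2 + 4 * pairConst B Cm / r ^ 2) * CK
    with hC₃
  set C₄ := 2 / (ε * εm) * (C₃ ^ 2 * (p + 2)) with hC₄
  have hC₁0 : 0 ≤ C₁ := by positivity
  have hC₂0 : 0 ≤ C₂ := abs_nonneg _
  have hC₄0 : 0 ≤ C₄ := by positivity
  refine ⟨C₁ + 2 * C₂ + C₄ + 1, by positivity, ?_⟩
  intro n D _ s j hs hθ hνθ hlθ hβ hβ1 hh hh1
  have hθN : s.θ ∈ N := hs.θ (Metric.mem_ball_self hr)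
  have hl : s.lam ∈ Λε := hs.lam (Metric.mem_ball_self hr)
  have mp : MeasurePreserving (fun z : (Ξ × Ξ × Ξ) × Vec d => z.1.1)
      ((μ.prod (μ.prod μ)).prod D) μ := measurePreserving_fst.comp measurePreserving_fst
  set δ := lam (nextθ M I n s) j - lam s.θ j with hδ
  set Z : Ξ → ℝ := outMK M I.K (I.h (n + 1)) j s.θ s.lam s.nu with hZ
  have hZm : Measurable Z := hset.measurable_outMK hK j
  have h0 : ∫⁻ z, ENNReal.ofReal (((stepWith M I n s z).lam j - lam (stepWith M I n s z).θ j) ^ 2)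
      ∂((μ.prod (μ.prod μ)).prod D) =
      ∫⁻ ξ, ENNReal.ofReal (((s.lam j - lam s.θ j) - δ + I.β (n + 1) * Z ξ) ^ 2) ∂μ := by
    rw [← mp.lintegral_comp (by fun_prop)]
    refine lintegral_congr fun z => ?_
    rw [stepWith_θ]
    have : (stepWith M I n s z).lam j = s.lam j + I.β (n + 1) * Z z.1.1 := rfl
    rw [this, hδ]
    congr 2
    ring
  rw [h0]
  refine (lintegral_sq_step_le (hreg.memLp_outMK hset hK hh hθN hl j) hβ hβ1 hκ
    (hreg.mul_integral_outMK_le hset hN hX hXc hΛ hΛc hK hr hh hθN hθ hs.nu hl hνθ hlθ j)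
    (hreg.integral_outMK_sq_le hset hX hK hh hh1 hθN hl hr hs.nu j) (δ := δ)).trans
    (ENNReal.ofReal_le_ofReal ?_)
  have hδ2 : δ ^ 2 ≤ L ^ 2 * (B ^ 2 * (p + 2) * (I.α (n + 1) ^ 2 * gradSize s)) := by
    have h1 := hL _ (hset.nextθ_mem ⟨_, hθ⟩ n s (I := I)) _ hθ
    have h2 : |δ| ≤ ‖lam (nextθ M I n s) - lam s.θ‖ := by
      have := PiLp.norm_apply_le (lam (nextθ M I n s) - lam s.θ) j
      simpa [hδ] using this
    calc δ ^ 2 = |δ| ^ 2 := (sq_abs _).symm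
      _ ≤ (L * ‖nextθ M I n s - s.θ‖) ^ 2 := pow_le_pow_left₀ (abs_nonneg _) (h2.trans h1) 2
      _ = L ^ 2 * ‖nextθ M I n s - s.θ‖ ^ 2 := by ring
      _ ≤ _ := by gcongr; exact hreg.norm_nextθ_sub_sq_le hset hθ
  have hG := one_le_gradSize s
  have h3 : (2 / (ε * εm) + 2) * (δ ^ 2 / I.β (n + 1)) ≤
      C₁ * (I.α (n + 1) ^ 2 / I.β (n + 1) * gradSize s) := by
    calc _ ≤ (2 / (ε * εm) + 2) *
          (L ^ 2 * (B ^ 2 * (p + 2) * (I.α (n + 1) ^ 2 * gradSize s)) / I.β (n + 1)) := by gcongr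
      _ = _ := by rw [hC₁]; ring
  have hsum := add_add_sum_sq_le (Finset.univ.filter (· < j)) (fun i => s.lam i - lam s.θ i)
    (I.h (n + 1) ^ 2) (s.nu - nu s.θ)
  set Q := (s.nu - nu s.θ) ^ 2 +
    ∑ i ∈ Finset.univ.filter (· < j), (s.lam i - lam s.θ i) ^ 2 with hQ
  have hQ0 : 0 ≤ Q := by positivity
  have hcard : ((Finset.univ.filter (· < j)).card : ℝ) ≤ p := by
    exact_mod_cast (Finset.card_le_univ _).trans_eq (by simp)
  have h4 : 2 / (ε * εm) * I.β (n + 1) * (C₃ * (I.h (n + 1) ^ 2 + |s.nu - nu s.θ| +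
      ∑ i ∈ Finset.univ.filter (· < j), |s.lam i - lam s.θ i|)) ^ 2 ≤
      C₄ * (I.β (n + 1) * Q) + C₄ * (I.β (n + 1) * I.h (n + 1) ^ 4) := by
    calc _ = 2 / (ε * εm) * I.β (n + 1) * C₃ ^ 2 * (I.h (n + 1) ^ 2 + |s.nu - nu s.θ| +
          ∑ i ∈ Finset.univ.filter (· < j), |s.lam i - lam s.θ i|) ^ 2 := by ring
      _ ≤ 2 / (ε * εm) * I.β (n + 1) * C₃ ^ 2 * ((p + 2) * (Q + I.h (n + 1) ^ 4)) := by
          gcongr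
          refine hsum.trans ?_
          rw [hQ]
          have : (I.h (n + 1) ^ 2) ^ 2 + (s.nu - nu s.θ) ^ 2 +
              ∑ i ∈ Finset.univ.filter (· < j), (s.lam i - lam s.θ i) ^ 2 =
              (s.nu - nu s.θ) ^ 2 +
              ∑ i ∈ Finset.univ.filter (· < j), (s.lam i - lam s.θ i) ^ 2 +
              I.h (n + 1) ^ 4 := by ring
          rw [this]
          gcongr
      _ = _ := by rw [hC₄]; ring
  have h5 : 2 * I.β (n + 1) ^ 2 *
      ((CK * Cm * pairConst B Cm + (CK / r) ^ 2 * Cm) / I.h (n + 1)) ≤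
      2 * C₂ * (I.β (n + 1) ^ 2 / I.h (n + 1)) := by
    calc _ ≤ 2 * I.β (n + 1) ^ 2 * (C₂ / I.h (n + 1)) := by
          gcongr; exact le_abs_self _
      _ = _ := by ring
  set x := I.α (n + 1) ^ 2 / I.β (n + 1) * gradSize s
  set y := I.β (n + 1) * I.h (n + 1) ^ 4
  set z := I.β (n + 1) ^ 2 / I.h (n + 1)
  set w := I.β (n + 1) * Q with hw
  have hx : 0 ≤ x := by positivity
  have hy : 0 ≤ y := by positivity
  have hz : 0 ≤ z := by positivity
  have hw0 : 0 ≤ w := by positivity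
  rw [mul_assoc _ (I.β (n + 1)) Q, ← hw]
  have k1 : C₁ * x + C₄ * w + C₄ * y + 2 * C₂ * z ≤
      (C₁ + 2 * C₂ + C₄ + 1) * w + (C₁ + 2 * C₂ + C₄ + 1) * (x + y + z) := by
    have := mul_nonneg hC₁0 hw0
    have := mul_nonneg hC₂0 hw0
    have := mul_nonneg hC₁0 (add_nonneg hy hz)
    have := mul_nonneg hC₂0 (add_nonneg hx hy)
    have := mul_nonneg hC₄0 (add_nonneg hx hz)
    linarith
  linarith

end KBSA

/-! ### The mean-square recursions along a run -/

namespace KBSA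

/-- A triangular system of contracting recursions, with a small coupling `γ` between all components:
a weighted sum of the components satisfies a scalar contracting recursion. -/
theorem exists_eventually_sum_le_mul {p : ℕ} {x R β γ : ℕ → ℝ} {y : ℕ → Fin p → ℝ} {κ C : ℝ}
    (hκ : 0 < κ) (hC : 0 ≤ C) (hx : ∀ n, 0 ≤ x n) (hy : ∀ n j, 0 ≤ y n j) (hR : ∀ n, 0 < R n)
    (hβ : ∀ n, 0 < β n) (hβ0 : Tendsto β atTop (𝓝 0)) (hγ : Tendsto γ atTop (𝓝 0))
    (hRslow : ∀ c > 0, ∀ᶠ n in atTop, R n ≤ (1 + c * β n) * R (n + 1))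
    (hxrec : ∀ᶠ n in atTop, x (n + 1) ≤ (1 - κ * β n) * x n + C * β n * R n +
      C * (β n * γ n) * (R n + x n + ∑ j, y n j))
    (hyrec : ∀ᶠ n in atTop, ∀ j, y (n + 1) j ≤ (1 - κ * β n) * y n j +
      C * β n * (R n + x n + ∑ i ∈ Finset.univ.filter (· < j), y n i) +
      C * (β n * γ n) * (R n + x n + ∑ j, y n j)) :
    ∃ A, 0 ≤ A ∧ ∀ᶠ n in atTop, x n + ∑ j, y n j ≤ A * R n := by
  obtain ⟨w, hw, htri⟩ := exists_triangular_weights p (half_pos hκ) hC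
  set ω := ∑ j, w j with hω
  have hω0 : 0 ≤ ω := Finset.sum_nonneg fun j _ => (hw j).le
  set W := 1 + 2 * C * ω / κ with hW
  have hW1 : 1 ≤ W := by rw [hW]; have : 0 ≤ 2 * C * ω / κ := by positivity
                         linarith
  have hWκ : ω * C ≤ κ / 2 * W := by
    have : κ / 2 * W = κ / 2 + C * ω := by rw [hW]; field_simp
    rw [this]; linarith [hκ]
  set V : ℕ → ℝ := fun n => W * x n + ∑ j, w j * y n j with hV
  have hV0 : ∀ n, 0 ≤ V n := fun n =>
    add_nonneg (mul_nonneg (by linarith) (hx n))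
      (Finset.sum_nonneg fun j _ => mul_nonneg (hw j).le (hy n j))
  set m := 1 + ∑ j, 1 / w j with hm
  have hm0 : 0 < m := by
    have : 0 ≤ ∑ j, 1 / w j := Finset.sum_nonneg fun j _ => (div_pos one_pos (hw j)).le
    linarith
  have hmV : ∀ n, x n + ∑ j, y n j ≤ m * V n := fun n => by
    have h1 : x n ≤ V n := by
      have : 0 ≤ ∑ j, w j * y n j := Finset.sum_nonneg fun j _ => mul_nonneg (hw j).le (hy n j)
      have := mul_le_mul_of_nonneg_right hW1 (hx n)
      simp only [hV]; linarith
    have h2 : ∑ j, y n j ≤ (∑ j, 1 / w j) * V n := by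
      rw [Finset.sum_mul]
      refine Finset.sum_le_sum fun j _ => ?_
      have h3 : w j * y n j ≤ V n := by
        have := Finset.single_le_sum (f := fun j => w j * y n j)
          (fun j _ => mul_nonneg (hw j).le (hy n j)) (Finset.mem_univ j)
        have h4 : 0 ≤ W * x n := mul_nonneg (by linarith) (hx n)
        simp only [hV]; linarith
      calc y n j = 1 / w j * (w j * y n j) := by have := (hw j).ne'; field_simp
        _ ≤ _ := mul_le_mul_of_nonneg_left h3 (div_pos one_pos (hw j)).le
    rw [hm, add_mul, one_mul]; linarith
  set η := κ / (4 * ((W + ω) * (C + 1) * m)) with hη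
  have hη0 : 0 < η := by positivity
  obtain ⟨A, hA, hAV⟩ := exists_eventually_le_mul (a := V) (R := R) (β := β) (c := κ / 4)
    (C := 2 * (W + ω) * C) (by positivity) hV0 hR hβ hβ0 (hRslow _ (by positivity)) (by
      filter_upwards [hxrec, hyrec, hγ.eventually_lt_const hη0, hγ.eventually_lt_const one_pos]
        with n h1 h2 h3 h4
      set T := R n + x n + ∑ j, y n j with hT
      have hβn := hβ n
      have hVn := hV0 n
      have hRn := hR n
      have e1 : ∑ j, w j * y (n + 1) j ≤ (1 - κ * β n) * ∑ j, w j * y n j +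
          ω * (C * β n * (R n + x n)) +
          β n * ∑ j, w j * (C * ∑ i ∈ Finset.univ.filter (· < j), y n i) +
          ω * (C * (β n * γ n) * T) := by
        rw [hω, Finset.sum_mul, Finset.sum_mul, Finset.mul_sum, Finset.mul_sum,
          ← Finset.sum_add_distrib, ← Finset.sum_add_distrib, ← Finset.sum_add_distrib]
        refine Finset.sum_le_sum fun j _ => ?_
        refine (mul_le_mul_of_nonneg_left (h2 j) (hw j).le).trans_eq ?_
        ring
      have e2 := htri (y n) (hy n)
      have e3 : C * (β n * γ n) * T ≤ C * β n * R n + C * β n * (η * (m * V n)) := by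
        have hTle : T ≤ R n + m * V n := by have := hmV n; rw [hT]; linarith
        have hT0 : 0 ≤ T := by
          have := Finset.sum_nonneg fun (j : Fin p) (_ : j ∈ Finset.univ) => hy n j
          have := hx n
          rw [hT]; linarith
        have hs0 : 0 ≤ x n + ∑ j, y n j := by
          have := Finset.sum_nonneg fun (j : Fin p) (_ : j ∈ Finset.univ) => hy n j
          have := hx n
          linarith
        have k1 : γ n * R n ≤ 1 * R n := mul_le_mul_of_nonneg_right h4.le hRn.le
        have k2 : γ n * (x n + ∑ j, y n j) ≤ η * (m * V n) :=
          mul_le_mul h3.le (hmV n) hs0 hη0.le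
        have k3 : γ n * T ≤ R n + η * (m * V n) := by
          rw [hT]; linarith
        calc C * (β n * γ n) * T = C * β n * (γ n * T) := by ring
          _ ≤ C * β n * (R n + η * (m * V n)) := by gcongr
          _ = _ := by ring
      have e4 : (W + ω) * (C * β n * (η * (m * V n))) ≤ κ / 4 * (β n * V n) := by
        have : (W + ω) * (C + 1) * m * η = κ / 4 := by rw [hη]; field_simp
        have k : 0 ≤ (W + ω) * m * η * (β n * V n) := by positivity
        rw [← this]
        nlinarith
      have e5 := mul_le_mul_of_nonneg_left h1 (by linarith : 0 ≤ W)
      have e6 := mul_le_mul_of_nonneg_left e2 hβn.le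
      have e7 := mul_le_mul_of_nonneg_left e3 (by linarith : 0 ≤ W + ω)
      have e8 := mul_le_mul_of_nonneg_right hWκ (mul_nonneg hβn.le (hx n))
      have eV : V n = W * x n + ∑ j, w j * y n j := rfl
      have eV' : V (n + 1) = W * x (n + 1) + ∑ j, w j * y (n + 1) j := rfl
      have f1 : β n * V n = β n * (W * x n) + β n * ∑ j, w j * y n j := by rw [eV]; ring
      have f2 : V (n + 1) ≤ V n - κ / 2 * (β n * V n) + κ / 4 * (β n * V n) +
          2 * (W + ω) * C * β n * R n := by
        rw [eV']
        set Y := ∑ j, w j * y n j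
        set U := ∑ j, w j * (C * ∑ i ∈ Finset.univ.filter (· < j), y n i)
        rw [f1] at e4 ⊢
        rw [eV]
        linarith
      linarith)
  refine ⟨m * A, by positivity, ?_⟩
  filter_upwards [hAV] with n hn
  calc _ ≤ m * V n := hmV n
    _ ≤ m * (A * R n) := by gcongr
    _ = _ := by ring

/-- The standing hypotheses on a run, with the neighbourhood and the constants fixed, and with the
root functions measurable and bounded. -/
structure IsRegularRun {d p : ℕ} {Ξ Ω : Type*} [MeasurableSpace Ξ] [MeasurableSpace Ω]
    (μ : Measure Ξ) [IsProbabilityMeasure μ] (P : Measure Ω)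
    (M : Problem d p Ξ) (I : Input d p) (W : Noise d Ξ Ω) (f : Vec d → ℝ → ℝ)
    (mbar : (j : Fin p) → Vec d → (Fin ((j : ℕ) + 1) → ℝ) → ℝ → ℝ)
    (nu : Vec d → ℝ) (lam : Vec d → Vec p) (N : Set (Vec d)) (Xε : Set ℝ) (Λε : Set (Vec p))
    (B ε Cq εq Cm εm CK r L : ℝ) : Prop where
  setting : Setting M μ f mbar nu lam
  sampling : IsSampling μ P W
  nhd : IsUniformNhd M P I W nu lam N Xε Λε
  regular : Regular M μ f mbar N Xε Λε B ε Cq εq Cm εm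
  direction : DirectionAssumption P W
  steps : StepAssumption I
  kernel : KernelBounds I.K CK
  nonempty : M.Θ.Nonempty
  r_pos : 0 < r
  inner : ∀ᵐ ω ∂P, ∀ n, IsInner N Xε Λε r (iter M I W n ω)
  measurable_nu : Measurable nu
  measurable_lam : Measurable lam
  bdd : ∀ θ, |nu θ| ≤ L ∧ ‖lam θ‖ ≤ L
  lipschitz_nu : ∀ θ₁ ∈ M.Θ, ∀ θ₂ ∈ M.Θ, |nu θ₁ - nu θ₂| ≤ L * ‖θ₁ - θ₂‖
  lipschitz_lam : ∀ θ₁ ∈ M.Θ, ∀ θ₂ ∈ M.Θ, ‖lam θ₁ - lam θ₂‖ ≤ L * ‖θ₁ - θ₂‖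

namespace IsRegularRun

variable {d p : ℕ} {Ξ Ω : Type*} [MeasurableSpace Ξ] [MeasurableSpace Ω]
  {μ : Measure Ξ} [IsProbabilityMeasure μ] {P : Measure Ω} [IsProbabilityMeasure P]
  {M : Problem d p Ξ} {I : Input d p} {W : Noise d Ξ Ω} {f : Vec d → ℝ → ℝ}
  {mbar : (j : Fin p) → Vec d → (Fin ((j : ℕ) + 1) → ℝ) → ℝ → ℝ}
  {nu : Vec d → ℝ} {lam : Vec d → Vec p} {N : Set (Vec d)} {Xε : Set ℝ} {Λε : Set (Vec p)}
  {B ε Cq εq Cm εm CK r L : ℝ}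

theorem isProbabilityMeasure_direction (hW : IsSampling μ P W) (n : ℕ) :
    IsProbabilityMeasure (P.map (W.Δ n)) :=
  Measure.isProbabilityMeasure_map (hW.measurable_Δ n).aemeasurable

theorem measurable_iter (hR : IsRegularRun μ P M I W f mbar nu lam N Xε Λε B ε Cq εq Cm εm CK r L)
    (n : ℕ) : Measurable (iter M I W n) :=
  hR.setting.measurable_iter hR.nonempty hR.regular.g_smooth hR.kernel.cont hR.sampling n

/-- A bound on the mean of a functional after one step, conditionally on the current iterate,
integrates to a bound on its mean. -/
theorem integral_succ_le
    (hR : IsRegularRun μ P M I W f mbar nu lam N Xε Λε B ε Cq εq Cm εm CK r L) (n : ℕ)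
    {F H : Iterate d p → ℝ} (hF : Measurable F) (hF0 : ∀ s, 0 ≤ F s)
    (hHi : Integrable (fun ω => H (iter M I W n ω)) P)
    (hH0 : ∀ᵐ ω ∂P, 0 ≤ H (iter M I W n ω))
    (hstep : ∀ᵐ ω ∂P, ∫⁻ z, ENNReal.ofReal (F (stepWith M I n (iter M I W n ω) z))
      ∂((μ.prod (μ.prod μ)).prod (P.map (W.Δ (n + 1)))) ≤ ENNReal.ofReal (H (iter M I W n ω))) :
    Integrable (fun ω => F (iter M I W (n + 1) ω)) P ∧
      ∫ ω, F (iter M I W (n + 1) ω) ∂P ≤ ∫ ω, H (iter M I W n ω) ∂P := by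
  have h1 := hR.setting.lintegral_iter_stepNoise hR.nonempty hR.regular.g_smooth hR.kernel.cont
    hR.sampling n (F := fun z => ENNReal.ofReal (F (stepWith M I n z.1 z.2)))
    (hF.comp (hR.setting.measurable_stepWith hR.nonempty hR.regular.g_smooth
      hR.kernel.cont n)).ennreal_ofReal
  have h2 : ∫⁻ ω, ENNReal.ofReal (F (iter M I W (n + 1) ω)) ∂P ≤
      ENNReal.ofReal (∫ ω, H (iter M I W n ω) ∂P) := by
    rw [ofReal_integral_eq_lintegral_ofReal hHi hH0]
    exact h1.trans_le (lintegral_mono_ae hstep)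
  have hm : AEStronglyMeasurable (fun ω => F (iter M I W (n + 1) ω)) P :=
    (hF.comp (hR.measurable_iter (n + 1))).aestronglyMeasurable
  exact ⟨integrable_of_lintegral_le hm (fun _ => hF0 _) h2,
    integral_le_of_lintegral_le hm (fun _ => hF0 _) (integral_nonneg_of_ae hH0) h2⟩

/-- Almost surely, the points perturbed in a fresh random direction lie in the neighbourhoods. -/
theorem ae_perturbed (hR : IsRegularRun μ P M I W f mbar nu lam N Xε Λε B ε Cq εq Cm εm CK r L)
    (n : ℕ) : ∀ᵐ ω ∂P, ∀ᵐ Δ ∂(P.map (W.Δ (n + 1))), ∀ σ ∈ ({1, -1} : Set ℝ),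
      pertθ σ (I.c (n + 1)) Δ (iter M I W n ω) ∈ N ∧
      pertNu σ (I.c (n + 1)) Δ (iter M I W n ω) ∈ Xε ∧
      pertLam σ (I.c (n + 1)) Δ (iter M I W n ω) ∈ Λε := by
  have := isProbabilityMeasure_direction hR.sampling (n + 1)
  set S : Set (Iterate d p × ((Ξ × Ξ × Ξ) × Vec d)) := {z | ∀ σ ∈ ({1, -1} : Set ℝ),
      pertθ σ (I.c (n + 1)) z.2.2 z.1 ∈ N ∧ pertNu σ (I.c (n + 1)) z.2.2 z.1 ∈ Xε ∧
      pertLam σ (I.c (n + 1)) z.2.2 z.1 ∈ Λε} with hS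
  have hSm : MeasurableSet S := by
    have : S = ⋂ σ ∈ ({1, -1} : Set ℝ), {z : Iterate d p × ((Ξ × Ξ × Ξ) × Vec d) |
      pertθ σ (I.c (n + 1)) z.2.2 z.1 ∈ N ∧ pertNu σ (I.c (n + 1)) z.2.2 z.1 ∈ Xε ∧
      pertLam σ (I.c (n + 1)) z.2.2 z.1 ∈ Λε} := by
      ext z; simp only [hS, Set.mem_ofPred_eq, mem_iInter]
    rw [this]
    refine MeasurableSet.biInter (Set.toFinite _).countable fun σ _ => ?_
    have hΔ : Measurable (fun z : Iterate d p × ((Ξ × Ξ × Ξ) × Vec d) => z.2.2) := by fun_prop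
    exact ((measurable_pertθ measurable_fst hΔ _ _) hR.nhd.open_N.measurableSet).inter
      (((measurable_pertNu measurable_fst hΔ _ _) hR.nhd.open_X.measurableSet).inter
        ((measurable_pertLam measurable_fst hΔ _ _) hR.nhd.open_Λ.measurableSet))
  have h1 := hR.setting.ae_ae_of_ae_iter_stepNoise hR.nonempty hR.regular.g_smooth hR.kernel.cont
    hR.sampling n hSm (by
      filter_upwards [hR.nhd.perturbed] with ω hω
      exact hω n)
  filter_upwards [h1] with ω hω
  have hmap : (P.map (W.Δ (n + 1))) =
      ((μ.prod (μ.prod μ)).prod (P.map (W.Δ (n + 1)))).map Prod.snd :=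
    measurePreserving_snd.map_eq.symm
  rw [hmap, ae_map_iff measurable_snd.aemeasurable]
  · exact hω
  · exact (show Measurable (fun Δ : Vec d => (iter M I W n ω, ((stepNoise W n ω).1, Δ))) by
      fun_prop) hSm

end IsRegularRun

end KBSA

/-! ### Second moments along a run -/

namespace KBSA

theorem lintegral_sq_add_mul_le {Ψ : Type*} [MeasurableSpace Ψ] {Q : Measure Ψ}
    [IsProbabilityMeasure Q] {Z : Ψ → ℝ} {a β v : ℝ} (hv : 0 ≤ v)
    (h : ∫⁻ x, ENNReal.ofReal (Z x ^ 2) ∂Q ≤ ENNReal.ofReal v) :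
    ∫⁻ x, ENNReal.ofReal ((a + β * Z x) ^ 2) ∂Q ≤ ENNReal.ofReal (2 * a ^ 2 + 2 * β ^ 2 * v) := by
  calc _ ≤ ∫⁻ x, (ENNReal.ofReal (2 * a ^ 2) + ENNReal.ofReal (2 * β ^ 2) *
        ENNReal.ofReal (Z x ^ 2)) ∂Q := by
        refine lintegral_mono fun x => ?_
        rw [← ENNReal.ofReal_mul (by positivity), ← ENNReal.ofReal_add (by positivity)
          (by positivity)]
        refine ENNReal.ofReal_le_ofReal ?_
        nlinarith [sq_nonneg (a - β * Z x)]
    _ ≤ _ := by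
        rw [lintegral_add_left measurable_const, lintegral_const_mul' _ _ ENNReal.ofReal_ne_top,
          lintegral_const, measure_univ, mul_one, ENNReal.ofReal_add (by positivity)
          (by positivity), ENNReal.ofReal_mul (p := 2 * β ^ 2) (by positivity)]
        gcongr

namespace IsRegularRun

variable {d p : ℕ} {Ξ Ω : Type*} [MeasurableSpace Ξ] [MeasurableSpace Ω]
  {μ : Measure Ξ} [IsProbabilityMeasure μ] {P : Measure Ω} [IsProbabilityMeasure P]
  {M : Problem d p Ξ} {I : Input d p} {W : Noise d Ξ Ω} {f : Vec d → ℝ → ℝ}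
  {mbar : (j : Fin p) → Vec d → (Fin ((j : ℕ) + 1) → ℝ) → ℝ → ℝ}
  {nu : Vec d → ℝ} {lam : Vec d → Vec p} {N : Set (Vec d)} {Xε : Set ℝ} {Λε : Set (Vec p)}
  {B ε Cq εq Cm εm CK r L : ℝ}

theorem measurable_norm_sq_G (j : Fin p) : Measurable (fun s : Iterate d p => ‖s.G j‖ ^ 2) :=
  (((measurable_pi_apply j).comp Iterate.measurable_G).norm).pow_const 2

theorem measurable_norm_sq_Gnu : Measurable (fun s : Iterate d p => ‖s.Gnu‖ ^ 2) :=
  Iterate.measurable_Gnu.norm.pow_const 2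

theorem integrable_gradSize_of {n : ℕ}
    (h1 : Integrable (fun ω => ‖(iter M I W n ω).Gnu‖ ^ 2) P)
    (h2 : ∀ j, Integrable (fun ω => ‖(iter M I W n ω).G j‖ ^ 2) P) :
    Integrable (fun ω => gradSize (iter M I W n ω)) P := by
  unfold gradSize
  exact ((integrable_const _).add h1).add (integrable_finsetSum _ fun j _ => h2 j)

theorem integrable_G (hR : IsRegularRun μ P M I W f mbar nu lam N Xε Λε B ε Cq εq Cm εm CK r L)
    (n : ℕ) : Integrable (fun ω => ‖(iter M I W n ω).Gnu‖ ^ 2) P ∧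
      ∀ j, Integrable (fun ω => ‖(iter M I W n ω).G j‖ ^ 2) P := by
  induction n with
  | zero => exact ⟨integrable_const (‖I.init.Gnu‖ ^ 2), fun j => integrable_const (‖I.init.G j‖ ^ 2)⟩
  | succ n ih =>
    have hβ := hR.steps.β_pos (n + 1) (by omega)
    have hc := hR.steps.c_pos (n + 1) (by omega)
    have hh := hR.steps.h_pos (n + 1) (by omega)
    have hD := hR.direction.isDirectionLaw hR.sampling n
    have := isProbabilityMeasure_direction hR.sampling (n + 1)
    have hi := integrable_gradSize_of ih.1 ih.2
    have hCq := hR.regular.Cq_pos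
    have hCm := hR.regular.Cm_pos
    refine ⟨?_, fun j => ?_⟩
    · refine (hR.integral_succ_le n (F := fun s => ‖s.Gnu‖ ^ 2) (H := fun s =>
        (1 + I.β (n + 1)) * ‖s.Gnu‖ ^ 2 +
        (I.β (n + 1) + d * I.β (n + 1) ^ 2) * Cq / I.c (n + 1) ^ 2 * gradSize s)
        measurable_norm_sq_Gnu (fun _ => sq_nonneg _)
        ((ih.1.const_mul _).add (hi.const_mul _)) (ae_of_all _ fun ω => ?_) ?_).1
      · have := one_le_gradSize (iter M I W n ω)
        positivity
      · filter_upwards [hR.ae_perturbed n] with ω hω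
        refine hR.regular.lintegral_Gnu_step_le_crude hR.setting hD hβ hc ?_
        filter_upwards [hω] with Δ hΔ σ hσ
        exact ⟨(hΔ σ hσ).1, (hΔ σ hσ).2.1⟩
    · refine (hR.integral_succ_le n (F := fun s => ‖s.G j‖ ^ 2) (H := fun s =>
        (1 + I.β (n + 1)) * ‖s.G j‖ ^ 2 +
        (I.β (n + 1) + d * I.β (n + 1) ^ 2) * ((CK / I.h (n + 1)) ^ 2 * (Cm + 1)) ^ 2 /
          I.c (n + 1) ^ 2 * gradSize s)
        (measurable_norm_sq_G j) (fun _ => sq_nonneg _)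
        (((ih.2 j).const_mul _).add (hi.const_mul _)) (ae_of_all _ fun ω => ?_) ?_).1
      · have := one_le_gradSize (iter M I W n ω)
        positivity
      · filter_upwards [hR.ae_perturbed n] with ω hω
        refine hR.regular.lintegral_G_step_le_crude hR.setting hR.kernel hD hβ hc hh j ?_
        filter_upwards [hω] with Δ hΔ σ hσ
        exact ⟨(hΔ σ hσ).1, (hΔ σ hσ).2.2⟩

theorem integrable_gradSize
    (hR : IsRegularRun μ P M I W f mbar nu lam N Xε Λε B ε Cq εq Cm εm CK r L) (n : ℕ) :
    Integrable (fun ω => gradSize (iter M I W n ω)) P :=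
  integrable_gradSize_of (hR.integrable_G n).1 (hR.integrable_G n).2

theorem integral_gradSize
    (hR : IsRegularRun μ P M I W f mbar nu lam N Xε Λε B ε Cq εq Cm εm CK r L) (n : ℕ) :
    ∫ ω, gradSize (iter M I W n ω) ∂P = 1 + ∫ ω, ‖(iter M I W n ω).Gnu‖ ^ 2 ∂P +
      ∑ j, ∫ ω, ‖(iter M I W n ω).G j‖ ^ 2 ∂P := by
  obtain ⟨h1, h2⟩ := hR.integrable_G n
  unfold gradSize
  have h3 : Integrable (fun ω => 1 + ‖(iter M I W n ω).Gnu‖ ^ 2) P := (integrable_const _).add h1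
  rw [integral_add h3 (integrable_finsetSum _ fun j _ => h2 j), integral_add (integrable_const _) h1,
    integral_finsetSum _ fun j _ => h2 j]
  simp

theorem integrable_sq (hR : IsRegularRun μ P M I W f mbar nu lam N Xε Λε B ε Cq εq Cm εm CK r L)
    (n : ℕ) : Integrable (fun ω => (iter M I W n ω).nu ^ 2) P ∧
      ∀ j, Integrable (fun ω => (iter M I W n ω).lam j ^ 2) P := by
  induction n with
  | zero => exact ⟨integrable_const (I.init.nu ^ 2), fun j => integrable_const (I.init.lam j ^ 2)⟩
  | succ n ih =>
    have hh := hR.steps.h_pos (n + 1) (by omega)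
    have := isProbabilityMeasure_direction hR.sampling (n + 1)
    have hCq := hR.regular.Cq_pos
    have hCm := hR.regular.Cm_pos
    have mp : MeasurePreserving (fun z : (Ξ × Ξ × Ξ) × Vec d => z.1.1)
      ((μ.prod (μ.prod μ)).prod (P.map (W.Δ (n + 1)))) μ :=
      measurePreserving_fst.comp measurePreserving_fst
    refine ⟨?_, fun j => ?_⟩
    · refine (hR.integral_succ_le n (F := fun s => s.nu ^ 2) (H := fun s =>
        2 * s.nu ^ 2 + 2 * I.β (n + 1) ^ 2 * Cq)
        (Iterate.measurable_nu.pow_const 2) (fun _ => sq_nonneg _)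
        ((ih.1.const_mul _).add (integrable_const _)) (ae_of_all _ fun ω => by positivity) ?_).1
      filter_upwards [hR.inner] with ω hω
      have hs := hω n
      set s := iter M I W n ω
      have hZm : Measurable (fun ξ => M.q s.θ (M.X s.θ ξ) s.nu) :=
        hR.setting.measurable_q_section _ _
      refine (mp.lintegral_comp (f := fun ξ => ENNReal.ofReal
        ((s.nu + I.β (n + 1) * M.q s.θ (M.X s.θ ξ) s.nu) ^ 2)) (by fun_prop)).trans_le ?_
      exact lintegral_sq_add_mul_le hCq.le (hR.regular.q_moment _
        (hs.θ (Metric.mem_ball_self hR.r_pos)) _ (hs.nu (Metric.mem_ball_self hR.r_pos)))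
    · refine (hR.integral_succ_le n (F := fun s => s.lam j ^ 2) (H := fun s =>
        2 * s.lam j ^ 2 + 2 * I.β (n + 1) ^ 2 * ((CK / I.h (n + 1)) ^ 2 * Cm))
        ((measurable_coord Iterate.measurable_lam j).pow_const 2) (fun _ => sq_nonneg _)
        (((ih.2 j).const_mul _).add (integrable_const _)) (ae_of_all _ fun ω => by positivity) ?_).1
      filter_upwards [hR.inner] with ω hω
      have hs := hω n
      set s := iter M I W n ω
      have hZm : Measurable (outMK M I.K (I.h (n + 1)) j s.θ s.lam s.nu) :=
        hR.setting.measurable_outMK hR.kernel j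
      refine (mp.lintegral_comp (f := fun ξ => ENNReal.ofReal
        ((s.lam j + I.β (n + 1) * outMK M I.K (I.h (n + 1)) j s.θ s.lam s.nu ξ) ^ 2))
        (by fun_prop)).trans_le ?_
      exact lintegral_sq_add_mul_le (by positivity) (hR.regular.lintegral_outMK_sq_le' hR.kernel hh
        (hs.θ (Metric.mem_ball_self hR.r_pos)) (hs.lam (Metric.mem_ball_self hR.r_pos)) j)

theorem memLp_nu_error
    (hR : IsRegularRun μ P M I W f mbar nu lam N Xε Λε B ε Cq εq Cm εm CK r L) (n : ℕ) :
    MemLp (fun ω => (iter M I W n ω).nu - nu (iter M I W n ω).θ) 2 P := by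
  have hm := hR.measurable_iter n
  refine MemLp.sub ((memLp_two_iff_integrable_sq
    (Iterate.measurable_nu.comp hm).aestronglyMeasurable).2 (hR.integrable_sq n).1) ?_
  exact MemLp.of_bound (hR.measurable_nu.comp
    (Iterate.measurable_θ.comp hm)).aestronglyMeasurable L (ae_of_all _ fun ω => (hR.bdd _).1)

theorem memLp_lam_error
    (hR : IsRegularRun μ P M I W f mbar nu lam N Xε Λε B ε Cq εq Cm εm CK r L) (n : ℕ) (j : Fin p) :
    MemLp (fun ω => (iter M I W n ω).lam j - lam (iter M I W n ω).θ j) 2 P := by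
  have hm := hR.measurable_iter n
  refine MemLp.sub ((memLp_two_iff_integrable_sq
    (measurable_coord (Iterate.measurable_lam.comp hm) j).aestronglyMeasurable).2
    ((hR.integrable_sq n).2 j)) ?_
  refine MemLp.of_bound (measurable_coord (hR.measurable_lam.comp
    (Iterate.measurable_θ.comp hm)) j).aestronglyMeasurable L (ae_of_all _ fun ω => ?_)
  exact (PiLp.norm_apply_le _ j).trans (hR.bdd _).2

theorem tendsto_β (hR : IsRegularRun μ P M I W f mbar nu lam N Xε Λε B ε Cq εq Cm εm CK r L) :
    Tendsto (fun n => I.β (n + 1)) atTop (𝓝 0) := by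
  have h : Tendsto (fun n => I.c n ^ 2 * I.h n ^ 2) atTop (𝓝 0) := by
    simpa using (hR.steps.c_lim.pow 2).mul (hR.steps.h_lim.pow 2)
  exact (hR.steps.β_small.isBigO.trans_tendsto h).comp (tendsto_add_atTop_nat 1)

/-- The variance of a gradient estimate, relative to its contraction, tends to `0`. -/
theorem tendsto_γ (hR : IsRegularRun μ P M I W f mbar nu lam N Xε Λε B ε Cq εq Cm εm CK r L) :
    Tendsto (fun n => I.β (n + 1) / (I.c (n + 1) * I.h (n + 1)) ^ 2) atTop (𝓝 0) := by
  have := hR.steps.β_small.tendsto_div_nhds_zero.comp (tendsto_add_atTop_nat 1)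
  refine this.congr fun n => ?_
  simp only [Function.comp_apply, mul_pow]

theorem eventually_c_mul_le
    (hR : IsRegularRun μ P M I W f mbar nu lam N Xε Λε B ε Cq εq Cm εm CK r L) (a : ℝ) {η : ℝ}
    (hη : 0 < η) : ∀ᶠ n in atTop, I.c (n + 1) * a ≤ η := by
  have h := (hR.steps.c_lim.comp (tendsto_add_atTop_nat 1)).mul_const a
  rw [zero_mul] at h
  exact (h.eventually_lt_const hη).mono fun _ hn => le_of_lt hn

theorem eventually_h_le
    (hR : IsRegularRun μ P M I W f mbar nu lam N Xε Λε B ε Cq εq Cm εm CK r L) {η : ℝ}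
    (hη : 0 < η) : ∀ᶠ n in atTop, I.h (n + 1) ≤ η :=
  ((hR.steps.h_lim.comp (tendsto_add_atTop_nat 1)).eventually_lt_const hη).mono
    fun _ hn => le_of_lt hn

theorem eventually_β_le
    (hR : IsRegularRun μ P M I W f mbar nu lam N Xε Λε B ε Cq εq Cm εm CK r L) {η : ℝ}
    (hη : 0 < η) : ∀ᶠ n in atTop, I.β (n + 1) ≤ η :=
  (hR.tendsto_β.eventually_lt_const hη).mono fun _ hn => le_of_lt hn

theorem eventually_integral_Gnu_succ_le
    (hR : IsRegularRun μ P M I W f mbar nu lam N Xε Λε B ε Cq εq Cm εm CK r L) :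
    ∀ᶠ n in atTop, ∫ ω, ‖(iter M I W (n + 1) ω).Gnu‖ ^ 2 ∂P ≤
      (1 - εq * I.β (n + 1)) * ∫ ω, ‖(iter M I W n ω).Gnu‖ ^ 2 ∂P + B ^ 2 * d / εq * I.β (n + 1) +
      d * Cq * (I.β (n + 1) * (I.β (n + 1) / (I.c (n + 1) * I.h (n + 1)) ^ 2)) *
        (1 + ∫ ω, ‖(iter M I W n ω).Gnu‖ ^ 2 ∂P + ∑ j, ∫ ω, ‖(iter M I W n ω).G j‖ ^ 2 ∂P) := by
  have hεq := hR.regular.εq_pos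
  have hCq := hR.regular.Cq_pos
  filter_upwards [hR.eventually_c_mul_le (4 * (1 + d) * (1 + p)) hR.r_pos,
    hR.eventually_h_le one_pos, hR.eventually_β_le (one_div_pos.2 hεq)] with n hc hh hβ
  have hD := hR.direction.isDirectionLaw hR.sampling n
  have := isProbabilityMeasure_direction hR.sampling (n + 1)
  obtain ⟨i1, i2⟩ := hR.integrable_G n
  have i3 := hR.integrable_gradSize n
  have hβn := hR.steps.β_pos (n + 1) (by omega)
  have hcn := hR.steps.c_pos (n + 1) (by omega)
  have hhn := hR.steps.h_pos (n + 1) (by omega)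
  have hκβ : 0 ≤ 1 - εq * I.β (n + 1) := by
    rw [le_div_iff₀ hεq] at hβ; linarith
  have i4 : Integrable (fun ω => (1 - εq * I.β (n + 1)) * ‖(iter M I W n ω).Gnu‖ ^ 2 +
    B ^ 2 * d / εq * I.β (n + 1)) P := (i1.const_mul _).add (integrable_const _)
  have h1 := (hR.integral_succ_le n (F := fun s => ‖s.Gnu‖ ^ 2) (H := fun s =>
    (1 - εq * I.β (n + 1)) * ‖s.Gnu‖ ^ 2 + B ^ 2 * d / εq * I.β (n + 1) +
    d * Cq * I.β (n + 1) ^ 2 / I.c (n + 1) ^ 2 * gradSize s)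
    measurable_norm_sq_Gnu (fun _ => sq_nonneg _) (i4.add (i3.const_mul _))
    (ae_of_all _ fun ω => by
      have := one_le_gradSize (iter M I W n ω)
      positivity) (by
      filter_upwards [hR.inner] with ω hω
      exact hR.regular.lintegral_Gnu_step_le_of_isInner hR.setting hR.nhd.open_N hR.nhd.convex_N
        hR.nhd.open_X hR.nhd.convex_X hD hR.r_pos (hω n) hβn hcn hc)).2
  rw [integral_add i4 (i3.const_mul _), integral_add (i1.const_mul _) (integrable_const _),
    integral_const_mul _ (fun ω => gradSize (iter M I W n ω)),
    integral_const_mul _ (fun ω => ‖(iter M I W n ω).Gnu‖ ^ 2), hR.integral_gradSize n] at h1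
  simp only [integral_const, probReal_univ, one_smul] at h1
  refine h1.trans (add_le_add le_rfl ?_)
  have hx : 0 ≤ ∫ ω, ‖(iter M I W n ω).Gnu‖ ^ 2 ∂P := integral_nonneg fun _ => sq_nonneg _
  have hY : 0 ≤ ∑ j, ∫ ω, ‖(iter M I W n ω).G j‖ ^ 2 ∂P :=
    Finset.sum_nonneg fun j _ => integral_nonneg fun _ => sq_nonneg _
  refine mul_le_mul_of_nonneg_right ?_ (by linarith)
  calc d * Cq * I.β (n + 1) ^ 2 / I.c (n + 1) ^ 2
      ≤ d * Cq * I.β (n + 1) ^ 2 / (I.c (n + 1) * I.h (n + 1)) ^ 2 := by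
        gcongr
        exact mul_le_of_le_one_right hcn.le hh
    _ = _ := by ring

/-- The recursion for `G_j` couples it to `G_ν` and to the earlier `G_i`; all the others enter only
through the variance, with the vanishing factor `β / (c h)²`. -/
theorem exists_eventually_integral_G_succ_le
    (hR : IsRegularRun μ P M I W f mbar nu lam N Xε Λε B ε Cq εq Cm εm CK r L) :
    ∃ κ > 0, ∃ C > 0, ∀ᶠ n in atTop, ∀ j, ∫ ω, ‖(iter M I W (n + 1) ω).G j‖ ^ 2 ∂P ≤
      (1 - κ * I.β (n + 1)) * ∫ ω, ‖(iter M I W n ω).G j‖ ^ 2 ∂P +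
      C * I.β (n + 1) * (1 + ∫ ω, ‖(iter M I W n ω).Gnu‖ ^ 2 ∂P +
        ∑ i ∈ Finset.univ.filter (· < j), ∫ ω, ‖(iter M I W n ω).G i‖ ^ 2 ∂P) +
      C * (I.β (n + 1) * (I.β (n + 1) / (I.c (n + 1) * I.h (n + 1)) ^ 2)) *
        (1 + ∫ ω, ‖(iter M I W n ω).Gnu‖ ^ 2 ∂P + ∑ j, ∫ ω, ‖(iter M I W n ω).G j‖ ^ 2 ∂P) := by
  obtain ⟨κ, hκ, C, hC, h₀, hh₀, hG⟩ := hR.regular.exists_lintegral_G_step_le hR.setting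
    hR.nhd.open_N hR.nhd.convex_N hR.nhd.open_X hR.nhd.open_Λ hR.kernel hR.r_pos
  refine ⟨κ, hκ, C, hC, ?_⟩
  filter_upwards [hR.eventually_c_mul_le (4 * (1 + d) * (1 + p)) hR.r_pos,
    hR.eventually_h_le hh₀, hR.eventually_β_le (one_div_pos.2 hκ)] with n hc hh hβ j
  have hD := hR.direction.isDirectionLaw hR.sampling n
  have := isProbabilityMeasure_direction hR.sampling (n + 1)
  obtain ⟨i1, i2⟩ := hR.integrable_G n
  have i3 := hR.integrable_gradSize n
  have hβn := hR.steps.β_pos (n + 1) (by omega)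
  have hcn := hR.steps.c_pos (n + 1) (by omega)
  have hhn := hR.steps.h_pos (n + 1) (by omega)
  have hκβ : 0 ≤ 1 - κ * I.β (n + 1) := by
    rw [le_div_iff₀ hκ] at hβ; linarith
  have i5 : Integrable (fun ω => 1 + ‖(iter M I W n ω).Gnu‖ ^ 2) P :=
    (integrable_const _).add i1
  have i7 : Integrable (fun ω => ∑ i ∈ Finset.univ.filter (· < j),
    ‖(iter M I W n ω).G i‖ ^ 2) P := integrable_finsetSum _ fun i _ => i2 i
  have i6 : Integrable (fun ω => 1 + ‖(iter M I W n ω).Gnu‖ ^ 2 +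
    ∑ i ∈ Finset.univ.filter (· < j), ‖(iter M I W n ω).G i‖ ^ 2) P := i5.add i7
  have i4 : Integrable (fun ω => (1 - κ * I.β (n + 1)) * ‖(iter M I W n ω).G j‖ ^ 2 +
    C * I.β (n + 1) * (1 + ‖(iter M I W n ω).Gnu‖ ^ 2 +
      ∑ i ∈ Finset.univ.filter (· < j), ‖(iter M I W n ω).G i‖ ^ 2)) P :=
    ((i2 j).const_mul _).add (i6.const_mul _)
  have h1 := (hR.integral_succ_le n (F := fun s => ‖s.G j‖ ^ 2) (H := fun s =>
    (1 - κ * I.β (n + 1)) * ‖s.G j‖ ^ 2 +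
      C * I.β (n + 1) * (1 + ‖s.Gnu‖ ^ 2 + ∑ i ∈ Finset.univ.filter (· < j), ‖s.G i‖ ^ 2) +
      C * (I.β (n + 1) ^ 2 / (I.c (n + 1) * I.h (n + 1)) ^ 2) * gradSize s)
    (measurable_norm_sq_G j) (fun _ => sq_nonneg _) (i4.add (i3.const_mul _))
    (ae_of_all _ fun ω => by
      have := one_le_gradSize (iter M I W n ω)
      positivity) (by
      filter_upwards [hR.inner] with ω hω
      exact hG n _ _ j hD (hω n) hβn hcn hc hhn hh)).2
  rw [integral_add i4 (i3.const_mul _), integral_add ((i2 j).const_mul _) (i6.const_mul _),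
    integral_const_mul, integral_const_mul, integral_const_mul, hR.integral_gradSize n,
    integral_add i5 i7, integral_add (integrable_const _) i1,
    integral_finsetSum _ fun i _ => i2 i] at h1
  simp only [integral_const, probReal_univ, one_smul] at h1
  refine h1.trans_eq ?_
  congr 2
  ring

/-- The gradient estimates are bounded in mean square. -/
theorem exists_eventually_integral_gradSize_le
    (hR : IsRegularRun μ P M I W f mbar nu lam N Xε Λε B ε Cq εq Cm εm CK r L) :
    ∃ A, 0 ≤ A ∧ ∀ᶠ n in atTop, ∫ ω, gradSize (iter M I W n ω) ∂P ≤ A := by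
  have hεq := hR.regular.εq_pos
  have hCq := hR.regular.Cq_pos
  obtain ⟨κ', hκ', C, hC, hG⟩ := hR.exists_eventually_integral_G_succ_le
  set κ := min εq κ' with hκdef
  have hκ : 0 < κ := lt_min hεq hκ'
  set C₁ := B ^ 2 * d / εq + d * Cq + C with hC₁
  have hB0 : 0 ≤ B ^ 2 * d / εq := by positivity
  have hd0 : 0 ≤ d * Cq := by positivity
  have hC₁0 : 0 ≤ C₁ := by positivity
  have hβpos : ∀ n, 0 < I.β (n + 1) := fun n => hR.steps.β_pos _ (by omega)
  have hγ0 : ∀ n, 0 ≤ I.β (n + 1) / (I.c (n + 1) * I.h (n + 1)) ^ 2 := fun n =>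
    div_nonneg (hβpos n).le (sq_nonneg _)
  have hx : ∀ n, 0 ≤ ∫ ω, ‖(iter M I W n ω).Gnu‖ ^ 2 ∂P := fun n =>
    integral_nonneg fun _ => sq_nonneg _
  have hy : ∀ n j, 0 ≤ ∫ ω, ‖(iter M I W n ω).G j‖ ^ 2 ∂P := fun n j =>
    integral_nonneg fun _ => sq_nonneg _
  obtain ⟨A, hA, hAe⟩ := exists_eventually_sum_le_mul (κ := κ) (C := C₁) (R := fun _ => 1)
    (x := fun n => ∫ ω, ‖(iter M I W n ω).Gnu‖ ^ 2 ∂P)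
    (y := fun n j => ∫ ω, ‖(iter M I W n ω).G j‖ ^ 2 ∂P)
    hκ hC₁0 hx hy (fun _ => one_pos) hβpos hR.tendsto_β
    hR.tendsto_γ (fun c hc => Eventually.of_forall fun n => by
      have := mul_pos hc (hβpos n); linarith) (by
      filter_upwards [hR.eventually_integral_Gnu_succ_le] with n h1
      have hβn := hβpos n
      have hγn := hγ0 n
      have hT : 0 ≤ 1 + ∫ ω, ‖(iter M I W n ω).Gnu‖ ^ 2 ∂P +
          ∑ j, ∫ ω, ‖(iter M I W n ω).G j‖ ^ 2 ∂P :=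
        add_nonneg (add_nonneg zero_le_one (hx n)) (Finset.sum_nonneg fun j _ => hy n j)
      refine h1.trans (add_le_add (add_le_add ?_ ?_) ?_)
      · refine mul_le_mul_of_nonneg_right ?_ (hx n)
        have := mul_le_mul_of_nonneg_right (min_le_left εq κ') hβn.le
        linarith
      · rw [mul_one]
        exact mul_le_mul_of_nonneg_right (by linarith) hβn.le
      · refine mul_le_mul_of_nonneg_right ?_ hT
        exact mul_le_mul_of_nonneg_right (by linarith) (mul_nonneg hβn.le hγn)) (by
      filter_upwards [hG] with n h1 j
      have hβn := hβpos n
      have hγn := hγ0 n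
      have hT : 0 ≤ 1 + ∫ ω, ‖(iter M I W n ω).Gnu‖ ^ 2 ∂P +
          ∑ j, ∫ ω, ‖(iter M I W n ω).G j‖ ^ 2 ∂P :=
        add_nonneg (add_nonneg zero_le_one (hx n)) (Finset.sum_nonneg fun j _ => hy n j)
      refine (h1 j).trans (add_le_add (add_le_add ?_ ?_) ?_)
      · refine mul_le_mul_of_nonneg_right ?_ (hy n j)
        have := mul_le_mul_of_nonneg_right (min_le_right εq κ') hβn.le
        linarith
      · refine mul_le_mul_of_nonneg_right ?_
          (add_nonneg (add_nonneg zero_le_one (hx n)) (Finset.sum_nonneg fun j _ => hy n j))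
        exact mul_le_mul_of_nonneg_right (by linarith) hβn.le
      · refine mul_le_mul_of_nonneg_right ?_ hT
        exact mul_le_mul_of_nonneg_right (by linarith) (mul_nonneg hβn.le hγn))
  refine ⟨1 + A, by positivity, ?_⟩
  filter_upwards [hAe] with n hn
  rw [hR.integral_gradSize n]
  linarith

end IsRegularRun

end KBSA

/-! ### The rates -/

namespace KBSA

namespace IsRegularRun

variable {d p : ℕ} {Ξ Ω : Type*} [MeasurableSpace Ξ] [MeasurableSpace Ω]
  {μ : Measure Ξ} [IsProbabilityMeasure μ] {P : Measure Ω} [IsProbabilityMeasure P]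
  {M : Problem d p Ξ} {I : Input d p} {W : Noise d Ξ Ω} {f : Vec d → ℝ → ℝ}
  {mbar : (j : Fin p) → Vec d → (Fin ((j : ℕ) + 1) → ℝ) → ℝ → ℝ}
  {nu : Vec d → ℝ} {lam : Vec d → Vec p} {N : Set (Vec d)} {Xε : Set ℝ} {Λε : Set (Vec p)}
  {B ε Cq εq Cm εm CK r L : ℝ}

theorem iter_succ_θ_mem (hset : Setting M μ f mbar nu lam) (hΘ : M.Θ.Nonempty) (n : ℕ) (ω : Ω) :
    (iter M I W (n + 1) ω).θ ∈ M.Θ := by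
  rw [iter_succ, stepWith_θ]
  exact hset.nextθ_mem hΘ n _

theorem iter_θ_mem (hset : Setting M μ f mbar nu lam) (hΘ : M.Θ.Nonempty) {n : ℕ} (hn : 1 ≤ n)
    (ω : Ω) : (iter M I W n ω).θ ∈ M.Θ := by
  obtain ⟨k, rfl⟩ := Nat.exists_eq_add_of_le' hn
  exact iter_succ_θ_mem hset hΘ k ω

/-- The forcing consists of the motion of the root, of relative order `(α / β)²`, and of the
variance. -/
theorem exists_eventually_nu_error_succ_le
    (hR : IsRegularRun μ P M I W f mbar nu lam N Xε Λε B ε Cq εq Cm εm CK r L) :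
    ∃ C > 0, ∀ᶠ n in atTop,
      ∫ ω, ((iter M I W (n + 1) ω).nu - nu (iter M I W (n + 1) ω).θ) ^ 2 ∂P ≤
      (1 - εq * I.β (n + 1)) * ∫ ω, ((iter M I W n ω).nu - nu (iter M I W n ω).θ) ^ 2 ∂P +
      C * I.β (n + 1) * ((I.α (n + 1) / I.β (n + 1)) ^ 2 + I.β (n + 1)) := by
  have hεq := hR.regular.εq_pos
  obtain ⟨A, hA, hAe⟩ := hR.exists_eventually_integral_gradSize_le
  obtain ⟨C, hC, hstep⟩ := hR.regular.exists_lintegral_nu_step_le hR.setting hR.nhd.open_X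
    hR.nhd.convex_X hR.lipschitz_nu (I := I)
  refine ⟨C * (A + 1), by positivity, ?_⟩
  filter_upwards [hAe, hR.eventually_β_le one_pos, hR.eventually_β_le (one_div_pos.2 hεq),
    eventually_ge_atTop 1] with n hAn hβ1 hβ hn
  have := isProbabilityMeasure_direction hR.sampling (n + 1)
  have hβn := hR.steps.β_pos (n + 1) (by omega)
  have i1 := (hR.memLp_nu_error n).integrable_sq
  have i3 := hR.integrable_gradSize n
  have hκβ : 0 ≤ 1 - εq * I.β (n + 1) := by
    rw [le_div_iff₀ hεq] at hβ; linarith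
  have i5 : Integrable (fun ω => I.α (n + 1) ^ 2 / I.β (n + 1) * gradSize (iter M I W n ω) +
    I.β (n + 1) ^ 2) P := (i3.const_mul _).add (integrable_const _)
  have h1 := (hR.integral_succ_le n (F := fun s => (s.nu - nu s.θ) ^ 2) (H := fun s =>
    (1 - εq * I.β (n + 1)) * (s.nu - nu s.θ) ^ 2 +
        C * (I.α (n + 1) ^ 2 / I.β (n + 1) * gradSize s + I.β (n + 1) ^ 2))
    ((Iterate.measurable_nu.sub (hR.measurable_nu.comp Iterate.measurable_θ)).pow_const 2)
    (fun _ => sq_nonneg _) ((i1.const_mul _).add (i5.const_mul _))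
    (ae_of_all _ fun ω => by
      have := one_le_gradSize (iter M I W n ω)
      positivity) (by
      filter_upwards [hR.inner] with ω hω
      have hΘ := iter_θ_mem (I := I) (W := W) hR.setting hR.nonempty hn ω
      have hN := (hω n).θ (Metric.mem_ball_self hR.r_pos)
      exact hstep n _ _ hN hΘ ((hω n).nu (Metric.mem_ball_self hR.r_pos))
        (hR.nhd.roots _ hΘ hN).1 hβn hβ1)).2
  rw [integral_add (i1.const_mul _) (i5.const_mul _), integral_const_mul, integral_const_mul,
    integral_add (i3.const_mul _) (integrable_const _), integral_const_mul] at h1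
  simp only [integral_const, probReal_univ, one_smul] at h1
  refine h1.trans (add_le_add le_rfl ?_)
  calc C * (I.α (n + 1) ^ 2 / I.β (n + 1) * ∫ ω, gradSize (iter M I W n ω) ∂P + I.β (n + 1) ^ 2)
      ≤ C * (I.α (n + 1) ^ 2 / I.β (n + 1) * (A + 1) + I.β (n + 1) ^ 2 * (A + 1)) := by
        gcongr
        · linarith
        · exact le_mul_of_one_le_right (sq_nonneg _) (by linarith)
    _ = _ := by field_simp

/-- The forcing consists of the motion of the root, the variance `β / h` of the kernel weight, the
squared bias `h⁴`, and the errors of `ν` and of the earlier components. -/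
theorem exists_eventually_lam_error_succ_le
    (hR : IsRegularRun μ P M I W f mbar nu lam N Xε Λε B ε Cq εq Cm εm CK r L) :
    ∃ C > 0, ∀ᶠ n in atTop, ∀ j,
      ∫ ω, ((iter M I W (n + 1) ω).lam j - lam (iter M I W (n + 1) ω).θ j) ^ 2 ∂P ≤
      (1 - ε * εm * I.β (n + 1)) *
        ∫ ω, ((iter M I W n ω).lam j - lam (iter M I W n ω).θ j) ^ 2 ∂P +
      C * I.β (n + 1) * ((I.α (n + 1) / I.β (n + 1)) ^ 2 + I.β (n + 1) / I.h (n + 1) +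
          I.h (n + 1) ^ 4 +
        ∫ ω, ((iter M I W n ω).nu - nu (iter M I W n ω).θ) ^ 2 ∂P +
        ∑ i ∈ Finset.univ.filter (· < j),
          ∫ ω, ((iter M I W n ω).lam i - lam (iter M I W n ω).θ i) ^ 2 ∂P) := by
  have hκ : 0 < ε * εm := mul_pos hR.regular.ε_pos hR.regular.εm_pos
  obtain ⟨A, hA, hAe⟩ := hR.exists_eventually_integral_gradSize_le
  obtain ⟨C, hC, hstep⟩ := hR.regular.exists_lintegral_lam_step_le hR.setting hR.nhd.open_N
    hR.nhd.open_X hR.nhd.convex_X hR.nhd.open_Λ hR.nhd.convex_Λ hR.kernel hR.r_pos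
    hR.lipschitz_lam
  refine ⟨C * (A + 1), by positivity, ?_⟩
  filter_upwards [hAe, hR.eventually_β_le one_pos, hR.eventually_β_le (one_div_pos.2 hκ),
    hR.eventually_h_le one_pos, eventually_ge_atTop 1] with n hAn hβ1 hβ hh1 hn j
  have := isProbabilityMeasure_direction hR.sampling (n + 1)
  have hβn := hR.steps.β_pos (n + 1) (by omega)
  have hhn := hR.steps.h_pos (n + 1) (by omega)
  have i1 := (hR.memLp_nu_error n).integrable_sq
  have i2 := fun j => (hR.memLp_lam_error n j).integrable_sq
  have i3 := hR.integrable_gradSize n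
  have hκβ : 0 ≤ 1 - ε * εm * I.β (n + 1) := by
    rw [le_div_iff₀ hκ] at hβ; linarith
  have i6 : Integrable (fun ω => ∑ i ∈ Finset.univ.filter (· < j),
      ((iter M I W n ω).lam i - lam (iter M I W n ω).θ i) ^ 2) P :=
    integrable_finsetSum _ fun i _ => i2 i
  have i7 : Integrable (fun ω => ((iter M I W n ω).nu - nu (iter M I W n ω).θ) ^ 2 +
      ∑ i ∈ Finset.univ.filter (· < j),
        ((iter M I W n ω).lam i - lam (iter M I W n ω).θ i) ^ 2) P := i1.add i6
  have i8 : Integrable (fun ω => I.α (n + 1) ^ 2 / I.β (n + 1) * gradSize (iter M I W n ω) +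
      I.β (n + 1) * I.h (n + 1) ^ 4) P := (i3.const_mul _).add (integrable_const _)
  have i9 : Integrable (fun ω => I.α (n + 1) ^ 2 / I.β (n + 1) * gradSize (iter M I W n ω) +
      I.β (n + 1) * I.h (n + 1) ^ 4 + I.β (n + 1) ^ 2 / I.h (n + 1)) P :=
    i8.add (integrable_const _)
  have i10 : Integrable (fun ω => (1 - ε * εm * I.β (n + 1)) *
      ((iter M I W n ω).lam j - lam (iter M I W n ω).θ j) ^ 2 + C * I.β (n + 1) *
      (((iter M I W n ω).nu - nu (iter M I W n ω).θ) ^ 2 + ∑ i ∈ Finset.univ.filter (· < j),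
        ((iter M I W n ω).lam i - lam (iter M I W n ω).θ i) ^ 2)) P :=
    ((i2 j).const_mul _).add (i7.const_mul _)
  have h1 := (hR.integral_succ_le n (F := fun s => (s.lam j - lam s.θ j) ^ 2) (H := fun s =>
    (1 - ε * εm * I.β (n + 1)) * (s.lam j - lam s.θ j) ^ 2 +
        C * I.β (n + 1) * ((s.nu - nu s.θ) ^ 2 +
          ∑ i ∈ Finset.univ.filter (· < j), (s.lam i - lam s.θ i) ^ 2) +
        C * (I.α (n + 1) ^ 2 / I.β (n + 1) * gradSize s + I.β (n + 1) * I.h (n + 1) ^ 4 +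
          I.β (n + 1) ^ 2 / I.h (n + 1)))
    (((measurable_coord Iterate.measurable_lam j).sub
      (measurable_coord (hR.measurable_lam.comp Iterate.measurable_θ) j)).pow_const 2)
    (fun _ => sq_nonneg _) (i10.add (i9.const_mul _))
    (ae_of_all _ fun ω => by
      have := one_le_gradSize (iter M I W n ω)
      positivity) (by
      filter_upwards [hR.inner] with ω hω
      have hΘ := iter_θ_mem (I := I) (W := W) hR.setting hR.nonempty hn ω
      have hN := (hω n).θ (Metric.mem_ball_self hR.r_pos)
      exact hstep n _ _ j (hω n) hΘ (hR.nhd.roots _ hΘ hN).1 (hR.nhd.roots _ hΘ hN).2 hβn hβ1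
        hhn hh1)).2
  rw [integral_add i10 (i9.const_mul _), integral_add ((i2 j).const_mul _) (i7.const_mul _),
    integral_const_mul, integral_const_mul, integral_const_mul,
    integral_add i8 (integrable_const _), integral_add (i3.const_mul _) (integrable_const _),
    integral_const_mul, integral_add i1 i6, integral_finsetSum _ fun i _ => i2 i] at h1
  simp only [integral_const, probReal_univ, one_smul] at h1
  set x := ∫ ω, ((iter M I W n ω).nu - nu (iter M I W n ω).θ) ^ 2 ∂P
  set S := ∑ i ∈ Finset.univ.filter (· < j),
          ∫ ω, ((iter M I W n ω).lam i - lam (iter M I W n ω).θ i) ^ 2 ∂P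
  have hx : 0 ≤ x := integral_nonneg fun _ => sq_nonneg _
  have hS : 0 ≤ S := Finset.sum_nonneg fun _ _ => integral_nonneg fun _ => sq_nonneg _
  refine h1.trans ?_
  rw [add_assoc]
  refine add_le_add le_rfl ?_
  have e1 : 1 ≤ A + 1 := by linarith
  calc C * I.β (n + 1) * (x + S) + C * (I.α (n + 1) ^ 2 / I.β (n + 1) *
        ∫ ω, gradSize (iter M I W n ω) ∂P + I.β (n + 1) * I.h (n + 1) ^ 4 +
          I.β (n + 1) ^ 2 / I.h (n + 1))
      ≤ C * I.β (n + 1) * ((x + S) * (A + 1)) + C * (I.α (n + 1) ^ 2 / I.β (n + 1) *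
        (A + 1) + I.β (n + 1) * I.h (n + 1) ^ 4 * (A + 1) +
          I.β (n + 1) ^ 2 / I.h (n + 1) * (A + 1)) := by
        refine add_le_add (mul_le_mul_of_nonneg_left
          (le_mul_of_one_le_right (by positivity) e1) (by positivity))
          (mul_le_mul_of_nonneg_left (add_le_add (add_le_add ?_
            (le_mul_of_one_le_right (by positivity) e1))
            (le_mul_of_one_le_right (by positivity) e1)) hC.le)
        exact mul_le_mul_of_nonneg_left (by linarith) (by positivity)
    _ = _ := by field_simp; ring

/-- If the step sizes and the bandwidths decay slowly, the mean square errors are of the order of the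
stationary solutions of their recursions. -/
theorem exists_eventually_error_le
    (hR : IsRegularRun μ P M I W f mbar nu lam N Xε Λε B ε Cq εq Cm εm CK r L)
    (hα : DecaysSlowly fun n => I.α (n + 1)) (hβ : DecaysSlowly fun n => I.β (n + 1))
    (hβi : DecaysSlowly fun n => (I.β (n + 1))⁻¹) (hh : DecaysSlowly fun n => I.h (n + 1))
    (hhi : DecaysSlowly fun n => (I.h (n + 1))⁻¹)
    (hnβ : Tendsto (fun n : ℕ => ((n : ℝ) + 1) * I.β (n + 1)) atTop atTop) :
    (∃ A, 0 ≤ A ∧ ∀ᶠ n in atTop,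
      ∫ ω, ((iter M I W n ω).nu - nu (iter M I W n ω).θ) ^ 2 ∂P ≤
        A * ((I.α (n + 1) / I.β (n + 1)) ^ 2 + I.β (n + 1))) ∧
    ∃ A, 0 ≤ A ∧ ∀ᶠ n in atTop,
      ∫ ω, ‖(iter M I W n ω).lam - lam (iter M I W n ω).θ‖ ^ 2 ∂P ≤
        A * ((I.α (n + 1) / I.β (n + 1)) ^ 2 + I.β (n + 1) / I.h (n + 1) + I.h (n + 1) ^ 4) := by
  have hεq := hR.regular.εq_pos
  have hαpos : ∀ n, 0 < I.α (n + 1) := fun n => hR.steps.α_pos _ (by omega)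
  have hβpos : ∀ n, 0 < I.β (n + 1) := fun n => hR.steps.β_pos _ (by omega)
  have hhpos : ∀ n, 0 < I.h (n + 1) := fun n => hR.steps.h_pos _ (by omega)
  obtain ⟨C, hC, hν⟩ := hR.exists_eventually_nu_error_succ_le
  obtain ⟨C', hC', hl⟩ := hR.exists_eventually_lam_error_succ_le
  have hαβ : DecaysSlowly fun n => (I.α (n + 1) / I.β (n + 1)) ^ 2 := by
    simp_rw [div_eq_mul_inv]
    exact (hα.mul hβi).pow 2
  have hslow : ∀ {T : ℕ → ℝ}, DecaysSlowly T → ∀ c > 0, ∀ᶠ n in atTop,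
      T n ≤ (1 + c * I.β (n + 1)) * T (n + 1) := fun hT c hc => hT.eventually_le hc hnβ
  have hx : ∀ n, 0 ≤ ∫ ω, ((iter M I W n ω).nu - nu (iter M I W n ω).θ) ^ 2 ∂P := fun n =>
    integral_nonneg fun _ => sq_nonneg _
  constructor
  · refine exists_eventually_le_mul hεq hx (fun n => ?_) hβpos hR.tendsto_β
      (hslow (hαβ.add hβ) _ (half_pos hεq)) (C := C) hν
    exact add_pos_of_nonneg_of_pos (sq_nonneg _) (hβpos n)
  · set κ := min εq (ε * εm) with hκdef
    have hκ : 0 < κ := lt_min hεq (mul_pos hR.regular.ε_pos hR.regular.εm_pos)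
    have hy : ∀ n j, 0 ≤ ∫ ω, ((iter M I W n ω).lam j - lam (iter M I W n ω).θ j) ^ 2 ∂P :=
      fun n j => integral_nonneg fun _ => sq_nonneg _
    have hRpos : ∀ n, 0 < (I.α (n + 1) / I.β (n + 1)) ^ 2 + I.β (n + 1) / I.h (n + 1) +
        I.h (n + 1) ^ 4 := fun n => by
      have := hαpos n; have := hβpos n; have := hhpos n
      positivity
    have hRslow : DecaysSlowly fun n => (I.α (n + 1) / I.β (n + 1)) ^ 2 +
        I.β (n + 1) / I.h (n + 1) + I.h (n + 1) ^ 4 := by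
      have : DecaysSlowly fun n => I.β (n + 1) / I.h (n + 1) := by
        simp_rw [div_eq_mul_inv]
        exact hβ.mul hhi
      exact (hαβ.add this).add (hh.pow 4)
    obtain ⟨A, hA, hAe⟩ := exists_eventually_sum_le_mul (κ := κ) (C := C + C') (γ := fun _ => 0)
      (R := fun n => (I.α (n + 1) / I.β (n + 1)) ^ 2 + I.β (n + 1) / I.h (n + 1) +
        I.h (n + 1) ^ 4)
      (x := fun n => ∫ ω, ((iter M I W n ω).nu - nu (iter M I W n ω).θ) ^ 2 ∂P)
      (y := fun n j => ∫ ω, ((iter M I W n ω).lam j - lam (iter M I W n ω).θ j) ^ 2 ∂P)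
      hκ (by positivity) hx hy hRpos hβpos hR.tendsto_β tendsto_const_nhds (hslow hRslow) (by
        filter_upwards [hν, hR.eventually_h_le one_pos] with n h1 hh1
        have hβn := hβpos n
        have hhn := hhpos n
        simp only [mul_zero, zero_mul, add_zero]
        refine h1.trans (add_le_add ?_ ?_)
        · refine mul_le_mul_of_nonneg_right ?_ (hx n)
          have := mul_le_mul_of_nonneg_right (min_le_left εq (ε * εm)) hβn.le
          linarith
        · have h2 : I.β (n + 1) ≤ I.β (n + 1) / I.h (n + 1) := le_div_self hβn.le hhn hh1
          have h3 : 0 ≤ I.h (n + 1) ^ 4 := by positivity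
          refine mul_le_mul ?_ (by linarith) (by positivity) (by positivity)
          exact mul_le_mul_of_nonneg_right (by linarith) hβn.le) (by
        filter_upwards [hl] with n h1 j
        have hβn := hβpos n
        simp only [mul_zero, zero_mul, add_zero]
        refine (h1 j).trans (add_le_add ?_ ?_)
        · refine mul_le_mul_of_nonneg_right ?_ (hy n j)
          have := mul_le_mul_of_nonneg_right (min_le_right εq (ε * εm)) hβn.le
          linarith
        · refine mul_le_mul_of_nonneg_right ?_ (add_nonneg (add_nonneg (hRpos n).le (hx n))
            (Finset.sum_nonneg fun j _ => hy n j))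
          exact mul_le_mul_of_nonneg_right (by linarith) hβn.le)
    refine ⟨A, hA, ?_⟩
    filter_upwards [hAe] with n hn
    refine le_trans ?_ hn
    have : ∀ ω, ‖(iter M I W n ω).lam - lam (iter M I W n ω).θ‖ ^ 2 =
        ∑ j, ((iter M I W n ω).lam j - lam (iter M I W n ω).θ j) ^ 2 := fun ω => by
      rw [EuclideanSpace.norm_sq_eq]
      simp
    simp_rw [this]
    rw [integral_finsetSum _ fun j _ => (hR.memLp_lam_error n j).integrable_sq]
    exact le_add_of_nonneg_left (hx n)

theorem memLp_lam_error_vec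
    (hR : IsRegularRun μ P M I W f mbar nu lam N Xε Λε B ε Cq εq Cm εm CK r L) (n : ℕ) :
    MemLp (fun ω => (iter M I W n ω).lam - lam (iter M I W n ω).θ) 2 P := by
  have hm := hR.measurable_iter n
  have hmeas : Measurable (fun ω => (iter M I W n ω).lam - lam (iter M I W n ω).θ) :=
    (Iterate.measurable_lam.comp hm).sub (hR.measurable_lam.comp (Iterate.measurable_θ.comp hm))
  have hsum : MemLp (fun ω => ∑ j,
      |(iter M I W n ω).lam j - lam (iter M I W n ω).θ j|) 2 P :=
    memLp_finsetSum _ fun j _ => (hR.memLp_lam_error n j).norm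
  refine hsum.of_le hmeas.aestronglyMeasurable (ae_of_all _ fun ω => ?_)
  refine (norm_vec_le_sum_abs _).trans ?_
  simp only [PiLp.sub_apply]
  exact le_abs_self _

end IsRegularRun

/-- The contraction accumulates faster than any power of `n`, because `α` is at least `1 / n` and
negligible against `β`. -/
theorem tendsto_mul_β {α β : ℕ → ℝ} (h : α =o[atTop] β) (hβ : ∀ n ≥ 1, 0 < β n) {n₀ : ℕ}
    (hn₀ : ∀ n ≥ n₀, 1 / (n : ℝ) ≤ α n) :
    Tendsto (fun n : ℕ => ((n : ℝ) + 1) * β (n + 1)) atTop atTop := by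
  refine tendsto_atTop.2 fun C => ?_
  have hC : 0 < 1 / (|C| + 1) := by positivity
  have h1 := (tendsto_add_atTop_nat 1).eventually (h.def hC)
  filter_upwards [h1, eventually_ge_atTop n₀] with n h2 hn
  have h3 := hn₀ (n + 1) (by omega)
  have h4 := hβ (n + 1) (by omega)
  push_cast at h3
  rw [Real.norm_eq_abs, Real.norm_eq_abs, abs_of_pos h4] at h2
  have h5 : 1 / ((n : ℝ) + 1) ≤ 1 / (|C| + 1) * β (n + 1) := h3.trans ((le_abs_self _).trans h2)
  have h6 : (0 : ℝ) < n + 1 := by positivity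
  rw [div_le_iff₀ h6] at h5
  have h7 : |C| + 1 ≤ (n + 1) * β (n + 1) := by
    have := mul_le_mul_of_nonneg_left h5 (by positivity : 0 ≤ |C| + 1)
    have e : (|C| + 1) * (1 / (|C| + 1) * β (n + 1) * (n + 1)) = (n + 1) * β (n + 1) := by
      field_simp
    linarith
  linarith [le_abs_self C]

theorem isBigO_sqrt_of_le {a R S : ℕ → ℝ} {A : ℝ} (hA : 0 ≤ A)
    (h : ∀ᶠ n in atTop, a n ≤ A * R n) (hRS : ∀ n, R n ≤ S n ^ 2) :
    (fun n => √(a n)) =O[atTop] S := by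
  refine Asymptotics.IsBigO.of_bound (√A) ?_
  filter_upwards [h] with n hn
  rw [Real.norm_eq_abs, abs_of_nonneg (Real.sqrt_nonneg _), Real.norm_eq_abs]
  calc √(a n) ≤ √(A * S n ^ 2) :=
        Real.sqrt_le_sqrt (hn.trans (mul_le_mul_of_nonneg_left (hRS n) hA))
    _ = √A * |S n| := by rw [Real.sqrt_mul hA, Real.sqrt_sq_eq_abs]

theorem exists_abs_sub_le_of_contDiffOn {d : ℕ} {V : Type*} [NormedAddCommGroup V]
    [NormedSpace ℝ V] {F : Vec d → V} {C : Set (Vec d)} (hF : ContDiffOn ℝ 2 F C)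
    (hC : Convex ℝ C) (hc : IsCompact C) :
    ∃ L, ∀ x ∈ C, ∀ y ∈ C, ‖F x - F y‖ ≤ L * ‖x - y‖ := by
  obtain ⟨L, hL⟩ := (hF.of_le (by norm_num : (1 : WithTop ℕ∞) ≤ 2)).exists_lipschitzOnWith
    (by norm_num) hC hc
  exact ⟨L, fun x hx y hy => hL.norm_sub_le hx hy⟩

end KBSA

theorem mainTheorem6 {d p : ℕ} {Ξ Ω : Type*} [MeasurableSpace Ξ] [MeasurableSpace Ω]
    (μ : Measure Ξ) [IsProbabilityMeasure μ] (P : Measure Ω) [IsProbabilityMeasure P]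
    (M : KBSA.Problem d p Ξ) (I : KBSA.Input d p) (W : KBSA.Noise d Ξ Ω)
    (f : KBSA.Vec d → ℝ → ℝ)
    (mbar : (j : Fin p) → KBSA.Vec d → (Fin ((j : ℕ) + 1) → ℝ) → ℝ → ℝ)
    (nu : KBSA.Vec d → ℝ) (lam : KBSA.Vec d → KBSA.Vec p)
    (hset : KBSA.Setting M μ f mbar nu lam)
    (hsamp : KBSA.IsSampling μ P W)
    (h1 : KBSA.RegularityAssumption M μ P I W f mbar nu lam)
    (h2 : KBSA.DirectionAssumption P W)
    (h3 : KBSA.StepAssumption I)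
    (h4 : KBSA.KernelAssumption I.K)
    (h5 : KBSA.RateAssumption M P I W nu lam) :
    ((∀ n, MemLp (fun ω => (KBSA.iter M I W n ω).nu - nu (KBSA.iter M I W n ω).θ) 2 P) ∧
      (fun n => √(∫ ω, ((KBSA.iter M I W n ω).nu - nu (KBSA.iter M I W n ω).θ) ^ 2 ∂P))
        =O[atTop] (fun n => I.α (n + 1) / I.β (n + 1) + I.β (n + 1) ^ (1 / 2 : ℝ))) ∧
    ((∀ n, MemLp (fun ω => (KBSA.iter M I W n ω).lam - lam (KBSA.iter M I W n ω).θ) 2 P) ∧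
      (fun n => √(∫ ω, ‖(KBSA.iter M I W n ω).lam - lam (KBSA.iter M I W n ω).θ‖ ^ 2 ∂P))
        =O[atTop] (fun n => I.α (n + 1) / I.β (n + 1)
          + I.β (n + 1) ^ (1 / 2 : ℝ) / I.h (n + 1) ^ (1 / 2 : ℝ) + I.h (n + 1) ^ 2)) := by
  classical
  obtain ⟨N, Xε, Λε, hU, B, ε, Cq, εq, Cm, εm, hreg⟩ := h1
  obtain ⟨CK, hK⟩ := h4.exists_bounds
  obtain ⟨r, hr, hinner⟩ := hU.iterates
  obtain ⟨θstar, hθstar, -⟩ := h5.equilibrium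
  have hΘ : M.Θ.Nonempty := ⟨θstar, interior_subset hθstar⟩
  have hΘm : MeasurableSet M.Θ := hset.compact_Θ.isClosed.measurableSet
  have hνc : ContinuousOn nu M.Θ := h5.nu_smooth.continuousOn
  have hlc : ContinuousOn lam M.Θ := h5.lam_smooth.continuousOn
  obtain ⟨L₁, hL₁⟩ := KBSA.exists_abs_sub_le_of_contDiffOn h5.nu_smooth hset.convex_Θ hset.compact_Θ
  obtain ⟨L₂, hL₂⟩ := KBSA.exists_abs_sub_le_of_contDiffOn h5.lam_smooth hset.convex_Θ
    hset.compact_Θ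
  obtain ⟨L₃, hL₃⟩ := hset.compact_Θ.exists_bound_of_continuousOn hνc
  obtain ⟨L₄, hL₄⟩ := hset.compact_Θ.exists_bound_of_continuousOn hlc
  set L := |L₁| + |L₂| + |L₃| + |L₄| with hL
  have q1 := le_abs_self L₁
  have q2 := le_abs_self L₂
  have q3 := le_abs_self L₃
  have q4 := le_abs_self L₄
  have p1 := abs_nonneg L₁
  have p2 := abs_nonneg L₂
  have p3 := abs_nonneg L₃
  have p4 := abs_nonneg L₄
  -- Off `Θ` the root functions are arbitrary; replacing them by `0` there makes them measurable.
  set nu' : KBSA.Vec d → ℝ := M.Θ.piecewise nu 0 with hnu'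
  set lam' : KBSA.Vec d → KBSA.Vec p := M.Θ.piecewise lam 0 with hlam'
  have enu : ∀ θ ∈ M.Θ, nu' θ = nu θ := fun θ hθ => piecewise_eq_of_mem _ _ _ hθ
  have elam : ∀ θ ∈ M.Θ, lam' θ = lam θ := fun θ hθ => piecewise_eq_of_mem _ _ _ hθ
  have hset' : KBSA.Setting M μ f mbar nu' lam' :=
    { hset with
      nu_root := fun θ hθ ν => by rw [enu θ hθ]; exact hset.nu_root θ hθ ν
      lam_root := fun θ hθ l => by rw [enu θ hθ, elam θ hθ]; exact hset.lam_root θ hθ l }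
  have hU' : KBSA.IsUniformNhd M P I W nu' lam' N Xε Λε :=
    { hU with
      roots := fun θ hθ hN => by rw [enu θ hθ, elam θ hθ]; exact hU.roots θ hθ hN }
  have hR : KBSA.IsRegularRun μ P M I W f mbar nu' lam' N Xε Λε B ε Cq εq Cm εm CK r L :=
    { setting := hset'
      sampling := hsamp
      nhd := hU'
      regular := hreg
      direction := h2
      steps := h3
      kernel := hK
      nonempty := hΘ
      r_pos := hr
      inner := hinner.mono fun ω hω n => ⟨(hω n).1, (hω n).2.1, (hω n).2.2⟩
      measurable_nu := hνc.measurable_piecewise continuousOn_const hΘm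
      measurable_lam := hlc.measurable_piecewise continuousOn_const hΘm
      bdd := fun θ => by
        by_cases hθ : θ ∈ M.Θ
        · rw [enu θ hθ, elam θ hθ]
          have a1 := hL₃ θ hθ
          have a2 := hL₄ θ hθ
          rw [Real.norm_eq_abs] at a1
          exact ⟨by linarith, by linarith⟩
        · rw [hnu', hlam', piecewise_eq_of_notMem _ _ _ hθ, piecewise_eq_of_notMem _ _ _ hθ]
          simp only [Pi.zero_apply, abs_zero, norm_zero]
          exact ⟨by positivity, by positivity⟩
      lipschitz_nu := fun x hx y hy => by
        rw [enu x hx, enu y hy]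
        exact (hL₁ x hx y hy).trans
          (mul_le_mul_of_nonneg_right (by linarith) (norm_nonneg _))
      lipschitz_lam := fun x hx y hy => by
        rw [elam x hx, elam y hy]
        exact (hL₂ x hx y hy).trans
          (mul_le_mul_of_nonneg_right (by linarith) (norm_nonneg _)) }
  obtain ⟨Cα, Cβ, Cc, Ch, nα, nβ, nc, nh, a, b, ec, eh, hCα, hCβ, -, hCh, hnα, hnβ, -, hnh, ha, hb,
    -, heh, -, hsizes⟩ := h5.sizes
  obtain ⟨n₀, -, hn₀⟩ := h5.α_range
  have eα : (fun n : ℕ => I.α (n + 1)) = fun n : ℕ => Cα / (((n + 1 : ℕ) : ℝ) + nα) ^ a :=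
    funext fun n => (hsizes (n + 1) (by omega)).1
  have eβ : (fun n : ℕ => I.β (n + 1)) = fun n : ℕ => Cβ / (((n + 1 : ℕ) : ℝ) + nβ) ^ b :=
    funext fun n => (hsizes (n + 1) (by omega)).2.1
  have eh' : (fun n : ℕ => I.h (n + 1)) = fun n : ℕ => Ch / (((n + 1 : ℕ) : ℝ) + nh) ^ eh :=
    funext fun n => (hsizes (n + 1) (by omega)).2.2.2
  have eβi : (fun n : ℕ => (I.β (n + 1))⁻¹) =
      fun n : ℕ => (Cβ / (((n + 1 : ℕ) : ℝ) + nβ) ^ b)⁻¹ :=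
    funext fun n => congrArg _ (hsizes (n + 1) (by omega)).2.1
  have ehi : (fun n : ℕ => (I.h (n + 1))⁻¹) =
      fun n : ℕ => (Ch / (((n + 1 : ℕ) : ℝ) + nh) ^ eh)⁻¹ :=
    funext fun n => congrArg _ (hsizes (n + 1) (by omega)).2.2.2
  have ha0 : 0 ≤ a := by linarith [ha.1]
  have hb0 : 0 ≤ b := by linarith [hb.1]
  obtain ⟨⟨A₁, hA₁, hν⟩, A₂, hA₂, hl⟩ := hR.exists_eventually_error_le
    (eα ▸ KBSA.DecaysSlowly.power hCα hnα ha0) (eβ ▸ KBSA.DecaysSlowly.power hCβ hnβ hb0)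
    (eβi ▸ KBSA.DecaysSlowly.power_inv hCβ hnβ hb0) (eh' ▸ KBSA.DecaysSlowly.power hCh hnh heh.le)
    (ehi ▸ KBSA.DecaysSlowly.power_inv hCh hnh heh.le)
    (KBSA.tendsto_mul_β h3.α_small h3.β_pos fun n hn => (hn₀ n hn).1)
  have hmem : ∀ n ω, 1 ≤ n → (KBSA.iter M I W n ω).θ ∈ M.Θ := fun n ω hn =>
    KBSA.IsRegularRun.iter_θ_mem hset hΘ hn ω
  have hpos : ∀ n, 0 < I.α (n + 1) ∧ 0 < I.β (n + 1) ∧ 0 < I.h (n + 1) := fun n =>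
    ⟨h3.α_pos _ (by omega), h3.β_pos _ (by omega), h3.h_pos _ (by omega)⟩
  refine ⟨⟨fun n => ?_, ?_⟩, fun n => ?_, ?_⟩
  -- `θ_0` need not lie in `Θ`, where the root functions were not changed, but it is deterministic.
  · rcases Nat.eq_zero_or_pos n with rfl | hn
    · exact memLp_const (I.init.nu - nu I.init.θ)
    · refine (hR.memLp_nu_error n).ae_eq (ae_of_all _ fun ω => ?_)
      simp only [enu _ (hmem n ω hn)]
  · refine KBSA.isBigO_sqrt_of_le hA₁ ?_ (R := fun n =>
      (I.α (n + 1) / I.β (n + 1)) ^ 2 + I.β (n + 1)) fun n => ?_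
    · filter_upwards [hν, eventually_ge_atTop 1] with n h hn
      simp only [enu _ (hmem n _ hn)] at h
      exact h
    · obtain ⟨k1, k2, k3⟩ := hpos n
      rw [← Real.sqrt_eq_rpow]
      have e1 := Real.sq_sqrt k2.le
      have e2 : 0 ≤ I.α (n + 1) / I.β (n + 1) * √(I.β (n + 1)) := by positivity
      nlinarith
  · rcases Nat.eq_zero_or_pos n with rfl | hn
    · exact memLp_const (I.init.lam - lam I.init.θ)
    · refine (hR.memLp_lam_error_vec n).ae_eq (ae_of_all _ fun ω => ?_)
      simp only [elam _ (hmem n ω hn)]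
  · refine KBSA.isBigO_sqrt_of_le hA₂ ?_ (R := fun n => (I.α (n + 1) / I.β (n + 1)) ^ 2 +
      I.β (n + 1) / I.h (n + 1) + I.h (n + 1) ^ 4) fun n => ?_
    · filter_upwards [hl, eventually_ge_atTop 1] with n h hn
      simp only [elam _ (hmem n _ hn)] at h
      exact h
    · obtain ⟨k1, k2, k3⟩ := hpos n
      rw [← Real.sqrt_eq_rpow, ← Real.sqrt_eq_rpow]
      have e1 : (√(I.β (n + 1)) / √(I.h (n + 1))) ^ 2 = I.β (n + 1) / I.h (n + 1) := by
        rw [div_pow, Real.sq_sqrt k2.le, Real.sq_sqrt k3.le]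
      set x := I.α (n + 1) / I.β (n + 1)
      set y := √(I.β (n + 1)) / √(I.h (n + 1))
      have hx : 0 ≤ x := by positivity
      have hy : 0 ≤ y := by positivity
      have hz : 0 ≤ I.h (n + 1) ^ 2 := by positivity
      rw [← e1]
      have : (x + y + I.h (n + 1) ^ 2) ^ 2 = x ^ 2 + y ^ 2 + I.h (n + 1) ^ 4 +
        2 * (x * y + x * I.h (n + 1) ^ 2 + y * I.h (n + 1) ^ 2) := by ring
      have : 0 ≤ x * y + x * I.h (n + 1) ^ 2 + y * I.h (n + 1) ^ 2 := by positivity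
      linarith
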